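/- Let $\mathbb F$ be $\mathbb R$ or $\mathbb C$. For integers $n\ge 1$, $m\ge 3$ put $k=\lceil m/2\rceil$, $l=\lfloor m/2\rfloor$, $V=(\mathbb F^n)^{\otimes k}$, $W=(\mathbb F^n)^{\otimes l}$, and $$B(n,m)=\min\left\{n^{l},\ \frac{n^{k}+1}{2}-\frac{(n+1)^{k}}{2^{k}}\right\}.$$ Let $X_m\subseteq(\mathbb F^n)^{\otimes m}$ be the set of product tensors $v_1\otimes\dots\otimes v_m$ (likewise $X_k\subseteq V$, $X_l\subseteq W$). A tuple $(x_1,\dots,x_R)\in X_m^R$ with $T=\sum_a x_a$ is the *unique tensor rank decomposition* of $T$ if $T$ has tensor rank $R$ and every other way of writing $T$ as a sum of $R$ product tensors is a permutation of it. *The algorithm.* Given $T\in(\mathbb F^n)^{\otimes m}=V\otimes W$: (1) Compute a basis of $U=T(W^*)\subseteq V$ and let $R=\dim U$. With $I_2\subseteq S^2(V^*)$ the space of quadratic forms vanishing on $X_k$ (given by a basis), compute a basis $P_1,\dots,P_s$ of $S^2(U)\cap I_2^\perp$. If $s=0$, then $U\cap X_k=\{0\}$: output the empty decomposition if $R=0$,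 and "Fail" otherwise. If $s>R$, output "Fail". (2) Run simultaneous diagonalization on $\mathcal T=\sum_i e_i\otimes P_i\in\mathbb F^s\otimes V\otimes V$. That is, draw $f,g\in(\mathbb F^s)^*$ independently from a probability law for which proper linear subspaces are null sets (e.g. the uniform law on the sphere). Let $\lambda_1,\dots,\lambda_r$ be the nonzero eigenvalues of $\mathcal T(f)\mathcal T(g)^+$, with eigenvectors $v_a$; fail unless they are simple and $r$ is the rank of this matrix. Fail unless the nonzero eigenvalues of $(\mathcal T(f)^+\mathcal T(g))^{\mathsf T}$ are likewise simple, as many as its rank, and equal to $\lambda_1^{-1},\dots,\lambda_r^{-1}$; let $w_a$ be the eigenvectors. Set $u_a=\mathcal T(h_a)$ for functionals $h_a$ dual to the $v_a\otimes w_a$, and fail if two of the $u_a$ are parallel. Fail also unless $\{u_a\otimes v_a\otimes w_a\}$ is a decomposition of $\mathcal T$ of the form $\{z_i\otimes v_i\otimes v_i: i\in[s]\}$ with linearly independent $z_i$ and linearly independent $v_i$. (3) If $s\ne R$, output "Fail". Otherwise take $\varphi_a\in V^*$ dual to $v_1,\dots,v_R$, and output $\{v_a\otimes T(\varphi_a)\}_{a\in[R]}$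 if all $T(\varphi_a)$ lie in $X_l$, and "Fail" if not. Then the following hold. * *Running time.* There are a constant $C$ and a single program which, for all $n\ge1$, $m\ge3$ and every $T\in(\mathbb F^n)^{\otimes m}$, carries out this algorithm in at most $\max(n,2)^{Cm}$ steps, that is, in $n^{O(m)}$ time. The model is exact arithmetic over $\mathbb F$ at unit cost, with at most $C$ calls to an oracle that diagonalizes matrices. * *Certification.* Whenever the algorithm, on any $T$ and for any choices it makes, does not output "Fail", its output is the unique tensor rank decomposition of $T$. * *Genericity.* For every integer $0\le R\le B(n,m)$ there is a Zariski open dense subset $\mathcal A\subseteq X_m^{R}$ such that for all $(x_1,\dots,x_R)\in\mathcal A$ the following holds for $T=\sum_a x_a$: $(x_1,\dots,x_R)$ is the unique tensor rank decomposition of $T$, and, for every choice of the bases in step (1), with probability $1$ over $f,g$ the algorithm outputs $\{x_1,\dots,x_R\}$. * *Size of the bound.* $B(n,4)=(n-1)^2/4$, and there is a constant $c>0$ with $B(n,m)\ge c\,n^{\lfloor m/2\rfloor}$ for all $m\ge3$ and $n\ge8$; in particular, for even $m$ the rank may be $\Omega(n^{m/2})$. -/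

import Mathlib

open scoped Matrix

noncomputable section

namespace TensorDecomp

/-! ### Tensors, product tensors, tensor rank decompositions -/

/-- The space of order-`m` tensors over `F ^ n`, in coordinates. -/
abbrev Tensor (F : Type*) (n m : ℕ) := (Fin m → Fin n) → F

/-- The set of product (separable, rank at most one) tensors `v₁ ⊗ ⋯ ⊗ vₘ`. -/
def productTensors (F : Type*) [RCLike F] (n m : ℕ) : Set (Tensor F n m) :=
  {x | ∃ v : Fin m → Fin n → F, x = fun c => ∏ i, v i (c i)}

/-- `T = x₁ + ⋯ + x_R` with product tensors `x₁, …, x_R`. -/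
def IsDecomposition {F : Type*} [RCLike F] {n m R : ℕ} (T : Tensor F n m)
    (x : Fin R → Tensor F n m) : Prop :=
  (∀ a, x a ∈ productTensors F n m) ∧ T = ∑ a, x a

/-- The tensor rank of `T` is `R`. -/
def HasTensorRank {F : Type*} [RCLike F] {n m : ℕ} (T : Tensor F n m) (R : ℕ) : Prop :=
  IsLeast {r : ℕ | ∃ x : Fin r → Tensor F n m, IsDecomposition T x} R

/-- `x` is the unique tensor rank decomposition of `T`: it is a shortest decomposition, and all
other decompositions of that length are permutations of it. -/
def IsUniqueRankDecomposition {F : Type*} [RCLike F] {n m R : ℕ} (T : Tensor F n m)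
    (x : Fin R → Tensor F n m) : Prop :=
  IsDecomposition T x ∧ HasTensorRank T R ∧
    ∀ y : Fin R → Tensor F n m, IsDecomposition T y → ∃ σ : Equiv.Perm (Fin R), y = x ∘ σ

/-! ### Zariski genericity -/

/-- The common zeros of a set of polynomials on the space of `R`-tuples of vectors. -/
def zeroSet {F : Type*} [RCLike F] {R : ℕ} {ι : Type*} (S : Set (MvPolynomial (Fin R × ι) F)) :
    Set (Fin R → ι → F) :=
  {x | ∀ f ∈ S, MvPolynomial.eval (fun q => x q.1 q.2) f = 0}

/-- `A` is open and dense in `Y`, for the topology on `Y` induced by the Zariski topology. -/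
def IsZariskiOpenDense {F : Type*} [RCLike F] {R : ℕ} {ι : Type*}
    (Y A : Set (Fin R → ι → F)) : Prop :=
  (∃ S : Set (MvPolynomial (Fin R × ι) F), A = Y \ zeroSet S) ∧
    ∀ S : Set (MvPolynomial (Fin R × ι) F), A ⊆ zeroSet S → Y ⊆ zeroSet S

/-! ### The simultaneous diagonalization algorithm

A tensor in `F ^ s ⊗ F ^ κ ⊗ F ^ τ` is given by its slices `P : Fin s → Matrix κ τ F`. -/

/-- The contraction `T(f)` of a three-mode tensor with a functional on its first mode. -/
def contract {F : Type*} [RCLike F] {κ τ : Type*} {s : ℕ} (P : Fin s → Matrix κ τ F)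
    (f : Fin s → F) : Matrix κ τ F :=
  ∑ i, f i • P i

/-- `B` is the Moore-Penrose pseudoinverse of `A`. -/
def IsMoorePenrose {F : Type*} [RCLike F] {κ τ : Type*} [Fintype κ] [Fintype τ]
    (A : Matrix κ τ F) (B : Matrix τ κ F) : Prop :=
  A * B * A = A ∧ B * A * B = B ∧ (A * B)ᴴ = A * B ∧ (B * A)ᴴ = B * A

/-- The nonzero eigenvalues of `M` are `lam₁, …, lam_r`, without repetition and as many as the
rank of `M`; the vectors `v₁, …, v_r` are corresponding eigenvectors. -/
structure SimpleSpectrum {F : Type*} [RCLike F] {κ : Type*} [Fintype κ] (M : Matrix κ κ F)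
    {r : ℕ} (lam : Fin r → F) (v : Fin r → κ → F) : Prop where
  rank_eq : M.rank = r
  injective : Function.Injective lam
  ne_zero : ∀ a, lam a ≠ 0
  vec_ne_zero : ∀ a, v a ≠ 0
  eigen : ∀ a, M *ᵥ v a = lam a • v a

/-- A list of `r` product tensors `u_a ⊗ v_a ⊗ w_a`, by their factors. -/
structure Triples (F : Type*) (s : ℕ) (κ τ : Type*) where
  r : ℕ
  u : Fin r → Fin s → F
  v : Fin r → κ → F
  w : Fin r → τ → F

/-- `out` is a possible output of the simultaneous diagonalization algorithm, on the tensor with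
slices `P` and with the random functionals `f, g`; `none` stands for "Fail". It is a relation
because eigenvectors and dual functionals are chosen arbitrarily. -/
def SimDiag {F : Type*} [RCLike F] {κ τ : Type*} [Fintype κ] [Fintype τ] {s : ℕ}
    (P : Fin s → Matrix κ τ F) (f g : Fin s → F) (out : Option (Triples F s κ τ)) : Prop :=
  ∃ (Tf' Tg' : Matrix τ κ F),
    IsMoorePenrose (contract P f) Tf' ∧ IsMoorePenrose (contract P g) Tg' ∧
    -- the eigenvalues of `T(f) T(g)⁺`
    (((¬ ∃ (r : ℕ) (lam : Fin r → F) (v : Fin r → κ → F),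
          SimpleSpectrum (contract P f * Tg') lam v) ∧ out = none) ∨
      ∃ (r : ℕ) (lam : Fin r → F) (v : Fin r → κ → F),
        SimpleSpectrum (contract P f * Tg') lam v ∧
        -- the eigenvalues of the transpose of `T(f)⁺ T(g)`
        (((¬ ∃ w : Fin r → τ → F,
              SimpleSpectrum (Tf' * contract P g)ᵀ (fun a => (lam a)⁻¹) w) ∧ out = none) ∨
          ∃ (w : Fin r → τ → F) (h : Fin r → κ → τ → F) (u : Fin r → Fin s → F),
            SimpleSpectrum (Tf' * contract P g)ᵀ (fun a => (lam a)⁻¹) w ∧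
            -- functionals dual to the `v_a ⊗ w_a`, and `u_a = T(h_a)`
            (∀ a b, ∑ i, ∑ j, h a i j * (v b i * w b j) = if a = b then 1 else 0) ∧
            (∀ a x, u a x = ∑ i, ∑ j, h a i j * P x i j) ∧
            (((∃ a b, a ≠ b ∧ u a ∈ Submodule.span F {u b}) ∧ out = none) ∨
              ((∀ a b, a ≠ b → u a ∉ Submodule.span F {u b}) ∧ out = some ⟨r, u, v, w⟩))))

/-! ### The algorithm computing the intersection of a subspace and a conic variety cut out by
quadrics

`S²(V)` for `V = F ^ κ` is the space of symmetric matrices, and a quadratic form on `V` is given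
by its symmetric matrix. -/

/-- `S²(U)`, spanned by the symmetric products of elements of `U`. -/
def symSquare {F : Type*} [RCLike F] {κ : Type*} (U : Submodule F (κ → F)) :
    Submodule F (Matrix κ κ F) :=
  Submodule.span F
    {M | ∃ x ∈ U, ∃ y ∈ U, M = Matrix.vecMulVec x y + Matrix.vecMulVec y x}

/-- The pairing of `S²(V*)` with `S²(V)`; the value of the quadratic form `Q` at `x` is
`pairing Q (x ⊗ x)`. -/
def pairing {F : Type*} [RCLike F] {κ : Type*} [Fintype κ] (Q M : Matrix κ κ F) : F :=
  ∑ i, ∑ j, Q i j * M i j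

/-- The degree-two component of the ideal of `X`: all quadratic forms vanishing on `X`. -/
def quadricsVanishingOn {F : Type*} [RCLike F] {κ : Type*} [Fintype κ] (X : Set (κ → F)) :
    Set (Matrix κ κ F) :=
  {Q | Q.IsSymm ∧ ∀ x ∈ X, pairing Q (Matrix.vecMulVec x x) = 0}

/-- `P₁, …, P_s` is a basis of `S²(U) ∩ I₂^⊥`, where `U` is the span of the `u_a` and `I₂` the
span of the quadrics `Q_j`. -/
def IsLiftedBasis {F : Type*} [RCLike F] {κ : Type*} [Fintype κ] {R p s : ℕ}
    (u : Fin R → κ → F) (Q : Fin p → Matrix κ κ F) (P : Fin s → Matrix κ κ F) : Prop :=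
  LinearIndependent F P ∧
    ∀ M, M ∈ Submodule.span F (Set.range P) ↔
      M ∈ symSquare (Submodule.span F (Set.range u)) ∧ ∀ j, pairing (Q j) M = 0

/-- The outputs of the algorithm: "`U` trivially intersects `X`", "the only elements of `U ∩ X`
are `v₁, …, v_s` (up to scale)", and "Fail". -/
inductive IntersectionOutput (F : Type*) (κ : Type*)
  | trivial
  | only (s : ℕ) (v : Fin s → κ → F)
  | fail

/-- The triples form a decomposition `∑ z_i ⊗ v_i ⊗ v_i` of the tensor with slices `P`, with `s`
terms, linearly independent `z₁, …, z_s` and linearly independent `v₁, …, v_s`. -/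
def HasSquareForm {F : Type*} [RCLike F] {κ : Type*} {s : ℕ}
    (P : Fin s → Matrix κ κ F) (D : Triples F s κ κ) (v : Fin s → κ → F) : Prop :=
  (∀ x i j, P x i j = ∑ a, D.u a x * D.v a i * D.w a j) ∧
    ∃ (e : D.r = s) (z : Fin s → Fin s → F),
      LinearIndependent F z ∧ LinearIndependent F v ∧
      ∀ a x i j, D.u a x * D.v a i * D.w a j =
        z (Fin.cast e a) x * v (Fin.cast e a) i * v (Fin.cast e a) j

/-- `out` is a possible output of the algorithm on a subspace of dimension `R`, when the basis
computed in its first step is `P₁, …, P_s` and the random functionals drawn are `f, g`. -/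
def IntersectionAlgorithm {F : Type*} [RCLike F] {κ : Type*} [Fintype κ] {s : ℕ} (R : ℕ)
    (P : Fin s → Matrix κ κ F) (f g : Fin s → F) (out : IntersectionOutput F κ) : Prop :=
  (s = 0 ∧ out = .trivial) ∨
  (R < s ∧ out = .fail) ∨
  (0 < s ∧ s ≤ R ∧
    ((SimDiag P f g none ∧ out = .fail) ∨
      ∃ D : Triples F s κ κ, SimDiag P f g (some D) ∧
        (((¬ ∃ v, HasSquareForm P D v) ∧ out = .fail) ∨
          ∃ v, HasSquareForm P D v ∧ out = .only s v)))

/-! ### Recovering and certifying tensor decompositions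

An order-`m` tensor is a matrix, through `(F ^ n)^{⊗ m} = V ⊗ W` where `V` and `W` are the tensor
spaces of orders `⌈m/2⌉ = (m + 1) / 2` and `⌊m/2⌋ = m / 2`. -/

/-- Concatenation of multi-indices. -/
def joinIdx {n m : ℕ} (a : Fin ((m + 1) / 2) → Fin n) (b : Fin (m / 2) → Fin n) : Fin m → Fin n :=
  fun i => if h : (i : ℕ) < (m + 1) / 2 then a ⟨i, h⟩ else b ⟨i - (m + 1) / 2, by omega⟩

/-- The first `⌈m/2⌉` entries of a multi-index. -/
def headIdx {n m : ℕ} (c : Fin m → Fin n) : Fin ((m + 1) / 2) → Fin n :=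
  fun i => c ⟨i, by omega⟩

/-- The last `⌊m/2⌋` entries of a multi-index. -/
def tailIdx {n m : ℕ} (c : Fin m → Fin n) : Fin (m / 2) → Fin n :=
  fun j => c ⟨(m + 1) / 2 + j, by omega⟩

/-- The flattening of `T`, an element of `V ⊗ W`. -/
def flatten {F : Type*} {n m : ℕ} (T : Tensor F n m) :
    Matrix (Fin ((m + 1) / 2) → Fin n) (Fin (m / 2) → Fin n) F :=
  fun a b => T (joinIdx a b)

/-- `v ⊗ w` as an order-`m` tensor. -/
def outer {F : Type*} [RCLike F] {n m : ℕ} (v : Tensor F n ((m + 1) / 2))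
    (w : Tensor F n (m / 2)) : Tensor F n m :=
  fun c => v (headIdx c) * w (tailIdx c)

/-- Everything that is chosen before the random functionals are drawn: a basis `u` of
`U = T(W*)`, linearly independent quadrics `Q` spanning the degree-two component of the ideal of
the variety `X` of product tensors in `V`, and a basis `P` of `S²(U) ∩ I₂^⊥`. -/
structure IsSetup {F : Type*} [RCLike F] {n m R p s : ℕ} (T : Tensor F n m)
    (u : Fin R → Tensor F n ((m + 1) / 2))
    (Q : Fin p → Matrix (Fin ((m + 1) / 2) → Fin n) (Fin ((m + 1) / 2) → Fin n) F)
    (P : Fin s → Matrix (Fin ((m + 1) / 2) → Fin n) (Fin ((m + 1) / 2) → Fin n) F) : Prop where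
  basis_indep : LinearIndependent F u
  basis_span : Submodule.span F (Set.range u) = LinearMap.range (flatten T).mulVecLin
  quadrics_indep : LinearIndependent F Q
  quadrics_span : (Submodule.span F (Set.range Q) : Set _) =
    quadricsVanishingOn (productTensors F n ((m + 1) / 2))
  lifted : IsLiftedBasis u Q P

/-- `out` is a possible output of the decomposition procedure for `T`: compute `U ∩ X` with the
intersection algorithm; unless this gives `v₁, …, v_R` with `R = dim U`, output "Fail" (`none`);
otherwise take functionals dual to the `v_a`, let `w_a = T(φ_a)`, and output the terms
`v_a ⊗ w_a` if all `w_a` are product tensors, and "Fail" if not. -/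
def DecompositionOutput {F : Type*} [RCLike F] {n m s : ℕ} (T : Tensor F n m) (R : ℕ)
    (P : Fin s → Matrix (Fin ((m + 1) / 2) → Fin n) (Fin ((m + 1) / 2) → Fin n) F)
    (f g : Fin s → F) (out : Option (Σ r : ℕ, Fin r → Tensor F n m)) : Prop :=
  (IntersectionAlgorithm R P f g .fail ∧ out = none) ∨
  (IntersectionAlgorithm R P f g .trivial ∧
    ((R ≠ 0 ∧ out = none) ∨ (R = 0 ∧ out = some ⟨0, Fin.elim0⟩))) ∨
  ∃ (r : ℕ) (v : Fin r → Tensor F n ((m + 1) / 2)),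
    IntersectionAlgorithm R P f g (.only r v) ∧
    ((r ≠ R ∧ out = none) ∨
      (r = R ∧ ∃ φ : Fin r → Tensor F n ((m + 1) / 2),
        (∀ a b, φ a ⬝ᵥ v b = if a = b then 1 else 0) ∧
        (((∃ a, φ a ᵥ* flatten T ∉ productTensors F n (m / 2)) ∧ out = none) ∨
          ((∀ a, φ a ᵥ* flatten T ∈ productTensors F n (m / 2)) ∧
            out = some ⟨r, fun a => outer (v a) (φ a ᵥ* flatten T)⟩))))

/-! ### A model of computation over the field `F`, with exact arithmetic

Programs of a random access machine: registers holding natural numbers, which serve as indices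
and counters, and two-dimensional arrays of field elements. Each operation, memory access, test
and loop iteration costs one step. Field elements can only be added, subtracted, multiplied,
divided, conjugated and tested for being zero. There is an oracle that diagonalizes matrices.
All loops are bounded, so that every program terminates. -/

/-- Expressions for natural numbers; the subtraction is truncated. -/
inductive NatExpr
  | const (c : ℕ)
  | var (x : ℕ)
  | add (d e : NatExpr)
  | sub (d e : NatExpr)
  | mul (d e : NatExpr)

/-- Expressions for field elements; `get A i j` is the entry `(i, j)` of the array `A`. -/
inductive FieldExpr
  | zero
  | one
  | get (A : ℕ) (i j : NatExpr)
  | add (d e : FieldExpr)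
  | sub (d e : FieldExpr)
  | mul (d e : FieldExpr)
  | div (d e : FieldExpr)
  | conj (d : FieldExpr)

/-- Tests. -/
inductive Test
  | lt (d e : NatExpr)
  | isZero (e : FieldExpr)
  | not (b : Test)
  | and (b c : Test)

/-- Programs. `loop x e p` runs `p` with `x = 0, 1, …, e - 1`. `diag A k E V x` calls the
oracle on the upper left `k × k` block of the array `A`. -/
inductive Program
  | skip
  | setNat (x : ℕ) (e : NatExpr)
  | setField (A : ℕ) (i j : NatExpr) (e : FieldExpr)
  | seq (p q : Program)
  | ite (b : Test) (p q : Program)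
  | loop (x : ℕ) (e : NatExpr) (p : Program)
  | diag (A : ℕ) (k : NatExpr) (E V x : ℕ)

/-- The state of the machine: registers, arrays, the number of steps made so far, and the number
of oracle calls made so far. -/
structure Machine (F : Type*) where
  nat : ℕ → ℕ
  field : ℕ → ℕ → ℕ → F
  time : ℕ
  calls : ℕ

/-- A diagonalization oracle: eigenvalues and a matrix of eigenvectors, or `none`. -/
abbrev DiagOracle (F : Type*) :=
  (k : ℕ) → Matrix (Fin k) (Fin k) F → Option ((Fin k → F) × Matrix (Fin k) (Fin k) F)

/-- The oracle diagonalizes every matrix that can be diagonalized over `F`, and reports the others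
as such. -/
def DiagOracle.IsCorrect {F : Type*} [RCLike F] (O : DiagOracle F) : Prop :=
  ∀ (k : ℕ) (M : Matrix (Fin k) (Fin k) F),
    (∀ d V, O k M = some (d, V) → IsUnit V ∧ M * V = V * Matrix.diagonal d) ∧
    (O k M = none → ¬ ∃ (d : Fin k → F) (V : Matrix (Fin k) (Fin k) F),
      IsUnit V ∧ M * V = V * Matrix.diagonal d)

/-- The value of an expression. -/
def NatExpr.val (ρ : ℕ → ℕ) : NatExpr → ℕ
  | const c => c
  | var x => ρ x
  | add d e => d.val ρ + e.val ρ
  | sub d e => d.val ρ - e.val ρ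
  | mul d e => d.val ρ * e.val ρ

/-- The number of steps for an expression. -/
def NatExpr.cost : NatExpr → ℕ
  | const _ => 1
  | var _ => 1
  | add d e => d.cost + e.cost + 1
  | sub d e => d.cost + e.cost + 1
  | mul d e => d.cost + e.cost + 1

/-- The value of an expression. -/
def FieldExpr.val {F : Type*} [RCLike F] (S : Machine F) : FieldExpr → F
  | zero => 0
  | one => 1
  | get A i j => S.field A (i.val S.nat) (j.val S.nat)
  | add d e => d.val S + e.val S
  | sub d e => d.val S - e.val S
  | mul d e => d.val S * e.val S
  | div d e => d.val S / e.val S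
  | conj d => star (d.val S)

/-- The number of steps for an expression. -/
def FieldExpr.cost : FieldExpr → ℕ
  | zero => 1
  | one => 1
  | get _ i j => i.cost + j.cost + 1
  | add d e => d.cost + e.cost + 1
  | sub d e => d.cost + e.cost + 1
  | mul d e => d.cost + e.cost + 1
  | div d e => d.cost + e.cost + 1
  | conj d => d.cost + 1

/-- The truth of a test. -/
def Test.Holds {F : Type*} [RCLike F] (S : Machine F) : Test → Prop
  | lt d e => d.val S.nat < e.val S.nat
  | isZero e => e.val S = 0
  | not b => ¬ b.Holds S
  | and b c => b.Holds S ∧ c.Holds S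

/-- The number of steps for a test. -/
def Test.cost : Test → ℕ
  | lt d e => d.cost + e.cost + 1
  | isZero e => e.cost + 1
  | not b => b.cost + 1
  | and b c => b.cost + c.cost + 1

/-- Let `t` steps pass. -/
def Machine.tick {F : Type*} (S : Machine F) (t : ℕ) : Machine F :=
  { S with time := S.time + t }

/-- Write a register. -/
def Machine.writeNat {F : Type*} (S : Machine F) (x a : ℕ) : Machine F :=
  { S with nat := fun y => if y = x then a else S.nat y }

/-- Write an array entry. -/
def Machine.writeField {F : Type*} (S : Machine F) (A i j : ℕ) (a : F) : Machine F :=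
  { S with field := fun B i' j' => if B = A ∧ i' = i ∧ j' = j then a else S.field B i' j' }

/-- An oracle call on the `k × k` block of the array `A`. On success, `x` becomes `1`, the
eigenvalues are written to the row `0` of the array `E` and the eigenvectors to the columns of the
array `V`; otherwise `x` becomes `0`. The call costs one step for each entry of the block. -/
def Machine.callDiag {F : Type*} (O : DiagOracle F) (S : Machine F) (A k E V x : ℕ) : Machine F :=
  match O k (fun i j => S.field A i j) with
  | none =>
      { nat := fun y => if y = x then 0 else S.nat y
        field := S.field
        time := S.time + (k * k + 1)
        calls := S.calls + 1 }
  | some (d, W) =>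
      { nat := fun y => if y = x then 1 else S.nat y
        field := fun B i j =>
          if h : B = V ∧ i < k ∧ j < k then W ⟨i, h.2.1⟩ ⟨j, h.2.2⟩
          else if h : B = E ∧ i = 0 ∧ j < k then d ⟨j, h.2.2⟩
          else S.field B i j
        time := S.time + (k * k + 1)
        calls := S.calls + 1 }

/-- Apply `f 0`, then `f 1`, …, then `f (b - 1)`. -/
def iterate {α : Type*} (f : ℕ → α → α) : ℕ → α → α
  | 0, a => a
  | b + 1, a => f b (iterate f b a)

open Classical in
/-- The run of a program. -/
def Program.run {F : Type*} [RCLike F] (O : DiagOracle F) : Program → Machine F → Machine F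
  | skip, S => S.tick 1
  | setNat x e, S => (S.writeNat x (e.val S.nat)).tick (e.cost + 1)
  | setField A i j e, S =>
      (S.writeField A (i.val S.nat) (j.val S.nat) (e.val S)).tick (i.cost + j.cost + e.cost + 1)
  | seq p q, S => q.run O (p.run O S)
  | ite b p q, S => if b.Holds S then p.run O (S.tick b.cost) else q.run O (S.tick b.cost)
  | loop x e p, S =>
      iterate (fun i S' => p.run O ((S'.writeNat x i).tick 1)) (e.val S.nat) (S.tick (e.cost + 1))
  | diag A k E V x, S => (S.tick k.cost).callDiag O A (k.val S.nat) E V x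

/-- The start: the registers `0, 1` hold `n, m`; row `0` of the array `0` holds the entries of
`T`, in the order of the base-`n` numbers `∑ i, c i * n ^ i`; the rows `0, 1` of the array `1`
hold the random scalars from which `f` and `g` are taken; the rest is zero. -/
def Machine.start {F : Type*} [RCLike F] {n m : ℕ} (T : Tensor F n m) (f g : ℕ → F) :
    Machine F where
  nat := fun x => if x = 0 then n else if x = 1 then m else 0
  field := fun A i j =>
    if A = 0 ∧ i = 0 then
      if h : j < n ^ m then T (finFunctionFinEquiv.symm ⟨j, h⟩) else 0
    else if A = 1 ∧ i = 0 then f j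
    else if A = 1 ∧ i = 1 then g j
    else 0
  time := 0
  calls := 0

/-- The output: "Fail" if the register `0` holds `0`; otherwise the register `1` holds the number
of terms, and row `a` of the array `0` the entries of the term number `a`. -/
def Machine.output {F : Type*} (n m : ℕ) (S : Machine F) :
    Option (Σ r : ℕ, Fin r → Tensor F n m) :=
  if S.nat 0 = 0 then none
  else some ⟨S.nat 1, fun a c => S.field 0 a (finFunctionFinEquiv c : Fin (n ^ m))⟩

/-! ### The rank bound and the random functionals -/

/-- `min { n^⌊m/2⌋, (n^⌈m/2⌉ + 1)/2 - (n+1)^⌈m/2⌉ / 2^⌈m/2⌉ }`. -/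
def rankBound (n m : ℕ) : ℝ :=
  min ((n : ℝ) ^ (m / 2))
    (((n : ℝ) ^ ((m + 1) / 2) + 1) / 2 - ((n : ℝ) + 1) ^ ((m + 1) / 2) / 2 ^ ((m + 1) / 2))

/-- Proper linear subspaces of `F ^ s` are null sets. For `s ≥ 1`, the uniform measure on the unit
sphere and all measures with a density have this property. -/
def NullOnSubspaces {F : Type*} [RCLike F] {s : ℕ} (μ : MeasureTheory.Measure (Fin s → F)) :
    Prop :=
  ∀ W : Submodule F (Fin s → F), W ≠ ⊤ → μ (W : Set (Fin s → F)) = 0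

end TensorDecomp

end

open TensorDecomp

/-! ### Exchange-invariant matrices and the quadrics through the product tensors -/

noncomputable section
namespace TensorDecomp

/-! The symmetric matrices annihilated by all quadrics through the product tensors are exactly the
matrices unchanged when matching entries of the two multi-indices are exchanged
(`prefixInvariant_of_pairing_eq_zero`, `PrefixInvariant.pairing_eq_zero`). Hence, for every choice
of bases, the span of `P` is the space of exchange-invariant elements of S²(U)
(`IsSetup.mem_span_iff`), and it contains x ⊗ x for every product tensor x in U.

Certification. If `P` is a sum of terms z_a ⊗ v_a ⊗ v_a with independent z_a and independent v_a,
its span is the span of the squares v_a ⊗ v_a, so the v_a are product tensors in U. A square of rank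
one in this span is a multiple of one of these squares (`exists_smul_of_square_mem_span`), so up to
scale U contains no other product tensors. If there are R = dim U of them, the heads of any
decomposition with R terms form a basis of U, hence are the v_a up to order and scale, and the tails
are recovered by dual functionals (`isUniqueRankDecomposition_of_squares`). No decomposition is
shorter, because the flattening has rank R.

Genericity. It must be shown that exchange-invariant elements M of S²(U) lie in the span of the
squares of the heads v_a. Write M as the sum of μ_{ab} v_a ⊗ v_b and pair it with a basis Q_j of the
quadrics. If the vector (Q_j(v_a, v_b))_j is outside the span of all vectors (Q_j(v_c, y))_j with c
different from a and b, then μ_{ab} = 0 (`mem_span_squares`). The rank bound is the dimension count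
that yields a nonzero quadric through the product tensors which is singular at R - 2 given points
(`exists_quadric`). Placing the two remaining points where its bilinear form does not vanish, with
the others chosen to make the span as large as possible, produces one tuple with this property and a
polynomial that guards it (`exists_poly_pair`). Tuples of product tensors are the image of an affine
space, so finitely many nonempty open conditions hold on a dense set. For such tuples every run of
the simultaneous diagonalization succeeds as soon as f and g avoid conditions of measure zero
(`SimDiag.exists_of_squareForm`, `ae_isGeneric`).

Running time. The program needs no pseudoinverses. Kernels are found by diagonalizing the Hermitian
matrix LᴴL, and T(f)T(g)⁺ is replaced by any X with X T(g) = T(f) and range in U, which has the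
right nonzero eigenvalues and eigenvectors (`SquareForm.solution_eigen`). Everything is verified at
the end. If the checks pass, the computed data justify the output (`main_accept`). If one fails,
"Fail" is a possible output of the algorithm, since otherwise `decompositionOutput_none_or` supplies
data that force all checks to pass (`main_reject`). A static analysis of loops and loop bounds gives
the time. -/

/-- `M` is invariant under exchanging the first `i` entries of its two multi-indices. -/
def PrefixInvariant {α : Type*} {n k : ℕ} (M : (Fin k → Fin n) → (Fin k → Fin n) → α) : Prop :=
  ∀ (i : ℕ) (c d : Fin k → Fin n), i ≤ k →
    M (({j : Fin k | (j : ℕ) < i} : Finset (Fin k)).piecewise d c)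
      (({j : Fin k | (j : ℕ) < i} : Finset (Fin k)).piecewise c d) = M c d

/-- Exchanging the first `a + 1` entries and then the first `a` entries again exchanges the entry
`a` alone. -/
theorem PrefixInvariant.swap_one {α : Type*} {n k : ℕ}
    {M : (Fin k → Fin n) → (Fin k → Fin n) → α} (hM : PrefixInvariant M) (a : Fin k)
    (c d : Fin k → Fin n) :
    M (Function.update c a (d a)) (Function.update d a (c a)) = M c d := by
  rw [← hM (a + 1) c d (by omega), ← hM a (Function.update c a (d a)) (Function.update d a (c a))
    (by omega)]
  congr 1 <;>
  · ext j
    simp only [Finset.piecewise, Finset.mem_filter, Finset.mem_univ, true_and,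
      Function.update_apply]
    by_cases h : j = a
    · subst h; simp
    · have : (j : ℕ) ≠ a := fun h' => h (Fin.ext h')
      have : (j : ℕ) < a + 1 ↔ (j : ℕ) < a := by omega
      simp [h, this]

theorem PrefixInvariant.piecewise {α : Type*} {n k : ℕ}
    {M : (Fin k → Fin n) → (Fin k → Fin n) → α} (hM : PrefixInvariant M) (A : Finset (Fin k))
    (c d : Fin k → Fin n) : M (A.piecewise d c) (A.piecewise c d) = M c d := by
  induction A using Finset.induction_on with
  | empty => simp
  | insert a A ha ih =>
    rw [← ih, ← hM.swap_one a (A.piecewise d c) (A.piecewise c d)]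
    simp [Finset.piecewise_insert, ha]

/-- When the unordered pairs agree, the second pair of multi-indices arises from the first by
exchanging the positions with `c' j ≠ c j`. -/
theorem PrefixInvariant.eq_of_sym2 {α : Type*} {n k : ℕ}
    {M : (Fin k → Fin n) → (Fin k → Fin n) → α} (hM : PrefixInvariant M)
    {c d c' d' : Fin k → Fin n} (h : ∀ j, s(c j, d j) = s(c' j, d' j)) : M c d = M c' d' := by
  rw [← hM.piecewise ({j | c' j ≠ c j} : Finset (Fin k)) c d]
  congr 1 <;>
  · ext j
    have := h j
    simp only [Sym2.eq_iff] at this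
    simp only [Finset.piecewise, Finset.mem_filter, Finset.mem_univ, true_and]
    split_ifs with h1
    · rcases this with ⟨h2, h3⟩ | ⟨h2, h3⟩
      · exact absurd h2.symm h1
      · simp [h2, h3]
    · rw [not_not] at h1
      rcases this with ⟨h2, h3⟩ | ⟨h2, h3⟩
      · simp [h2, h3]
      · simp [← h2, h3, h1]

variable {F : Type*} [RCLike F]

theorem prefixInvariant_of_mem_productTensors {n k : ℕ} {w : Tensor F n k}
    (hw : w ∈ productTensors F n k) : PrefixInvariant (fun c d => w c * w d) := by
  obtain ⟨v, rfl⟩ := hw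
  intro i c d _
  simp only [← Finset.prod_mul_distrib]
  refine Finset.prod_congr rfl fun j _ => ?_
  simp only [Finset.piecewise]
  split_ifs <;> ring

/-- Fix `c₀` with `w c₀ ≠ 0`. Invariance says that changing one entry multiplies `w` by a factor
that does not depend on the other entries, so passing from `c₀` to `c` one entry at a time writes `w
c` as a product. -/
theorem mem_productTensors_of_prefixInvariant {n k : ℕ} (hk : 0 < k) {w : Tensor F n k}
    (hw : PrefixInvariant (fun c d => w c * w d)) : w ∈ productTensors F n k := by
  by_cases h0 : ∀ c, w c = 0
  · refine ⟨fun _ _ => 0, ?_⟩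
    ext c
    rw [h0 c]
    exact (Finset.prod_eq_zero (Finset.mem_univ ⟨0, hk⟩) rfl).symm
  push Not at h0
  obtain ⟨c₀, hc₀⟩ := h0
  have key : ∀ (c : Fin k → Fin n) (A : Finset (Fin k)),
      w (A.piecewise c c₀) = w c₀ * ∏ i ∈ A, (w (Function.update c₀ i (c i)) / w c₀) := by
    intro c A
    induction A using Finset.induction_on with
    | empty => simp
    | insert a A ha ih =>
      have h1 := hw.swap_one a (A.piecewise c c₀) (Function.update c₀ a (c a))
      simp only [Function.update_self, Function.update_idem, ha, not_false_eq_true,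
        Finset.piecewise_eq_of_notMem, Function.update_eq_self] at h1
      rw [Finset.prod_insert ha, Finset.piecewise_insert, mul_left_comm, ← ih]
      field_simp
      rw [h1]; ring
  -- The constant `w c₀` is absorbed into the factor number `0`, which exists because `k` is
  -- positive.
  refine ⟨fun i j => w (Function.update c₀ i j) / w c₀ * if i = ⟨0, hk⟩ then w c₀ else 1, ?_⟩
  ext c
  have := key c Finset.univ
  rw [Finset.piecewise_univ] at this
  rw [this, Finset.prod_mul_distrib]
  simp [mul_comm]

theorem smul_mem_productTensors {n k : ℕ} (hk : 0 < k) {w : Tensor F n k} (a : F)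
    (hw : w ∈ productTensors F n k) : a • w ∈ productTensors F n k := by
  refine mem_productTensors_of_prefixInvariant hk fun i c d hi => ?_
  have := prefixInvariant_of_mem_productTensors hw i c d hi
  simp only [Pi.smul_apply, smul_eq_mul] at this ⊢
  linear_combination a ^ 2 * this

theorem pairing_vecMulVec {κ : Type*} [Fintype κ] (Q : Matrix κ κ F) (x y : κ → F) :
    pairing Q (Matrix.vecMulVec x y) = x ⬝ᵥ Q *ᵥ y := by
  simp only [pairing, Matrix.vecMulVec_apply, dotProduct, Matrix.mulVec, Finset.mul_sum]
  exact Finset.sum_congr rfl fun i _ => Finset.sum_congr rfl fun j _ => by ring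

/-- The space `pairing` as a bilinear map. -/
def pairingLin (F : Type*) [RCLike F] (κ : Type*) [Fintype κ] :
    Matrix κ κ F →ₗ[F] Matrix κ κ F →ₗ[F] F :=
  LinearMap.mk₂ F pairing
    (fun A B M => by simp [pairing, add_mul, Finset.sum_add_distrib])
    (fun a A M => by simp [pairing, mul_assoc, Finset.mul_sum])
    (fun A M M' => by simp [pairing, mul_add, Finset.sum_add_distrib])
    (fun a A M => by simp [pairing, mul_left_comm, Finset.mul_sum])

@[simp] theorem pairingLin_apply {κ : Type*} [Fintype κ] (Q M : Matrix κ κ F) :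
    pairingLin F κ Q M = pairing Q M := rfl

/-- The degree-two component of the ideal of `X`, as a subspace. -/
def quadricSpace {κ : Type*} [Fintype κ] (X : Set (κ → F)) : Submodule F (Matrix κ κ F) where
  carrier := quadricsVanishingOn X
  add_mem' := by
    rintro A B ⟨hA, hA'⟩ ⟨hB, hB'⟩
    refine ⟨hA.add hB, fun x hx => ?_⟩
    rw [← pairingLin_apply, map_add, LinearMap.add_apply, pairingLin_apply, pairingLin_apply,
      hA' x hx, hB' x hx, add_zero]
  zero_mem' := ⟨Matrix.isSymm_zero, fun x _ => by simp [pairing]⟩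
  smul_mem' := by
    rintro a A ⟨hA, hA'⟩
    refine ⟨hA.smul a, fun x hx => ?_⟩
    rw [← pairingLin_apply, map_smul, LinearMap.smul_apply, pairingLin_apply, hA' x hx, smul_zero]

theorem mem_quadricSpace {κ : Type*} [Fintype κ] {X : Set (κ → F)} {Q : Matrix κ κ F} :
    Q ∈ quadricSpace X ↔ Q.IsSymm ∧ ∀ x ∈ X, pairing Q (Matrix.vecMulVec x x) = 0 := Iff.rfl

/-- The symmetrized binomial quadric with terms `(c, d)` and `(c', d')` vanishes on product tensors.
Its pairing with a symmetric `M` is twice `M c d - M c' d'`. -/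
theorem prefixInvariant_of_pairing_eq_zero {n k : ℕ}
    {M : Matrix (Fin k → Fin n) (Fin k → Fin n) F} (hM : M.IsSymm)
    (h : ∀ Q ∈ quadricSpace (productTensors F n k), pairing Q M = 0) : PrefixInvariant M := by
  classical
  intro i c d hi
  set c' := ({j : Fin k | (j : ℕ) < i} : Finset (Fin k)).piecewise d c with hc'
  set d' := ({j : Fin k | (j : ℕ) < i} : Finset (Fin k)).piecewise c d with hd'
  have pair_single : ∀ (a b : Fin k → Fin n) (M : Matrix (Fin k → Fin n) (Fin k → Fin n) F),
      pairing (Matrix.single a b 1) M = M a b := by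
    intro a b M
    simp [pairing, Matrix.single_apply, ite_and]
  have hpair : ∀ M : Matrix (Fin k → Fin n) (Fin k → Fin n) F,
      pairing (Matrix.single c d 1 + Matrix.single d c 1 - Matrix.single c' d' 1
        - Matrix.single d' c' 1) M = M c d + M d c - M c' d' - M d' c' := by
    intro M
    simp only [← pairingLin_apply, map_sub, map_add, LinearMap.sub_apply, LinearMap.add_apply]
    simp only [pairingLin_apply, pair_single]
  have := h (Matrix.single c d 1 + Matrix.single d c 1 - Matrix.single c' d' 1
        - Matrix.single d' c' 1) ⟨?_, fun x hx => ?_⟩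
  · rw [hpair, hM.apply c d, hM.apply c' d'] at this
    have h2 : (2 : F) * (M c d - M c' d') = 0 := by linear_combination this
    have := (mul_eq_zero.mp h2).resolve_left two_ne_zero
    exact (sub_eq_zero.mp this).symm
  · simp only [Matrix.IsSymm, Matrix.transpose_sub, Matrix.transpose_add, Matrix.transpose_single]
    abel
  · rw [hpair]
    have := prefixInvariant_of_mem_productTensors hx i c d hi
    simp only [← hc', ← hd'] at this
    simp only [Matrix.vecMulVec_apply]
    linear_combination (-2) * this

theorem PrefixInvariant.isSymm {α : Type*} {n k : ℕ} {M : Matrix (Fin k → Fin n) (Fin k → Fin n) α}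
    (hM : PrefixInvariant M) : M.IsSymm := by
  ext c d
  exact hM.eq_of_sym2 fun j => Sym2.eq_swap

/-- Evaluating `Q` at a product tensor with indeterminate factors gives the zero polynomial. Its
coefficients are sums of entries of `Q` over the pairs of multi-indices with the same monomial. The
monomial determines the unordered pairs of entries, so `M` is constant on each of these classes. -/
theorem PrefixInvariant.pairing_eq_zero {n k : ℕ}
    {M : Matrix (Fin k → Fin n) (Fin k → Fin n) F} (hM : PrefixInvariant M)
    {Q : Matrix (Fin k → Fin n) (Fin k → Fin n) F}
    (hQ : Q ∈ quadricSpace (productTensors F n k)) : pairing Q M = 0 := by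
  classical
  let mono : (Fin k → Fin n) × (Fin k → Fin n) → (Fin k × Fin n →₀ ℕ) := fun cd =>
    ∑ i, (Finsupp.single (i, cd.1 i) 1 + Finsupp.single (i, cd.2 i) 1)
  have mono_apply : ∀ cd j x, mono cd (j, x) =
      (if cd.1 j = x then 1 else 0) + (if cd.2 j = x then 1 else 0) := by
    intro cd j x
    simp only [mono, Finsupp.coe_finsetSum, Finset.sum_apply, Finsupp.add_apply,
      Finsupp.single_apply, Prod.mk.injEq, Finset.sum_add_distrib, ite_and]
    simp
  have mono_sym2 : ∀ cd cd', mono cd = mono cd' →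
      ∀ j, s(cd.1 j, cd.2 j) = s(cd'.1 j, cd'.2 j) := by
    intro cd cd' h j
    have h' := fun x => (mono_apply cd j x).symm.trans ((DFunLike.congr_fun h (j, x)).trans
      (mono_apply cd' j x))
    have h1 := h' (cd.1 j)
    have h2 := h' (cd'.1 j)
    have h3 := h' (cd.2 j)
    have h4 := h' (cd'.2 j)
    rw [Sym2.eq_iff]
    grind
  let p : MvPolynomial (Fin k × Fin n) F := ∑ cd, MvPolynomial.monomial (mono cd) (Q cd.1 cd.2)
  -- The field is infinite, so a polynomial is determined by its values, and the values of `p` are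
  -- those of `Q` at product tensors.
  have hp : p = 0 := by
    refine MvPolynomial.funext fun y => ?_
    have := hQ.2 (fun c => ∏ i, y (i, c i)) ⟨fun i j => y (i, j), rfl⟩
    rw [map_zero, ← this, pairing, ← Fintype.sum_prod_type', map_sum]
    refine Finset.sum_congr rfl fun cd _ => ?_
    rw [MvPolynomial.eval_monomial, Matrix.vecMulVec_apply, ← Finset.prod_mul_distrib]
    congr 1
    rw [← Finsupp.prod_finsetSum_index (by simp) (fun _ _ _ => pow_add _ _ _)]
    refine Finset.prod_congr rfl fun i _ => ?_
    rw [Finsupp.prod_add_index' (by simp) (fun _ _ _ => pow_add _ _ _)]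
    simp [Finsupp.prod_single_index]
  have hfib : ∀ m, ∑ cd with mono cd = m, Q cd.1 cd.2 = 0 := by
    intro m
    have := congrArg (MvPolynomial.coeff m) hp
    simpa [p, MvPolynomial.coeff_sum, MvPolynomial.coeff_monomial, Finset.sum_filter] using this
  rw [pairing, ← Fintype.sum_prod_type', ← Finset.sum_fiberwise_of_maps_to
    (g := mono) (t := Finset.univ.image mono) (fun x _ => Finset.mem_image_of_mem _ (Finset.mem_univ x))]
  refine Finset.sum_eq_zero fun m hm => ?_
  obtain ⟨cd₀, -, rfl⟩ := Finset.mem_image.mp hm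
  have : ∀ cd ∈ ({cd | mono cd = mono cd₀} : Finset _), Q cd.1 cd.2 * M cd.1 cd.2
      = Q cd.1 cd.2 * M cd₀.1 cd₀.2 := by
    intro cd hcd
    rw [hM.eq_of_sym2 (mono_sym2 _ _ (Finset.mem_filter.mp hcd).2)]
  rw [Finset.sum_congr rfl this, ← Finset.sum_mul, hfib, zero_mul]

end TensorDecomp
end

/-! ### Dual families, symmetric squares, orthogonal projections and pseudoinverses -/

noncomputable section
namespace TensorDecomp
variable {F : Type*} [RCLike F] {κ τ : Type*} [Fintype κ] [Fintype τ]

/-- `φ` is a family of functionals dual to the family `v`. -/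
def IsDual {s : ℕ} (φ v : Fin s → κ → F) : Prop :=
  ∀ a b, φ a ⬝ᵥ v b = if a = b then 1 else 0

theorem exists_isDual {s : ℕ} {v : Fin s → κ → F} (hv : LinearIndependent F v) :
    ∃ φ, IsDual φ v := by
  classical
  obtain ⟨g, hg⟩ := (Fintype.linearCombination F v).exists_leftInverse_of_injective
    (LinearMap.ker_eq_bot.mpr hv.fintypeLinearCombination_injective)
  refine ⟨fun a i => g (Pi.single i 1) a, fun a b => ?_⟩
  have h1 : g (v b) = Pi.single b 1 := by
    have := LinearMap.congr_fun hg (Pi.single b 1)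
    simpa [Fintype.linearCombination_apply_single] using this
  have h2 : g (v b) a = ∑ i, v b i * g (Pi.single i 1) a := by
    conv_lhs => rw [pi_eq_sum_univ' (v b)]
    simp [map_sum, Finset.sum_apply]
  rw [dotProduct, Finset.sum_congr rfl fun i _ => mul_comm _ _, ← h2, h1, Pi.single_apply]

theorem IsDual.linearIndependent {s : ℕ} {φ v : Fin s → κ → F} (h : IsDual φ v) :
    LinearIndependent F v := by
  rw [Fintype.linearIndependent_iff]
  intro g hg a
  have := congrArg (fun x => φ a ⬝ᵥ x) hg
  simpa [dotProduct_sum, h a] using this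

theorem IsDual.dotProduct_sum {s : ℕ} {φ v : Fin s → κ → F} (h : IsDual φ v) (c : Fin s → F)
    (a : Fin s) : φ a ⬝ᵥ ∑ b, c b • v b = c a := by
  simp [_root_.dotProduct_sum, h a]

theorem IsDual.sum_eq {s : ℕ} {φ v : Fin s → κ → F} (h : IsDual φ v) {x : κ → F}
    (hx : x ∈ Submodule.span F (Set.range v)) : ∑ a, (φ a ⬝ᵥ x) • v a = x := by
  obtain ⟨c, rfl⟩ := (Submodule.mem_span_range_iff_exists_fun F).mp hx
  simp_rw [h.dotProduct_sum]

theorem vecMulVec_mulVec' (x y z : κ → F) :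
    Matrix.vecMulVec x y *ᵥ z = (y ⬝ᵥ z) • x := by
  ext i
  simp [Matrix.mulVec, dotProduct, Matrix.vecMulVec_apply, Finset.mul_sum, mul_comm, mul_left_comm]

theorem exists_dotProduct_ne_zero {p : κ → F} (hp : p ≠ 0) : ∃ y, p ⬝ᵥ y ≠ 0 := by
  by_contra! h
  exact hp (dotProduct_eq_zero_iff.mp h)

/-- A rank-one square in the span of the squares of linearly independent vectors is a multiple of
one of these. -/
theorem exists_smul_of_square_mem_span {s : ℕ} {v : Fin s → κ → F} (hv : LinearIndependent F v)
    {p : κ → F} (hp : p ≠ 0) (h : Matrix.vecMulVec p p ∈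
      Submodule.span F (Set.range fun a => Matrix.vecMulVec (v a) (v a))) :
    ∃ (a : Fin s) (c : F), c ≠ 0 ∧ p = c • v a := by
  obtain ⟨φ, hφ⟩ := exists_isDual hv
  obtain ⟨α, hα⟩ := (Submodule.mem_span_range_iff_exists_fun F).mp h
  have key : ∀ y, (p ⬝ᵥ y) • p = ∑ a, (α a * (v a ⬝ᵥ y)) • v a := by
    intro y
    rw [← vecMulVec_mulVec', ← hα, Matrix.sum_mulVec]
    simp [Matrix.smul_mulVec, vecMulVec_mulVec', smul_smul]
  obtain ⟨y, hy⟩ := exists_dotProduct_ne_zero hp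
  obtain ⟨β, hβ⟩ : ∃ β : Fin s → F, p = ∑ a, β a • v a := by
    refine ⟨fun a => (p ⬝ᵥ y)⁻¹ * (α a * (v a ⬝ᵥ y)), ?_⟩
    simp_rw [mul_smul (p ⬝ᵥ y)⁻¹, ← Finset.smul_sum]
    rw [← key y, smul_smul, inv_mul_cancel₀ hy, one_smul]
  -- At `φ b` the expansion reads `β b • p = α b • v b`. Its coefficient at `v a` is zero, so at
  -- most one `β` is nonzero.
  have hβα : ∀ a b, a ≠ b → β b * β a = 0 := by
    intro a b hab
    have h1 := congrArg (fun x => φ a ⬝ᵥ x) (key (φ b))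
    simp only [hφ.dotProduct_sum, dotProduct_smul, smul_eq_mul] at h1
    rw [hβ, dotProduct_comm, hφ.dotProduct_sum, hφ.dotProduct_sum, dotProduct_comm, hφ b a,
      if_neg (Ne.symm hab), mul_zero] at h1
    exact h1
  obtain ⟨a, ha⟩ : ∃ a, β a ≠ 0 := by
    by_contra! h0
    exact hp (by rw [hβ]; simp [h0])
  refine ⟨a, β a, ha, ?_⟩
  conv_lhs => rw [hβ]
  refine Finset.sum_eq_single a (fun b _ hb => ?_) (by simp)
  rw [(mul_eq_zero.mp (hβα b a hb)).resolve_left ha, zero_smul]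

theorem exists_coeff_of_mem_symSquare {κ : Type*} {s : ℕ} {v : Fin s → κ → F} {M : Matrix κ κ F}
    (hM : M ∈ symSquare (Submodule.span F (Set.range v))) :
    ∃ m : Matrix (Fin s) (Fin s) F, m.IsSymm ∧
      M = ∑ a, ∑ b, m a b • Matrix.vecMulVec (v a) (v b) := by
  induction hM using Submodule.span_induction with
  | mem x hx =>
    obtain ⟨x, hx, y, hy, rfl⟩ := hx
    obtain ⟨α, rfl⟩ := (Submodule.mem_span_range_iff_exists_fun F).mp hx
    obtain ⟨β, rfl⟩ := (Submodule.mem_span_range_iff_exists_fun F).mp hy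
    refine ⟨Matrix.vecMulVec α β + Matrix.vecMulVec β α, ?_, ?_⟩
    · ext a b; simp [Matrix.vecMulVec_apply]; ring
    · ext i j
      simp only [Matrix.add_apply, Matrix.vecMulVec_apply, Matrix.sum_apply, Matrix.smul_apply,
        smul_eq_mul, Finset.sum_apply, Pi.smul_apply, Finset.sum_mul_sum]
      rw [← Finset.sum_add_distrib]
      refine Finset.sum_congr rfl fun a _ => ?_
      rw [← Finset.sum_add_distrib]
      exact Finset.sum_congr rfl fun b _ => by ring
  | zero => exact ⟨0, Matrix.isSymm_zero, by simp⟩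
  | add x y _ _ hx hy =>
    obtain ⟨m, hm, rfl⟩ := hx
    obtain ⟨m', hm', rfl⟩ := hy
    exact ⟨m + m', hm.add hm', by simp [add_smul, Finset.sum_add_distrib]⟩
  | smul c x _ hx =>
    obtain ⟨m, hm, rfl⟩ := hx
    exact ⟨c • m, hm.smul c, by simp [mul_smul, Finset.smul_sum]⟩

theorem mulVec_mem_of_mem_symSquare {U : Submodule F (κ → F)} {M : Matrix κ κ F}
    (hM : M ∈ symSquare U) : M.IsSymm ∧ ∀ y, M *ᵥ y ∈ U := by
  induction hM using Submodule.span_induction with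
  | mem x hx =>
    obtain ⟨x, hx, y, hy, rfl⟩ := hx
    refine ⟨?_, fun z => ?_⟩
    · ext a b; simp [Matrix.vecMulVec_apply]; ring
    · rw [Matrix.add_mulVec, vecMulVec_mulVec', vecMulVec_mulVec']
      exact U.add_mem (U.smul_mem _ hx) (U.smul_mem _ hy)
  | zero => exact ⟨Matrix.isSymm_zero, by simp⟩
  | add x y _ _ hx hy =>
    exact ⟨hx.1.add hy.1, fun z => by rw [Matrix.add_mulVec]; exact U.add_mem (hx.2 z) (hy.2 z)⟩
  | smul c x _ hx =>
    exact ⟨hx.1.smul c, fun z => by rw [Matrix.smul_mulVec]; exact U.smul_mem _ (hx.2 z)⟩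

theorem vecMulVec_self_mem_symSquare {κ : Type*} {U : Submodule F (κ → F)} {x : κ → F} (hx : x ∈ U) :
    Matrix.vecMulVec x x ∈ symSquare U := by
  have : Matrix.vecMulVec x x = (2 : F)⁻¹ • (Matrix.vecMulVec x x + Matrix.vecMulVec x x) := by
    rw [← two_smul F, smul_smul, inv_mul_cancel₀ two_ne_zero, one_smul]
  rw [this]
  exact Submodule.smul_mem _ _ (Submodule.subset_span ⟨x, hx, x, hx, rfl⟩)

theorem exists_basis_family (U : Submodule F (κ → F)) :
    ∃ (s : ℕ) (v : Fin s → κ → F), LinearIndependent F v ∧ Submodule.span F (Set.range v) = U := by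
  let b := Module.finBasis F U
  refine ⟨_, fun a => (b a : κ → F), b.linearIndependent.map' U.subtype U.ker_subtype, ?_⟩
  have := congrArg (Submodule.map U.subtype) b.span_eq
  rw [Submodule.map_span, Submodule.map_top, Submodule.range_subtype, ← Set.range_comp] at this
  exact this

/-- If the columns of a symmetric matrix lie in `U`, so do its rows, and the matrix expands in the
products `v a ⊗ v b` with coefficients read off by a dual family. This replaces a span by linear
equations, which a program can solve. -/
theorem mem_symSquare_iff {U : Submodule F (κ → F)} {M : Matrix κ κ F} :
    M ∈ symSquare U ↔ M.IsSymm ∧ ∀ y, M *ᵥ y ∈ U := by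
  refine ⟨mulVec_mem_of_mem_symSquare, fun ⟨hs, hM⟩ => ?_⟩
  obtain ⟨s, v, hv, rfl⟩ := exists_basis_family U
  obtain ⟨φ, hφ⟩ := exists_isDual hv
  have hM' : ∀ y, M *ᵥ y = ∑ a, (y ⬝ᵥ M *ᵥ φ a) • v a := by
    intro y
    conv_lhs => rw [← hφ.sum_eq (hM y)]
    refine Finset.sum_congr rfl fun a _ => ?_
    congr 1
    rw [Matrix.dotProduct_mulVec, ← Matrix.mulVec_transpose, hs.eq, dotProduct_comm]
  have key : M = ∑ a, ∑ b, (φ b ⬝ᵥ M *ᵥ φ a) • Matrix.vecMulVec (v a) (v b) := by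
    rw [← Matrix.mulVec_injective.eq_iff]
    funext y
    rw [hM' y, Matrix.sum_mulVec]
    refine Finset.sum_congr rfl fun a _ => ?_
    rw [Matrix.sum_mulVec]
    have h1 : ∀ b, ((φ b ⬝ᵥ M *ᵥ φ a) • Matrix.vecMulVec (v a) (v b)) *ᵥ y
        = ((φ b ⬝ᵥ M *ᵥ φ a) * (v b ⬝ᵥ y)) • v a := fun b => by
      rw [Matrix.smul_mulVec, vecMulVec_mulVec', smul_smul]
    rw [Finset.sum_congr rfl fun b _ => h1 b, ← Finset.sum_smul]
    congr 1
    conv_lhs => rw [← hφ.sum_eq (hM (φ a)), dotProduct_sum]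
    exact Finset.sum_congr rfl fun b _ => by rw [dotProduct_smul, smul_eq_mul, dotProduct_comm y]
  -- Averaging the expansion with its transpose produces the generators of `symSquare`.
  have hM2 : M = (2 : F)⁻¹ • ∑ a, ∑ b, (φ b ⬝ᵥ M *ᵥ φ a) •
      (Matrix.vecMulVec (v a) (v b) + Matrix.vecMulVec (v b) (v a)) := by
    have : M + M = ∑ a, ∑ b, (φ b ⬝ᵥ M *ᵥ φ a) •
      (Matrix.vecMulVec (v a) (v b) + Matrix.vecMulVec (v b) (v a)) := by
      simp_rw [smul_add, Finset.sum_add_distrib]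
      congr 1
      conv_lhs => rw [← hs.eq, key]
      simp_rw [Matrix.transpose_sum, Matrix.transpose_smul, Matrix.transpose_vecMulVec]
    rw [← this, ← two_smul F, smul_smul, inv_mul_cancel₀ two_ne_zero, one_smul]
  rw [hM2]
  refine Submodule.smul_mem _ _ (Submodule.sum_mem _ fun a _ => Submodule.sum_mem _ fun b _ =>
    Submodule.smul_mem _ _ (Submodule.subset_span
      ⟨_, Submodule.subset_span ⟨a, rfl⟩, _, Submodule.subset_span ⟨b, rfl⟩, rfl⟩))

/-- `H` is the orthogonal projection with kernel `Z`. -/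
structure IsProjector (H : Matrix κ κ F) (Z : Submodule F (κ → F)) : Prop where
  herm : Hᴴ = H
  idem : H * H = H
  ker : ∀ x, H *ᵥ x = 0 ↔ x ∈ Z

theorem IsProjector.one [DecidableEq κ] : IsProjector (1 : Matrix κ κ F) ⊥ :=
  ⟨Matrix.conjTranspose_one, one_mul _, fun x => by simp⟩

theorem star_dotProduct_self_eq_zero {h : κ → F} : star h ⬝ᵥ h = 0 ↔ h = 0 := by
  refine ⟨fun H => ?_, fun H => by simp [H]⟩
  have : ∑ i, ‖h i‖ ^ 2 = 0 := by
    have h1 : ((∑ i, ‖h i‖ ^ 2 : ℝ) : F) = 0 := by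
      rw [← H, dotProduct]
      push_cast
      refine Finset.sum_congr rfl fun i _ => ?_
      simp [RCLike.star_def, RCLike.conj_mul]
    exact_mod_cast h1
  rw [Finset.sum_eq_zero_iff_of_nonneg fun i _ => by positivity] at this
  ext i
  simpa using this i (Finset.mem_univ i)

theorem IsProjector.star_dotProduct {H : Matrix κ κ F} {Z : Submodule F (κ → F)}
    (hH : IsProjector H Z) (x y : κ → F) : star (H *ᵥ x) ⬝ᵥ y = star x ⬝ᵥ H *ᵥ y := by
  rw [Matrix.star_mulVec, hH.herm, Matrix.dotProduct_mulVec]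

theorem IsProjector.mulVec_mulVec {H : Matrix κ κ F} {Z : Submodule F (κ → F)}
    (hH : IsProjector H Z) (x : κ → F) : H *ᵥ (H *ᵥ x) = H *ᵥ x := by
  rw [Matrix.mulVec_mulVec, hH.idem]

theorem IsProjector.dotProduct_self {H : Matrix κ κ F} {Z : Submodule F (κ → F)}
    (hH : IsProjector H Z) (t : κ → F) : star t ⬝ᵥ H *ᵥ t = star (H *ᵥ t) ⬝ᵥ H *ᵥ t := by
  rw [hH.star_dotProduct, hH.mulVec_mulVec]

theorem IsProjector.dotProduct_eq_zero {H : Matrix κ κ F} {Z : Submodule F (κ → F)}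
    (hH : IsProjector H Z) {t : κ → F} : star t ⬝ᵥ H *ᵥ t = 0 ↔ t ∈ Z := by
  rw [hH.dotProduct_self, star_dotProduct_self_eq_zero, hH.ker]

/-- One step of the Gram-Schmidt process, on the level of projections. -/
theorem IsProjector.step {H : Matrix κ κ F} {Z : Submodule F (κ → F)} (hH : IsProjector H Z)
    (t : κ → F) :
    IsProjector (H - (star t ⬝ᵥ H *ᵥ t)⁻¹ • Matrix.vecMulVec (H *ᵥ t) (star (H *ᵥ t)))
      (Z ⊔ Submodule.span F {t}) := by
  -- For `t` in `Z` the correction has the coefficient `0⁻¹ = 0`, so the projection stays as it is,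
  -- as it should.
  by_cases ht : t ∈ Z
  · rw [hH.dotProduct_eq_zero.mpr ht, inv_zero, zero_smul, sub_zero,
      sup_eq_left.mpr (Submodule.span_le.mpr (by simpa using ht))]
    exact hH
  have hq : star t ⬝ᵥ H *ᵥ t ≠ 0 := fun h => ht (hH.dotProduct_eq_zero.mp h)
  have hstar : star (star t ⬝ᵥ H *ᵥ t) = star t ⬝ᵥ H *ᵥ t := by
    conv_rhs => rw [Matrix.star_dotProduct, hH.star_dotProduct]
  have hself := hH.dotProduct_self t
  set h := H *ᵥ t with hh
  set q := star t ⬝ᵥ h with hqdef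
  have mv : ∀ x, (H - q⁻¹ • Matrix.vecMulVec h (star h)) *ᵥ x =
      H *ᵥ x - (q⁻¹ * (star h ⬝ᵥ x)) • h := by
    intro x
    rw [Matrix.sub_mulVec, Matrix.smul_mulVec, vecMulVec_mulVec', smul_smul]
  have hHh : H *ᵥ h = h := hH.mulVec_mulVec t
  have hhH : ∀ x, star h ⬝ᵥ H *ᵥ x = star h ⬝ᵥ x := fun x => by
    rw [← hH.star_dotProduct, hHh]
  refine ⟨?_, ?_, fun x => ?_⟩
  · rw [Matrix.conjTranspose_sub, Matrix.conjTranspose_smul, hH.herm, star_inv₀, hstar,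
      Matrix.conjTranspose_vecMulVec, star_star]
  · rw [← Matrix.mulVec_injective.eq_iff]
    funext x
    rw [← Matrix.mulVec_mulVec, mv x, mv, Matrix.mulVec_sub, hH.mulVec_mulVec, Matrix.mulVec_smul,
      hHh, dotProduct_sub, hhH, dotProduct_smul, ← hself, smul_eq_mul,
      mul_assoc, mul_comm _ q, inv_mul_cancel_left₀ hq, sub_self, mul_zero, zero_smul, sub_zero]
  · rw [mv, Submodule.mem_sup]
    constructor
    · intro hx
      refine ⟨x - (q⁻¹ * (star h ⬝ᵥ x)) • t, ?_, (q⁻¹ * (star h ⬝ᵥ x)) • t,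
        Submodule.smul_mem _ _ (Submodule.mem_span_singleton_self t), by simp⟩
      rw [← hH.ker, Matrix.mulVec_sub, Matrix.mulVec_smul, ← hh, hx]
    · rintro ⟨y, hy, z, hz, rfl⟩
      obtain ⟨a, rfl⟩ := Submodule.mem_span_singleton.mp hz
      have hy' := (hH.ker y).mpr hy
      have h1 : star h ⬝ᵥ y = 0 := by rw [← hhH, hy', dotProduct_zero]
      have h2 : star h ⬝ᵥ t = q := by rw [← hhH, ← hh, ← hself]
      rw [Matrix.mulVec_add, Matrix.mulVec_smul, hy', ← hh, dotProduct_add, h1, dotProduct_smul,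
        h2, zero_add, zero_add, smul_eq_mul, mul_comm a, inv_mul_cancel_left₀ hq, sub_self]

theorem exists_isProjector (Z : Submodule F (κ → F)) : ∃ H : Matrix κ κ F, IsProjector H Z := by
  classical
  obtain ⟨s, rfl⟩ := IsNoetherian.noetherian Z
  induction s using Finset.induction_on with
  | empty => exact ⟨1, by simpa using IsProjector.one⟩
  | insert x s _ ih =>
    obtain ⟨H, hH⟩ := ih
    have := hH.step x
    rw [Finset.coe_insert, Submodule.span_insert, sup_comm]
    exact ⟨_, this⟩

theorem IsProjector.mulVec_eq_self_iff {H : Matrix κ κ F} {Z : Submodule F (κ → F)}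
    (hH : IsProjector H Z) (x : κ → F) : H *ᵥ x = x ↔ ∀ t ∈ Z, star t ⬝ᵥ x = 0 := by
  constructor
  · intro hx t ht
    rw [← hx, ← hH.star_dotProduct, (hH.ker t).mpr ht, star_zero, zero_dotProduct]
  · intro hx
    have h1 : x - H *ᵥ x ∈ Z := by
      rw [← hH.ker, Matrix.mulVec_sub, hH.mulVec_mulVec, sub_self]
    have h2 : star (x - H *ᵥ x) ⬝ᵥ (x - H *ᵥ x) = 0 := by
      rw [dotProduct_sub, hx _ h1, ← hH.star_dotProduct, (hH.ker _).mpr h1, star_zero,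
        zero_dotProduct, sub_zero]
    exact (sub_eq_zero.mp (star_dotProduct_self_eq_zero.mp h2)).symm

theorem IsProjector.sub_mem {H : Matrix κ κ F} {Z : Submodule F (κ → F)}
    (hH : IsProjector H Z) (x : κ → F) : x - H *ᵥ x ∈ Z := by
  rw [← hH.ker, Matrix.mulVec_sub, hH.mulVec_mulVec, sub_self]

/-- Let `1 - H` and `1 - K` be the orthogonal projections onto the ranges of `A` and of `Aᴴ`. Choose
`G` with `G * A = 1 - K`. Then `B = G * (1 - H)` satisfies `A * B = 1 - H` and `B * A = 1 - K`, from
which the four Penrose equations follow. -/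
theorem exists_isMoorePenrose (A : Matrix κ τ F) : ∃ B : Matrix τ κ F, IsMoorePenrose A B := by
  classical
  obtain ⟨H, hH⟩ := exists_isProjector (LinearMap.range A.mulVecLin)
  obtain ⟨K, hK⟩ := exists_isProjector (LinearMap.range Aᴴ.mulVecLin)
  have hHA : H * A = 0 := by
    rw [← Matrix.mulVec_injective.eq_iff]
    funext x
    rw [← Matrix.mulVec_mulVec, (hH.ker (A *ᵥ x)).mpr ⟨x, rfl⟩, Matrix.zero_mulVec]
  have hAK : A * K = 0 := by
    have : K * Aᴴ = 0 := by
      rw [← Matrix.mulVec_injective.eq_iff]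
      funext x
      rw [← Matrix.mulVec_mulVec, (hK.ker (Aᴴ *ᵥ x)).mpr ⟨x, rfl⟩, Matrix.zero_mulVec]
    have := congrArg Matrix.conjTranspose this
    simpa [hK.herm] using this
  obtain ⟨G, hG⟩ : ∃ G : Matrix τ κ F, G * A = 1 - K := by
    -- The kernel of `A` is orthogonal to the range of `Aᴴ`, so `1 - K` factors through `A`; any
    -- extension of the factor to the whole space is a possible `G`.
    have hker : LinearMap.ker A.mulVecLin ≤ LinearMap.ker (1 - K).mulVecLin := by
      intro x hx
      rw [LinearMap.mem_ker, Matrix.mulVecLin_apply] at hx ⊢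
      rw [Matrix.sub_mulVec, Matrix.one_mulVec, sub_eq_zero, eq_comm, hK.mulVec_eq_self_iff]
      rintro _ ⟨y, rfl⟩
      rw [Matrix.mulVecLin_apply, Matrix.star_mulVec, Matrix.conjTranspose_conjTranspose,
        ← Matrix.dotProduct_mulVec, hx, dotProduct_zero]
    obtain ⟨g, hg⟩ := LinearMap.exists_extend
      ((LinearMap.ker A.mulVecLin).liftQ _ hker ∘ₗ
        A.mulVecLin.quotKerEquivRange.symm.toLinearMap)
    refine ⟨LinearMap.toMatrix' g, ?_⟩
    rw [← Matrix.mulVec_injective.eq_iff]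
    funext x
    rw [← Matrix.mulVec_mulVec, LinearMap.toMatrix'_mulVec]
    have := LinearMap.congr_fun hg ⟨A *ᵥ x, ⟨x, rfl⟩⟩
    simp only [LinearMap.comp_apply, Submodule.subtype_apply, LinearEquiv.coe_coe] at this
    rw [this]
    have h3 : A.mulVecLin.quotKerEquivRange.symm ⟨A *ᵥ x, ⟨x, rfl⟩⟩ =
        (LinearMap.ker A.mulVecLin).mkQ x :=
      A.mulVecLin.quotKerEquivRange_symm_apply_image x ⟨x, rfl⟩
    rw [h3]
    rfl
  have hAB : A * (G * (1 - H)) = 1 - H := by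
    rw [← Matrix.mulVec_injective.eq_iff]
    funext x
    obtain ⟨y, hy⟩ := hH.sub_mem x
    rw [Matrix.mulVecLin_apply] at hy
    have h1 : (1 - H) *ᵥ x = A *ᵥ y := by rw [hy, Matrix.sub_mulVec, Matrix.one_mulVec]
    rw [← Matrix.mul_assoc, ← Matrix.mulVec_mulVec, h1, Matrix.mulVec_mulVec, Matrix.mul_assoc,
      hG, Matrix.mul_sub, hAK, Matrix.mul_one, sub_zero]
  have hBA : G * (1 - H) * A = 1 - K := by
    rw [Matrix.mul_assoc, Matrix.sub_mul, hHA, Matrix.one_mul, sub_zero, hG]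
  refine ⟨G * (1 - H), ?_, ?_, ?_, ?_⟩
  · rw [hAB, Matrix.sub_mul, hHA, Matrix.one_mul, sub_zero]
  · rw [Matrix.mul_assoc, hAB, Matrix.mul_assoc]
    congr 1
    rw [Matrix.mul_sub, Matrix.sub_mul, Matrix.sub_mul, hH.idem]
    simp
  · rw [hAB, Matrix.conjTranspose_sub, hH.herm, Matrix.conjTranspose_one]
  · rw [hBA, Matrix.conjTranspose_sub, hK.herm, Matrix.conjTranspose_one]

end TensorDecomp
end

/-! ### Simultaneous diagonalization of a tensor with symmetric slices -/

noncomputable section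
namespace TensorDecomp
variable {F : Type*} [RCLike F] {κ τ : Type*} [Fintype κ] [Fintype τ] {s : ℕ}

/-- `P = ∑ z_a ⊗ v_a ⊗ v_a` with linearly independent `z_a` and linearly independent `v_a`. -/
structure SquareForm {κ : Type*} (P : Fin s → Matrix κ κ F) (z : Fin s → Fin s → F)
    (v : Fin s → κ → F) : Prop where
  indep_z : LinearIndependent F z
  indep_v : LinearIndependent F v
  eq : ∀ x i j, P x i j = ∑ a, z a x * v a i * v a j

/-- The functionals `f`, `g` are in general position with respect to the `z_a`. -/
structure IsGeneric (f g : Fin s → F) (z : Fin s → Fin s → F) : Prop where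
  left : ∀ a, f ⬝ᵥ z a ≠ 0
  right : ∀ a, g ⬝ᵥ z a ≠ 0
  cross : ∀ a b, a ≠ b → (f ⬝ᵥ z a) * (g ⬝ᵥ z b) ≠ (f ⬝ᵥ z b) * (g ⬝ᵥ z a)

theorem IsGeneric.swap {f g : Fin s → F} {z : Fin s → Fin s → F} (h : IsGeneric f g z) :
    IsGeneric g f z :=
  ⟨h.right, h.left, fun a b hab H => h.cross a b hab (by linear_combination -H)⟩

theorem IsGeneric.ratio_injective {f g : Fin s → F} {z : Fin s → Fin s → F}
    (h : IsGeneric f g z) : Function.Injective fun a => (f ⬝ᵥ z a) / (g ⬝ᵥ z a) := by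
  intro a b hab
  by_contra hne
  rw [div_eq_div_iff (h.right a) (h.right b)] at hab
  exact h.cross a b hne hab

theorem SquareForm.contract_apply {κ : Type*} {P : Fin s → Matrix κ κ F} {z : Fin s → Fin s → F}
    {v : Fin s → κ → F} (h : SquareForm P z v) (f : Fin s → F) (i j : κ) :
    contract P f i j = ∑ a, (f ⬝ᵥ z a) * v a i * v a j := by
  simp only [contract, Matrix.sum_apply, Matrix.smul_apply, smul_eq_mul, h.eq, dotProduct,
    Finset.mul_sum, Finset.sum_mul]
  rw [Finset.sum_comm]
  exact Finset.sum_congr rfl fun a _ => Finset.sum_congr rfl fun b _ => by ring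

theorem SquareForm.contract_transpose {κ : Type*} {P : Fin s → Matrix κ κ F}
    {z : Fin s → Fin s → F} {v : Fin s → κ → F} (h : SquareForm P z v) (f : Fin s → F) :
    (contract P f)ᵀ = contract P f := by
  ext i j
  rw [Matrix.transpose_apply, h.contract_apply, h.contract_apply]
  exact Finset.sum_congr rfl fun a _ => by ring

theorem SquareForm.contract_mulVec {P : Fin s → Matrix κ κ F} {z : Fin s → Fin s → F}
    {v : Fin s → κ → F} (h : SquareForm P z v) (f : Fin s → F) (y : κ → F) :
    contract P f *ᵥ y = ∑ a, ((f ⬝ᵥ z a) * (v a ⬝ᵥ y)) • v a := by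
  ext i
  simp only [Matrix.mulVec, dotProduct, h.contract_apply, Finset.sum_apply, Pi.smul_apply,
    smul_eq_mul, Finset.mul_sum, Finset.sum_mul]
  rw [Finset.sum_comm]
  exact Finset.sum_congr rfl fun a _ => Finset.sum_congr rfl fun b _ =>
    Finset.sum_congr rfl fun c _ => by ring

theorem SquareForm.contract_mulVec_mem {P : Fin s → Matrix κ κ F} {z : Fin s → Fin s → F}
    {v : Fin s → κ → F} (h : SquareForm P z v) (f : Fin s → F) (y : κ → F) :
    contract P f *ᵥ y ∈ Submodule.span F (Set.range v) := by
  rw [h.contract_mulVec]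
  exact Submodule.sum_mem _ fun a _ => Submodule.smul_mem _ _ (Submodule.subset_span ⟨a, rfl⟩)

/-- The `v_a` are eigenvectors of `P(f) B`, for any inner inverse `B` of `P(g)`. -/
theorem SquareForm.eigen {P : Fin s → Matrix κ κ F} {z : Fin s → Fin s → F}
    {v : Fin s → κ → F} (h : SquareForm P z v) {f g : Fin s → F} (hg : ∀ a, g ⬝ᵥ z a ≠ 0)
    {B : Matrix κ κ F} (hB : contract P g * B * contract P g = contract P g) (b : Fin s) :
    (contract P f * B) *ᵥ v b = ((f ⬝ᵥ z b) / (g ⬝ᵥ z b)) • v b := by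
  obtain ⟨φ, hφ⟩ := exists_isDual h.indep_v
  have h1 : contract P g *ᵥ φ b = (g ⬝ᵥ z b) • v b := by
    rw [h.contract_mulVec, Finset.sum_eq_single b]
    · rw [dotProduct_comm (v b), hφ b b, if_pos rfl, mul_one]
    · intro c _ hc
      rw [dotProduct_comm (v c), hφ b c, if_neg (Ne.symm hc), mul_zero, zero_smul]
    · simp
  -- On the range of `P(g)`, which contains `v b` by `h1`, the inner inverse makes `P(g) B` the
  -- identity.
  have h2 : contract P g *ᵥ (B *ᵥ v b) = v b := by
    have := congrArg (· *ᵥ φ b) hB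
    simp only [← Matrix.mulVec_mulVec, h1, Matrix.mulVec_smul] at this
    exact smul_right_injective _ (hg b) this
  -- These are the coefficients of `P(g) B v_b = v_b` in the independent family `v`.
  have h3 : ∀ a, (g ⬝ᵥ z a) * (v a ⬝ᵥ B *ᵥ v b) = if a = b then 1 else 0 := by
    intro a
    rw [h.contract_mulVec] at h2
    rw [← hφ.dotProduct_sum (fun a => (g ⬝ᵥ z a) * (v a ⬝ᵥ B *ᵥ v b)) a, h2, hφ]
  rw [← Matrix.mulVec_mulVec, h.contract_mulVec, Finset.sum_eq_single b]
  · have := h3 b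
    rw [if_pos rfl] at this
    rw [eq_div_of_mul_eq (hg b) ((mul_comm _ _).trans this), mul_one_div]
  · intro c _ hc
    have := h3 c
    rw [if_neg hc] at this
    rw [(mul_eq_zero.mp this).resolve_left (hg c), mul_zero, zero_smul]
  · simp

/-- An eigenvector with nonzero eigenvalue lies in the range of `M`, hence in the span of the `v a`;
since the `lam a` are distinct, only one coefficient can be nonzero. -/
theorem exists_eigen_of_range_le {v : Fin s → κ → F} (hv : LinearIndependent F v)
    {M : Matrix κ κ F} {lam : Fin s → F} (hl : Function.Injective lam)
    (hM : ∀ a, M *ᵥ v a = lam a • v a) (hr : ∀ y, M *ᵥ y ∈ Submodule.span F (Set.range v))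
    {x : κ → F} {μ : F} (hx : x ≠ 0) (hμ : μ ≠ 0) (hxμ : M *ᵥ x = μ • x) :
    ∃ a, μ = lam a ∧ ∃ c : F, c ≠ 0 ∧ x = c • v a := by
  obtain ⟨φ, hφ⟩ := exists_isDual hv
  have hxs : x ∈ Submodule.span F (Set.range v) := by
    have := Submodule.smul_mem _ μ⁻¹ (hr x)
    rwa [hxμ, smul_smul, inv_mul_cancel₀ hμ, one_smul] at this
  obtain ⟨β, rfl⟩ := (Submodule.mem_span_range_iff_exists_fun F).mp hxs
  have h1 : ∀ a, β a * lam a = μ * β a := by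
    intro a
    have := congrArg (φ a ⬝ᵥ ·) hxμ
    simp only [Matrix.mulVec_sum, Matrix.mulVec_smul, hM, smul_smul, dotProduct_smul,
      hφ.dotProduct_sum, smul_eq_mul] at this
    exact this
  obtain ⟨a, ha⟩ : ∃ a, β a ≠ 0 := by
    by_contra! h0
    exact hx (by simp [h0])
  have hμa : μ = lam a := mul_right_cancel₀ ha ((h1 a).symm.trans (mul_comm _ _))
  refine ⟨a, hμa, β a, ha, Finset.sum_eq_single a (fun b _ hb => ?_) (by simp)⟩
  have h2 : β b * (lam b - lam a) = 0 := by rw [mul_sub, h1, hμa]; ring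
  rw [(mul_eq_zero.mp h2).resolve_right (sub_ne_zero.mpr fun h => hb (hl h)), zero_smul]

theorem SquareForm.simpleSpectrum {P : Fin s → Matrix κ κ F} {z : Fin s → Fin s → F}
    {v : Fin s → κ → F} (h : SquareForm P z v) {f g : Fin s → F} (hfg : IsGeneric f g z)
    {B : Matrix κ κ F} (hB : contract P g * B * contract P g = contract P g) :
    SimpleSpectrum (contract P f * B) (fun a => (f ⬝ᵥ z a) / (g ⬝ᵥ z a)) v := by
  have he := fun b => h.eigen (f := f) hfg.right hB b
  have hne : ∀ a, (f ⬝ᵥ z a) / (g ⬝ᵥ z a) ≠ 0 := fun a => div_ne_zero (hfg.left a) (hfg.right a)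
  refine ⟨?_, hfg.ratio_injective, hne, fun a => h.indep_v.ne_zero a, he⟩
  have hrange : LinearMap.range (contract P f * B).mulVecLin = Submodule.span F (Set.range v) := by
    apply le_antisymm
    · rintro _ ⟨y, rfl⟩
      rw [Matrix.mulVecLin_apply, ← Matrix.mulVec_mulVec]
      exact h.contract_mulVec_mem f _
    · rw [Submodule.span_le]
      rintro _ ⟨a, rfl⟩
      refine ⟨((f ⬝ᵥ z a) / (g ⬝ᵥ z a))⁻¹ • v a, ?_⟩
      rw [Matrix.mulVecLin_apply, Matrix.mulVec_smul, he, smul_smul, inv_mul_cancel₀ (hne a),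
        one_smul]
  rw [Matrix.rank, hrange, finrank_span_eq_card h.indep_v, Fintype.card_fin]

/-- The slices are symmetric, so the second eigenvalue problem of the algorithm is the first one
with `f` and `g` exchanged. Only the inner-inverse identity has to be carried over, because
`SquareForm.eigen` uses nothing else. -/
theorem SquareForm.transposed_eq {P : Fin s → Matrix κ κ F} {z : Fin s → Fin s → F}
    {v : Fin s → κ → F} (h : SquareForm P z v) (f g : Fin s → F) {B : Matrix κ κ F}
    (hB : contract P f * B * contract P f = contract P f) :
    (B * contract P g)ᵀ = contract P g * Bᵀ ∧
      contract P f * Bᵀ * contract P f = contract P f := by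
  rw [Matrix.transpose_mul, h.contract_transpose]
  refine ⟨rfl, ?_⟩
  have := congrArg Matrix.transpose hB
  rwa [Matrix.transpose_mul, Matrix.transpose_mul, h.contract_transpose, ← Matrix.mul_assoc] at this

theorem not_mem_span_singleton_of_linearIndependent {z : Fin s → Fin s → F}
    (hz : LinearIndependent F z) {a b : Fin s} (hab : a ≠ b) : z a ∉ Submodule.span F {z b} := by
  have := hz.notMem_span_image (s := {b}) (x := a) (by simpa using hab)
  simpa using this

theorem sum_sum_mul_sum {κ ι : Type*} [Fintype κ] [Fintype ι] (h : κ → κ → F) (c : ι → F)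
    (v : ι → κ → F) :
    ∑ i, ∑ j, h i j * ∑ b, c b * v b i * v b j =
      ∑ b, c b * ∑ i, ∑ j, h i j * (v b i * v b j) := by
  simp only [Finset.mul_sum]
  rw [Finset.sum_congr rfl fun i _ => Finset.sum_comm, Finset.sum_comm]
  exact Finset.sum_congr rfl fun b _ => Finset.sum_congr rfl fun i _ =>
    Finset.sum_congr rfl fun j _ => by ring

/-- With the `v a` as eigenvectors in both modes and `φ a ⊗ φ a` as functionals, the vectors `u a`
come out as the `z a`. -/
theorem SquareForm.exists_simDiag {P : Fin s → Matrix κ κ F} {z : Fin s → Fin s → F}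
    {v : Fin s → κ → F} (h : SquareForm P z v) {f g : Fin s → F} (hfg : IsGeneric f g z) :
    ∃ D, SimDiag P f g (some D) ∧ HasSquareForm P D v := by
  obtain ⟨Tf', hf⟩ := exists_isMoorePenrose (contract P f)
  obtain ⟨Tg', hg⟩ := exists_isMoorePenrose (contract P g)
  obtain ⟨φ, hφ⟩ := exists_isDual h.indep_v
  have ht := h.transposed_eq f g hf.1
  refine ⟨⟨s, z, v, v⟩, ⟨Tf', Tg', hf, hg, Or.inr ⟨s, _, v, h.simpleSpectrum hfg hg.1,
    Or.inr ⟨v, fun a i j => φ a i * φ a j, z, ?_, ?_, ?_, Or.inr ⟨?_, rfl⟩⟩⟩⟩, h.eq, rfl, z,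
    h.indep_z, h.indep_v, fun a x i j => rfl⟩
  · rw [ht.1]
    have := h.simpleSpectrum hfg.swap ht.2
    simpa only [inv_div] using this
  · intro a b
    have : ∑ i, ∑ j, φ a i * φ a j * (v b i * v b j) = (φ a ⬝ᵥ v b) * (φ a ⬝ᵥ v b) := by
      simp only [dotProduct, Finset.sum_mul_sum]
      exact Finset.sum_congr rfl fun i _ => Finset.sum_congr rfl fun j _ => by ring
    rw [this, hφ]
    split_ifs <;> simp
  · intro a x
    have : ∑ i, ∑ j, φ a i * φ a j * P x i j =
        ∑ b, z b x * ((φ a ⬝ᵥ v b) * (φ a ⬝ᵥ v b)) := by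
      simp only [h.eq]
      rw [sum_sum_mul_sum]
      refine Finset.sum_congr rfl fun b _ => ?_
      simp only [dotProduct, Finset.sum_mul_sum]
      exact congrArg _ (Finset.sum_congr rfl fun i _ => Finset.sum_congr rfl fun j _ => by ring)
    rw [this]
    simp [hφ a]
  · intro a b hab
    exact not_mem_span_singleton_of_linearIndependent h.indep_z hab

/-- The eigenvectors found in any run are multiples `c a • v (σ a)` and `c' a • v (σ' a)`. The
matching of reciprocal eigenvalues forces `σ' = σ`, and the dual functionals scale inversely, so `u
a` is `z (σ a)` divided by `c a * c' a`. The terms are therefore the original ones in another order,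
and no check can fail. -/
theorem SimDiag.exists_of_squareForm {P : Fin s → Matrix κ κ F} {z : Fin s → Fin s → F}
    {v : Fin s → κ → F} (h : SquareForm P z v) {f g : Fin s → F} (hfg : IsGeneric f g z)
    {out : Option (Triples F s κ κ)} (hout : SimDiag P f g out) :
    ∃ D, out = some D ∧ ∃ v, HasSquareForm P D v := by
  obtain ⟨Tf', Tg', hf, hg, hout⟩ := hout
  have ht := h.transposed_eq f g hf.1
  have sp := h.simpleSpectrum hfg hg.1
  have sp2 := h.simpleSpectrum hfg.swap ht.2
  rw [← ht.1] at sp2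
  have hmem : ∀ (f : Fin s → F) (B : Matrix κ κ F) y, (contract P f * B) *ᵥ y ∈
      Submodule.span F (Set.range v) := fun f B y => by
    rw [← Matrix.mulVec_mulVec]; exact h.contract_mulVec_mem f _
  rcases hout with ⟨hno, -⟩ | ⟨r, lam, v', hsp, hout⟩
  · exact absurd ⟨s, _, v, sp⟩ hno
  obtain rfl : r = s := hsp.rank_eq.symm.trans sp.rank_eq
  have hex := fun a => exists_eigen_of_range_le h.indep_v hfg.ratio_injective sp.eigen
    (hmem f Tg') (hsp.vec_ne_zero a) (hsp.ne_zero a) (hsp.eigen a)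
  choose σ hlam c hc hv' using hex
  have hσ : Function.Injective σ := fun a b hab => hsp.injective (by rw [hlam, hlam, hab])
  have hσb : Function.Bijective σ := Finite.injective_iff_bijective.mp hσ
  rcases hout with ⟨hno, -⟩ | ⟨w, H, u, hsp', hH, hu, hout⟩
  · refine absurd ⟨fun a => v (σ a), sp2.rank_eq, fun a b hab => hsp.injective (inv_injective hab),
      fun a => inv_ne_zero (hsp.ne_zero a), fun a => h.indep_v.ne_zero _, fun a => ?_⟩ hno
    have := sp2.eigen (σ a)
    rw [this, hlam, inv_div]
  have hex := fun a => exists_eigen_of_range_le h.indep_v hfg.swap.ratio_injective sp2.eigen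
    (by rw [ht.1]; exact hmem g _) (hsp'.vec_ne_zero a) (hsp'.ne_zero a) (hsp'.eigen a)
  choose σ' hlam' c' hc' hw using hex
  have hσσ' : ∀ a, σ' a = σ a := fun a => hfg.swap.ratio_injective (by
    have := hlam' a
    rw [hlam, inv_div] at this
    exact this.symm)
  simp_rw [hσσ'] at hw
  have hu' : ∀ a, u a = (c a * c' a)⁻¹ • z (σ a) := by
    intro a
    ext x
    have h1 : ∀ b, ∑ i, ∑ j, H a i j * (v (σ b) i * v (σ b) j) =
        if a = b then (c b * c' b)⁻¹ else 0 := by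
      intro b
      have := hH a b
      rw [hv' b, hw b] at this
      simp only [Pi.smul_apply, smul_eq_mul] at this
      have h2 : (c b * c' b) * ∑ i, ∑ j, H a i j * (v (σ b) i * v (σ b) j) =
          if a = b then 1 else 0 := by
        rw [← this, Finset.mul_sum]
        refine Finset.sum_congr rfl fun i _ => ?_
        rw [Finset.mul_sum]
        exact Finset.sum_congr rfl fun j _ => by ring
      have hcc : c b * c' b ≠ 0 := mul_ne_zero (hc b) (hc' b)
      rw [← inv_mul_cancel_left₀ hcc (∑ i, ∑ j, H a i j * (v (σ b) i * v (σ b) j)), h2]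
      split_ifs <;> simp
    have h3 : u a x = ∑ b, z (σ b) x * ∑ i, ∑ j, H a i j * (v (σ b) i * v (σ b) j) := by
      have := (Equiv.ofBijective σ hσb).sum_comp
        (fun b => z b x * ∑ i, ∑ j, H a i j * (v b i * v b j))
      simp only [Equiv.ofBijective_apply] at this
      rw [hu, this]
      simp only [h.eq]
      rw [sum_sum_mul_sum]
    rw [h3]
    simp_rw [h1]
    simp [mul_comm]
  have hz' : LinearIndependent F fun a => z (σ a) := h.indep_z.comp σ hσ
  have hcc : ∀ a, (c a * c' a)⁻¹ ≠ 0 := fun a => inv_ne_zero (mul_ne_zero (hc a) (hc' a))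
  have hu_li : LinearIndependent F u := by
    have := hz'.units_smul (fun a => Units.mk0 _ (hcc a))
    convert this using 1
    funext a
    exact hu' a
  rcases hout with ⟨⟨a, b, hab, hmem⟩, -⟩ | ⟨-, rfl⟩
  · exact absurd hmem (not_mem_span_singleton_of_linearIndependent hu_li hab)
  -- Since `w a` is `c' a / c a` times `v' a`, moving this scalar to the first mode turns each term
  -- into a square.
  refine ⟨_, rfl, v', ?_, rfl, fun a => (c' a / c a) • u a, ?_, ?_, ?_⟩
  · intro x i j
    rw [h.eq, ← (Equiv.ofBijective σ hσb).sum_comp]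
    refine Finset.sum_congr rfl fun a _ => ?_
    simp only [hu', hv' a, hw a, Equiv.ofBijective_apply, Pi.smul_apply, smul_eq_mul]
    field_simp [hc a, hc' a]
  · exact hu_li.units_smul (fun a => Units.mk0 (c' a / c a) (div_ne_zero (hc' a) (hc a)))
  · have := (h.indep_v.comp σ hσ).units_smul (fun a => Units.mk0 _ (hc a))
    convert this using 1
    funext a
    exact hv' a
  · intro a x i j
    simp only [hw a, hv' a, Fin.cast_eq_self, Pi.smul_apply, smul_eq_mul]
    field_simp [hc a]

theorem HasSquareForm.exists_squareForm {κ : Type*} [Fintype κ] {P : Fin s → Matrix κ κ F}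
    {D : Triples F s κ κ}
    {v : Fin s → κ → F} (h : HasSquareForm P D v) : ∃ z, SquareForm P z v := by
  obtain ⟨r, u, v', w⟩ := D
  obtain ⟨h1, e, z, hz, hv, h2⟩ := h
  dsimp only at e
  subst e
  exact ⟨z, hz, hv, fun x i j => by rw [h1]; exact Finset.sum_congr rfl fun a _ => h2 a x i j⟩

theorem exists_ne_zero_apply {ι : Type*} {x : ι → F} (hx : x ≠ 0) : ∃ i, x i ≠ 0 :=
  Function.ne_iff.mp hx

theorem SimpleSpectrum.linearIndependent {M : Matrix κ κ F} {r : ℕ} {lam : Fin r → F}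
    {v : Fin r → κ → F} (h : SimpleSpectrum M lam v) : LinearIndependent F v :=
  Module.End.eigenvectors_linearIndependent' M.mulVecLin lam h.injective v fun a =>
    ⟨Module.End.mem_eigenspace_iff.mpr (h.eigen a), h.vec_ne_zero a⟩

/-- A run that survives every check forces a square form of `P` and functionals in general position.
This converse of `SimDiag.exists_of_squareForm` lets "Fail" be declared whenever such data do not
exist. -/
theorem intersection_fail_or_exists (P : Fin s → Matrix κ κ F) (f g : Fin s → F) :
    (∃ D : Triples F s κ κ, SimDiag P f g (some D) ∧ ∃ z v, SquareForm P z v ∧ IsGeneric f g z ∧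
      HasSquareForm P D v) ∨
    SimDiag P f g none ∨
    (∃ D : Triples F s κ κ, SimDiag P f g (some D) ∧ ¬ ∃ v, HasSquareForm P D v) := by
  obtain ⟨Tf', hf⟩ := exists_isMoorePenrose (contract P f)
  obtain ⟨Tg', hg⟩ := exists_isMoorePenrose (contract P g)
  by_cases h1 : ∃ (r : ℕ) (lam : Fin r → F) (v : Fin r → κ → F),
          SimpleSpectrum (contract P f * Tg') lam v
  swap
  · exact Or.inr (Or.inl ⟨Tf', Tg', hf, hg, Or.inl ⟨h1, rfl⟩⟩)
  obtain ⟨r, lam, v, hsp⟩ := h1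
  by_cases h2 : ∃ w : Fin r → κ → F,
    SimpleSpectrum (Tf' * contract P g)ᵀ (fun a => (lam a)⁻¹) w
  swap
  · exact Or.inr (Or.inl ⟨Tf', Tg', hf, hg, Or.inr ⟨r, lam, v, hsp, Or.inl ⟨h2, rfl⟩⟩⟩)
  obtain ⟨w, hsp'⟩ := h2
  obtain ⟨φ, hφ⟩ := exists_isDual hsp.linearIndependent
  obtain ⟨ψ, hψ⟩ := exists_isDual hsp'.linearIndependent
  have hh : ∀ a b, ∑ i, ∑ j, φ a i * ψ a j * (v b i * w b j) = if a = b then 1 else 0 := by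
    intro a b
    have : ∑ i, ∑ j, φ a i * ψ a j * (v b i * w b j) = (φ a ⬝ᵥ v b) * (ψ a ⬝ᵥ w b) := by
      simp only [dotProduct, Finset.sum_mul_sum]
      exact Finset.sum_congr rfl fun i _ => Finset.sum_congr rfl fun j _ => by ring
    rw [this, hφ, hψ]
    split_ifs <;> simp
  set u : Fin r → Fin s → F := fun a x => ∑ i, ∑ j, φ a i * ψ a j * P x i j with hu
  by_cases h3 : ∃ a b, a ≠ b ∧ u a ∈ Submodule.span F {u b}
  · exact Or.inr (Or.inl ⟨Tf', Tg', hf, hg, Or.inr ⟨r, lam, v, hsp, Or.inr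
      ⟨w, fun a i j => φ a i * ψ a j, u, hsp', hh, fun _ _ => rfl, Or.inl ⟨h3, rfl⟩⟩⟩⟩)
  push Not at h3
  have hD : SimDiag P f g (some ⟨r, u, v, w⟩) := ⟨Tf', Tg', hf, hg, Or.inr ⟨r, lam, v, hsp, Or.inr
      ⟨w, fun a i j => φ a i * ψ a j, u, hsp', hh, fun _ _ => rfl, Or.inr ⟨h3, rfl⟩⟩⟩⟩
  by_cases h4 : ∃ v', HasSquareForm P ⟨r, u, v, w⟩ v'
  swap
  · exact Or.inr (Or.inr ⟨_, hD, h4⟩)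
  refine Or.inl ⟨_, hD, ?_⟩
  obtain ⟨v', hv'⟩ := h4
  have hv'0 := hv'
  obtain ⟨h5, e, z, hz, hvi, h6⟩ := hv'
  dsimp only at e
  subst e
  simp only [Fin.cast_eq_self] at h6
  have hsf : SquareForm P z v' :=
    ⟨hz, hvi, fun x i j => by rw [h5]; exact Finset.sum_congr rfl fun a _ => h6 a x i j⟩
  -- Equal nonzero product tensors have parallel factors: divide by a nonzero coordinate of the
  -- other two modes.
  have hpar : ∀ a, ∃ c : F, v' a = c • v a := by
    intro a
    obtain ⟨x, hx⟩ := exists_ne_zero_apply (hz.ne_zero a)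
    obtain ⟨j, hj⟩ := exists_ne_zero_apply (hvi.ne_zero a)
    refine ⟨(z a x * v' a j)⁻¹ * (u a x * w a j), ?_⟩
    ext i
    have := h6 a x i j
    rw [Pi.smul_apply, smul_eq_mul]
    field_simp
    linear_combination -this
  have hpar' : ∀ a, ∃ c : F, v' a = c • w a := by
    intro a
    obtain ⟨x, hx⟩ := exists_ne_zero_apply (hz.ne_zero a)
    obtain ⟨j, hj⟩ := exists_ne_zero_apply (hvi.ne_zero a)
    refine ⟨(z a x * v' a j)⁻¹ * (u a x * v a j), ?_⟩
    ext i
    have := h6 a x j i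
    rw [Pi.smul_apply, smul_eq_mul]
    field_simp
    linear_combination -this
  have heig : ∀ a, (contract P f * Tg') *ᵥ v' a = lam a • v' a := by
    intro a
    obtain ⟨c, hc⟩ := hpar a
    rw [hc, Matrix.mulVec_smul, hsp.eigen, smul_comm]
  have heig' : ∀ a, (contract P g * Tf'ᵀ) *ᵥ v' a = (lam a)⁻¹ • v' a := by
    intro a
    obtain ⟨c, hc⟩ := hpar' a
    rw [← (hsf.transposed_eq f g hf.1).1, hc, Matrix.mulVec_smul, hsp'.eigen, smul_comm]
  -- If `f ⬝ᵥ z a` were zero, every vector in the range of `P(f)` would have coefficient zero at `v'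
  -- a`, which is impossible for an eigenvector `v' a` with nonzero eigenvalue.
  have hnz : ∀ (f : Fin r → F) (B : Matrix κ κ F) (l : Fin r → F), (∀ a, l a ≠ 0) →
      (∀ a, (contract P f * B) *ᵥ v' a = l a • v' a) → ∀ a, f ⬝ᵥ z a ≠ 0 := by
    intro f B l hl h a h0
    obtain ⟨χ, hχ⟩ := exists_isDual hvi
    have := h a
    rw [← Matrix.mulVec_mulVec, hsf.contract_mulVec] at this
    have := congrArg (χ a ⬝ᵥ ·) this
    simp only [hχ.dotProduct_sum (fun b => (f ⬝ᵥ z b) * (v' b ⬝ᵥ B *ᵥ v' a)), dotProduct_smul,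
      hχ a a, h0, zero_mul, if_true, smul_eq_mul, mul_one] at this
    exact hl a this.symm
  have hfz := hnz f Tg' lam hsp.ne_zero heig
  have hgz := hnz g Tf'ᵀ _ hsp'.ne_zero heig'
  refine ⟨z, v', hsf, ⟨hfz, hgz, fun a b hab H => hab (hsp.injective ?_)⟩, hv'0⟩
  have hl : ∀ a, lam a = (f ⬝ᵥ z a) / (g ⬝ᵥ z a) := by
    intro a
    have := (heig a).symm.trans (hsf.eigen hgz hg.1 a)
    exact smul_left_injective F (hvi.ne_zero a) this
  rw [hl, hl, div_eq_div_iff (hgz a) (hgz b), H]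

end TensorDecomp
end

/-! ### Flattenings, uniqueness of decompositions and certification -/

noncomputable section
namespace TensorDecomp
variable {F : Type*} [RCLike F] {n m : ℕ}

@[simp] theorem headIdx_joinIdx (a : Fin ((m + 1) / 2) → Fin n) (b : Fin (m / 2) → Fin n) :
    headIdx (m := m) (joinIdx a b) = a := by
  ext i; simp [headIdx, joinIdx]

@[simp] theorem tailIdx_joinIdx (a : Fin ((m + 1) / 2) → Fin n) (b : Fin (m / 2) → Fin n) :
    tailIdx (m := m) (joinIdx a b) = b := by
  ext i; simp [tailIdx, joinIdx]

@[simp] theorem joinIdx_headIdx_tailIdx (c : Fin m → Fin n) :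
    joinIdx (headIdx c) (tailIdx c) = c := by
  ext i
  simp only [joinIdx, headIdx, tailIdx]
  split_ifs with h
  · rfl
  · congr 2
    ext
    simp only
    omega

theorem flatten_injective {F : Type*} {n m : ℕ} : Function.Injective (flatten (F := F) (n := n) (m := m)) := by
  intro T T' h
  funext c
  have := congrFun (congrFun h (headIdx c)) (tailIdx c)
  simpa [flatten] using this

/-- The positions of the first half and those of the second half are all positions. -/
def halfEquiv (m : ℕ) : Fin ((m + 1) / 2) ⊕ Fin (m / 2) ≃ Fin m :=
  finSumFinEquiv.trans (finCongr (by omega))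

theorem prod_eq_head_mul_tail (v : Fin m → Fin n → F) (c : Fin m → Fin n) :
    ∏ i, v i (c i) = (∏ i, v (halfEquiv m (.inl i)) (headIdx c i)) *
      ∏ i, v (halfEquiv m (.inr i)) (tailIdx c i) := by
  rw [← (halfEquiv m).prod_comp, Fintype.prod_sum_type]
  rfl

theorem outer_mem_productTensors {v : Tensor F n ((m + 1) / 2)} {w : Tensor F n (m / 2)}
    (hv : v ∈ productTensors F n ((m + 1) / 2)) (hw : w ∈ productTensors F n (m / 2)) :
    outer (m := m) v w ∈ productTensors F n m := by
  obtain ⟨v, rfl⟩ := hv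
  obtain ⟨w, rfl⟩ := hw
  refine ⟨fun i => Sum.elim v w ((halfEquiv m).symm i), ?_⟩
  funext c
  rw [prod_eq_head_mul_tail]
  simp [outer]

theorem exists_outer_of_mem_productTensors {x : Tensor F n m} (hx : x ∈ productTensors F n m) :
    ∃ v ∈ productTensors F n ((m + 1) / 2), ∃ w ∈ productTensors F n (m / 2), x = outer v w := by
  obtain ⟨v, rfl⟩ := hx
  refine ⟨_, ⟨fun i => v (halfEquiv m (.inl i)), rfl⟩, _, ⟨fun i => v (halfEquiv m (.inr i)), rfl⟩,
    ?_⟩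
  funext c
  exact prod_eq_head_mul_tail v c

/-- The subspace `T(W*)` of `V`. -/
abbrev flatRange (T : Tensor F n m) : Submodule F (Tensor F n ((m + 1) / 2)) :=
  LinearMap.range (flatten T).mulVecLin

theorem flatten_sum_outer {r : ℕ} (v : Fin r → Tensor F n ((m + 1) / 2))
    (w : Fin r → Tensor F n (m / 2)) (i : Fin ((m + 1) / 2) → Fin n) (j : Fin (m / 2) → Fin n) :
    flatten (∑ a, outer (m := m) (v a) (w a)) i j = ∑ a, v a i * w a j := by
  simp [flatten, outer, Finset.sum_apply]

theorem flatten_sum_outer_mulVec {r : ℕ} (v : Fin r → Tensor F n ((m + 1) / 2))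
    (w : Fin r → Tensor F n (m / 2)) (y : Tensor F n (m / 2)) :
    flatten (∑ a, outer (m := m) (v a) (w a)) *ᵥ y = ∑ a, (w a ⬝ᵥ y) • v a := by
  ext i
  simp only [Matrix.mulVec, dotProduct, flatten_sum_outer, Finset.sum_mul, Finset.sum_apply,
    Pi.smul_apply, smul_eq_mul]
  rw [Finset.sum_comm]
  exact Finset.sum_congr rfl fun a _ => Finset.sum_congr rfl fun b _ => by ring

theorem flatRange_sum_outer_le {r : ℕ} (v : Fin r → Tensor F n ((m + 1) / 2))
    (w : Fin r → Tensor F n (m / 2)) :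
    flatRange (∑ a, outer (m := m) (v a) (w a)) ≤ Submodule.span F (Set.range v) := by
  rintro _ ⟨y, rfl⟩
  rw [Matrix.mulVecLin_apply, flatten_sum_outer_mulVec]
  exact Submodule.sum_mem _ fun a _ => Submodule.smul_mem _ _ (Submodule.subset_span ⟨a, rfl⟩)

theorem IsDual.vecMul_flatten_sum_outer {r : ℕ} {φ v : Fin r → Tensor F n ((m + 1) / 2)}
    (h : IsDual φ v) (w : Fin r → Tensor F n (m / 2)) (a : Fin r) :
    φ a ᵥ* flatten (∑ a, outer (m := m) (v a) (w a)) = w a := by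
  ext j
  have : ∀ b, ∑ i, φ a i * (v b i * w b j) = (φ a ⬝ᵥ v b) * w b j := fun b => by
    rw [dotProduct, Finset.sum_mul]; exact Finset.sum_congr rfl fun i _ => by ring
  simp only [Matrix.vecMul, dotProduct, flatten_sum_outer, Finset.mul_sum]
  rw [Finset.sum_comm, Finset.sum_congr rfl fun b _ => this b]
  simp [h a]

/-- Each column of the flattening is expanded in `v` by the dual functionals; collecting the
coefficients gives the tails. -/
theorem IsDual.eq_sum_outer {r : ℕ} {φ v : Fin r → Tensor F n ((m + 1) / 2)} (h : IsDual φ v)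
    {T : Tensor F n m} (hT : flatRange T ≤ Submodule.span F (Set.range v)) :
    T = ∑ a, outer (v a) (φ a ᵥ* flatten T) := by
  classical
  refine flatten_injective ?_
  rw [← Matrix.mulVec_injective.eq_iff]
  funext y
  rw [flatten_sum_outer_mulVec]
  have hy : flatten T *ᵥ y ∈ flatRange T := ⟨y, rfl⟩
  conv_lhs => rw [← h.sum_eq (hT hy)]
  exact Finset.sum_congr rfl fun a _ => by rw [Matrix.dotProduct_mulVec]

theorem finrank_flatRange_le {r : ℕ} {T : Tensor F n m} {y : Fin r → Tensor F n m}
    (hy : IsDecomposition T y) : Module.finrank F (flatRange T) ≤ r := by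
  obtain ⟨hy, rfl⟩ := hy
  choose p _ q _ hpq using fun a => exists_outer_of_mem_productTensors (hy a)
  obtain rfl : y = fun a => outer (p a) (q a) := funext hpq
  calc _ ≤ Module.finrank F (Submodule.span F (Set.range p)) :=
        Submodule.finrank_mono (flatRange_sum_outer_le p q)
    _ ≤ r := (finrank_range_le_card (R := F) p).trans_eq (Fintype.card_fin r)

theorem outer_smul_left (c : F) (v : Tensor F n ((m + 1) / 2)) (w : Tensor F n (m / 2)) :
    outer (m := m) (c • v) w = outer v (c • w) := by
  funext d; simp [outer]; ring

/-- A decomposition with `r` terms bounds the rank of the flattening by `r`, so `R` is minimal. In a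
second decomposition with `R` terms the heads span `flatRange T`, hence are independent. Their
squares satisfy `hsq`, so each head is a multiple of some `v a`, and independence makes the
assignment a bijection. -/
theorem isUniqueRankDecomposition_of_squares {R : ℕ} {T : Tensor F n m}
    {v : Fin R → Tensor F n ((m + 1) / 2)} {w : Fin R → Tensor F n (m / 2)}
    (hli : LinearIndependent F v) (hv : ∀ a, v a ∈ productTensors F n ((m + 1) / 2))
    (hw : ∀ a, w a ∈ productTensors F n (m / 2)) (hT : T = ∑ a, outer (v a) (w a))
    (hR : Module.finrank F (flatRange T) = R)
    (hsq : ∀ M ∈ symSquare (flatRange T), PrefixInvariant M →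
      M ∈ Submodule.span F (Set.range fun a => Matrix.vecMulVec (v a) (v a))) :
    IsUniqueRankDecomposition T fun a => outer (v a) (w a) := by
  have hdec : IsDecomposition T fun a => outer (v a) (w a) :=
    ⟨fun a => outer_mem_productTensors (hv a) (hw a), hT⟩
  refine ⟨hdec, ⟨⟨_, hdec⟩, fun r ⟨y, hy⟩ => hR ▸ finrank_flatRange_le hy⟩, fun y hy => ?_⟩
  obtain ⟨φ, hφ⟩ := exists_isDual hli
  obtain ⟨hy, hTy⟩ := hy
  choose p hp q hq hpq using fun a => exists_outer_of_mem_productTensors (hy a)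
  simp_rw [hpq] at hTy
  have hle : flatRange T ≤ Submodule.span F (Set.range p) := hTy ▸ flatRange_sum_outer_le p q
  have hcard : Module.finrank F (Submodule.span F (Set.range p)) ≤ R :=
    (finrank_range_le_card (R := F) p).trans_eq (Fintype.card_fin R)
  have hspan : flatRange T = Submodule.span F (Set.range p) :=
    Submodule.eq_of_le_of_finrank_le hle (by rw [hR]; exact hcard)
  have hpli : LinearIndependent F p := by
    rw [linearIndependent_iff_card_eq_finrank_span, Fintype.card_fin, Set.finrank, ← hspan, hR]
  have hpv : ∀ b, ∃ (a : Fin R) (c : F), c ≠ 0 ∧ p b = c • v a := fun b =>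
    exists_smul_of_square_mem_span hli (hpli.ne_zero b) <|
      hsq _ (vecMulVec_self_mem_symSquare (hspan ▸ Submodule.subset_span ⟨b, rfl⟩))
        (prefixInvariant_of_mem_productTensors (hp b))
  choose σ c hc hpσ using hpv
  have hσ : Function.Injective σ := by
    intro a b hab
    by_contra hne
    have h1 : p a ∈ Submodule.span F {p b} := by
      rw [Submodule.mem_span_singleton]
      refine ⟨c a * (c b)⁻¹, ?_⟩
      rw [hpσ b, smul_smul, inv_mul_cancel_right₀ (hc b), hpσ a, hab]
    have := hpli.notMem_span_image (s := {b}) (x := a) (by simpa using hne)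
    simp only [Set.image_singleton] at this
    exact this h1
  let e := Equiv.ofBijective σ (Finite.injective_iff_bijective.mp hσ)
  refine ⟨e, funext fun b => ?_⟩
  -- With the scalars moved to the tails, both decompositions have the heads `v`; contraction with
  -- the dual functionals then identifies the tails.
  have hTe : T = ∑ a, outer (v a) ((c (e.symm a)) • q (e.symm a)) := by
    rw [hTy, ← e.sum_comp (fun a => outer (v a) ((c (e.symm a)) • q (e.symm a)))]
    refine Finset.sum_congr rfl fun b _ => ?_
    rw [Equiv.symm_apply_apply, hpσ b, outer_smul_left]
    rfl
  have h1 := hφ.vecMul_flatten_sum_outer w (e b)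
  have h2 := hφ.vecMul_flatten_sum_outer (fun a => (c (e.symm a)) • q (e.symm a)) (e b)
  rw [← hTe, hT, h1, Equiv.symm_apply_apply] at h2
  rw [hpq, hpσ, outer_smul_left, ← h2]
  rfl

section Setup
variable {R p s : ℕ} {T : Tensor F n m} {u : Fin R → Tensor F n ((m + 1) / 2)}
  {Q : Fin p → Matrix (Fin ((m + 1) / 2) → Fin n) (Fin ((m + 1) / 2) → Fin n) F}
  {P : Fin s → Matrix (Fin ((m + 1) / 2) → Fin n) (Fin ((m + 1) / 2) → Fin n) F}

theorem forall_pairing_eq_zero_iff {κ : Type*} [Fintype κ] {X : Set (κ → F)} {p : ℕ}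
    {Q : Fin p → Matrix κ κ F}
    (hQ : (Submodule.span F (Set.range Q) : Set _) = quadricsVanishingOn X) (M : Matrix κ κ F) :
    (∀ j, pairing (Q j) M = 0) ↔ ∀ A ∈ quadricSpace X, pairing A M = 0 := by
  constructor
  · intro h A hA
    replace hA : A ∈ (Submodule.span F (Set.range Q) : Set _) := by rw [hQ]; exact hA
    induction hA using Submodule.span_induction with
    | mem x hx => obtain ⟨j, rfl⟩ := hx; exact h j
    | zero => simp [pairing]
    | add x y _ _ hx hy => rw [← pairingLin_apply] at *; rw [map_add, LinearMap.add_apply, hx, hy, add_zero]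
    | smul c x _ hx => rw [← pairingLin_apply] at *; rw [map_smul, LinearMap.smul_apply, hx, smul_zero]
  · intro h j
    refine h _ ?_
    have : Q j ∈ (Submodule.span F (Set.range Q) : Set _) := Submodule.subset_span ⟨j, rfl⟩
    rw [hQ] at this
    exact this

/-- For symmetric matrices, annihilation by the quadrics is exchange invariance. The span of `P`
thus depends only on `T`, and the chosen bases `u` and `Q` play no further role. -/
theorem IsSetup.mem_span_iff (h : IsSetup T u Q P)
    (M : Matrix (Fin ((m + 1) / 2) → Fin n) (Fin ((m + 1) / 2) → Fin n) F) :
    M ∈ Submodule.span F (Set.range P) ↔ M ∈ symSquare (flatRange T) ∧ PrefixInvariant M := by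
  rw [h.lifted.2, h.basis_span, forall_pairing_eq_zero_iff h.quadrics_span]
  refine and_congr_right fun hM => ⟨fun h => ?_, fun h A hA => h.pairing_eq_zero hA⟩
  exact prefixInvariant_of_pairing_eq_zero (mem_symSquare_iff.mp hM).1 h

theorem IsSetup.finrank_flatRange (h : IsSetup T u Q P) :
    Module.finrank F (flatRange T) = R := by
  rw [flatRange, ← h.basis_span, finrank_span_eq_card h.basis_indep, Fintype.card_fin]

/-- The inclusion of the left side is clear, and the left side already has dimension `s`, which `s`
squares cannot exceed. -/
theorem SquareForm.span_eq {κ : Type*} [Fintype κ] {P : Fin s → Matrix κ κ F}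
    {z : Fin s → Fin s → F} {v : Fin s → κ → F} (h : SquareForm P z v)
    (hP : LinearIndependent F P) : Submodule.span F (Set.range P) =
      Submodule.span F (Set.range fun a => Matrix.vecMulVec (v a) (v a)) := by
  refine Submodule.eq_of_le_of_finrank_le ?_ ?_
  · rw [Submodule.span_le]
    rintro _ ⟨x, rfl⟩
    have : P x = ∑ a, z a x • Matrix.vecMulVec (v a) (v a) := by
      ext i j
      simp [h.eq, Matrix.sum_apply, Matrix.vecMulVec_apply, mul_assoc]
    rw [this]
    exact Submodule.sum_mem _ fun a _ => Submodule.smul_mem _ _ (Submodule.subset_span ⟨a, rfl⟩)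
  · rw [finrank_span_eq_card hP]
    exact finrank_range_le_card (R := F) fun a => Matrix.vecMulVec (v a) (v a)

theorem mem_of_vecMulVec_mem_symSquare {κ : Type*} [Fintype κ] {U : Submodule F (κ → F)}
    {x : κ → F} (h : Matrix.vecMulVec x x ∈ symSquare U) : x ∈ U := by
  by_cases hx : x = 0
  · rw [hx]; exact U.zero_mem
  obtain ⟨y, hy⟩ := exists_dotProduct_ne_zero hx
  have := U.smul_mem (x ⬝ᵥ y)⁻¹ ((mem_symSquare_iff.mp h).2 y)
  rwa [vecMulVec_mulVec', smul_smul, inv_mul_cancel₀ hy, one_smul] at this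

theorem IsSetup.square_mem (h : IsSetup T u Q P) {z : Fin s → Fin s → F}
    {v : Fin s → Tensor F n ((m + 1) / 2)} (hP : SquareForm P z v) (a : Fin s) :
    Matrix.vecMulVec (v a) (v a) ∈ symSquare (flatRange T) ∧
      PrefixInvariant (Matrix.vecMulVec (v a) (v a)) := by
  rw [← h.mem_span_iff, hP.span_eq h.lifted.1]
  exact Submodule.subset_span ⟨a, rfl⟩

theorem IsSetup.mem_productTensors (h : IsSetup T u Q P) (hm : 3 ≤ m) {z : Fin s → Fin s → F}
    {v : Fin s → Tensor F n ((m + 1) / 2)} (hP : SquareForm P z v) (a : Fin s) :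
    v a ∈ productTensors F n ((m + 1) / 2) :=
  mem_productTensors_of_prefixInvariant (by omega) (h.square_mem hP a).2

theorem IsSetup.span_eq_flatRange (h : IsSetup T u Q P) {z : Fin s → Fin s → F}
    {v : Fin s → Tensor F n ((m + 1) / 2)} (hP : SquareForm P z v) (hs : s = R) :
    Submodule.span F (Set.range v) = flatRange T := by
  refine Submodule.eq_of_le_of_finrank_le ?_ ?_
  · rw [Submodule.span_le]
    rintro _ ⟨a, rfl⟩
    exact mem_of_vecMulVec_mem_symSquare (h.square_mem hP a).1
  · rw [h.finrank_flatRange, finrank_span_eq_card hP.indep_v, Fintype.card_fin, hs]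

theorem IsSetup.isUniqueRankDecomposition (h : IsSetup T u Q P) (hm : 3 ≤ m)
    {z : Fin s → Fin s → F} {v : Fin s → Tensor F n ((m + 1) / 2)} (hP : SquareForm P z v)
    (hs : s = R) {φ : Fin s → Tensor F n ((m + 1) / 2)} (hφ : IsDual φ v)
    (hw : ∀ a, φ a ᵥ* flatten T ∈ productTensors F n (m / 2)) :
    IsUniqueRankDecomposition T fun a => outer (v a) (φ a ᵥ* flatten T) := by
  refine isUniqueRankDecomposition_of_squares hP.indep_v (h.mem_productTensors hm hP) hw
    (hφ.eq_sum_outer (h.span_eq_flatRange hP hs).ge) (hs ▸ h.finrank_flatRange) ?_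
  intro M hM hM'
  rw [← hP.span_eq h.lifted.1]
  exact (h.mem_span_iff M).mpr ⟨hM, hM'⟩

theorem isUniqueRankDecomposition_of_flatRange_eq_bot (hT : Module.finrank F (flatRange T) = 0) :
    IsUniqueRankDecomposition T (Fin.elim0 : Fin 0 → Tensor F n m) := by
  classical
  have h0 : T = 0 := by
    refine flatten_injective ?_
    rw [← Matrix.mulVec_injective.eq_iff]
    funext y
    have := Submodule.finrank_eq_zero.mp hT
    have h1 : flatten T *ᵥ y ∈ flatRange T := ⟨y, rfl⟩
    rw [this, Submodule.mem_bot] at h1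
    rw [h1]
    exact (Matrix.zero_mulVec y).symm
  have hd : IsDecomposition T (Fin.elim0 : Fin 0 → Tensor F n m) := ⟨fun a => a.elim0, by simp [h0]⟩
  exact ⟨hd, ⟨⟨_, hd⟩, fun r _ => Nat.zero_le r⟩, fun y _ => ⟨1, Subsingleton.elim _ _⟩⟩

/-- Only the final test for a square form, the equality of `s` with the rank, and the test of the
tails matter. How the eigenvectors were obtained, and whether `f` and `g` were in general position,
is irrelevant. -/
theorem IsSetup.certification (h : IsSetup T u Q P) (hm : 3 ≤ m) {f g : Fin s → F} {r : ℕ}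
    {y : Fin r → Tensor F n m} (hy : DecompositionOutput T R P f g (some ⟨r, y⟩)) :
    IsUniqueRankDecomposition T y := by
  rcases hy with ⟨-, hy⟩ | ⟨-, ⟨-, hy⟩ | ⟨rfl, hy⟩⟩ | ⟨r, v, hI, ⟨-, hy⟩ | ⟨hr, φ, hφ, ⟨-, hy⟩ | ⟨hw, hy⟩⟩⟩
  · cases hy
  · cases hy
  · cases hy
    exact isUniqueRankDecomposition_of_flatRange_eq_bot h.finrank_flatRange
  · cases hy
  · cases hy
  · cases hy
    rcases hI with ⟨-, hI⟩ | ⟨-, hI⟩ | ⟨-, -, ⟨-, hI⟩ | ⟨D, -, ⟨-, hI⟩ | ⟨v', hv', hI⟩⟩⟩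
    · cases hI
    · cases hI
    · cases hI
    · cases hI
    · cases hI
      obtain ⟨z, hz⟩ := hv'.exists_squareForm
      exact h.isUniqueRankDecomposition hm hz hr hφ hw

theorem decompositionOutput_some {z : Fin s → Fin s → F}
    {v φ : Fin s → Tensor F n ((m + 1) / 2)} (hP : SquareForm P z v) {f g : Fin s → F}
    (hfg : IsGeneric f g z) (hφ : IsDual φ v)
    (hw : ∀ a, φ a ᵥ* flatten T ∈ productTensors F n (m / 2)) :
    DecompositionOutput T s P f g (some ⟨s, fun a => outer (v a) (φ a ᵥ* flatten T)⟩) := by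
  rcases Nat.eq_zero_or_pos s with rfl | hs
  · refine Or.inr (Or.inl ⟨Or.inl ⟨rfl, rfl⟩, Or.inr ⟨rfl, ?_⟩⟩)
    congr 2
    exact Subsingleton.elim _ _
  · obtain ⟨D, hD, hv⟩ := hP.exists_simDiag hfg
    exact Or.inr (Or.inr ⟨s, v, Or.inr (Or.inr ⟨hs, le_rfl, Or.inr ⟨D, hD, Or.inr ⟨v, hv, rfl⟩⟩⟩),
      Or.inr ⟨rfl, φ, hφ, Or.inr ⟨hw, rfl⟩⟩⟩)

/-- If the procedure cannot fail, the data it computes are as desired. -/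
theorem decompositionOutput_none_or (T : Tensor F n m) (R : ℕ)
    (P : Fin s → Matrix (Fin ((m + 1) / 2) → Fin n) (Fin ((m + 1) / 2) → Fin n) F)
    (f g : Fin s → F) :
    DecompositionOutput T R P f g none ∨ (s = R ∧ ∃ z v φ, SquareForm P z v ∧ IsGeneric f g z ∧
      IsDual φ v ∧ ∀ a, φ a ᵥ* flatten T ∈ productTensors F n (m / 2)) := by
  rcases Nat.eq_zero_or_pos s with rfl | hs
  · by_cases hR : R = 0
    · refine Or.inr ⟨hR.symm, Fin.elim0, Fin.elim0, Fin.elim0, ⟨linearIndependent_empty_type,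
        linearIndependent_empty_type, fun x => x.elim0⟩, ⟨fun a => a.elim0, fun a => a.elim0,
          fun a => a.elim0⟩, fun a => a.elim0, fun a => a.elim0⟩
    · exact Or.inl (Or.inr (Or.inl ⟨Or.inl ⟨rfl, rfl⟩, Or.inl ⟨hR, rfl⟩⟩))
  rcases lt_or_ge R s with hRs | hRs
  · exact Or.inl (Or.inl ⟨Or.inr (Or.inl ⟨hRs, rfl⟩), rfl⟩)
  rcases intersection_fail_or_exists P f g with ⟨D, hD, z, v, hP, hfg, hv⟩ | h | ⟨D, hD, hv⟩
  · have hI : IntersectionAlgorithm R P f g (.only s v) :=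
      Or.inr (Or.inr ⟨hs, hRs, Or.inr ⟨D, hD, Or.inr ⟨v, hv, rfl⟩⟩⟩)
    by_cases hsR : s = R
    · obtain ⟨φ, hφ⟩ := exists_isDual hP.indep_v
      by_cases hw : ∀ a, φ a ᵥ* flatten T ∈ productTensors F n (m / 2)
      · exact Or.inr ⟨hsR, z, v, φ, hP, hfg, hφ, hw⟩
      · push Not at hw
        exact Or.inl (Or.inr (Or.inr ⟨s, v, hI, Or.inr ⟨hsR, φ, hφ, Or.inl ⟨hw, rfl⟩⟩⟩))
    · exact Or.inl (Or.inr (Or.inr ⟨s, v, hI, Or.inl ⟨hsR, rfl⟩⟩))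
  · exact Or.inl (Or.inl ⟨Or.inr (Or.inr ⟨hs, hRs, Or.inl ⟨h, rfl⟩⟩), rfl⟩)
  · exact Or.inl (Or.inl ⟨Or.inr (Or.inr ⟨hs, hRs, Or.inr ⟨D, hD, Or.inl ⟨hv, rfl⟩⟩⟩), rfl⟩)

/-- A run may return the vectors rescaled and permuted, with any dual functionals. This is why `hw`
ranges over all square forms of `P` and not only the given one. -/
theorem not_decompositionOutput_none {z : Fin s → Fin s → F}
    {v : Fin s → Tensor F n ((m + 1) / 2)} (hP : SquareForm P z v) {f g : Fin s → F}
    (hfg : IsGeneric f g z)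
    (hw : ∀ (z : Fin s → Fin s → F) (v φ : Fin s → Tensor F n ((m + 1) / 2)),
      SquareForm P z v → IsDual φ v → ∀ a, φ a ᵥ* flatten T ∈ productTensors F n (m / 2)) :
    ¬ DecompositionOutput T s P f g none := by
  rintro (⟨hI, -⟩ | ⟨hI, ⟨hs, -⟩ | ⟨-, hy⟩⟩ | ⟨r, v', hI, ⟨hr, -⟩ | ⟨hr, φ, hφ, ⟨hw', -⟩ | ⟨-, hy⟩⟩⟩)
  · rcases hI with ⟨-, hI⟩ | ⟨hI, -⟩ | ⟨-, -, ⟨hI, -⟩ | ⟨D, hD, ⟨hI, -⟩ | ⟨v', hv', hI⟩⟩⟩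
    · cases hI
    · exact lt_irrefl _ hI
    · obtain ⟨D, hD, -⟩ := hI.exists_of_squareForm hP hfg
      cases hD
    · obtain ⟨D', hD', h⟩ := hD.exists_of_squareForm hP hfg
      cases hD'
      exact hI h
    · cases hI
  · rcases hI with ⟨hI, -⟩ | ⟨-, hI⟩ | ⟨-, -, ⟨-, hI⟩ | ⟨D, hD, ⟨-, hI⟩ | ⟨v', hv', hI⟩⟩⟩
    · exact hs hI
    all_goals cases hI
  · cases hy
  · rcases hI with ⟨-, hI⟩ | ⟨-, hI⟩ | ⟨-, -, ⟨-, hI⟩ | ⟨D, hD, ⟨-, hI⟩ | ⟨v', hv', hI⟩⟩⟩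
    all_goals cases hI
    exact hr rfl
  · rcases hI with ⟨-, hI⟩ | ⟨-, hI⟩ | ⟨-, -, ⟨-, hI⟩ | ⟨D, hD, ⟨-, hI⟩ | ⟨v', hv', hI⟩⟩⟩
    all_goals cases hI
    obtain ⟨z', hz'⟩ := hv'.exists_squareForm
    obtain ⟨a, ha⟩ := hw'
    exact ha (hw z' _ φ hz' hφ a)
  · cases hy

end Setup
end TensorDecomp
end

/-! ### The rank bound, quadrics by dimension count, and Zariski density -/

noncomputable section
namespace TensorDecomp

theorem rankBound_four {n : ℕ} (hn : 1 ≤ n) : rankBound n 4 = ((n : ℝ) - 1) ^ 2 / 4 := by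
  have h1 : (4 + 1) / 2 = 2 := rfl
  rw [rankBound, h1, min_eq_right]
  · ring
  · have : (1 : ℝ) ≤ n := by exact_mod_cast hn
    nlinarith

/-- For `n ≥ 8` the ratio `(n + 1) / (2 n)` is at most `9 / 16`, and the exponent is at least two,
so the subtracted term is at most `81 / 256` of the power. The remainder `1 / 2 - 81 / 256 = 47 /
256` exceeds `1 / 8`. -/
theorem rankBound_ge (n m : ℕ) (hn : 8 ≤ n) (hm : 3 ≤ m) :
    (1 / 8 : ℝ) * (n : ℝ) ^ (m / 2) ≤ rankBound n m := by
  have hn' : (8 : ℝ) ≤ n := by exact_mod_cast hn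
  have hpow : (n : ℝ) ^ (m / 2) ≤ (n : ℝ) ^ ((m + 1) / 2) :=
    pow_le_pow_right₀ (by linarith) (by omega)
  have hpos : (0 : ℝ) < (n : ℝ) ^ (m / 2) := by positivity
  refine le_min (by linarith) ?_
  have h1 : ((n : ℝ) + 1) ^ ((m + 1) / 2) / 2 ^ ((m + 1) / 2) ≤
      81 / 256 * (n : ℝ) ^ ((m + 1) / 2) := by
    rw [← div_pow]
    calc (((n : ℝ) + 1) / 2) ^ ((m + 1) / 2) ≤ (9 / 16 * (n : ℝ)) ^ ((m + 1) / 2) :=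
          pow_le_pow_left₀ (by positivity) (by linarith) _
      _ = (9 / 16) ^ ((m + 1) / 2) * (n : ℝ) ^ ((m + 1) / 2) := mul_pow _ _ _
      _ ≤ 81 / 256 * (n : ℝ) ^ ((m + 1) / 2) := by
          gcongr
          calc (9 / 16 : ℝ) ^ ((m + 1) / 2) ≤ (9 / 16) ^ 2 :=
                pow_le_pow_of_le_one (by norm_num) (by norm_num) (by omega)
            _ = _ := by norm_num
  linarith

/-- Multiplied by `n ^ k`, the second term of the minimum compares dimensions: S²(V) has room for `R
* n ^ k` conditions besides the `(n (n + 1) / 2) ^ k` conditions that make a quadric vanish on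
product tensors. -/
theorem card_bound_of_le_rankBound {n m R : ℕ} (hR : (R : ℝ) ≤ rankBound n m) :
    R * n ^ ((m + 1) / 2) + Fintype.card (Sym2 (Fin n)) ^ ((m + 1) / 2) ≤
      Fintype.card (Sym2 (Fin ((m + 1) / 2) → Fin n)) := by
  set k := (m + 1) / 2
  have h1 := hR.trans (min_le_right _ _)
  have hc : ∀ N : ℕ, ((Nat.choose (N + 1) 2 : ℕ) : ℝ) = N * (N + 1) / 2 := by
    intro N
    rw [Nat.cast_choose_two]
    push_cast
    ring
  have : (R * (n : ℝ) ^ k + ((n : ℝ) * (n + 1) / 2) ^ k) ≤ (n : ℝ) ^ k * ((n : ℝ) ^ k + 1) / 2 := by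
    have hN : (0 : ℝ) ≤ (n : ℝ) ^ k := by positivity
    have := mul_le_mul_of_nonneg_right h1 hN
    have e : ((n : ℝ) * (n + 1) / 2) ^ k = ((n : ℝ) + 1) ^ k / 2 ^ k * (n : ℝ) ^ k := by
      rw [div_pow, mul_pow]; ring
    rw [e]
    change (R : ℝ) * (n : ℝ) ^ k ≤
      (((n : ℝ) ^ k + 1) / 2 - ((n : ℝ) + 1) ^ k / 2 ^ k) * (n : ℝ) ^ k at this
    linarith
  have key : ((R * n ^ k + Fintype.card (Sym2 (Fin n)) ^ k : ℕ) : ℝ) ≤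
      (Fintype.card (Sym2 (Fin k → Fin n)) : ℕ) := by
    rw [Sym2.card, Sym2.card]
    simp only [Fintype.card_fin, Fintype.card_fun]
    push_cast [hc]
    exact this
  exact_mod_cast key

variable {F : Type*} [RCLike F]

section Quadric
variable {n k : ℕ}

/-- The product of the values of `y` at the two elements of a pair. -/
def symMul {α : Type*} (y : α → F) : Sym2 α → F :=
  Sym2.lift ⟨fun a b => y a * y b, fun _ _ => mul_comm _ _⟩

/-- A quadratic form vanishes on product tensors if its coefficients sum to zero over the pairs of
multi-indices with the same pairs of entries. -/
theorem mem_quadricSpace_of_sum_eq_zero {Q : Matrix (Fin k → Fin n) (Fin k → Fin n) F}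
    (hs : Q.IsSymm) (h : ∀ o : Fin k → Sym2 (Fin n),
      ∑ cd : (Fin k → Fin n) × (Fin k → Fin n),
        (if (fun i => s(cd.1 i, cd.2 i)) = o then Q cd.1 cd.2 else 0) = 0) :
    Q ∈ quadricSpace (productTensors F n k) := by
  refine ⟨hs, ?_⟩
  rintro _ ⟨v, rfl⟩
  rw [pairing, ← Fintype.sum_prod_type']
  have h1 : ∀ cd : (Fin k → Fin n) × (Fin k → Fin n), Q cd.1 cd.2 * Matrix.vecMulVec
      (fun c => ∏ i, v i (c i)) (fun c => ∏ i, v i (c i)) cd.1 cd.2 =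
      ∑ o : Fin k → Sym2 (Fin n), (∏ i, symMul (v i) (o i)) *
        (if (fun i => s(cd.1 i, cd.2 i)) = o then Q cd.1 cd.2 else 0) := by
    intro cd
    simp only [mul_ite, mul_zero, Finset.sum_ite_eq, Finset.mem_univ, if_true,
      Matrix.vecMulVec_apply, ← Finset.prod_mul_distrib]
    rw [mul_comm]
    rfl
  rw [Finset.sum_congr rfl fun cd _ => h1 cd, Finset.sum_comm]
  refine Finset.sum_eq_zero fun o _ => ?_
  rw [← Finset.mul_sum, h o, mul_zero]

/-- By a dimension count, there is a quadric through the product tensors that is singular at all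
but two of the given points. -/
theorem exists_quadric {R : ℕ}
    (hR : R * n ^ k + Fintype.card (Sym2 (Fin n)) ^ k ≤ Fintype.card (Sym2 (Fin k → Fin n)))
    (hn : 0 < n) {a b : Fin R} (hab : a ≠ b) (p : Fin R → (Fin k → Fin n) → F) :
    ∃ Q ∈ quadricSpace (productTensors F n k), Q ≠ 0 ∧
      ∀ c, c ≠ a → c ≠ b → ∀ i, (p c ᵥ* Q) i = 0 := by
  classical
  -- A quadric is a function on unordered pairs. The first component of `L` collects the coefficient
  -- sums that must vanish on the variety, the second the products of the quadric with the points
  -- other than `a` and `b`.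
  let L : (Sym2 (Fin k → Fin n) → F) →ₗ[F]
      ((Fin k → Sym2 (Fin n)) → F) × ({c : Fin R // c ≠ a ∧ c ≠ b} × (Fin k → Fin n) → F) :=
    { toFun := fun q => (fun o => ∑ cd : (Fin k → Fin n) × (Fin k → Fin n),
          (if (fun i => s(cd.1 i, cd.2 i)) = o then q s(cd.1, cd.2) else 0),
        fun ci => ∑ j, p ci.1 j * q s(j, ci.2))
      map_add' := fun q q' => by
        ext x
        · simp only [Pi.add_apply, Prod.mk_add_mk, ← Finset.sum_add_distrib]
          exact Finset.sum_congr rfl fun _ _ => by split_ifs <;> simp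
        · simp [mul_add, Finset.sum_add_distrib]
      map_smul' := fun r q => by
        ext x
        · simp [Finset.mul_sum]
        · simp only [Pi.smul_apply, smul_eq_mul, RingHom.id_apply, Prod.smul_mk, Finset.mul_sum]
          exact Finset.sum_congr rfl fun _ _ => by ring }
  have hcard : Fintype.card {c : Fin R // c ≠ a ∧ c ≠ b} = R - 2 := by
    rw [Fintype.card_subtype]
    have : ({c | c ≠ a ∧ c ≠ b} : Finset (Fin R)) = Finset.univ \ {a, b} := by
      ext c; simp
    rw [this, Finset.card_sdiff_of_subset (Finset.subset_univ _), Finset.card_pair hab]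
    simp
  have h2 : 2 ≤ R := by
    have := a.isLt
    have := b.isLt
    have : (a : ℕ) ≠ b := fun h => hab (Fin.ext h)
    omega
  -- Omitting two points saves `2 * n ^ k` conditions, which turns the assumed inequality into a
  -- strict one.
  have hker : LinearMap.ker L ≠ ⊥ := by
    apply LinearMap.ker_ne_bot_of_finrank_lt
    rw [Module.finrank_prod]
    simp only [Module.finrank_fintype_fun_eq_card, Fintype.card_prod, Fintype.card_fun,
      Fintype.card_fin, hcard]
    have hN : 0 < n ^ k := pow_pos hn k
    have : (R - 2) * n ^ k + 2 * n ^ k = R * n ^ k := by rw [← add_mul]; congr 1; omega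
    omega
  obtain ⟨q, hq, hq0⟩ := Submodule.exists_mem_ne_zero_of_ne_bot hker
  have hq1 := congrArg Prod.fst (LinearMap.mem_ker.mp hq)
  have hq2 := congrArg Prod.snd (LinearMap.mem_ker.mp hq)
  refine ⟨fun c d => q s(c, d), mem_quadricSpace_of_sum_eq_zero ?_ fun o => congrFun hq1 o, ?_, ?_⟩
  · ext c d
    exact congrArg q Sym2.eq_swap
  · intro h0
    refine hq0 (funext fun e => ?_)
    induction e using Sym2.ind with
    | _ c d => exact congrFun (congrFun h0 c) d
  · intro c hca hcb i
    exact congrFun hq2 (⟨c, hca, hcb⟩, i)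

end Quadric

section Zariski
variable {n m R : ℕ}

/-- The set of tuples of product tensors. -/
def productTuples (F : Type*) [RCLike F] (n m R : ℕ) : Set (Fin R → Tensor F n m) :=
  {x | ∀ a, x a ∈ productTensors F n m}

/-- The parametrization of the tuples of product tensors, on polynomials. -/
def pullback (F : Type*) [RCLike F] (n m R : ℕ) :
    MvPolynomial (Fin R × (Fin m → Fin n)) F →ₐ[F] MvPolynomial (Fin R × Fin m × Fin n) F :=
  MvPolynomial.aeval fun q => ∏ i, MvPolynomial.X (q.1, i, q.2 i)

/-- The value of a polynomial at a tuple. -/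
def evalTuple (x : Fin R → Tensor F n m) : MvPolynomial (Fin R × (Fin m → Fin n)) F →+* F :=
  MvPolynomial.eval fun q => x q.1 q.2

theorem eval_pullback (y : Fin R × Fin m × Fin n → F) (p : MvPolynomial (Fin R × (Fin m → Fin n)) F) :
    MvPolynomial.eval y (pullback F n m R p) =
      evalTuple (fun a c => ∏ i, y (a, i, c i)) p := by
  induction p using MvPolynomial.induction_on with
  | C a => simp [pullback, evalTuple]
  | add p q hp hq => simp [hp, hq]
  | mul_X p q hp =>
    rw [map_mul, map_mul, map_mul, hp]
    congr 1
    simp [pullback, evalTuple]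

theorem pullback_ne_zero {p : MvPolynomial (Fin R × (Fin m → Fin n)) F} {x : Fin R → Tensor F n m}
    (hx : x ∈ productTuples F n m R) (hp : evalTuple x p ≠ 0) : pullback F n m R p ≠ 0 := by
  choose v hv using hx
  intro h
  apply hp
  have := eval_pullback (fun q => v q.1 q.2.1 q.2.2) p
  rw [h, map_zero] at this
  rw [this, show x = _ from funext hv]

theorem exists_of_pullback_ne_zero {p : MvPolynomial (Fin R × (Fin m → Fin n)) F}
    (hp : pullback F n m R p ≠ 0) : ∃ x ∈ productTuples F n m R, evalTuple x p ≠ 0 := by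
  by_contra! h
  refine hp (MvPolynomial.funext fun y => ?_)
  rw [eval_pullback, map_zero]
  exact h _ fun a => ⟨fun i j => y (a, i, j), rfl⟩

/-- The tuples of product tensors are parametrized by an affine space, whose coordinate ring is a
domain. If `f` were nonzero somewhere on them, `p * f` would pull back to a nonzero polynomial,
contradicting that `f` vanishes wherever `p` does not. -/
theorem isZariskiOpenDense_of_pullback_ne_zero {p : MvPolynomial (Fin R × (Fin m → Fin n)) F}
    (hp : pullback F n m R p ≠ 0) :
    IsZariskiOpenDense (productTuples F n m R) (productTuples F n m R \ zeroSet {p}) := by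
  refine ⟨⟨_, rfl⟩, fun S hS x hx f hf => ?_⟩
  by_contra hne
  obtain ⟨y, hy, hpy⟩ := exists_of_pullback_ne_zero (p := p * f) (by
    rw [map_mul]
    exact mul_ne_zero hp (pullback_ne_zero hx hne))
  rw [map_mul] at hpy
  refine right_ne_zero_of_mul hpy (hS ⟨hy, fun h => ?_⟩ f hf)
  exact left_ne_zero_of_mul hpy (h p rfl)

/-- Linear independence is an open condition. -/
theorem exists_poly_linearIndependent {σ ι : Type*} [Fintype ι] {r : ℕ}
    (a : Fin r → ι → MvPolynomial σ F) (y : σ → F)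
    (hy : LinearIndependent F fun i j => MvPolynomial.eval y (a i j)) :
    ∃ g : MvPolynomial σ F, MvPolynomial.eval y g ≠ 0 ∧ ∀ x, MvPolynomial.eval x g ≠ 0 →
      LinearIndependent F fun i j => MvPolynomial.eval x (a i j) := by
  obtain ⟨φ, hφ⟩ := exists_isDual hy
  -- Pairing with a fixed family dual to the vectors at `y` gives a square matrix. It is the
  -- identity at `y`, and wherever its determinant is nonzero the vectors are independent.
  let G : Matrix (Fin r) (Fin r) (MvPolynomial σ F) :=
    Matrix.of fun i j => ∑ l, a i l * MvPolynomial.C (φ j l)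
  have hG : ∀ x, MvPolynomial.eval x G.det =
      (Matrix.of fun i j => ∑ l, MvPolynomial.eval x (a i l) * φ j l).det := by
    intro x
    rw [RingHom.map_det]
    congr 1
    ext i j
    simp [G]
  refine ⟨G.det, ?_, fun x hx => ?_⟩
  · rw [hG]
    have : (Matrix.of fun i j => ∑ l, MvPolynomial.eval y (a i l) * φ j l) = 1 := by
      ext i j
      have := hφ j i
      rw [dotProduct_comm] at this
      simp only [Matrix.of_apply, Matrix.one_apply]
      rw [← ite_congr (propext eq_comm) (fun _ => rfl) (fun _ => rfl)] at this
      exact this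
    rw [this, Matrix.det_one]
    exact one_ne_zero
  · rw [hG] at hx
    rw [Fintype.linearIndependent_iff]
    intro c hc
    refine congrFun (Matrix.eq_zero_of_vecMul_eq_zero hx (v := c) ?_)
    ext j
    simp only [Matrix.vecMul, dotProduct, Matrix.of_apply, Finset.mul_sum, Pi.zero_apply]
    rw [Finset.sum_comm]
    refine Finset.sum_eq_zero fun l _ => ?_
    have := congrFun hc l
    simp only [Finset.sum_apply, Pi.smul_apply, smul_eq_mul, Pi.zero_apply] at this
    simp_rw [← mul_assoc]
    rw [← Finset.sum_mul, this, zero_mul]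

end Zariski
end TensorDecomp
end

/-! ### Open conditions on tuples of product tensors -/

noncomputable section
namespace TensorDecomp
variable {F : Type*} [RCLike F] {n m R : ℕ}

/-- The coordinates `x_a(·, t)` of a tuple. -/
def headPart (t : Fin (m / 2) → Fin n) (x : Fin R → Tensor F n m) (a : Fin R) :
    Tensor F n ((m + 1) / 2) := fun c => x a (joinIdx c t)

/-- The coordinates `x_a(c, ·)` of a tuple. -/
def tailPart (c : Fin ((m + 1) / 2) → Fin n) (x : Fin R → Tensor F n m) (a : Fin R) :
    Tensor F n (m / 2) := fun t => x a (joinIdx c t)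

/-- The values of quadratic forms at two of the given points. -/
def pairRow {κ : Type*} [Fintype κ] {p : ℕ} (b : Fin p → Matrix κ κ F) (v : Fin R → κ → F)
    (a a' : Fin R) : Fin p → F := fun j => v a ⬝ᵥ b j *ᵥ v a'

/-- The values of quadratic forms at one of the given points, other than two of them, and a
coordinate vector. -/
def polarRow {κ : Type*} [Fintype κ] {p : ℕ} (b : Fin p → Matrix κ κ F) (v : Fin R → κ → F)
    (a a' : Fin R) (ci : Fin R × κ) : Fin p → F :=
  fun j => if ci.1 = a ∨ ci.1 = a' then 0 else (v ci.1 ᵥ* b j) ci.2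

/-- The span of the values of the quadratic forms at the products of all vectors with the given
points other than two of them. -/
def polarSpan {κ : Type*} [Fintype κ] {p : ℕ} (b : Fin p → Matrix κ κ F) (v : Fin R → κ → F)
    (a a' : Fin R) : Submodule F (Fin p → F) :=
  Submodule.span F (Set.range (polarRow b v a a'))

theorem single_mem_productTensors {k : ℕ} (c : Fin k → Fin n) :
    (Pi.single c 1 : Tensor F n k) ∈ productTensors F n k := by
  classical
  refine ⟨fun i => Pi.single (c i) 1, ?_⟩
  funext d
  simp only [Pi.single_apply, Finset.prod_ite_zero, Finset.prod_const_one, Finset.mem_univ,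
    true_implies, funext_iff]

/-- The coefficients of `Q` in the family `b` define a functional that kills all polar rows, because
`Q` is singular at the other points, but not the row of the pair. -/
theorem pairRow_notMem_polarSpan {κ : Type*} [Fintype κ] {p : ℕ} {b : Fin p → Matrix κ κ F}
    {v : Fin R → κ → F} {a a' : Fin R} {Q : Matrix κ κ F}
    (hQ : Q ∈ Submodule.span F (Set.range b)) (hQ0 : ∀ c, c ≠ a → c ≠ a' → ∀ i, (v c ᵥ* Q) i = 0)
    (hv : v a ⬝ᵥ Q *ᵥ v a' ≠ 0) : pairRow b v a a' ∉ polarSpan b v a a' := by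
  obtain ⟨α, rfl⟩ := (Submodule.mem_span_range_iff_exists_fun F).mp hQ
  intro h
  have key : ∀ r ∈ polarSpan b v a a', α ⬝ᵥ r = 0 := by
    intro r hr
    induction hr using Submodule.span_induction with
    | mem x hx =>
      obtain ⟨⟨c, i⟩, rfl⟩ := hx
      by_cases hc : c = a ∨ c = a'
      · simp [polarRow, hc, dotProduct]
      · push Not at hc
        have := hQ0 c hc.1 hc.2 i
        rw [Matrix.vecMul_sum, Finset.sum_apply] at this
        simpa [polarRow, hc.1, hc.2, dotProduct, Matrix.vecMul_smul] using this
    | zero => simp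
    | add x y _ _ hx hy => rw [dotProduct_add, hx, hy, add_zero]
    | smul c x _ hx => rw [dotProduct_smul, hx, smul_zero]
  apply hv
  have := key _ h
  rw [Matrix.sum_mulVec, dotProduct_sum, ← this]
  simp [pairRow, dotProduct, Matrix.smul_mulVec, Finset.mul_sum, mul_left_comm]

/-- Polynomials whose values are the entries of `pairRow` and `polarRow`. -/
def rowPoly {p : ℕ} (t : Fin (m / 2) → Fin n)
    (b : Fin p → Matrix (Fin ((m + 1) / 2) → Fin n) (Fin ((m + 1) / 2) → Fin n) F) (a a' : Fin R) :
    Option (Fin R × (Fin ((m + 1) / 2) → Fin n)) → Fin p →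
      MvPolynomial (Fin R × (Fin m → Fin n)) F
  | none, j => ∑ c, MvPolynomial.X (a, joinIdx c t) *
      ∑ d, MvPolynomial.C (b j c d) * MvPolynomial.X (a', joinIdx d t)
  | some (c, i), j => if c = a ∨ c = a' then 0 else
      ∑ d, MvPolynomial.X (c, joinIdx d t) * MvPolynomial.C (b j d i)

/-- The family consisting of `pairRow` and `polarRow`. -/
def rowFamily {κ : Type*} [Fintype κ] {p : ℕ} (b : Fin p → Matrix κ κ F) (v : Fin R → κ → F)
    (a a' : Fin R) : Option (Fin R × κ) → Fin p → F
  | none => pairRow b v a a'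
  | some ci => polarRow b v a a' ci

theorem eval_rowPoly {p : ℕ} (t : Fin (m / 2) → Fin n)
    (b : Fin p → Matrix (Fin ((m + 1) / 2) → Fin n) (Fin ((m + 1) / 2) → Fin n) F) (a a' : Fin R)
    (x : Fin R → Tensor F n m) (o : Option (Fin R × (Fin ((m + 1) / 2) → Fin n))) (j : Fin p) :
    evalTuple x (rowPoly t b a a' o j) = rowFamily b (headPart t x) a a' o j := by
  rcases o with _ | ⟨c, i⟩
  · simp [rowPoly, evalTuple, rowFamily, pairRow, headPart, dotProduct, Matrix.mulVec]
  · simp only [rowPoly, evalTuple, rowFamily, polarRow]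
    split_ifs
    · simp
    · simp [Matrix.vecMul, dotProduct, headPart]

theorem span_rowFamily {κ : Type*} [Fintype κ] {p : ℕ} (b : Fin p → Matrix κ κ F)
    (v : Fin R → κ → F) (a a' : Fin R) :
    Submodule.span F (Set.range (rowFamily b v a a')) =
      Submodule.span F {pairRow b v a a'} ⊔ polarSpan b v a a' := by
  rw [polarSpan, ← Submodule.span_union]
  congr 1
  ext r
  constructor
  · rintro ⟨_ | ci, rfl⟩
    · exact Or.inl rfl
    · exact Or.inr ⟨ci, rfl⟩
  · rintro (rfl | ⟨ci, rfl⟩)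
    · exact ⟨none, rfl⟩
    · exact ⟨some ci, rfl⟩

theorem headPart_outer_mem (t : Fin (m / 2) → Fin n) {x : Fin R → Tensor F n m}
    (hx : x ∈ productTuples F n m R) (a : Fin R) :
    ∃ v ∈ productTensors F n ((m + 1) / 2), ∃ w ∈ productTensors F n (m / 2),
      x a = outer v w ∧ headPart t x a = w t • v := by
  obtain ⟨v, hv, w, hw, h⟩ := exists_outer_of_mem_productTensors (hx a)
  refine ⟨v, hv, w, hw, h, ?_⟩
  funext c
  simp [headPart, h, outer, mul_comm]

/-- The polar span does not involve the points `a` and `a'`. Take a tuple for which it has maximal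
rank and a quadric singular at the other points, then move the two points to coordinate vectors
where the quadric has a nonzero entry. There the row of the pair raises the rank by one. Rank at
least this large is an open condition, and by maximality it excludes that the row lies in the polar
span. -/
theorem exists_poly_pair {p : ℕ} (hn : 0 < n)
    (hR : R * n ^ ((m + 1) / 2) + Fintype.card (Sym2 (Fin n)) ^ ((m + 1) / 2) ≤
      Fintype.card (Sym2 (Fin ((m + 1) / 2) → Fin n))) (t : Fin (m / 2) → Fin n)
    {b : Fin p → Matrix (Fin ((m + 1) / 2) → Fin n) (Fin ((m + 1) / 2) → Fin n) F}
    (hb : Submodule.span F (Set.range b) = quadricSpace (productTensors F n ((m + 1) / 2)))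
    {a a' : Fin R} (haa : a ≠ a') :
    ∃ g : MvPolynomial (Fin R × (Fin m → Fin n)) F, pullback F n m R g ≠ 0 ∧
      ∀ x ∈ productTuples F n m R, evalTuple x g ≠ 0 →
        pairRow b (headPart t x) a a' ∉ polarSpan b (headPart t x) a a' := by
  classical
  let ρ : (Fin R → Tensor F n m) → ℕ := fun x =>
    Module.finrank F (polarSpan b (headPart t x) a a')
  have hρ : ∀ x, ρ x ≤ p := fun x => by
    simpa using Submodule.finrank_le (polarSpan b (headPart t x) a a')
  have hne : (productTuples F n m R).Nonempty :=
    ⟨fun _ => Pi.single (fun _ => ⟨0, hn⟩) 1, fun _ => single_mem_productTensors _⟩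
  obtain ⟨x₀, hx₀, hmax⟩ : ∃ x₀ ∈ productTuples F n m R, ∀ x ∈ productTuples F n m R,
      ρ x ≤ ρ x₀ := by
    -- Since `ρ` is at most `p`, minimizing `p - ρ` maximizes `ρ`.
    refine ⟨_, Function.argminOn_mem (fun x => p - ρ x) _ hne, fun x hx => ?_⟩
    have h1 := Function.argminOn_le (fun x => p - ρ x) _ hx
    have h2 := hρ x
    have h3 := hρ (Function.argminOn (fun x => p - ρ x) _ hne)
    omega
  obtain ⟨Q, hQ, hQ0, hQp⟩ := exists_quadric hR hn haa (headPart t x₀)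
  obtain ⟨c, d, hcd⟩ : ∃ c d, Q c d ≠ 0 := by
    by_contra! h
    exact hQ0 (by ext c d; exact h c d)
  -- The tails of the new terms are the coordinate vector at `t`, so that their head parts at `t`
  -- are exactly the coordinate vectors at `c` and `d`.
  let y : Fin R → Tensor F n m := fun e => if e = a then outer (Pi.single c 1) (Pi.single t 1) else
    if e = a' then outer (Pi.single d 1) (Pi.single t 1) else x₀ e
  have hy : y ∈ productTuples F n m R := by
    intro e
    simp only [y]
    split_ifs
    · exact outer_mem_productTensors (single_mem_productTensors _) (single_mem_productTensors _)
    · exact outer_mem_productTensors (single_mem_productTensors _) (single_mem_productTensors _)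
    · exact hx₀ e
  have hya : headPart t y a = Pi.single c 1 := by
    funext i
    simp [headPart, y, outer]
  have hya' : headPart t y a' = Pi.single d 1 := by
    funext i
    simp [headPart, y, outer, haa.symm]
  have hyc : ∀ e, e ≠ a → e ≠ a' → headPart t y e = headPart t x₀ e := by
    intro e h1 h2
    funext i
    simp [headPart, y, h1, h2]
  have hrow : pairRow b (headPart t y) a a' ∉ polarSpan b (headPart t y) a a' := by
    refine pairRow_notMem_polarSpan (Q := Q) (by rw [hb]; exact hQ) (fun e h1 h2 => ?_) ?_
    · rw [hyc e h1 h2]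
      exact hQp e h1 h2
    · rw [hya, hya']
      simpa using hcd
  have hspan : polarSpan b (headPart t y) a a' = polarSpan b (headPart t x₀) a a' := by
    have : polarRow b (headPart t y) a a' = polarRow b (headPart t x₀) a a' := by
      funext ⟨e, i⟩ j
      simp only [polarRow]
      split_ifs with h
      · rfl
      · push Not at h
        rw [hyc e h.1 h.2]
    rw [polarSpan, polarSpan, this]
  -- A basis of the row space at `y`, selected among the rows themselves so that the same selection
  -- makes sense at any other tuple.
  obtain ⟨f, hf, -, hfli⟩ := Submodule.exists_fun_fin_finrank_span_eq F
    (Set.range (rowFamily b (headPart t y) a a'))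
  choose τ hτ using hf
  have hli : LinearIndependent F fun i j => MvPolynomial.eval (fun q => y q.1 q.2)
      (rowPoly t b a a' (τ i) j) := by
    have : (fun i j => MvPolynomial.eval (fun q : Fin R × (Fin m → Fin n) => y q.1 q.2)
        (rowPoly t b a a' (τ i) j)) = f := by
      funext i j
      rw [← hτ i]
      exact eval_rowPoly t b a a' y (τ i) j
    rw [this]
    exact hfli
  obtain ⟨g, hg, hg'⟩ := exists_poly_linearIndependent (fun i j => rowPoly t b a a' (τ i) j)
    (fun q => y q.1 q.2) hli
  refine ⟨g, pullback_ne_zero hy hg, fun x hx hgx hmem => ?_⟩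
  have h1 := hg' _ hgx
  have h2 : (fun i j => MvPolynomial.eval (fun q : Fin R × (Fin m → Fin n) => x q.1 q.2)
      (rowPoly t b a a' (τ i) j)) = fun i => rowFamily b (headPart t x) a a' (τ i) := by
    funext i j
    exact eval_rowPoly t b a a' x (τ i) j
  rw [h2] at h1
  have h3 : Module.finrank F (Submodule.span F (Set.range (rowFamily b (headPart t y) a a')))
      ≤ Module.finrank F (Submodule.span F (Set.range (rowFamily b (headPart t x) a a'))) := by
    have := finrank_span_eq_card h1
    rw [Fintype.card_fin] at this
    rw [← this]
    refine Submodule.finrank_mono (Submodule.span_mono ?_)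
    rintro _ ⟨i, rfl⟩
    exact ⟨_, rfl⟩
  -- If the row of the pair were in the polar span at `x`, the whole family would have rank `ρ x`,
  -- at most `ρ x₀`; but it is at least the rank at `y`, which exceeds `ρ x₀`.
  have hsup : Submodule.span F {pairRow b (headPart t x) a a'} ⊔ polarSpan b (headPart t x) a a' =
      polarSpan b (headPart t x) a a' :=
    sup_eq_right.mpr (Submodule.span_le.mpr (by simpa using hmem))
  rw [span_rowFamily, span_rowFamily, hsup, hspan] at h3
  have h4 : polarSpan b (headPart t x₀) a a' <
      Submodule.span F {pairRow b (headPart t y) a a'} ⊔ polarSpan b (headPart t x₀) a a' := by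
    refine lt_of_le_of_ne le_sup_right fun h => hrow ?_
    rw [hspan, h]
    exact Submodule.mem_sup_left (Submodule.mem_span_singleton_self _)
  have h5 := Submodule.finrank_lt_finrank_of_lt h4
  have h6 := hmax x hx
  simp only [ρ] at h6
  omega

theorem exists_poly_headPart (t : Fin (m / 2) → Fin n) (hR : R ≤ n ^ ((m + 1) / 2)) :
    ∃ g : MvPolynomial (Fin R × (Fin m → Fin n)) F, pullback F n m R g ≠ 0 ∧
      ∀ x, evalTuple x g ≠ 0 → LinearIndependent F (headPart t x) := by
  classical
  let e : Fin R → (Fin ((m + 1) / 2) → Fin n) := fun a =>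
    finFunctionFinEquiv.symm (Fin.castLE hR a)
  have he : Function.Injective e := finFunctionFinEquiv.symm.injective.comp (Fin.castLE_injective hR)
  let y : Fin R → Tensor F n m := fun a => outer (Pi.single (e a) 1) (Pi.single t 1)
  have hy : y ∈ productTuples F n m R := fun a =>
    outer_mem_productTensors (single_mem_productTensors _) (single_mem_productTensors _)
  obtain ⟨g, hg, hg'⟩ := exists_poly_linearIndependent
    (fun (a : Fin R) (c : Fin ((m + 1) / 2) → Fin n) =>
      (MvPolynomial.X (a, joinIdx c t) : MvPolynomial (Fin R × (Fin m → Fin n)) F))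
    (fun q => y q.1 q.2) (by
      have := (Pi.basisFun F (Fin ((m + 1) / 2) → Fin n)).linearIndependent.comp e he
      convert this using 1
      funext a c
      simp [y, outer])
  refine ⟨g, pullback_ne_zero hy hg, fun x hx => ?_⟩
  have := hg' _ hx
  simp only [MvPolynomial.eval_X] at this
  exact this

theorem exists_poly_tailPart (c : Fin ((m + 1) / 2) → Fin n) (hR : R ≤ n ^ (m / 2)) :
    ∃ g : MvPolynomial (Fin R × (Fin m → Fin n)) F, pullback F n m R g ≠ 0 ∧
      ∀ x, evalTuple x g ≠ 0 → LinearIndependent F (tailPart c x) := by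
  classical
  let e : Fin R → (Fin (m / 2) → Fin n) := fun a =>
    finFunctionFinEquiv.symm (Fin.castLE hR a)
  have he : Function.Injective e := finFunctionFinEquiv.symm.injective.comp (Fin.castLE_injective hR)
  let y : Fin R → Tensor F n m := fun a => outer (Pi.single c 1) (Pi.single (e a) 1)
  have hy : y ∈ productTuples F n m R := fun a =>
    outer_mem_productTensors (single_mem_productTensors _) (single_mem_productTensors _)
  obtain ⟨g, hg, hg'⟩ := exists_poly_linearIndependent
    (fun (a : Fin R) (t : Fin (m / 2) → Fin n) =>
      (MvPolynomial.X (a, joinIdx c t) : MvPolynomial (Fin R × (Fin m → Fin n)) F))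
    (fun q => y q.1 q.2) (by
      have := (Pi.basisFun F (Fin (m / 2) → Fin n)).linearIndependent.comp e he
      convert this using 1
      funext a t
      simp [y, outer])
  refine ⟨g, pullback_ne_zero hy hg, fun x hx => ?_⟩
  have := hg' _ hx
  simp only [MvPolynomial.eval_X] at this
  exact this

/-- Pairing the expansion of `M` with the quadrics gives a linear relation between the rows of all
pairs of points. Diagonal pairs contribute zero, because the quadrics vanish at the points, and any
pair other than the given one contains a third point, so its row is in the polar span. The given row
is outside, which forces its coefficient to vanish. -/
theorem mem_span_squares {κ : Type*} [Fintype κ] {p : ℕ} {b : Fin p → Matrix κ κ F}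
    {X : Set (κ → F)} (hb : ∀ j, b j ∈ quadricSpace X) {v : Fin R → κ → F} (hv : ∀ a, v a ∈ X)
    (h : ∀ a a', a ≠ a' → pairRow b v a a' ∉ polarSpan b v a a') {M : Matrix κ κ F}
    (hM : M ∈ symSquare (Submodule.span F (Set.range v))) (hbM : ∀ j, pairing (b j) M = 0) :
    M ∈ Submodule.span F (Set.range fun a => Matrix.vecMulVec (v a) (v a)) := by
  classical
  obtain ⟨μ, hμ, rfl⟩ := exists_coeff_of_mem_symSquare hM
  have hsum : ∑ a, ∑ a', μ a a' • pairRow b v a a' = 0 := by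
    ext j
    rw [Pi.zero_apply, ← hbM j, ← pairingLin_apply]
    simp only [map_sum, map_smul, pairingLin_apply, pairing_vecMulVec, Finset.sum_apply,
      Pi.smul_apply, pairRow]
  have hdiag : ∀ a, pairRow b v a a = 0 := fun a => by
    ext j
    have := (hb j).2 (v a) (hv a)
    rwa [pairing_vecMulVec] at this
  have hcomm : ∀ a a', pairRow b v a a' = pairRow b v a' a := fun a a' => by
    ext j
    rw [pairRow, Matrix.dotProduct_mulVec, ← Matrix.mulVec_transpose, (hb j).1.eq, dotProduct_comm]
    rfl
  have hoff : ∀ a a', a ≠ a' → μ a a' = 0 := by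
    intro a a' haa
    by_contra hne
    refine h a a' haa ?_
    have hcase : ∀ c d, (c = a ∧ d = a') ∨ (c = a' ∧ d = a) ∨
        pairRow b v c d ∈ polarSpan b v a a' := by
      intro c d
      have hmem : ∀ c d, c ≠ a → c ≠ a' → pairRow b v c d ∈ polarSpan b v a a' := by
        intro c d h1 h2
        have : pairRow b v c d = ∑ i, v d i • polarRow b v a a' (c, i) := by
          ext j
          simp only [pairRow, Matrix.dotProduct_mulVec, Finset.sum_apply, Pi.smul_apply, polarRow,
            h1, h2, or_self, if_false, smul_eq_mul]
          exact Finset.sum_congr rfl fun i _ => mul_comm _ _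
        rw [this]
        exact Submodule.sum_mem _ fun i _ => Submodule.smul_mem _ _ (Submodule.subset_span ⟨_, rfl⟩)
      by_cases h1 : c = a
      · by_cases h2 : d = a'
        · exact Or.inl ⟨h1, h2⟩
        · by_cases h3 : d = a
          · right; right
            rw [h1, h3, hdiag]
            exact Submodule.zero_mem _
          · right; right
            rw [hcomm]
            exact hmem d c h3 h2
      · by_cases h2 : c = a'
        · by_cases h3 : d = a
          · exact Or.inr (Or.inl ⟨h2, h3⟩)
          · by_cases h4 : d = a'
            · right; right
              rw [h2, h4, hdiag]
              exact Submodule.zero_mem _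
            · right; right
              rw [hcomm]
              exact hmem d c h3 h4
        · exact Or.inr (Or.inr (hmem c d h1 h2))
    have hW : ∀ c d, ∃ r ∈ polarSpan b v a a', μ c d • pairRow b v c d =
        ((if c = a ∧ d = a' then μ a a' else 0) + (if c = a' ∧ d = a then μ a a' else 0)) •
          pairRow b v a a' + r := by
      intro c d
      rcases hcase c d with ⟨rfl, rfl⟩ | ⟨rfl, rfl⟩ | hr
      · exact ⟨0, Submodule.zero_mem _, by simp [haa]⟩
      · refine ⟨0, Submodule.zero_mem _, ?_⟩
        rw [hcomm c d, hμ.apply]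
        simp [haa, haa.symm]
      · by_cases h1 : c = a ∧ d = a'
        · obtain ⟨rfl, rfl⟩ := h1
          exact absurd hr (h c d haa)
        · by_cases h2 : c = a' ∧ d = a
          · obtain ⟨rfl, rfl⟩ := h2
            exact absurd (hcomm c d ▸ hr) (h d c haa)
          · exact ⟨_, Submodule.smul_mem _ (μ c d) hr, by simp [h1, h2]⟩
    choose r hr hμr using hW
    simp_rw [hμr, Finset.sum_add_distrib, ← Finset.sum_smul, Finset.sum_add_distrib, ite_and] at hsum
    simp only [Finset.sum_ite_eq', Finset.mem_univ, if_true, Finset.sum_const_zero, Finset.sum_ite_irrel] at hsum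
    -- The unordered pair occurs twice among the ordered ones, with equal coefficients by symmetry,
    -- so division by two is needed.
    have h2 : (μ a a' + μ a a') ≠ 0 := by
      rw [← two_mul]
      exact mul_ne_zero two_ne_zero hne
    have h3 : pairRow b v a a' = (μ a a' + μ a a')⁻¹ • -(∑ c, ∑ d, r c d) := by
      rw [← eq_neg_of_add_eq_zero_left hsum, smul_smul, inv_mul_cancel₀ h2, one_smul]
    rw [h3]
    exact Submodule.smul_mem _ _ (Submodule.neg_mem _ (Submodule.sum_mem _ fun c _ =>
      Submodule.sum_mem _ fun d _ => hr c d))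
  refine Submodule.sum_mem _ fun a _ => Submodule.sum_mem _ fun a' _ => ?_
  by_cases haa : a = a'
  · subst haa
    exact Submodule.smul_mem _ _ (Submodule.subset_span ⟨a, rfl⟩)
  · rw [hoff a a' haa, zero_smul]
    exact Submodule.zero_mem _

end TensorDecomp
end

/-! ### Generic tuples and random functionals -/

noncomputable section
namespace TensorDecomp
variable {F : Type*} [RCLike F] {n m R : ℕ}

/-- What generic tuples of product tensors satisfy. -/
structure IsGenericTuple (x : Fin R → Tensor F n m) (v : Fin R → Tensor F n ((m + 1) / 2))
    (w : Fin R → Tensor F n (m / 2)) : Prop where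
  eq : x = fun a => outer (v a) (w a)
  head_mem : ∀ a, v a ∈ productTensors F n ((m + 1) / 2)
  tail_mem : ∀ a, w a ∈ productTensors F n (m / 2)
  head_indep : LinearIndependent F v
  tail_indep : LinearIndependent F w
  squares : ∀ M ∈ symSquare (Submodule.span F (Set.range v)), PrefixInvariant M →
    M ∈ Submodule.span F (Set.range fun a => Matrix.vecMulVec (v a) (v a))

theorem exists_quadric_basis {κ : Type*} [Fintype κ] (X : Set (κ → F)) :
    ∃ (p : ℕ) (b : Fin p → Matrix κ κ F), LinearIndependent F b ∧
      Submodule.span F (Set.range b) = quadricSpace X := by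
  let b := Module.finBasis F (quadricSpace X)
  refine ⟨_, fun j => (b j : Matrix κ κ F),
    b.linearIndependent.map' (quadricSpace X).subtype (Submodule.ker_subtype _), ?_⟩
  have := congrArg (Submodule.map (Submodule.subtype _)) b.span_eq
  rw [Submodule.map_span, Submodule.map_top, Submodule.range_subtype, ← Set.range_comp] at this
  exact this

/-- The open set is defined by the product of the polynomials for independent heads, for independent
tails and for all pairs of distinct points; its pullback is nonzero because each factor has a
nonzero pullback. -/
theorem exists_isZariskiOpenDense (hn : 1 ≤ n) (hm : 3 ≤ m) (hR : (R : ℝ) ≤ rankBound n m) :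
    ∃ A : Set (Fin R → Tensor F n m), IsZariskiOpenDense (productTuples F n m R) A ∧
      ∀ x ∈ A, ∃ v w, IsGenericTuple x v w := by
  classical
  -- The first term of the minimum is there for the independence of the tails; the heads have at
  -- least as much room.
  have hRl : R ≤ n ^ (m / 2) := by
    have := hR.trans (min_le_left _ _)
    exact_mod_cast this
  have hRk : R ≤ n ^ ((m + 1) / 2) := hRl.trans (Nat.pow_le_pow_right hn (by omega))
  let t : Fin (m / 2) → Fin n := fun _ => ⟨0, hn⟩
  obtain ⟨g₁, hg₁, hv⟩ := exists_poly_headPart (F := F) t hRk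
  obtain ⟨p, b, -, hb⟩ := exists_quadric_basis (productTensors F n ((m + 1) / 2))
  obtain ⟨g₂, hg₂, hw⟩ := exists_poly_tailPart (F := F) (fun _ => ⟨0, hn⟩ : Fin ((m + 1) / 2) → Fin n) hRl
  have hpair := fun (q : {q : Fin R × Fin R // q.1 ≠ q.2}) =>
    exists_poly_pair hn (card_bound_of_le_rankBound hR) t hb q.2
  choose g₃ hg₃ hq using hpair
  have hg : pullback F n m R (g₁ * g₂ * ∏ q, g₃ q) ≠ 0 := by
    rw [map_mul, map_mul, map_prod]
    exact mul_ne_zero (mul_ne_zero hg₁ hg₂) (Finset.prod_ne_zero_iff.mpr fun q _ => hg₃ q)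
  refine ⟨_, isZariskiOpenDense_of_pullback_ne_zero hg, fun x ⟨hx, hx0⟩ => ?_⟩
  have hne : evalTuple x (g₁ * g₂ * ∏ q, g₃ q) ≠ 0 := by
    intro h
    exact hx0 fun f hf => by rw [Set.mem_singleton_iff.mp hf]; exact h
  rw [map_mul, map_mul, map_prod] at hne
  have hvi := hv x (left_ne_zero_of_mul (left_ne_zero_of_mul hne))
  have hwi := hw x (right_ne_zero_of_mul (left_ne_zero_of_mul hne))
  have hqx := fun q => hq q x hx (Finset.prod_ne_zero_iff.mp (right_ne_zero_of_mul hne) q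
    (Finset.mem_univ q))
  choose v' hv' w' hw' hxe hve using headPart_outer_mem t hx
  have hne0 : ∀ a, w' a t ≠ 0 := fun a h => hvi.ne_zero a (by rw [hve, h, zero_smul])
  -- The factors of a product tensor are determined up to scale. Taking the head part at `t` as head
  -- makes the heads polynomial in `x`; the tails are divided by their nonzero coordinate at `t` to
  -- compensate.
  have hxe' : x = fun a => outer (headPart t x a) ((w' a t)⁻¹ • w' a) := by
    funext a
    rw [← outer_smul_left, hve, smul_smul, inv_mul_cancel₀ (hne0 a), one_smul, ← hxe]
  have hw_li : LinearIndependent F fun a => (w' a t)⁻¹ • w' a := by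
    have h1 : ∀ a, tailPart (fun _ => ⟨0, hn⟩) x a = v' a (fun _ => ⟨0, hn⟩) • w' a := by
      intro a
      funext j
      simp [tailPart, hxe a, outer]
    have h2 : ∀ a, v' a (fun _ => ⟨0, hn⟩) ≠ 0 := fun a h => hwi.ne_zero a (by rw [h1, h, zero_smul])
    have := hwi.units_smul fun a => Units.mk0 ((w' a t)⁻¹ * (v' a (fun _ => ⟨0, hn⟩))⁻¹)
      (mul_ne_zero (inv_ne_zero (hne0 a)) (inv_ne_zero (h2 a)))
    convert this using 1
    funext a
    simp only [Pi.smul_apply', Units.smul_mk0, h1, smul_smul]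
    rw [inv_mul_cancel_right₀ (h2 a)]
  have hvm : ∀ a, headPart t x a ∈ productTensors F n ((m + 1) / 2) := fun a => by
    rw [hve]; exact smul_mem_productTensors (by omega) _ (hv' a)
  refine ⟨headPart t x, _, hxe', hvm,
    fun a => smul_mem_productTensors (by omega) _ (hw' a), hvi, hw_li, fun M hM hM' => ?_⟩
  have hbj : ∀ j, b j ∈ quadricSpace (productTensors F n ((m + 1) / 2)) := fun j =>
    hb ▸ Submodule.subset_span ⟨j, rfl⟩
  exact mem_span_squares hbj hvm
    (fun a a' haa => hqx ⟨(a, a'), haa⟩) hM fun j => hM'.pairing_eq_zero (hbj j)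

namespace IsGenericTuple
variable {x : Fin R → Tensor F n m} {v : Fin R → Tensor F n ((m + 1) / 2)}
  {w : Fin R → Tensor F n (m / 2)}

/-- Functionals dual to the independent tails map to the individual heads, so the range is the full
span of the heads. -/
theorem flatRange_eq (h : IsGenericTuple x v w) :
    flatRange (∑ a, x a) = Submodule.span F (Set.range v) := by
  rw [h.eq]
  refine le_antisymm (flatRange_sum_outer_le v w) ?_
  obtain ⟨ψ, hψ⟩ := exists_isDual h.tail_indep
  rw [Submodule.span_le]
  rintro _ ⟨a, rfl⟩
  refine ⟨ψ a, ?_⟩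
  rw [Matrix.mulVecLin_apply, flatten_sum_outer_mulVec]
  rw [Finset.sum_eq_single a]
  · rw [dotProduct_comm, hψ, if_pos rfl, one_smul]
  · intro b _ hb
    rw [dotProduct_comm, hψ, if_neg hb.symm, zero_smul]
  · simp

theorem isUniqueRankDecomposition (h : IsGenericTuple x v w) :
    IsUniqueRankDecomposition (∑ a, x a) x := by
  have := isUniqueRankDecomposition_of_squares (T := ∑ a, x a) h.head_indep h.head_mem h.tail_mem
    (by rw [h.eq]) (by rw [h.flatRange_eq, finrank_span_eq_card h.head_indep, Fintype.card_fin])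
    (by rw [h.flatRange_eq]; exact h.squares)
  rw [← h.eq] at this
  exact this

end IsGenericTuple

theorem linearIndependent_squares {κ : Type*} [Fintype κ] {v : Fin R → κ → F}
    (hv : LinearIndependent F v) :
    LinearIndependent F fun a => Matrix.vecMulVec (v a) (v a) := by
  obtain ⟨φ, hφ⟩ := exists_isDual hv
  rw [Fintype.linearIndependent_iff]
  intro c hc a
  have h1 := congrArg (fun M => φ a ⬝ᵥ M *ᵥ φ a) hc
  simp only [Matrix.sum_mulVec, Matrix.smul_mulVec, vecMulVec_mulVec', Matrix.zero_mulVec,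
    dotProduct_zero, smul_smul] at h1
  rw [hφ.dotProduct_sum (fun b => c b * (v b ⬝ᵥ φ a)), dotProduct_comm, hφ, if_pos rfl,
    mul_one] at h1
  exact h1

/-- Expressing the slices in the squares gives a square matrix of coefficients. Its rows are
independent because `P` is, hence so are its columns, which are the `z a`. -/
theorem exists_squareForm_of_span_eq {κ : Type*} [Fintype κ] {s : ℕ} {P : Fin s → Matrix κ κ F}
    (hP : LinearIndependent F P) {v : Fin s → κ → F} (hv : LinearIndependent F v)
    (h : ∀ x, P x ∈ Submodule.span F (Set.range fun a => Matrix.vecMulVec (v a) (v a))) :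
    ∃ z, SquareForm P z v := by
  choose c hc using fun x => (Submodule.mem_span_range_iff_exists_fun F).mp (h x)
  have hcli : LinearIndependent F c := by
    rw [Fintype.linearIndependent_iff] at hP ⊢
    intro g hg
    refine hP g ?_
    simp_rw [← hc, Finset.smul_sum, smul_smul]
    rw [Finset.sum_comm]
    refine Finset.sum_eq_zero fun a _ => ?_
    rw [← Finset.sum_smul]
    have := congrFun hg a
    simp only [Finset.sum_apply, Pi.smul_apply, smul_eq_mul, Pi.zero_apply] at this
    rw [this, zero_smul]
  refine ⟨fun a x => c x a, ?_, hv, fun x i j => ?_⟩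
  · have h1 : IsUnit (Matrix.of c) := Matrix.linearIndependent_rows_iff_isUnit.mp hcli
    exact Matrix.linearIndependent_cols_iff_isUnit.mpr h1
  · rw [← hc x]
    simp [Matrix.sum_apply, Matrix.vecMulVec_apply, mul_assoc]

-- The first two conditions exclude finitely many hyperplanes. For fixed `f` with `f ⬝ᵥ z a ≠ 0`,
-- the cross condition excludes the hyperplane of `g` orthogonal to a nontrivial combination of `z
-- a` and `z b`, and Fubini applies.
open MeasureTheory in
theorem ae_isGeneric {s : ℕ} {z : Fin s → Fin s → F} (hz : LinearIndependent F z)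
    (μ : Measure (Fin s → F)) [IsProbabilityMeasure μ] (hμ : NullOnSubspaces μ) :
    ∀ᵐ fg ∂(μ.prod μ), IsGeneric fg.1 fg.2 z := by
  have hlin : ∀ c : Fin s → F, c ≠ 0 → ∀ᵐ f ∂μ, f ⬝ᵥ c ≠ 0 := by
    intro c hc
    let L : (Fin s → F) →ₗ[F] F := (dotProductBilin F F).flip c
    have hL : ∀ f, L f = f ⬝ᵥ c := fun f => rfl
    have := hμ (LinearMap.ker L) (by
      intro h
      rw [LinearMap.ker_eq_top] at h
      obtain ⟨y, hy⟩ := exists_dotProduct_ne_zero hc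
      apply hy
      rw [dotProduct_comm, ← hL, h]
      rfl)
    rw [ae_iff]
    convert this using 2
    ext f
    simp [hL]
  have hcont : ∀ a, Continuous fun f : Fin s → F => f ⬝ᵥ z a := fun a => by
    unfold dotProduct; fun_prop
  have h1 : ∀ a, ∀ᵐ fg ∂(μ.prod μ), fg.1 ⬝ᵥ z a ≠ 0 := fun a =>
    Measure.quasiMeasurePreserving_fst.ae (hlin _ (hz.ne_zero a))
  have h2 : ∀ a, ∀ᵐ fg ∂(μ.prod μ), fg.2 ⬝ᵥ z a ≠ 0 := fun a =>
    Measure.quasiMeasurePreserving_snd.ae (hlin _ (hz.ne_zero a))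
  have h3 : ∀ a b, a ≠ b → ∀ᵐ fg ∂(μ.prod μ),
      (fg.1 ⬝ᵥ z a) * (fg.2 ⬝ᵥ z b) ≠ (fg.1 ⬝ᵥ z b) * (fg.2 ⬝ᵥ z a) := by
    intro a b hab
    rw [Measure.ae_prod_iff_ae_ae]
    · filter_upwards [hlin _ (hz.ne_zero a)] with f hf
      have : (f ⬝ᵥ z a) • z b - (f ⬝ᵥ z b) • z a ≠ 0 := by
        intro h0
        refine not_mem_span_singleton_of_linearIndependent hz hab.symm
          (Submodule.mem_span_singleton.mpr ⟨(f ⬝ᵥ z a)⁻¹ * (f ⬝ᵥ z b), ?_⟩)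
        rw [mul_smul, ← sub_eq_zero.mp h0, smul_smul, inv_mul_cancel₀ hf, one_smul]
      filter_upwards [hlin _ this] with g hg h
      apply hg
      rw [dotProduct_sub, dotProduct_smul, dotProduct_smul, smul_eq_mul, smul_eq_mul, h, sub_self]
    -- Fubini needs a measurable set; here it is the complement of a closed one.
    · refine (IsClosed.measurableSet (isClosed_eq ?_ ?_)).compl
      · exact ((hcont a).comp continuous_fst).mul ((hcont b).comp continuous_snd)
      · exact ((hcont b).comp continuous_fst).mul ((hcont a).comp continuous_snd)
  have h3' : ∀ᵐ fg ∂(μ.prod μ), ∀ a b, a ≠ b →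
      (fg.1 ⬝ᵥ z a) * (fg.2 ⬝ᵥ z b) ≠ (fg.1 ⬝ᵥ z b) * (fg.2 ⬝ᵥ z a) := by
    rw [ae_all_iff]; intro a
    rw [ae_all_iff]; intro b
    by_cases hab : a = b
    · exact Filter.Eventually.of_forall fun _ h => absurd hab h
    · filter_upwards [h3 a b hab] with _ h _ using h
  filter_upwards [ae_all_iff.mpr h1, ae_all_iff.mpr h2, h3'] with fg h1 h2 h3 using ⟨h1, h2, h3⟩

/-- For a generic tuple the span of `P` is the span of the squares of the heads. This determines all
dimensions, `s = R' = R`, and gives a square form, after which the success of the algorithm depends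
only on the position of `f` and `g`. -/
theorem IsGenericTuple.setup {x : Fin R → Tensor F n m} {v : Fin R → Tensor F n ((m + 1) / 2)}
    {w : Fin R → Tensor F n (m / 2)} (h : IsGenericTuple x v w) (hm : 3 ≤ m) {R' p s : ℕ}
    {u : Fin R' → Tensor F n ((m + 1) / 2)}
    {Q : Fin p → Matrix (Fin ((m + 1) / 2) → Fin n) (Fin ((m + 1) / 2) → Fin n) F}
    {P : Fin s → Matrix (Fin ((m + 1) / 2) → Fin n) (Fin ((m + 1) / 2) → Fin n) F}
    (hS : IsSetup (∑ a, x a) u Q P) (μ : MeasureTheory.Measure (Fin s → F))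
    [MeasureTheory.IsProbabilityMeasure μ] (hμ : NullOnSubspaces μ) :
    ∀ᵐ fg ∂(μ.prod μ),
      (∃ out, DecompositionOutput (∑ a, x a) R' P fg.1 fg.2 out) ∧
      ∀ out, DecompositionOutput (∑ a, x a) R' P fg.1 fg.2 out →
        ∃ σ : Equiv.Perm (Fin R), out = some ⟨R, x ∘ σ⟩ := by
  have hspan : Submodule.span F (Set.range P) =
      Submodule.span F (Set.range fun a => Matrix.vecMulVec (v a) (v a)) := by
    apply le_antisymm
    · intro M hM
      rw [hS.mem_span_iff, h.flatRange_eq] at hM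
      exact h.squares M hM.1 hM.2
    · rw [Submodule.span_le]
      rintro _ ⟨a, rfl⟩
      rw [SetLike.mem_coe, hS.mem_span_iff, h.flatRange_eq]
      exact ⟨vecMulVec_self_mem_symSquare (Submodule.subset_span ⟨a, rfl⟩),
        prefixInvariant_of_mem_productTensors (h.head_mem a)⟩
  obtain rfl : s = R := by
    have h1 := finrank_span_eq_card hS.lifted.1
    rw [hspan, finrank_span_eq_card (linearIndependent_squares h.head_indep)] at h1
    simpa using h1.symm
  obtain rfl : R' = s := by
    rw [← hS.finrank_flatRange, h.flatRange_eq, finrank_span_eq_card h.head_indep, Fintype.card_fin]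
  obtain ⟨z, hz⟩ := exists_squareForm_of_span_eq hS.lifted.1 h.head_indep
    (fun x => hspan ▸ Submodule.subset_span ⟨x, rfl⟩)
  obtain ⟨φ, hφ⟩ := exists_isDual h.head_indep
  have hdual : ∀ (z' : Fin R' → Fin R' → F) (v' φ' : Fin R' → Tensor F n ((m + 1) / 2)),
      SquareForm P z' v' → IsDual φ' v' →
        ∀ a, φ' a ᵥ* flatten (∑ a, x a) ∈ productTensors F n (m / 2) := by
    intro z' v' φ' hz' hφ' a
    -- Two square forms of `P` have the same span of squares, so their vectors agree up to order and
    -- scale. Dual functionals of the second one therefore contract the tensor to multiples of the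
    -- tails `w`.
    have hpar : ∀ b, ∃ (c : Fin R') (r : F), r ≠ 0 ∧ v b = r • v' c := fun b => by
      refine exists_smul_of_square_mem_span hz'.indep_v (h.head_indep.ne_zero b) ?_
      rw [← hz'.span_eq hS.lifted.1, hspan]
      exact Submodule.subset_span ⟨b, rfl⟩
    choose σ r hr hσ using hpar
    have hσi : Function.Injective σ := by
      intro b c hbc
      by_contra hne
      have h1 : v b ∈ Submodule.span F {v c} := by
        rw [Submodule.mem_span_singleton]
        refine ⟨r b * (r c)⁻¹, ?_⟩
        rw [hσ c, smul_smul, inv_mul_cancel_right₀ (hr c), hσ b, hbc]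
      have := h.head_indep.notMem_span_image (s := {c}) (x := b) (by simpa using hne)
      simp only [Set.image_singleton] at this
      exact this h1
    obtain ⟨b, rfl⟩ := (Finite.injective_iff_surjective.mp hσi) a
    have : φ' (σ b) ᵥ* flatten (∑ a, x a) = r b • w b := by
      have hx : (∑ a, x a) = ∑ a, outer (m := m) (v' (σ a)) (r a • w a) := by
        rw [h.eq]
        refine Finset.sum_congr rfl fun a _ => ?_
        rw [← outer_smul_left, ← hσ]
      have hd : IsDual (fun a => φ' (σ a)) (fun a => v' (σ a)) := fun a b => by
        rw [hφ']
        simp [hσi.eq_iff]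
      rw [hx]
      exact hd.vecMul_flatten_sum_outer _ b
    rw [this]
    exact smul_mem_productTensors (by omega) _ (h.tail_mem b)
  filter_upwards [ae_isGeneric hz.indep_z μ hμ] with fg hfg
  refine ⟨⟨_, decompositionOutput_some hz hfg hφ fun a => hdual z v φ hz hφ a⟩, fun out hout => ?_⟩
  rcases out with _ | ⟨r, y⟩
  · exact absurd hout (not_decompositionOutput_none hz hfg hdual)
  -- An output is certified to be a shortest decomposition, and uniqueness for `x` makes it a
  -- permutation of `x`.
  · have h1 := hS.certification hm hout
    have h2 := h.isUniqueRankDecomposition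
    obtain rfl : r = R' := h1.2.1.unique h2.2.1
    obtain ⟨σ, hσ⟩ := h2.2.2 y h1.1
    exact ⟨σ, by rw [hσ]⟩

end TensorDecomp
end

noncomputable section
namespace TensorDecomp

/-! ### Programs: what they read and write, and their running time -/

instance : Add NatExpr := ⟨.add⟩
instance : Sub NatExpr := ⟨.sub⟩
instance : Mul NatExpr := ⟨.mul⟩
instance : Add FieldExpr := ⟨.add⟩
instance : Sub FieldExpr := ⟨.sub⟩
instance : Mul FieldExpr := ⟨.mul⟩
instance : Div FieldExpr := ⟨.div⟩

/-- The registers occurring in an expression. -/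
def NatExpr.vars : NatExpr → List ℕ
  | const _ => []
  | var x => [x]
  | add d e => d.vars ++ e.vars
  | sub d e => d.vars ++ e.vars
  | mul d e => d.vars ++ e.vars

/-- The arrays occurring in an expression. -/
def FieldExpr.reads : FieldExpr → List ℕ
  | zero => []
  | one => []
  | get A _ _ => [A]
  | add d e => d.reads ++ e.reads
  | sub d e => d.reads ++ e.reads
  | mul d e => d.reads ++ e.reads
  | div d e => d.reads ++ e.reads
  | conj d => d.reads

/-- The arrays occurring in a test. -/
def Test.reads : Test → List ℕ
  | lt _ _ => []
  | isZero e => e.reads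
  | not b => b.reads
  | and b c => b.reads ++ c.reads

namespace Program

/-- The registers to which a program writes. -/
def regs : Program → List ℕ
  | skip => []
  | setNat x _ => [x]
  | setField _ _ _ _ => []
  | seq p q => p.regs ++ q.regs
  | ite _ p q => p.regs ++ q.regs
  | loop x _ p => x :: p.regs
  | diag _ _ _ _ x => [x]

/-- The arrays to which a program writes. -/
def arrs : Program → List ℕ
  | skip => []
  | setNat _ _ => []
  | setField A _ _ _ => [A]
  | seq p q => p.arrs ++ q.arrs
  | ite _ p q => p.arrs ++ q.arrs
  | loop _ _ p => p.arrs
  | diag _ _ E V _ => [E, V]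

/-- The arrays that a program reads. -/
def reads : Program → List ℕ
  | skip => []
  | setNat _ _ => []
  | setField _ _ _ e => e.reads
  | seq p q => p.reads ++ q.reads
  | ite b p q => b.reads ++ (p.reads ++ q.reads)
  | loop _ _ p => p.reads
  | diag A _ _ _ _ => [A]

/-- The expressions for the number of iterations of a loop or the size of a matrix. -/
def bounds : Program → List NatExpr
  | skip => []
  | setNat _ _ => []
  | setField _ _ _ _ => []
  | seq p q => p.bounds ++ q.bounds
  | ite _ p q => p.bounds ++ q.bounds
  | loop _ e p => e :: p.bounds
  | diag _ k _ _ _ => [k]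

/-- The nesting depth of loops. -/
def depth : Program → ℕ
  | skip => 0
  | setNat _ _ => 0
  | setField _ _ _ _ => 0
  | seq p q => max p.depth q.depth
  | ite _ p q => max p.depth q.depth
  | loop _ _ p => p.depth + 1
  | diag _ _ _ _ _ => 2

/-- The length of a program, as far as it matters for the running time. -/
def size : Program → ℕ
  | skip => 1
  | setNat _ e => e.cost + 1
  | setField _ i j e => i.cost + j.cost + e.cost + 1
  | seq p q => p.size + q.size
  | ite b p q => b.cost + (p.size + q.size)
  | loop _ e p => e.cost + 2 + p.size
  | diag _ k _ _ _ => k.cost + 2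

/-- The number of oracle calls in the text of a program. -/
def calls : Program → ℕ
  | skip => 0
  | setNat _ _ => 0
  | setField _ _ _ _ => 0
  | seq p q => p.calls + q.calls
  | ite _ p q => p.calls + q.calls
  | loop _ _ p => p.calls
  | diag _ _ _ _ _ => 1

/-- No oracle call is inside a loop. -/
def LoopsCallFree : Program → Prop
  | skip => True
  | setNat _ _ => True
  | setField _ _ _ _ => True
  | seq p q => p.LoopsCallFree ∧ q.LoopsCallFree
  | ite _ p q => p.LoopsCallFree ∧ q.LoopsCallFree
  | loop _ _ p => p.LoopsCallFree ∧ p.calls = 0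
  | diag _ _ _ _ _ => True

end Program

theorem NatExpr.val_congr {ρ ρ' : ℕ → ℕ} {e : NatExpr} (h : ∀ x ∈ e.vars, ρ x = ρ' x) :
    e.val ρ = e.val ρ' := by
  induction e with
  | const c => rfl
  | var x => exact h x (by simp [vars])
  | add d e hd he | sub d e hd he | mul d e hd he =>
    simp only [val]
    rw [hd fun x hx => h x (by simp [vars, hx]), he fun x hx => h x (by simp [vars, hx])]

variable {F : Type*} [RCLike F]

theorem FieldExpr.val_congr {S S' : Machine F} (hn : S.nat = S'.nat) {e : FieldExpr}
    (h : ∀ A ∈ e.reads, S.field A = S'.field A) : e.val S = e.val S' := by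
  induction e with
  | zero => rfl
  | one => rfl
  | get A i j => simp only [val]; rw [hn, h A (by simp [reads])]
  | add d e hd he | sub d e hd he | mul d e hd he | div d e hd he =>
    simp only [val]
    rw [hd fun x hx => h x (by simp [reads, hx]), he fun x hx => h x (by simp [reads, hx])]
  | conj d hd => simp only [val]; rw [hd fun x hx => h x (by simp [reads, hx])]

theorem Test.holds_congr {S S' : Machine F} (hn : S.nat = S'.nat) {b : Test}
    (h : ∀ A ∈ b.reads, S.field A = S'.field A) : b.Holds S ↔ b.Holds S' := by
  induction b with
  | lt d e => simp only [Holds]; rw [hn]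
  | isZero e => simp only [Holds]; rw [FieldExpr.val_congr hn h]
  | not b hb => simp only [Holds]; rw [hb h]
  | and b c hb hc =>
    simp only [Holds]
    rw [hb fun x hx => h x (by simp [reads, hx]), hc fun x hx => h x (by simp [reads, hx])]

theorem iterate_induction {α : Type*} {f : ℕ → α → α} {a : α} (P : ℕ → α → Prop) {b : ℕ}
    (h0 : P 0 a) (hs : ∀ i < b, ∀ a, P i a → P (i + 1) (f i a)) : P b (iterate f b a) := by
  induction b with
  | zero => exact h0
  | succ b ih => exact hs b (Nat.lt_succ_self b) _ (ih fun i hi => hs i (by omega))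

variable {O : DiagOracle F}

theorem run_nat_of_notMem {x : ℕ} {p : Program} (hx : x ∉ p.regs) (S : Machine F) :
    (p.run O S).nat x = S.nat x := by
  induction p generalizing S with
  | skip => rfl
  | setNat y e =>
    have : x ≠ y := by simpa [Program.regs] using hx
    simp [Program.run, Machine.tick, Machine.writeNat, this]
  | setField A i j e => rfl
  | seq p q hp hq =>
    simp only [Program.regs, List.mem_append, not_or] at hx
    simp only [Program.run]
    rw [hq hx.2, hp hx.1]
  | ite b p q hp hq =>
    simp only [Program.regs, List.mem_append, not_or] at hx
    simp only [Program.run]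
    split_ifs
    · rw [hp hx.1]; rfl
    · rw [hq hx.2]; rfl
  | loop y e p hp =>
    simp only [Program.regs, List.mem_cons, not_or] at hx
    simp only [Program.run]
    refine iterate_induction (fun (_ : ℕ) (S' : Machine F) => S'.nat x = S.nat x) rfl fun i _ S' h => ?_
    rw [hp hx.2]
    simp [Machine.tick, Machine.writeNat, hx.1, h]
  | diag A k E V y =>
    have : x ≠ y := by simpa [Program.regs] using hx
    simp only [Program.run, Machine.callDiag]
    split <;> simp [this, Machine.tick]

theorem run_field_of_notMem {B : ℕ} {p : Program} (hB : B ∉ p.arrs) (S : Machine F) :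
    (p.run O S).field B = S.field B := by
  induction p generalizing S with
  | skip => rfl
  | setNat y e => rfl
  | setField A i j e =>
    have : B ≠ A := by simpa [Program.arrs] using hB
    simp [Program.run, Machine.tick, Machine.writeField, this]
  | seq p q hp hq =>
    simp only [Program.arrs, List.mem_append, not_or] at hB
    simp only [Program.run]
    rw [hq hB.2, hp hB.1]
  | ite b p q hp hq =>
    simp only [Program.arrs, List.mem_append, not_or] at hB
    simp only [Program.run]
    split_ifs
    · rw [hp hB.1]; rfl
    · rw [hq hB.2]; rfl
  | loop y e p hp =>
    simp only [Program.run]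
    refine iterate_induction (fun (_ : ℕ) (S' : Machine F) => S'.field B = S.field B) rfl fun i _ S' h => ?_
    rw [hp hB]
    exact h
  | diag A k E V y =>
    simp only [Program.arrs, List.mem_cons, List.not_mem_nil, or_false, not_or] at hB
    simp only [Program.run, Machine.callDiag]
    split <;> simp [hB.1, hB.2, Machine.tick]

/-- Two states agree except for the array `B`. -/
def AgreeOff (B : ℕ) (S S' : Machine F) : Prop :=
  S.nat = S'.nat ∧ ∀ A, A ≠ B → S.field A = S'.field A

/-- This is used for the array of random scalars: a part of the program that does not read them
computes the same result for all of them. -/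
theorem AgreeOff.run {B : ℕ} {p : Program} (hB : B ∉ p.reads) {S S' : Machine F}
    (h : AgreeOff B S S') : AgreeOff B (p.run O S) (p.run O S') := by
  induction p generalizing S S' with
  | skip => exact h
  | setNat y e =>
    refine ⟨?_, h.2⟩
    simp only [Program.run, Machine.tick, Machine.writeNat, h.1]
  | setField A i j e =>
    refine ⟨h.1, fun C hC => ?_⟩
    have he := FieldExpr.val_congr h.1 (e := e) fun C hC => h.2 C fun hCB => hB (hCB ▸ hC)
    simp only [Program.run, Machine.tick, Machine.writeField, h.1, h.2 C hC, he]
  | seq p q hp hq =>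
    simp only [Program.reads, List.mem_append, not_or] at hB
    exact hq hB.2 (hp hB.1 h)
  | ite b p q hp hq =>
    simp only [Program.reads, List.mem_append, not_or] at hB
    have hb := Test.holds_congr h.1 (b := b) fun C hC => h.2 C fun hCB => hB.1 (hCB ▸ hC)
    by_cases hS : b.Holds S
    · simp only [Program.run, if_pos hS, if_pos (hb.mp hS)]
      exact hp hB.2.1 h
    · simp only [Program.run, if_neg hS, if_neg (mt hb.mpr hS)]
      exact hq hB.2.2 h
  | loop y e p hp =>
    simp only [Program.run, h.1]
    generalize e.val S'.nat = b
    induction b with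
    | zero => exact h
    | succ b ih =>
      refine hp hB ⟨funext fun z => ?_, ih.2⟩
      exact congrArg (fun ρ : ℕ → ℕ => if z = y then b else ρ z) ih.1
  | diag A k E V y =>
    have hA : A ≠ B := by simpa [Program.reads, eq_comm] using hB
    obtain ⟨ρ, X, t, c⟩ := S
    obtain ⟨ρ', X', t', c'⟩ := S'
    obtain ⟨h1, h2⟩ := h
    dsimp only at h1 h2
    subst h1
    simp only [Program.run, Machine.callDiag, Machine.tick, h2 A hA]
    cases O (k.val ρ) fun i j => X' A i j with
    | none => exact ⟨rfl, h2⟩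
    | some dW =>
      refine ⟨rfl, fun C hC => ?_⟩
      simp only [h2 C hC]

/-- Loop bodies contain no calls, so iterations do not multiply the count. -/
theorem calls_run_le {p : Program} (hp : p.LoopsCallFree) (S : Machine F) :
    (p.run O S).calls ≤ S.calls + p.calls := by
  induction p generalizing S with
  | skip => exact le_rfl
  | setNat y e => exact le_rfl
  | setField A i j e => exact le_rfl
  | seq p q ihp ihq =>
    simp only [Program.run, Program.calls]
    have := ihq hp.2 (p.run O S)
    have := ihp hp.1 S
    omega
  | ite b p q ihp ihq =>
    simp only [Program.run, Program.calls]
    have h1 := ihq hp.2 (S.tick b.cost)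
    have h2 := ihp hp.1 (S.tick b.cost)
    simp only [Machine.tick] at h1 h2 ⊢
    split_ifs <;> omega
  | loop y e p ihp =>
    simp only [Program.run, Program.calls]
    refine iterate_induction (fun (_ : ℕ) (S' : Machine F) => S'.calls ≤ S.calls + p.calls) (by simp [Machine.tick])
      fun i _ S' h => ?_
    have := ihp hp.1 ((S'.writeNat y i).tick 1)
    rw [hp.2] at this h ⊢
    exact this.trans h
  | diag A k E V y =>
    simp only [Program.run, Machine.callDiag, Program.calls]
    split <;> simp [Machine.tick]

/-- A program whose loop bounds are at most `L` runs in time `O(L ^ depth)`. -/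
theorem time_run_le {D : List ℕ} {p : Program} {L : ℕ} (hL : 1 ≤ L)
    (hreg : ∀ x ∈ D, x ∉ p.regs) (hvars : ∀ e ∈ p.bounds, ∀ x ∈ e.vars, x ∈ D) (S : Machine F)
    (hb : ∀ e ∈ p.bounds, e.val S.nat ≤ L) :
    (p.run O S).time ≤ S.time + p.size * L ^ p.depth := by
  -- Loop bounds involve only registers in `D`, which the program never writes, so their initial
  -- values persist.
  have key : ∀ {S S' : Machine F}, (∀ x ∈ D, S'.nat x = S.nat x) → ∀ {l : List NatExpr},
      (∀ e ∈ l, ∀ x ∈ e.vars, x ∈ D) → (∀ e ∈ l, e.val S.nat ≤ L) →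
      ∀ e ∈ l, e.val S'.nat ≤ L := by
    intro S S' h l hv hl e he
    rw [NatExpr.val_congr fun x hx => h x (hv e he x hx)]
    exact hl e he
  induction p generalizing S with
  | skip => simp [Program.run, Machine.tick, Program.size, Program.depth]
  | setNat y e => simp [Program.run, Machine.tick, Program.size, Program.depth, Machine.writeNat]
  | setField A i j e =>
    simp [Program.run, Machine.tick, Program.size, Program.depth, Machine.writeField]
  | seq p q ihp ihq =>
    simp only [Program.regs, List.mem_append, not_or] at hreg
    simp only [Program.bounds, List.mem_append] at hvars hb
    simp only [Program.run, Program.size, Program.depth]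
    have h1 := ihp (fun x hx => (hreg x hx).1) (fun e he => hvars e (Or.inl he)) S
      (fun e he => hb e (Or.inl he))
    have h2 := ihq (fun x hx => (hreg x hx).2) (fun e he => hvars e (Or.inr he)) (p.run O S)
      (key (fun x hx => run_nat_of_notMem (hreg x hx).1 S) (fun e he => hvars e (Or.inr he))
        (fun e he => hb e (Or.inr he)))
    have h3 : p.size * L ^ p.depth ≤ p.size * L ^ max p.depth q.depth :=
      Nat.mul_le_mul_left _ (Nat.pow_le_pow_right hL (le_max_left _ _))
    have h4 : q.size * L ^ q.depth ≤ q.size * L ^ max p.depth q.depth :=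
      Nat.mul_le_mul_left _ (Nat.pow_le_pow_right hL (le_max_right _ _))
    rw [add_mul]
    omega
  | ite b p q ihp ihq =>
    simp only [Program.regs, List.mem_append, not_or] at hreg
    simp only [Program.bounds, List.mem_append] at hvars hb
    simp only [Program.run, Program.size, Program.depth]
    have h1 := ihp (fun x hx => (hreg x hx).1) (fun e he => hvars e (Or.inl he)) (S.tick b.cost)
      (fun e he => hb e (Or.inl he))
    have h2 := ihq (fun x hx => (hreg x hx).2) (fun e he => hvars e (Or.inr he)) (S.tick b.cost)
      (fun e he => hb e (Or.inr he))
    have h3 : p.size * L ^ p.depth ≤ p.size * L ^ max p.depth q.depth :=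
      Nat.mul_le_mul_left _ (Nat.pow_le_pow_right hL (le_max_left _ _))
    have h4 : q.size * L ^ q.depth ≤ q.size * L ^ max p.depth q.depth :=
      Nat.mul_le_mul_left _ (Nat.pow_le_pow_right hL (le_max_right _ _))
    have h5 : b.cost ≤ b.cost * L ^ max p.depth q.depth :=
      Nat.le_mul_of_pos_right _ (pow_pos hL _)
    rw [add_mul, add_mul]
    simp only [Machine.tick] at h1 h2 ⊢
    split_ifs <;> omega
  | loop y e p ihp =>
    simp only [Program.regs, List.mem_cons, not_or] at hreg
    simp only [Program.bounds, List.mem_cons, forall_eq_or_imp] at hvars hb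
    simp only [Program.run, Program.size, Program.depth]
    have h := iterate_induction (f := fun i (S' : Machine F) => p.run O ((S'.writeNat y i).tick 1))
      (a := S.tick (e.cost + 1)) (b := e.val S.nat)
      (fun i S' => (∀ x ∈ D, S'.nat x = S.nat x) ∧
        S'.time ≤ S.time + (e.cost + 1) + i * (1 + p.size * L ^ p.depth))
      ⟨fun x _ => rfl, by simp [Machine.tick]⟩ (by
        intro i _ S' ⟨hn, ht⟩
        have hn' : ∀ x ∈ D, ((S'.writeNat y i).tick 1).nat x = S.nat x := fun x hx => by
          simp [Machine.tick, Machine.writeNat, (hreg x hx).1, hn x hx]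
        refine ⟨fun x hx => by rw [run_nat_of_notMem (hreg x hx).2, hn' x hx], ?_⟩
        have := ihp (fun x hx => (hreg x hx).2) hvars.2 ((S'.writeNat y i).tick 1)
          (key hn' hvars.2 hb.2)
        simp only [Machine.tick, Machine.writeNat] at this ht ⊢
        rw [add_mul]
        omega)
    refine h.2.trans ?_
    have h1 : e.val S.nat * (1 + p.size * L ^ p.depth) ≤ L * (1 + p.size * L ^ p.depth) :=
      Nat.mul_le_mul_right _ hb.1
    have h2 : L * (1 + p.size * L ^ p.depth) ≤ (1 + p.size) * L ^ (p.depth + 1) := by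
      rw [mul_add, add_mul, pow_succ]
      have : L * 1 ≤ 1 * (L ^ p.depth * L) := by
        rw [mul_comm]
        gcongr
        exact Nat.le_mul_of_pos_left _ (pow_pos hL _)
      have h' : L * (p.size * L ^ p.depth) = p.size * (L ^ p.depth * L) := by ring
      omega
    have h3 : e.cost + 1 ≤ (e.cost + 1) * L ^ (p.depth + 1) :=
      Nat.le_mul_of_pos_right _ (pow_pos hL _)
    have h4 : (e.cost + 2 + p.size) * L ^ (p.depth + 1) =
      (e.cost + 1) * L ^ (p.depth + 1) + (1 + p.size) * L ^ (p.depth + 1) := by ring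
    omega
  | diag A k E V y =>
    have hk : k.val S.nat ≤ L := hb k (by simp [Program.bounds])
    have h1 : (Program.run O (.diag A k E V y) S).time = S.time + k.cost +
        (k.val S.nat * k.val S.nat + 1) := by
      simp only [Program.run, Machine.callDiag]
      split <;> simp [Machine.tick]
    rw [h1]
    simp only [Program.size, Program.depth]
    have h2 : k.val S.nat * k.val S.nat ≤ L ^ 2 := by rw [pow_two]; exact Nat.mul_le_mul hk hk
    have h3 : k.cost ≤ k.cost * L ^ 2 := Nat.le_mul_of_pos_right _ (pow_pos hL _)
    have h4 : 1 ≤ L ^ 2 := Nat.one_le_pow _ _ hL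
    rw [add_mul]
    omega

/-! ### Loops with an invariant -/

/-- The invariant does not see the counters of steps and calls, and `hI` makes it indifferent to the
loop register, which each round overwrites. The body may also use that registers and arrays it never
writes still have their values from before the loop. -/
theorem run_loop {x : ℕ} {e : NatExpr} {p : Program} {S : Machine F}
    (I : ℕ → (ℕ → ℕ) → (ℕ → ℕ → ℕ → F) → Prop) (h0 : I 0 S.nat S.field)
    (hI : ∀ i ρ A j, I i ρ A → I i (fun y => if y = x then j else ρ y) A)
    (hs : ∀ i < e.val S.nat, ∀ S' : Machine F, I i S'.nat S'.field → S'.nat x = i →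
      (∀ y, y ∉ p.regs → y ≠ x → S'.nat y = S.nat y) → (∀ B, B ∉ p.arrs → S'.field B = S.field B) →
      I (i + 1) (p.run O S').nat (p.run O S').field) :
    I (e.val S.nat) ((Program.loop x e p).run O S).nat ((Program.loop x e p).run O S).field := by
  have := iterate_induction (f := fun i (S' : Machine F) => p.run O ((S'.writeNat x i).tick 1))
      (a := S.tick (e.cost + 1)) (b := e.val S.nat)
      (fun i S' => I i S'.nat S'.field ∧ (∀ y, y ∉ p.regs → y ≠ x → S'.nat y = S.nat y) ∧
        (∀ B, B ∉ p.arrs → S'.field B = S.field B))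
      ⟨h0, fun _ _ _ => rfl, fun _ _ => rfl⟩ (by
        intro i hi S' ⟨h1, h2, h3⟩
        have h2' : ∀ y, y ∉ p.regs → y ≠ x → ((S'.writeNat x i).tick 1).nat y = S.nat y :=
          fun y hy hyx => by simp [Machine.tick, Machine.writeNat, hyx, h2 y hy hyx]
        refine ⟨hs i hi _ (hI i _ _ i h1) (by simp [Machine.tick, Machine.writeNat]) h2' h3, ?_, ?_⟩
        · intro y hy hyx
          rw [run_nat_of_notMem hy, h2' y hy hyx]
        · intro B hB
          rw [run_field_of_notMem hB]
          exact h3 B hB)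
  exact this.1

end TensorDecomp
end

noncomputable section
namespace TensorDecomp

/-! ### Building blocks of programs -/

section Frame

variable {F : Type*}

/-- The states agree except for the registers `rs` and the arrays `as`. -/
def Frame (rs as : List ℕ) (S S' : Machine F) : Prop :=
  (∀ x, x ∉ rs → S'.nat x = S.nat x) ∧ ∀ A, A ∉ as → S'.field A = S.field A

theorem Frame.symm {rs as : List ℕ} {S S' : Machine F} (h : Frame rs as S S') :
    Frame rs as S' S :=
  ⟨fun x hx => (h.1 x hx).symm, fun A hA => (h.2 A hA).symm⟩

theorem Frame.trans {rs as rs' as' : List ℕ} {S S' S'' : Machine F} (h : Frame rs as S S')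
    (h' : Frame rs' as' S' S'') : Frame (rs ++ rs') (as ++ as') S S'' := by
  simp only [Frame, List.mem_append, not_or]
  exact ⟨fun x hx => (h'.1 x hx.2).trans (h.1 x hx.1),
    fun A hA => (h'.2 A hA.2).trans (h.2 A hA.1)⟩

theorem Frame.mono {rs as rs' as' : List ℕ} {S S' : Machine F} (h : Frame rs as S S')
    (hr : rs ⊆ rs') (ha : as ⊆ as') : Frame rs' as' S S' :=
  ⟨fun x hx => h.1 x fun hx' => hx (hr hx'), fun A hA => h.2 A fun hA' => hA (ha hA')⟩

end Frame

@[simp] theorem NatExpr.val_hAdd (ρ : ℕ → ℕ) (d e : NatExpr) :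
    (d + e).val ρ = d.val ρ + e.val ρ := rfl
@[simp] theorem NatExpr.val_hSub (ρ : ℕ → ℕ) (d e : NatExpr) :
    (d - e).val ρ = d.val ρ - e.val ρ := rfl
@[simp] theorem NatExpr.val_hMul (ρ : ℕ → ℕ) (d e : NatExpr) :
    (d * e).val ρ = d.val ρ * e.val ρ := rfl
@[simp] theorem NatExpr.val_const (ρ : ℕ → ℕ) (c : ℕ) : (const c).val ρ = c := rfl
@[simp] theorem NatExpr.val_var (ρ : ℕ → ℕ) (x : ℕ) : (var x).val ρ = ρ x := rfl

section Values

set_option linter.unusedSectionVars false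

variable {F : Type*} [RCLike F] (S : Machine F)

@[simp] theorem FieldExpr.val_hAdd (d e : FieldExpr) : (d + e).val S = d.val S + e.val S := rfl
@[simp] theorem FieldExpr.val_hSub (d e : FieldExpr) : (d - e).val S = d.val S - e.val S := rfl
@[simp] theorem FieldExpr.val_hMul (d e : FieldExpr) : (d * e).val S = d.val S * e.val S := rfl
@[simp] theorem FieldExpr.val_hDiv (d e : FieldExpr) : (d / e).val S = d.val S / e.val S := rfl
@[simp] theorem FieldExpr.val_one : (one).val S = (1 : F) := rfl
@[simp] theorem FieldExpr.val_conj (d : FieldExpr) : (conj d).val S = star (d.val S) := rfl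
@[simp] theorem FieldExpr.val_get (A : ℕ) (i j : NatExpr) :
    (get A i j).val S = S.field A (i.val S.nat) (j.val S.nat) := rfl
@[simp] theorem Machine.tick_nat (t : ℕ) : (S.tick t).nat = S.nat := rfl
@[simp] theorem Machine.tick_field (t : ℕ) : (S.tick t).field = S.field := rfl
@[simp] theorem Machine.writeNat_field (x a : ℕ) : (S.writeNat x a).field = S.field := rfl
@[simp] theorem Machine.writeField_nat (A i j : ℕ) (a : F) : (S.writeField A i j a).nat = S.nat :=
  rfl
theorem Machine.writeNat_nat (x a y : ℕ) :
    (S.writeNat x a).nat y = if y = x then a else S.nat y := rfl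
theorem Machine.writeField_field (A i j : ℕ) (a : F) (B i' j' : ℕ) :
    (S.writeField A i j a).field B i' j' =
      if B = A ∧ i' = i ∧ j' = j then a else S.field B i' j' := rfl

end Values

variable {F : Type*} [RCLike F] {O : DiagOracle F}

theorem run_frame (p : Program) (S : Machine F) : Frame p.regs p.arrs S (p.run O S) :=
  ⟨fun _ hx => run_nat_of_notMem hx S, fun _ hA => run_field_of_notMem hA S⟩

/-- A rule for loops whose body keeps an invariant. -/
theorem run_loop_frame {x : ℕ} {e : NatExpr} {p : Program} {S : Machine F}
    (I : ℕ → (ℕ → ℕ) → (ℕ → ℕ → ℕ → F) → Prop) (h0 : I 0 S.nat S.field)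
    (hI : ∀ i ρ A j, I i ρ A → I i (fun y => if y = x then j else ρ y) A)
    (hs : ∀ i < e.val S.nat, ∀ S' : Machine F, I i S'.nat S'.field → S'.nat x = i →
      Frame (x :: p.regs) p.arrs S S' → I (i + 1) (p.run O S').nat (p.run O S').field) :
    I (e.val S.nat) ((Program.loop x e p).run O S).nat ((Program.loop x e p).run O S).field :=
  run_loop I h0 hI fun i hi S' h1 h2 h3 h4 =>
    hs i hi S' h1 h2 ⟨fun y hy => h3 y (fun h => hy (List.mem_cons_of_mem _ h))
      (fun h => hy (h ▸ List.mem_cons_self)), h4⟩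

namespace Program

/-- Run programs one after the other. -/
def seqs : List Program → Program
  | [] => skip
  | p :: l => seq p (seqs l)

/-- Quotient (in the register `d`) and remainder (in the register `r`) of `c` by `q`. -/
def divMod (d r : ℕ) (c q b : NatExpr) : Program :=
  seq (setNat r c) (seq (setNat d (.const 0))
    (loop 9 b (ite (.lt (.var r) q) skip
      (seq (setNat r (.var r - q)) (setNat d (.var d + .const 1))))))

/-- The power `a ^ i` (in the register `r`), for `i ≤ b`. -/
def pow (r : ℕ) (a i b : NatExpr) : Program :=
  seq (setNat r (.const 1)) (loop 8 b (ite (.lt (.var 8) i) (setNat r (.var r * a)) skip))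

/-- The sum of the values of `e`, where the register `12` runs up to `c`. -/
def sum (c : NatExpr) (prep : Program) (e : FieldExpr) : Program :=
  seq (setField 3 (.const 0) (.const 0) .zero)
    (loop 12 c (seq prep (setField 3 (.const 0) (.const 0) (.get 3 (.const 0) (.const 0) + e))))

/-- Fill an `a × b` array; the registers `10` and `11` hold the indices. -/
def fill (A : ℕ) (a b c : NatExpr) (prep : Program) (e : FieldExpr) : Program :=
  loop 10 a (loop 11 b (seq (sum c prep e)
    (setField A (.var 10) (.var 11) (.get 3 (.const 0) (.const 0)))))

/-- Fill rows of an array, one for every value of the register `10` that satisfies the test. The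
register `x` counts the rows. -/
def select (A x : ℕ) (a b : NatExpr) (t : Test) (e : FieldExpr) : Program :=
  seq (setNat x (.const 0)) (loop 10 a (ite t
    (seq (loop 11 b (setField A (.var x) (.var 11) e)) (setNat x (.var x + .const 1))) skip))

/-- Check that a test fails for all values of the registers `10` and `11`. -/
def check (x : ℕ) (a b : NatExpr) (prep : Program) (t : Test) : Program :=
  seq (setNat x (.const 1))
    (loop 10 a (loop 11 b (seq prep (ite t (setNat x (.const 0)) skip))))

end Program

open Program

theorem run_seq (p q : Program) (S : Machine F) : (seq p q).run O S = q.run O (p.run O S) := rfl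

/-- The run of several programs. -/
def runs (O : DiagOracle F) (l : List Program) (S : Machine F) : Machine F :=
  l.foldl (fun S p => p.run O S) S

theorem runs_append (l l' : List Program) (S : Machine F) :
    runs O (l ++ l') S = runs O l' (runs O l S) := List.foldl_append

theorem run_seqs (l : List Program) (S : Machine F) :
    (seqs l).run O S = (runs O l S).tick 1 := by
  induction l generalizing S with
  | nil => rfl
  | cons p l ih => exact ih _

theorem runs_frame (l : List Program) (S : Machine F) :
    Frame (seqs l).regs (seqs l).arrs S (runs O l S) := by
  have := run_frame (O := O) (seqs l) S
  rwa [run_seqs] at this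

theorem run_setNat_nat (x : ℕ) (e : NatExpr) (S : Machine F) (y : ℕ) :
    ((setNat x e).run O S).nat y = if y = x then e.val S.nat else S.nat y := rfl

theorem run_ite_pos {b : Test} {p q : Program} {S : Machine F} (h : b.Holds S) :
    (ite b p q).run O S = p.run O (S.tick b.cost) := if_pos h

theorem run_ite_neg {b : Test} {p q : Program} {S : Machine F} (h : ¬ b.Holds S) :
    (ite b p q).run O S = q.run O (S.tick b.cost) := if_neg h

/-- Division by repeated subtraction keeps `d * q + r = c`. After `i` rounds either `r < q` or `d ≥
i`; with at least `c` rounds and positive `q` the second alternative also implies `r < q`. -/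
theorem run_divMod {d r : ℕ} {c q b : NatExpr} (hdr : d ≠ r) (hd : d ≠ 9) (hr : r ≠ 9)
    (hq : d ∉ q.vars ∧ r ∉ q.vars ∧ 9 ∉ q.vars) (hb : d ∉ b.vars ∧ r ∉ b.vars)
    {S : Machine F} (hq0 : 0 < q.val S.nat) (hcb : c.val S.nat ≤ b.val S.nat) :
    ((divMod d r c q b).run O S).nat d = c.val S.nat / q.val S.nat ∧
      ((divMod d r c q b).run O S).nat r = c.val S.nat % q.val S.nat := by
  set S1 := (setNat d (.const 0)).run O ((setNat r c).run O S) with hS1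
  have hrun : (divMod d r c q b).run O S =
    (loop 9 b (ite (.lt (.var r) q) skip
      (seq (setNat r (.var r - q)) (setNat d (.var d + .const 1))))).run O S1 := rfl
  have hdr' : r ≠ d := hdr.symm
  have h1 : ∀ y, S1.nat y = if y = d then 0 else if y = r then c.val S.nat else S.nat y :=
    fun y => rfl
  have hb1 : b.val S1.nat = b.val S.nat := NatExpr.val_congr fun x hx => by
    simp [h1, ne_of_mem_of_not_mem hx hb.1, ne_of_mem_of_not_mem hx hb.2]
  have hq1 : q.val S1.nat = q.val S.nat := NatExpr.val_congr fun x hx => by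
    simp [h1, ne_of_mem_of_not_mem hx hq.1, ne_of_mem_of_not_mem hx hq.2.1]
  rw [hrun]
  have key := run_loop_frame (O := O) (x := 9) (e := b) (S := S1)
    (p := ite (.lt (.var r) q) skip (seq (setNat r (.var r - q)) (setNat d (.var d + .const 1))))
    (fun i ρ _ => ρ d * q.val S.nat + ρ r = c.val S.nat ∧ (ρ r < q.val S.nat ∨ i ≤ ρ d))
    (by simp [h1, hdr']) (by
      intro i ρ _ j h
      simpa [hd, hr] using h)
    (by
      intro i _ S' ⟨h2, h3⟩ h9 hF
      have hq' : q.val S'.nat = q.val S.nat := by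
        rw [← hq1]
        refine NatExpr.val_congr fun x hx => hF.1 x ?_
        simp only [regs, List.nil_append, List.cons_append, List.mem_cons, List.not_mem_nil,
          or_false, not_or]
        exact ⟨fun h => hq.2.2 (h ▸ hx), fun h => hq.2.1 (h ▸ hx), fun h => hq.1 (h ▸ hx)⟩
      by_cases hlt : S'.nat r < q.val S'.nat
      · rw [run_ite_pos (by exact hlt)]
        rw [hq'] at hlt
        exact ⟨h2, Or.inl hlt⟩
      · rw [run_ite_neg (by exact hlt)]
        rw [hq'] at hlt
        simp only [run_seq, run_setNat_nat, NatExpr.val_hSub, NatExpr.val_var, NatExpr.val_hAdd,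
          NatExpr.val_const, Machine.tick_nat, if_true, hdr, hdr', if_false, hq']
        rw [add_mul, one_mul]
        omega)
  rw [hb1] at key
  obtain ⟨h2, h3⟩ := key
  generalize ((loop 9 b _).run O S1).nat d = D at *
  generalize ((loop 9 b _).run O S1).nat r = E at *
  have hlt : E < q.val S.nat := by
    rcases h3 with h3 | h3
    · exact h3
    · by_contra hE
      have : D ≤ D * q.val S.nat := Nat.le_mul_of_pos_right _ hq0
      omega
  constructor
  · rw [← h2, mul_comm, Nat.mul_add_div hq0, Nat.div_eq_of_lt hlt, add_zero]
  · rw [← h2, mul_comm, Nat.mul_add_mod, Nat.mod_eq_of_lt hlt]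

/-- Round `j` multiplies only if `j < i`, so the power after `j` rounds has exponent `min j i`. The
number of rounds can thus be a fixed parameter even if `i` is a working register. -/
theorem run_pow {r : ℕ} {a i b : NatExpr} (hr : r ≠ 8) (ha : r ∉ a.vars ∧ 8 ∉ a.vars)
    (hi : r ∉ i.vars ∧ 8 ∉ i.vars) (hb : r ∉ b.vars) {S : Machine F}
    (hib : i.val S.nat ≤ b.val S.nat) :
    ((pow r a i b).run O S).nat r = a.val S.nat ^ i.val S.nat := by
  set S1 := (setNat r (.const 1)).run O S with hS1
  have hrun : (pow r a i b).run O S =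
    (loop 8 b (ite (.lt (.var 8) i) (setNat r (.var r * a)) skip)).run O S1 := rfl
  have h1 : ∀ y, S1.nat y = if y = r then 1 else S.nat y := fun y => rfl
  have hv : ∀ e : NatExpr, r ∉ e.vars → e.val S1.nat = e.val S.nat := fun e he =>
    NatExpr.val_congr fun x hx => by simp [h1, ne_of_mem_of_not_mem hx he]
  rw [hrun]
  have key := run_loop_frame (O := O) (x := 8) (e := b) (S := S1)
    (p := ite (.lt (.var 8) i) (setNat r (.var r * a)) skip)
    (fun j ρ _ => ρ r = a.val S.nat ^ min j (i.val S.nat))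
    (by simp [h1]) (by
      intro j ρ _ z h
      simpa [hr] using h)
    (by
      intro j _ S' h2 h8 hF
      have hv' : ∀ e : NatExpr, (r ∉ e.vars ∧ 8 ∉ e.vars) → e.val S'.nat = e.val S.nat := by
        intro e he
        rw [← hv e he.1]
        refine NatExpr.val_congr fun x hx => hF.1 x ?_
        simp only [regs, List.append_nil, List.mem_cons, List.not_mem_nil, or_false, not_or]
        exact ⟨fun h => he.2 (h ▸ hx), fun h => he.1 (h ▸ hx)⟩
      by_cases hlt : S'.nat 8 < i.val S'.nat
      · rw [run_ite_pos (by exact hlt)]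
        rw [hv' i hi, h8] at hlt
        simp only [run_setNat_nat, NatExpr.val_hMul, NatExpr.val_var, Machine.tick_nat, if_true,
          hv' a ha, h2]
        rw [min_eq_left hlt.le, min_eq_left hlt, pow_succ]
      · rw [run_ite_neg (by exact hlt)]
        rw [hv' i hi, h8] at hlt
        change S'.nat r = _
        rw [h2, min_eq_right (by omega), min_eq_right (by omega)])
  rw [hv b hb, min_eq_right hib] at key
  exact key

theorem run_sum {c : NatExpr} {prep : Program} {e : FieldExpr} (hprep : prep.arrs = []) {S : Machine F} {val : ℕ → F}
    (hval : ∀ z < c.val S.nat, ∀ S' : Machine F, Frame (12 :: prep.regs) [3] S S' →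
      S'.nat 12 = z → e.val (prep.run O S') = val z) :
    ((sum c prep e).run O S).field 3 0 0 = ∑ z ∈ Finset.range (c.val S.nat), val z := by
  set S1 := (setField 3 (.const 0) (.const 0) .zero).run O S with hS1
  have h1 : Frame [] [3] S S1 :=
    run_frame (setField 3 (.const 0) (.const 0) .zero) S
  have key := run_loop_frame (O := O) (x := 12) (e := c) (S := S1)
    (p := seq prep (setField 3 (.const 0) (.const 0) (.get 3 (.const 0) (.const 0) + e)))
    (fun z _ X => X 3 0 0 = ∑ z ∈ Finset.range z, val z)
    (by
      simp only [hS1, run, Machine.tick_field, Machine.writeField_field, NatExpr.val_const]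
      simp [FieldExpr.val]) (fun _ _ _ _ h => h)
    (by
      intro z hz S' h2 h12 hF
      have h := hval z hz S' (by
        refine (h1.trans hF).mono (fun x hx => ?_) (fun x hx => ?_) <;>
          simp [regs, arrs, hprep] at hx ⊢ <;> tauto) h12
      have h3 : (prep.run O S').field 3 = S'.field 3 :=
        run_field_of_notMem (by simp [hprep]) S'
      simp only [run, Machine.tick_field, Machine.writeField_field, NatExpr.val_const,
        FieldExpr.val_hAdd, FieldExpr.val_get, h, h3, h2, Finset.sum_range_succ, and_self,
        if_true])
  exact key

/-- The inner invariant says that earlier rows, and the current row up to column `j`, have their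
final entries. They survive later rounds because sums are accumulated in the array `3`, which
differs from `A`, and `prep` writes no array. -/
theorem run_fill {A : ℕ} {a b c : NatExpr} {prep : Program} {e : FieldExpr}
    (hprep : prep.arrs = []) (hA : A ≠ 3)
    (hregs : ∀ x ∈ 10 :: 11 :: 12 :: (b.vars ++ c.vars), x ∉ prep.regs)
    (hb : ∀ x ∈ [10, 11, 12], x ∉ b.vars) (hc : ∀ x ∈ [10, 11, 12], x ∉ c.vars)
    {S : Machine F} {val : ℕ → ℕ → ℕ → F}
    (hval : ∀ i < a.val S.nat, ∀ j < b.val S.nat, ∀ z < c.val S.nat, ∀ S' : Machine F,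
      Frame (fill A a b c prep e).regs (fill A a b c prep e).arrs S S' →
      S'.nat 10 = i → S'.nat 11 = j → S'.nat 12 = z → e.val (prep.run O S') = val i j z)
    {i j : ℕ} (hi : i < a.val S.nat) (hj : j < b.val S.nat) :
    ((fill A a b c prep e).run O S).field A i j =
      ∑ z ∈ Finset.range (c.val S.nat), val i j z := by
  have hregs' : ∀ x ∈ b.vars ++ c.vars, x ∉ 10 :: 11 :: 12 :: prep.regs := by
    intro x hx
    have h1 := hregs x (by simp [List.mem_append.mp hx])
    simp only [List.mem_cons, List.not_mem_nil, or_false, forall_eq_or_imp, forall_eq] at hb hc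
    simp only [List.mem_cons, not_or]
    rcases List.mem_append.mp hx with hx | hx <;>
    · refine ⟨?_, ?_, ?_, h1⟩ <;> (rintro rfl; tauto)
  have key := run_loop_frame (O := O) (x := 10) (e := a) (S := S)
    (p := loop 11 b (seq (sum c prep e)
      (setField A (.var 10) (.var 11) (.get 3 (.const 0) (.const 0)))))
    (fun i _ X => ∀ i' < i, ∀ j' < b.val S.nat, X A i' j' =
      ∑ z ∈ Finset.range (c.val S.nat), val i' j' z)
    (fun i' hi' => absurd hi' (Nat.not_lt_zero _)) (fun _ _ _ _ h => h)
    (by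
      intro i hi S1 h1 h10 hF1
      have hF1' : Frame (fill A a b c prep e).regs (fill A a b c prep e).arrs S S1 := hF1
      have hb1 : b.val S1.nat = b.val S.nat := NatExpr.val_congr fun x hx => hF1.1 x (by
        have := hregs' x (by simp [hx])
        simpa [regs, sum] using this)
      have key := run_loop_frame (O := O) (x := 11) (e := b) (S := S1)
        (p := seq (sum c prep e) (setField A (.var 10) (.var 11) (.get 3 (.const 0) (.const 0))))
        (fun j _ X => ∀ i' < i + 1, ∀ j' < b.val S.nat, (i' < i ∨ j' < j) → X A i' j' =
          ∑ z ∈ Finset.range (c.val S.nat), val i' j' z)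
        (fun i' _ j' hj' h => h1 i' (by omega) j' hj') (fun _ _ _ _ h => h)
        (by
          intro j hj S2 h2 h11 hF2
          rw [hb1] at hj
          have hF2' : Frame (fill A a b c prep e).regs (fill A a b c prep e).arrs S S2 :=
            by
            refine (hF1.trans hF2).mono (fun x hx => ?_) (fun x hx => ?_) <;>
            · simp [fill, sum, regs, arrs] at hx ⊢
              tauto
          have hc2 : c.val S2.nat = c.val S.nat := NatExpr.val_congr fun x hx => hF2'.1 x (by
            have := hregs' x (by simp [hx])
            simpa [regs, sum, fill] using this)
          have h10' : S2.nat 10 = i := by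
            rw [hF2.1 10 ?_, h10]
            have := hregs 10 (by simp)
            simp [regs, sum, this]
          have hsum := run_sum (O := O) (c := c) hprep (S := S2) (val := val i j) (by
            intro z hz S3 hF3 h12
            refine hval i hi j hj z (hc2 ▸ hz) S3
              ((hF2'.trans hF3).mono (fun x hx => ?_) (fun x hx => ?_)) ?_ ?_ h12
            · simp [fill, sum, regs] at hx ⊢
              tauto
            · simp [fill, sum, arrs, hprep] at hx ⊢
              tauto
            · rw [hF3.1 10 ?_, h10']
              have := hregs 10 (by simp)
              simp [this]
            · rw [hF3.1 11 ?_, h11]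
              have := hregs 11 (by simp)
              simp [this])
          rw [hc2] at hsum
          set S3 := (sum c prep e).run O S2 with hS3
          have hF3 : Frame (sum c prep e).regs (sum c prep e).arrs S2 S3 := run_frame _ _
          have h10'' : S3.nat 10 = i := by
            rw [hF3.1 10 ?_, h10']
            have := hregs 10 (by simp)
            simp [regs, sum, this]
          have h11'' : S3.nat 11 = j := by
            rw [hF3.1 11 ?_, h11]
            have := hregs 11 (by simp)
            simp [regs, sum, this]
          have hA3 : S3.field A = S2.field A := hF3.2 A (by simp [sum, arrs, hprep, hA])
          intro i' hi' j' hj' hij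
          simp only [run_seq, ← hS3]
          simp only [run, Machine.tick_field, Machine.writeField_field, FieldExpr.val_get,
            NatExpr.val_const, NatExpr.val_var, h10'', h11'', hsum, true_and]
          split_ifs with h
          · rw [h.1, h.2]
          · rw [hA3]
            exact h2 i' hi' j' hj' (by omega))
      intro i' hi' j' hj'
      exact key i' hi' j' hj' (Or.inr (hb1 ▸ hj')))
  exact key i hi j hj

end TensorDecomp
end

/-! ### Selection, checks and oracle calls as programs -/

noncomputable section
namespace TensorDecomp

open Program

variable {F : Type*} [RCLike F] {O : DiagOracle F}

/-- After `i` rounds the counter is the number of indices below `i` satisfying `p`, so the index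
written next goes to the row of its rank. Rows never reached keep the initial value zero; later sums
over a fixed range rely on this. -/
theorem run_select {A x : ℕ} {a b : NatExpr} {t : Test} {e : FieldExpr} (hx : x ∉ [10, 11])
    (ha : x ∉ a.vars) (hb : ∀ y ∈ [x, 10, 11], y ∉ b.vars) {S : Machine F}
    (hS : ∀ i j, S.field A i j = 0) {p : ℕ → Prop} [DecidablePred p] {val : ℕ → ℕ → F}
    (ht : ∀ i < a.val S.nat, ∀ S' : Machine F,
      Frame (select A x a b t e).regs (select A x a b t e).arrs S S' →
      S'.nat 10 = i → (t.Holds S' ↔ p i))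
    (hval : ∀ i < a.val S.nat, p i → ∀ j < b.val S.nat, ∀ S' : Machine F,
      Frame (select A x a b t e).regs (select A x a b t e).arrs S S' →
      S'.nat 10 = i → S'.nat 11 = j → e.val S' = val i j) :
    ((select A x a b t e).run O S).nat x = Nat.count p (a.val S.nat) ∧
      ∀ i j, ((select A x a b t e).run O S).field A i j =
        if i < Nat.count p (a.val S.nat) ∧ j < b.val S.nat then val (Nat.nth p i) j else 0 := by
  simp only [List.mem_cons, List.not_mem_nil, or_false, not_or, forall_eq_or_imp, forall_eq]
    at hx hb
  set S1 := (setNat x (.const 0)).run O S with hS1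
  have h1 : Frame [x] [] S S1 := run_frame (setNat x (.const 0)) S
  have ha1 : a.val S1.nat = a.val S.nat := NatExpr.val_congr fun y hy => h1.1 y (by
    simpa using ne_of_mem_of_not_mem hy ha)
  have hx1 : S1.nat x = 0 := by simp [hS1, run_setNat_nat]
  have key := run_loop_frame (O := O) (x := 10) (e := a) (S := S1)
    (p := ite t
      (seq (loop 11 b (setField A (.var x) (.var 11) e)) (setNat x (.var x + .const 1))) skip)
    (fun i ρ X => ρ x = Nat.count p i ∧ ∀ i' j, X A i' j =
      if i' < Nat.count p i ∧ j < b.val S.nat then val (Nat.nth p i') j else 0)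
    ⟨by simpa using hx1, fun i j => by
      rw [h1.2 A (by simp)]
      simpa using hS i j⟩
    (fun i ρ X j h => ⟨by simpa [hx.1] using h.1, h.2⟩)
    (by
      intro i hi S2 ⟨h2, h3⟩ h10 hF
      rw [ha1] at hi
      have hF2 : Frame (select A x a b t e).regs (select A x a b t e).arrs S S2 := by
        refine (h1.trans hF).mono (fun y hy => ?_) (fun y hy => ?_) <;>
        · simp [select, regs, arrs] at hy ⊢
          tauto
      by_cases hp : p i
      · rw [run_ite_pos ((ht i hi S2 hF2 h10).mpr hp)]
        have hb2 : b.val S2.nat = b.val S.nat := NatExpr.val_congr fun y hy => hF2.1 y (by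
          have h1 := ne_of_mem_of_not_mem hy hb.1
          have h2 := ne_of_mem_of_not_mem hy hb.2.1
          have h3 := ne_of_mem_of_not_mem hy hb.2.2
          simp [select, regs, h1, h2, h3])
        have key := run_loop_frame (O := O) (x := 11) (e := b) (S := S2.tick t.cost)
          (p := setField A (.var x) (.var 11) e)
          (fun j _ X => ∀ i' j', X A i' j' =
            if (i' < Nat.count p i ∧ j' < b.val S.nat) ∨ (i' = Nat.count p i ∧ j' < j) then
              val (Nat.nth p i') j' else 0)
          (by simpa using h3) (fun _ _ _ _ h => h)
          (by
            intro j hj S3 h4 h11 hF3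
            rw [Machine.tick_nat, hb2] at hj
            have hF3' : Frame (select A x a b t e).regs (select A x a b t e).arrs S S3 := by
              refine (hF2.trans (show Frame [11] [A] S2 S3 from hF3)).mono (fun y hy => ?_)
                (fun y hy => ?_) <;>
              · simp [select, regs, arrs] at hy ⊢
                tauto
            have h10' : S3.nat 10 = i := by
              rw [hF3.1 10 (by simp [regs])]
              exact h10
            have hx3 : S3.nat x = Nat.count p i := by
              rw [hF3.1 x (by simp [regs, hx.2])]
              exact h2
            intro i' j'
            simp only [run, Machine.tick_field, Machine.writeField_field, NatExpr.val_var, true_and,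
              hx3, h11, hval i hi hp j hj S3 hF3' h10' h11, h4]
            by_cases hij : i' = Nat.count p i ∧ j' = j
            · rw [if_pos hij, if_pos (by omega), hij.1, hij.2, Nat.nth_count hp]
            · rw [if_neg hij]
              refine if_congr ?_ rfl rfl
              omega)
        rw [Machine.tick_nat, hb2] at key
        have hx4 : ((loop 11 b (setField A (.var x) (.var 11) e)).run O (S2.tick t.cost)).nat x =
            Nat.count p i := by
          rw [run_nat_of_notMem (by simp [regs, hx.2])]
          exact h2
        have hc : Nat.count p (i + 1) = Nat.count p i + 1 := by simp [Nat.count_succ, hp]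
        refine ⟨?_, fun i' j' => ?_⟩
        · simp [run_seq, run_setNat_nat, hx4, hc]
        · have := key i' j'
          rw [run_seq]
          refine this.trans (if_congr ?_ rfl rfl)
          rw [hc]
          omega
      · rw [run_ite_neg (mt (ht i hi S2 hF2 h10).mp hp)]
        have hc : Nat.count p (i + 1) = Nat.count p i := by simp [Nat.count_succ, hp]
        rw [hc]
        exact ⟨h2, h3⟩)
  rw [ha1] at key
  exact key

/-- The register starts at `1`, a bad pair resets it to `0`, and nothing sets it again. -/
theorem run_check {x : ℕ} {a b : NatExpr} {prep : Program} {t : Test} (hprep : prep.arrs = [])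
    (hx : x ∉ 10 :: 11 :: prep.regs) (ha : x ∉ a.vars)
    (hb : ∀ y ∈ b.vars, y ∉ x :: 10 :: 11 :: prep.regs) (hp10 : 10 ∉ prep.regs) {S : Machine F}
    {bad : ℕ → ℕ → Prop}
    (ht : ∀ i < a.val S.nat, ∀ j < b.val S.nat, ∀ S' : Machine F,
      Frame (check x a b prep t).regs (check x a b prep t).arrs S S' →
      S'.nat 10 = i → S'.nat 11 = j → (t.Holds (prep.run O S') ↔ bad i j)) :
    ((check x a b prep t).run O S).nat x ≠ 0 ↔
      ∀ i < a.val S.nat, ∀ j < b.val S.nat, ¬ bad i j := by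
  have hx' := hx
  simp only [List.mem_cons, not_or] at hx'
  set S1 := (setNat x (.const 1)).run O S with hS1
  have h1 : Frame [x] [] S S1 := run_frame (setNat x (.const 1)) S
  have ha1 : a.val S1.nat = a.val S.nat := NatExpr.val_congr fun y hy => h1.1 y (by
    simpa using ne_of_mem_of_not_mem hy ha)
  have hx1 : S1.nat x = 1 := by simp [hS1, run_setNat_nat]
  have key := run_loop_frame (O := O) (x := 10) (e := a) (S := S1)
    (p := loop 11 b (seq prep (ite t (setNat x (.const 0)) skip)))
    (fun i ρ _ => ρ x ≠ 0 ↔ ∀ i' < i, ∀ j < b.val S.nat, ¬ bad i' j)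
    (by simp [hx1]) (fun i ρ X j h => by simpa [hx'.1] using h)
    (by
      intro i hi S2 h2 h10 hF
      rw [ha1] at hi
      have hF2 : Frame (check x a b prep t).regs (check x a b prep t).arrs S S2 := by
        refine (h1.trans hF).mono (fun y hy => ?_) (fun y hy => ?_) <;>
        · simp [check, regs, arrs, hprep] at hy ⊢
          try tauto
      have hb2 : b.val S2.nat = b.val S.nat := NatExpr.val_congr fun y hy => hF2.1 y (by
        have := hb y hy
        simp only [List.mem_cons, not_or] at this
        simp [check, regs, this])
      have key := run_loop_frame (O := O) (x := 11) (e := b) (S := S2)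
        (p := seq prep (ite t (setNat x (.const 0)) skip))
        (fun j ρ _ => ρ x ≠ 0 ↔ (∀ i' < i, ∀ j < b.val S.nat, ¬ bad i' j) ∧
          ∀ j' < j, ¬ bad i j')
        (by simpa using h2) (fun i ρ X j h => by simpa [hx'.2.1] using h)
        (by
          intro j hj S3 h3 h11 hF3
          rw [hb2] at hj
          have hF3' : Frame (check x a b prep t).regs (check x a b prep t).arrs S S3 := by
            refine (hF2.trans hF3).mono (fun y hy => ?_) (fun y hy => ?_) <;>
            · simp [check, regs, arrs, hprep] at hy ⊢
              try tauto
          have h10' : S3.nat 10 = i := by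
            rw [hF3.1 10 (by simp [regs, hp10, Ne.symm hx'.1])]
            exact h10
          have hx4 : (prep.run O S3).nat x = S3.nat x := run_nat_of_notMem hx'.2.2 S3
          have hh := ht i hi j hj S3 hF3' h10' h11
          rw [run_seq]
          by_cases hbad : bad i j
          · rw [run_ite_pos (hh.mpr hbad)]
            simp only [run_setNat_nat, if_true, NatExpr.val_const, ne_eq, not_true, false_iff,
              not_and]
            exact fun _ h => h j (Nat.lt_succ_self j) hbad
          · rw [run_ite_neg (mt hh.mp hbad)]
            change (prep.run O S3).nat x ≠ 0 ↔ _
            rw [hx4, h3]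
            refine and_congr_right fun _ => ⟨fun h j' hj' => ?_, fun h j' hj' => h j' (by omega)⟩
            rcases Nat.lt_succ_iff_lt_or_eq.mp hj' with hj' | rfl
            · exact h j' hj'
            · exact hbad)
      rw [hb2] at key
      rw [key]
      refine ⟨fun h i' hi' => ?_, fun h => ⟨fun i' hi' => h i' (by omega), h i (by omega)⟩⟩
      rcases Nat.lt_succ_iff_lt_or_eq.mp hi' with hi' | rfl
      · exact h.1 i' hi'
      · exact h.2)
  rw [ha1] at key
  exact key

/-- The `a × b` block of an array. -/
def block (X : ℕ → ℕ → F) (a b : ℕ) : Matrix (Fin a) (Fin b) F := fun i j => X i j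

theorem run_diag (hO : O.IsCorrect) {A E V x : ℕ} {k : NatExpr} (hEV : E ≠ V) (S : Machine F)
    {K : ℕ} (hK : k.val S.nat = K) :
    (((diag A k E V x).run O S).nat x ≠ 0 ↔ ∃ (d : Fin K → F) (W : Matrix (Fin K) (Fin K) F),
      IsUnit W ∧ block (S.field A) K K * W = W * Matrix.diagonal d) ∧
    (((diag A k E V x).run O S).nat x ≠ 0 →
      IsUnit (block (((diag A k E V x).run O S).field V) K K) ∧
      block (S.field A) K K * block (((diag A k E V x).run O S).field V) K K =
        block (((diag A k E V x).run O S).field V) K K *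
          Matrix.diagonal fun j : Fin K => ((diag A k E V x).run O S).field E 0 j) := by
  subst hK
  obtain ⟨h1, h2⟩ := hO _ (block (S.field A) (k.val S.nat) (k.val S.nat))
  have hM : (fun i j => (S.tick k.cost).field A i j : Matrix (Fin (k.val S.nat)) (Fin (k.val S.nat)) F) =
    block (S.field A) (k.val S.nat) (k.val S.nat) := rfl
  simp only [run, Machine.callDiag]
  rw [hM]
  cases h : O (k.val S.nat) (block (S.field A) (k.val S.nat) (k.val S.nat)) with
  | none => simpa using h2 h
  | some dW =>
    obtain ⟨d, W⟩ := dW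
    have h3 := h1 d W h
    simp only [if_true, ne_eq, one_ne_zero, not_false_eq_true, true_iff, forall_const]
    refine ⟨⟨d, W, h3⟩, ?_⟩
    convert h3 using 2
    · ext i j
      simp [block]
    · congr 1
      ext i j
      simp [block]
    · congr 1
      · ext i j
        simp [block]
      · congr 1
        ext j
        simp [hEV]

end TensorDecomp
end

noncomputable section
namespace TensorDecomp

/-! ### Kernels and linear systems by diagonalization of Hermitian matrices -/

theorem exists_of_lt_count {p : ℕ → Prop} [DecidablePred p] {b t : ℕ} (h : t < Nat.count p b) :
    ∃ j < b, p j ∧ Nat.count p j = t ∧ Nat.nth p t = j := by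
  induction b with
  | zero => simp at h
  | succ b ih =>
    by_cases ht : t < Nat.count p b
    · obtain ⟨j, hj, h⟩ := ih ht
      exact ⟨j, by omega, h⟩
    · have hb : p b := by
        by_contra hb
        simp [Nat.count_succ, hb] at h
        exact ht h
      have : t = Nat.count p b := by
        simp [Nat.count_succ, hb] at h
        omega
      subst this
      exact ⟨b, by omega, hb, rfl, Nat.nth_count hb⟩

theorem sum_range_count {M : Type*} [AddCommMonoid M] (p : ℕ → Prop) [DecidablePred p]
    (f : ℕ → M) (b : ℕ) :
    ∑ t ∈ Finset.range (Nat.count p b), f (Nat.nth p t) =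
      ∑ j ∈ Finset.range b, if p j then f j else 0 := by
  induction b with
  | zero => simp
  | succ b ih =>
    rw [Finset.sum_range_succ, ← ih, Nat.count_succ]
    split_ifs with h
    · rw [Finset.sum_range_succ, Nat.nth_count h]
    · simp

theorem sum_range_mul {M : Type*} [AddCommMonoid M] (f : ℕ → M) (a b : ℕ) :
    ∑ j ∈ Finset.range (a * b), f j =
      ∑ i ∈ Finset.range a, ∑ j ∈ Finset.range b, f (i * b + j) := by
  induction a with
  | zero => simp
  | succ a ih =>
    rw [Finset.sum_range_succ, ← ih, add_mul, one_mul, Finset.sum_range_add]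

variable {F : Type*} [RCLike F]

theorem block_mulVec_apply (X : ℕ → ℕ → F) (a b : ℕ) (x : ℕ → F) (i : Fin a) :
    (block X a b *ᵥ fun j : Fin b => x j) i = ∑ j ∈ Finset.range b, X i j * x j := by
  rw [Finset.sum_range]
  rfl

/-- By the spectral theorem a correct oracle cannot decline a Hermitian matrix. -/
theorem exists_diagonalization {n : Type*} [Fintype n] [DecidableEq n] {A : Matrix n n F}
    (hA : A.IsHermitian) :
    ∃ (d : n → F) (W : Matrix n n F), IsUnit W ∧ A * W = W * Matrix.diagonal d := by
  refine ⟨fun i => (hA.eigenvalues i : F), hA.eigenvectorUnitary, ?_, ?_⟩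
  · exact ⟨Unitary.toUnits hA.eigenvectorUnitary, rfl⟩
  · ext i j
    have h := congrFun (hA.mulVec_eigenvectorBasis j) i
    rw [Matrix.mul_diagonal]
    have h1 : (A * (hA.eigenvectorUnitary : Matrix n n F)) i j =
      (A *ᵥ ⇑(hA.eigenvectorBasis j)) i := rfl
    rw [h1, h, mul_comm]
    simp [RCLike.real_smul_eq_coe_mul]

/-- The first `s` rows of `P` are a basis of the kernel of the `a × b` block of `L`, and the other
rows vanish. -/
structure IsKernelBasis (L : ℕ → ℕ → F) (a b : ℕ) (P : ℕ → ℕ → F) (s : ℕ) : Prop where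
  indep : ∀ c : ℕ → F, (∀ j < b, ∑ t ∈ Finset.range s, c t * P t j = 0) → ∀ t < s, c t = 0
  span : ∀ x : ℕ → F, (∀ i < a, ∑ j ∈ Finset.range b, L i j * x j = 0) →
    ∃ c : ℕ → F, ∀ j < b, x j = ∑ t ∈ Finset.range s, c t * P t j
  mem : ∀ t, ∀ i < a, ∑ j ∈ Finset.range b, L i j * P t j = 0
  zero : ∀ t j, s ≤ t → P t j = 0

theorem isUnit_block_iff_sum {W : ℕ → ℕ → F} {b : ℕ} (hW : IsUnit (block W b b)) :
    (∀ y : ℕ → F, (∀ i < b, ∑ j ∈ Finset.range b, W i j * y j = 0) → ∀ j < b, y j = 0) ∧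
    ∀ x : ℕ → F, ∃ y : ℕ → F, ∀ i < b, x i = ∑ j ∈ Finset.range b, W i j * y j := by
  constructor
  · intro y hy j hj
    have h : block W b b *ᵥ (fun j : Fin b => y j) = block W b b *ᵥ 0 := by
      ext i
      rw [block_mulVec_apply, hy i i.2, Matrix.mulVec_zero]
      rfl
    exact congrFun (Matrix.mulVec_injective_iff_isUnit.mpr hW h) ⟨j, hj⟩
  · intro x
    obtain ⟨y, hy⟩ := Matrix.mulVec_surjective_iff_isUnit.mpr hW fun i : Fin b => x i
    refine ⟨fun j => if h : j < b then y ⟨j, h⟩ else 0, fun i hi => ?_⟩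
    have := congrFun hy ⟨i, hi⟩
    rw [← this, Finset.sum_range]
    simp [Matrix.mulVec, dotProduct, block]

-- The kernels of `L` and of `LᴴL` coincide. In any eigenvector basis of the latter, orthogonal or
-- not, the columns for the eigenvalue zero form a basis of the kernel.
open scoped ComplexOrder in
theorem IsKernelBasis.of_diagonalization {L G W P : ℕ → ℕ → F} {d : ℕ → F} {a b s : ℕ}
    (hG : ∀ i < b, ∀ j < b, G i j = ∑ z ∈ Finset.range a, star (L z i) * L z j)
    (hW : IsUnit (block W b b))
    (hd : block G b b * block W b b = block W b b * Matrix.diagonal fun j : Fin b => d j)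
    [DecidablePred fun j => d j = 0] (hs : s = Nat.count (fun j => d j = 0) b)
    (hP : ∀ i j, P i j = if i < s ∧ j < b then W j (Nat.nth (fun j => d j = 0) i) else 0) :
    IsKernelBasis L a b P s := by
  have hGL : block G b b = (block L a b)ᴴ * block L a b := by
    ext i j
    rw [Matrix.mul_apply]
    change G i j = _
    rw [hG i i.2 j j.2, Finset.sum_range]
    rfl
  have hker : ∀ x : ℕ → F, (∀ i < a, ∑ j ∈ Finset.range b, L i j * x j = 0) ↔
      block G b b *ᵥ (fun j : Fin b => x j) = 0 := by
    intro x
    rw [hGL, Matrix.conjTranspose_mul_self_mulVec_eq_zero]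
    constructor
    · intro h
      ext i
      rw [block_mulVec_apply, h i i.2]
      rfl
    · intro h i hi
      rw [← block_mulVec_apply L a b x ⟨i, hi⟩, h]
      rfl
  have hWd : ∀ y : ℕ → F, block G b b *ᵥ (block W b b *ᵥ fun j : Fin b => y j) =
      block W b b *ᵥ fun j : Fin b => d j * y j := by
    intro y
    rw [Matrix.mulVec_mulVec, hd, ← Matrix.mulVec_mulVec]
    congr 1
    ext j
    rw [Matrix.mulVec_diagonal]
  -- A combination of the selected rows is `W` applied to a vector supported on the zero
  -- eigenvalues; this transports statements about selected rows to the invertible matrix `W`.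
  have hsum : ∀ (c : ℕ → F) (j : ℕ), j < b → ∑ t ∈ Finset.range s, c t * P t j =
      ∑ i ∈ Finset.range b, W j i * if d i = 0 then c (Nat.count (fun j => d j = 0) i) else 0 := by
    intro c j hj
    have h := sum_range_count (fun j => d j = 0)
      (fun i => W j i * c (Nat.count (fun j => d j = 0) i)) b
    rw [← hs] at h
    simp only [mul_ite, mul_zero]
    rw [← h]
    refine Finset.sum_congr rfl fun t ht => ?_
    have ht' := Finset.mem_range.mp ht
    obtain ⟨i, hi, h1, h2, h3⟩ := exists_of_lt_count (hs ▸ ht')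
    rw [hP, if_pos ⟨ht', hj⟩, h3, h2, mul_comm]
  obtain ⟨hinj, hsurj⟩ := isUnit_block_iff_sum hW
  refine ⟨fun c hc t ht => ?_, fun x hx => ?_, fun t => ?_, fun t j ht => ?_⟩
  · obtain ⟨i, hi, h1, h2, h3⟩ := exists_of_lt_count (hs ▸ ht)
    have := hinj _ (fun j hj => (hsum c j hj).symm.trans (hc j hj)) i hi
    rwa [if_pos h1, h2] at this
  · obtain ⟨y, hy⟩ := hsurj x
    have hx' : (fun j : Fin b => x j) = block W b b *ᵥ fun j : Fin b => y j := by
      ext i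
      rw [block_mulVec_apply, hy i i.2]
    rw [hker, hx', hWd] at hx
    -- For `x = W y` in the kernel all `d j * y j` vanish, so `y` is supported on the zero
    -- eigenvalues.
    have h0 := hinj (fun j => d j * y j) fun i hi => by
      rw [← block_mulVec_apply W b b _ ⟨i, hi⟩, hx]
      rfl
    refine ⟨fun t => y (Nat.nth (fun j => d j = 0) t), fun j hj => ?_⟩
    rw [hsum _ j hj, hy j hj]
    refine Finset.sum_congr rfl fun i hi => ?_
    split_ifs with h
    · rw [Nat.nth_count h]
    · rw [(mul_eq_zero.mp (h0 i (Finset.mem_range.mp hi))).resolve_left h]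
  · rw [hker]
    by_cases ht : t < s
    · obtain ⟨i, hi, h1, h2, h3⟩ := exists_of_lt_count (hs ▸ ht)
      have : (fun j : Fin b => P t j) = block W b b *ᵥ fun j : Fin b => if (j : ℕ) = i then 1 else 0 := by
        ext j
        rw [block_mulVec_apply W b b (fun j => if j = i then 1 else 0), hP, if_pos ⟨ht, j.2⟩, h3]
        simp [hi]
      rw [this, hWd (fun j => if j = i then 1 else 0)]
      convert Matrix.mulVec_zero (block W b b) using 2
      ext j
      by_cases hj : (j : ℕ) = i <;> simp [hj, h1]
    · convert Matrix.mulVec_zero (block G b b) using 2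
      ext j
      rw [hP, if_neg (by omega)]
      rfl
  · rw [hP, if_neg (by omega)]

theorem isHermitian_block {L G : ℕ → ℕ → F} {a b : ℕ}
    (hG : ∀ i < b, ∀ j < b, G i j = ∑ z ∈ Finset.range a, star (L z i) * L z j) :
    (block G b b).IsHermitian := by
  ext i j
  change star (G j i) = G i j
  rw [hG _ i.2 _ j.2, hG _ j.2 _ i.2]
  simp [mul_comm]

/-- The coefficients of the linear system `X A = t B`, `K X = 0`. -/
def systemCoeff (A B K : ℕ → ℕ → F) (N x y : ℕ) : F :=
  if x / (N * N) = 0 then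
    if y = N * N then - B (x / N) (x % N)
    else if x / N = y / N then A (y % N) (x % N) else 0
  else if y = N * N then 0 else if x % N = y % N then K (x % (N * N) / N) (y / N) else 0

/-- The unknown number `i * N + j` is the entry `(i, j)` of `X`, and the last unknown, number `N *
N`, is `t`. The first `N * N` equations are the entries of `X A - t B`, the following `N * N` those
of `K X`. -/
theorem systemCoeff_sum {A B K : ℕ → ℕ → F} {N : ℕ} (X : ℕ → F) {r c : ℕ} (hr : r < N)
    (hc : c < N) :
    ∑ y ∈ Finset.range (N * N + 1), systemCoeff A B K N (r * N + c) y * X y =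
      ∑ z ∈ Finset.range N, X (r * N + z) * A z c - X (N * N) * B r c ∧
    ∑ y ∈ Finset.range (N * N + 1), systemCoeff A B K N (N * N + (r * N + c)) y * X y =
      ∑ z ∈ Finset.range N, K r z * X (z * N + c) := by
  have hN : 0 < N := by omega
  have hlt : r * N + c < N * N := by nlinarith
  have h1 : (r * N + c) / (N * N) = 0 := Nat.div_eq_of_lt hlt
  have h2 : (N * N + (r * N + c)) / (N * N) = 1 := by
    rw [Nat.add_div_left _ (by positivity), h1]
  have h3 : (N * N + (r * N + c)) % (N * N) = r * N + c := by
    rw [Nat.add_mod_left, Nat.mod_eq_of_lt hlt]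
  have h4 : ∀ i j, j < N → (i * N + j) / N = i := fun i j hj => by
    rw [mul_comm, Nat.mul_add_div hN, Nat.div_eq_of_lt hj, add_zero]
  have h5 : ∀ i j, j < N → (i * N + j) % N = j := fun i j hj => by
    rw [mul_comm, Nat.mul_add_mod, Nat.mod_eq_of_lt hj]
  have h6 : (N * N + (r * N + c)) % N = c := by
    rw [← add_assoc, ← add_mul, h5 _ _ hc]
  have h7 : ∀ i < N, ∀ j < N, i * N + j ≠ N * N := fun i hi j hj => by nlinarith
  rw [Finset.sum_range_succ, Finset.sum_range_succ, sum_range_mul, sum_range_mul]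
  constructor
  · have : systemCoeff A B K N (r * N + c) (N * N) = - B r c := by
      simp [systemCoeff, h1, h4, h5, hc]
    rw [this, Finset.sum_eq_single_of_mem r (Finset.mem_range.mpr hr)]
    · rw [sub_eq_add_neg]
      congr 1
      · refine Finset.sum_congr rfl fun z hz => ?_
        have hz' := Finset.mem_range.mp hz
        rw [mul_comm (X _)]
        simp [systemCoeff, h1, h4, h5, hc, hz', h7 r hr z hz']
      · ring
    · intro i hi hir
      refine Finset.sum_eq_zero fun z hz => ?_
      have hz' := Finset.mem_range.mp hz
      have hi' := Finset.mem_range.mp hi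
      simp [systemCoeff, h1, h4, hc, hz', h7 i hi' z hz', Ne.symm hir]
  · have : systemCoeff A B K N (N * N + (r * N + c)) (N * N) = 0 := by
      simp [systemCoeff, h2]
    rw [this, zero_mul, add_zero]
    refine Finset.sum_congr rfl fun i hi => ?_
    have hi' := Finset.mem_range.mp hi
    rw [Finset.sum_eq_single_of_mem c (Finset.mem_range.mpr hc)]
    · simp [systemCoeff, h2, h3, h4, h5, h6, hc, h7 i hi' c hc]
    · intro z hz hzc
      have hz' := Finset.mem_range.mp hz
      simp [systemCoeff, h2, h5, h6, hz', h7 i hi' z hz', Ne.symm hzc]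

/-- Solutions of `X A = B`, `K X = 0` from the kernel of the homogenized system. -/
theorem system_solution {A B K L Q D X : ℕ → ℕ → F} {N s : ℕ}
    (hL : ∀ x < 2 * (N * N), ∀ y < N * N + 1, L x y = systemCoeff A B K N x y)
    (hQ : IsKernelBasis L (2 * (N * N)) (N * N + 1) Q s)
    (hD : D 0 0 = ∑ z ∈ Finset.range (N * N + 1), star (Q z (N * N)) * Q z (N * N))
    (hX : ∀ i < N, ∀ j < N, X i j =
      ∑ z ∈ Finset.range (N * N + 1), star (Q z (N * N)) * Q z (i * N + j) / D 0 0)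
    (hs : s ≤ N * N + 1)
    (hsol : ∃ X₀ : ℕ → ℕ → F,
      (∀ i < N, ∀ j < N, ∑ z ∈ Finset.range N, X₀ i z * A z j = B i j) ∧
      ∀ i < N, ∀ j < N, ∑ z ∈ Finset.range N, K i z * X₀ z j = 0) :
    (∀ i < N, ∀ j < N, ∑ z ∈ Finset.range N, X i z * A z j = B i j) ∧
      ∀ i < N, ∀ j < N, ∑ z ∈ Finset.range N, K i z * X z j = 0 := by
  rcases Nat.eq_zero_or_pos N with rfl | hN
  · simp
  have h4 : ∀ i j, j < N → (i * N + j) / N = i := fun i j hj => by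
    rw [mul_comm, Nat.mul_add_div hN, Nat.div_eq_of_lt hj, add_zero]
  have h5 : ∀ i j, j < N → (i * N + j) % N = j := fun i j hj => by
    rw [mul_comm, Nat.mul_add_mod, Nat.mod_eq_of_lt hj]
  have h7 : ∀ i < N, ∀ j < N, i * N + j < N * N := fun i hi j hj => by nlinarith
  have hsys : ∀ x : ℕ → F, (∀ i < 2 * (N * N), ∑ j ∈ Finset.range (N * N + 1), L i j * x j = 0) ↔
      (∀ i < N, ∀ j < N, ∑ z ∈ Finset.range N, x (i * N + z) * A z j = x (N * N) * B i j) ∧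
      ∀ i < N, ∀ j < N, ∑ z ∈ Finset.range N, K i z * x (z * N + j) = 0 := by
    intro x
    have hLs : ∀ i < 2 * (N * N), ∑ j ∈ Finset.range (N * N + 1), L i j * x j =
        ∑ j ∈ Finset.range (N * N + 1), systemCoeff A B K N i j * x j := fun i hi =>
      Finset.sum_congr rfl fun j hj => by rw [hL i hi j (Finset.mem_range.mp hj)]
    constructor
    · intro h
      refine ⟨fun i hi j hj => ?_, fun i hi j hj => ?_⟩
      · have h8 := h7 i hi j hj
        have := h (i * N + j) (by omega)
        rw [hLs _ (by omega), (systemCoeff_sum x hi hj).1] at this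
        exact sub_eq_zero.mp this
      · have h8 := h7 i hi j hj
        have := h (N * N + (i * N + j)) (by omega)
        rwa [hLs _ (by omega), (systemCoeff_sum x hi hj).2] at this
    · rintro ⟨h8, h9⟩ i hi
      rw [hLs i hi]
      by_cases hiN : i < N * N
      · have e : i = i / N * N + i % N := (Nat.div_add_mod' i N).symm
        have hr : i / N < N := Nat.div_lt_of_lt_mul hiN
        have hc : i % N < N := Nat.mod_lt _ hN
        rw [e, (systemCoeff_sum x hr hc).1, h8 _ hr _ hc, sub_self]
      · obtain ⟨i, rfl⟩ := Nat.exists_eq_add_of_le (not_lt.mp hiN)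
        have hiN : i < N * N := by omega
        have e : i = i / N * N + i % N := (Nat.div_add_mod' i N).symm
        have hr : i / N < N := Nat.div_lt_of_lt_mul hiN
        have hc : i % N < N := Nat.mod_lt _ hN
        rw [e, (systemCoeff_sum x hr hc).2, h9 _ hr _ hc]
  obtain ⟨X₀, h8, h9⟩ := hsol
  -- A solution of the inhomogeneous system is a kernel vector with last coordinate `1`.
  obtain ⟨c, hc⟩ := hQ.span (fun y => if y = N * N then 1 else X₀ (y / N) (y % N)) (by
    rw [hsys]
    refine ⟨fun i hi j hj => ?_, fun i hi j hj => ?_⟩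
    · rw [if_pos rfl, one_mul, ← h8 i hi j hj]
      refine Finset.sum_congr rfl fun z hz => ?_
      have hz' := Finset.mem_range.mp hz
      rw [if_neg (h7 i hi z hz').ne, h4 _ _ hz', h5 _ _ hz']
    · rw [← h9 i hi j hj]
      refine Finset.sum_congr rfl fun z hz => ?_
      have hz' := Finset.mem_range.mp hz
      rw [if_neg (h7 z hz' j hj).ne, h4 _ _ hj, h5 _ _ hj])
  -- `D 0 0` is the sum of the squared absolute values of the last coordinates of the kernel basis.
  -- If it were zero, no kernel vector could have last coordinate `1`. Weighting the basis vectors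
  -- by the conjugates of these coordinates, divided by `D 0 0`, gives last coordinate `1` without a
  -- search for a pivot.
  have hD0 : D 0 0 ≠ 0 := by
    rw [hD]
    intro h
    have h10 : ∀ t < N * N + 1, Q t (N * N) = 0 := by
      have : star (fun z : Fin (N * N + 1) => Q z (N * N)) ⬝ᵥ
          (fun z : Fin (N * N + 1) => Q z (N * N)) = 0 := by
        rw [← h, Finset.sum_range]
        rfl
      exact fun t ht => congrFun (star_dotProduct_self_eq_zero.mp this) ⟨t, ht⟩
    have := hc (N * N) (by omega)
    rw [if_pos rfl, Finset.sum_eq_zero] at this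
    · exact one_ne_zero this
    · intro t ht
      have := Finset.mem_range.mp ht
      rw [h10 t (by omega), mul_zero]
  have hmem := fun t => (hsys (Q t)).mp (hQ.mem t)
  constructor
  · intro i hi j hj
    have : ∀ z ∈ Finset.range N, X i z * A z j = ∑ t ∈ Finset.range (N * N + 1),
        star (Q t (N * N)) / D 0 0 * (Q t (i * N + z) * A z j) := by
      intro z hz
      rw [hX i hi z (Finset.mem_range.mp hz), Finset.sum_mul]
      exact Finset.sum_congr rfl fun t _ => by ring
    rw [Finset.sum_congr rfl this, Finset.sum_comm]
    simp_rw [← Finset.mul_sum, (hmem _).1 i hi j hj]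
    have : ∀ t, star (Q t (N * N)) / D 0 0 * (Q t (N * N) * B i j) =
        (star (Q t (N * N)) * Q t (N * N)) * (B i j / D 0 0) := fun t => by ring
    simp_rw [this]
    rw [← Finset.sum_mul, ← hD, mul_div_cancel₀ _ hD0]
  · intro i hi j hj
    have : ∀ z ∈ Finset.range N, K i z * X z j = ∑ t ∈ Finset.range (N * N + 1),
        star (Q t (N * N)) / D 0 0 * (K i z * Q t (z * N + j)) := by
      intro z hz
      rw [hX z (Finset.mem_range.mp hz) j hj, Finset.mul_sum]
      exact Finset.sum_congr rfl fun t _ => by ring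
    rw [Finset.sum_congr rfl this, Finset.sum_comm]
    simp_rw [← Finset.mul_sum, (hmem _).2 i hi j hj, mul_zero]
    exact Finset.sum_const_zero

end TensorDecomp
end

noncomputable section
namespace TensorDecomp

/-! ### Numbering of multi-indices -/

/-- The number of a multi-index. -/
def idx {n k : ℕ} (c : Fin k → Fin n) : ℕ := (finFunctionFinEquiv c : Fin (n ^ k))

theorem idx_lt {n k : ℕ} (c : Fin k → Fin n) : idx c < n ^ k := (finFunctionFinEquiv c).2

theorem exists_idx_eq {n k j : ℕ} (hj : j < n ^ k) : ∃ c : Fin k → Fin n, idx c = j :=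
  ⟨finFunctionFinEquiv.symm ⟨j, hj⟩, by simp [idx]⟩

theorem sum_idx {M : Type*} [AddCommMonoid M] {n k : ℕ} (f : ℕ → M) :
    ∑ c : Fin k → Fin n, f (idx c) = ∑ j ∈ Finset.range (n ^ k), f j := by
  rw [Finset.sum_range]
  exact finFunctionFinEquiv.sum_comp fun j : Fin (n ^ k) => f j

/-- The digits of the number of a multi-index. -/
def digit {n k : ℕ} (c : Fin k → Fin n) (j : ℕ) : ℕ := if h : j < k then c ⟨j, h⟩ else 0

theorem digit_lt {n k : ℕ} (c : Fin k → Fin n) {j : ℕ} (hj : j < k) : digit c j < n := by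
  rw [digit, dif_pos hj]
  exact (c _).2

theorem idx_eq_sum_digit {n k : ℕ} (c : Fin k → Fin n) :
    idx c = ∑ j ∈ Finset.range k, digit c j * n ^ j := by
  rw [idx, finFunctionFinEquiv_apply, Finset.sum_range]
  simp [digit]

theorem sum_mul_pow_lt {n i : ℕ} {g : ℕ → ℕ} (hg : ∀ j < i, g j < n) :
    ∑ j ∈ Finset.range i, g j * n ^ j < n ^ i := by
  induction i with
  | zero => simp
  | succ i ih =>
    rw [Finset.sum_range_succ, pow_succ, mul_comm (n ^ i)]
    have h1 := ih fun j hj => hg j (by omega)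
    have h2 : (g i + 1) * n ^ i ≤ n * n ^ i := Nat.mul_le_mul_right _ (hg i (by omega))
    rw [add_mul, one_mul] at h2
    omega

theorem idx_split {n k i : ℕ} (c : Fin k → Fin n) (hi : i ≤ k) :
    idx c = ∑ j ∈ Finset.range i, digit c j * n ^ j + ∑ j ∈ Finset.Ico i k, digit c j * n ^ j := by
  rw [idx_eq_sum_digit, Finset.range_eq_Ico, Finset.range_eq_Ico,
    Finset.sum_Ico_consecutive _ (Nat.zero_le i) hi]

theorem idx_mod {n k i : ℕ} (c : Fin k → Fin n) (hi : i ≤ k) :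
    idx c % n ^ i = ∑ j ∈ Finset.range i, digit c j * n ^ j := by
  have h : n ^ i ∣ ∑ j ∈ Finset.Ico i k, digit c j * n ^ j :=
    Finset.dvd_sum fun j hj => (pow_dvd_pow n (Finset.mem_Ico.mp hj).1).mul_left _
  rw [idx_split c hi, Nat.add_mod, Nat.mod_eq_zero_of_dvd h, add_zero, Nat.mod_mod,
    Nat.mod_eq_of_lt (sum_mul_pow_lt fun j hj => digit_lt c (by omega))]

/-- Replace the lower digits of `c` by those of `d`. -/
def exchange (q c d : ℕ) : ℕ := c - c % q + d % q

/-- Position `j` has weight `n ^ j`, so the first `i` entries make up the remainder modulo `n ^ i`.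
This is why exchanges of initial segments, and not of arbitrary sets, define invariance. -/
theorem idx_piecewise {n k i : ℕ} (c d : Fin k → Fin n) (hi : i ≤ k) :
    idx (({j : Fin k | (j : ℕ) < i} : Finset (Fin k)).piecewise d c) =
      exchange (n ^ i) (idx c) (idx d) := by
  have h : ∀ j, digit (({j : Fin k | (j : ℕ) < i} : Finset (Fin k)).piecewise d c) j =
      if j < i then digit d j else digit c j := by
    intro j
    by_cases hj : j < k
    · simp only [digit, dif_pos hj, Finset.piecewise, Finset.mem_filter, Finset.mem_univ, true_and]
      split_ifs <;> rfl
    · simp [digit, hj]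
  rw [exchange, idx_mod c hi, idx_mod d hi, idx_split _ hi, idx_split c hi, Nat.add_sub_cancel_left,
    add_comm]
  congr 1
  · refine Finset.sum_congr rfl fun j hj => ?_
    rw [h, if_neg (by have := (Finset.mem_Ico.mp hj).1; omega)]
  · refine Finset.sum_congr rfl fun j hj => ?_
    rw [h, if_pos (Finset.mem_range.mp hj)]

theorem exchange_lt {n k i c d : ℕ} (hi : i ≤ k) (hc : c < n ^ k) (hd : d < n ^ k) :
    exchange (n ^ i) c d < n ^ k := by
  obtain ⟨c, rfl⟩ := exists_idx_eq hc
  obtain ⟨d, rfl⟩ := exists_idx_eq hd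
  rw [← idx_piecewise c d hi]
  exact idx_lt _

theorem idx_joinIdx {n m : ℕ} (a : Fin ((m + 1) / 2) → Fin n) (b : Fin (m / 2) → Fin n) :
    idx (joinIdx a b) = idx a + n ^ ((m + 1) / 2) * idx b := by
  have hm : m = (m + 1) / 2 + m / 2 := by omega
  have h : ∀ j < m, digit (joinIdx a b) j =
      if j < (m + 1) / 2 then digit a j else digit b (j - (m + 1) / 2) := by
    intro j hj
    simp only [digit, dif_pos hj, joinIdx]
    by_cases h : j < (m + 1) / 2
    · rw [dif_pos h, if_pos h, dif_pos h]
    · rw [dif_neg h, if_neg h, dif_pos (by omega)]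
  rw [idx_eq_sum_digit, idx_eq_sum_digit a, idx_eq_sum_digit b, Finset.mul_sum]
  rw [Finset.sum_congr rfl fun j hj => by rw [h j (Finset.mem_range.mp hj)]]
  rw [congrArg Finset.range hm, Finset.sum_range_add]
  congr 1
  · refine Finset.sum_congr rfl fun j hj => ?_
    rw [if_pos (Finset.mem_range.mp hj)]
  · refine Finset.sum_congr rfl fun j hj => ?_
    rw [if_neg (by omega), Nat.add_sub_cancel_left, pow_add]
    ring

theorem prefixInvariant_iff {α : Type*} {n k : ℕ} (M : ℕ → ℕ → α) :
    PrefixInvariant (fun c d : Fin k → Fin n => M (idx c) (idx d)) ↔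
      ∀ i ≤ k, ∀ c < n ^ k, ∀ d < n ^ k,
        M (exchange (n ^ i) c d) (exchange (n ^ i) d c) = M c d := by
  constructor
  · intro h i hi c hc d hd
    obtain ⟨c, rfl⟩ := exists_idx_eq hc
    obtain ⟨d, rfl⟩ := exists_idx_eq hd
    rw [← idx_piecewise c d hi, ← idx_piecewise d c hi]
    refine Eq.trans ?_ (h i c d hi)
    congr 2
  · intro h i c d hi
    refine Eq.trans ?_ (h i hi _ (idx_lt c) _ (idx_lt d))
    rw [← idx_piecewise c d hi, ← idx_piecewise d c hi]

/-! ### The linear systems for the range of a flattening and for the lifted basis -/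

variable {F : Type*} [RCLike F]

/-- The coefficients of the linear system for the lifted basis. -/
def liftCoeff (K : ℕ → ℕ → F) (n k N x y : ℕ) : F :=
  if x / (N * N) = k + 1 then
    if x % (N * N) % N = y % N then K (x % (N * N) / N) (y / N) else 0
  else (if x % (N * N) = y then 1 else 0) -
    if exchange (n ^ (x / (N * N))) (x % (N * N) / N) (x % (N * N) % N) * N +
      exchange (n ^ (x / (N * N))) (x % (N * N) % N) (x % (N * N) / N) = y then 1 else 0

theorem mul_add_div_mod {N : ℕ} (i : ℕ) {j : ℕ} (hj : j < N) :
    (i * N + j) / N = i ∧ (i * N + j) % N = j := by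
  rw [mul_comm i, Nat.mul_add_div (by omega), Nat.div_eq_of_lt hj, add_zero, Nat.mul_add_mod,
    Nat.mod_eq_of_lt hj]
  exact ⟨rfl, rfl⟩

theorem mul_add_lt {N i j M : ℕ} (hi : i < M) (hj : j < N) : i * N + j < M * N := by
  have : (i + 1) * N ≤ M * N := Nat.mul_le_mul_right _ hi
  rw [add_mul, one_mul] at this
  omega

/-- Equations are numbered by a block `i` and a pair `(c, d)`. A block `i ≤ k` compares an entry
with the one after exchanging the first `i` digits; the block `k + 1` says that `K` annihilates the
columns. -/
theorem liftCoeff_sum {K : ℕ → ℕ → F} {n k : ℕ} (x : ℕ → F) {i c d : ℕ} (hi : i ≤ k + 1)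
    (hc : c < n ^ k) (hd : d < n ^ k) :
    ∑ y ∈ Finset.range (n ^ k * n ^ k),
        liftCoeff K n k (n ^ k) (i * (n ^ k * n ^ k) + (c * n ^ k + d)) y * x y =
      if i = k + 1 then ∑ z ∈ Finset.range (n ^ k), K c z * x (z * n ^ k + d)
      else x (c * n ^ k + d) -
        x (exchange (n ^ i) c d * n ^ k + exchange (n ^ i) d c) := by
  have hexc : i ≤ k → exchange (n ^ i) c d * n ^ k + exchange (n ^ i) d c < n ^ k * n ^ k :=
    fun h => mul_add_lt (exchange_lt h hc hd) (exchange_lt h hd hc)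
  have h1 := mul_add_lt hc hd
  obtain ⟨h2, h3⟩ := mul_add_div_mod i h1
  obtain ⟨h4, h5⟩ := mul_add_div_mod c hd
  simp only [liftCoeff, h2, h3, h4, h5]
  by_cases h : i = k + 1
  · simp only [if_pos h]
    rw [sum_range_mul]
    refine Finset.sum_congr rfl fun z _ => ?_
    rw [Finset.sum_eq_single_of_mem d (Finset.mem_range.mpr hd)]
    · obtain ⟨h6, h7⟩ := mul_add_div_mod z hd
      rw [h6, h7, if_pos rfl]
    · intro y hy hyd
      obtain ⟨h6, h7⟩ := mul_add_div_mod z (Finset.mem_range.mp hy)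
      rw [h7, if_neg (Ne.symm hyd), zero_mul]
  · simp only [if_neg h, sub_mul, ite_mul, one_mul, zero_mul, Finset.sum_sub_distrib,
      Finset.sum_ite_eq, Finset.mem_range]
    rw [if_pos h1, if_pos (hexc (by omega))]

theorem liftCoeff_iff {L K : ℕ → ℕ → F} {n k : ℕ}
    (hL : ∀ r < (k + 2) * (n ^ k * n ^ k), ∀ y < n ^ k * n ^ k,
      L r y = liftCoeff K n k (n ^ k) r y) (x : ℕ → F) :
    (∀ r < (k + 2) * (n ^ k * n ^ k), ∑ y ∈ Finset.range (n ^ k * n ^ k), L r y * x y = 0) ↔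
      PrefixInvariant (fun c d : Fin k → Fin n => x (idx c * n ^ k + idx d)) ∧
      ∀ c < n ^ k, ∀ d < n ^ k, ∑ z ∈ Finset.range (n ^ k), K c z * x (z * n ^ k + d) = 0 := by
  have hLs : ∀ r < (k + 2) * (n ^ k * n ^ k), ∑ y ∈ Finset.range (n ^ k * n ^ k), L r y * x y =
      ∑ y ∈ Finset.range (n ^ k * n ^ k), liftCoeff K n k (n ^ k) r y * x y := fun r hr =>
    Finset.sum_congr rfl fun y hy => by rw [hL r hr y (Finset.mem_range.mp hy)]
  rw [prefixInvariant_iff (fun c d => x (c * n ^ k + d))]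
  constructor
  · intro h
    have h' : ∀ i ≤ k + 1, ∀ c < n ^ k, ∀ d < n ^ k, _ := fun i hi c hc d hd => by
      have hlt : i * (n ^ k * n ^ k) + (c * n ^ k + d) < (k + 2) * (n ^ k * n ^ k) :=
        mul_add_lt (by omega) (mul_add_lt hc hd)
      have := h _ hlt
      rw [hLs _ hlt, liftCoeff_sum x hi hc hd] at this
      exact this
    refine ⟨fun i hi c hc d hd => ?_, fun c hc d hd => ?_⟩
    · have := h' i (by omega) c hc d hd
      rw [if_neg (by omega)] at this
      exact (sub_eq_zero.mp this).symm
    · have := h' (k + 1) le_rfl c hc d hd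
      rwa [if_pos rfl] at this
  · rintro ⟨h1, h2⟩ r hr
    rw [hLs r hr]
    have hpos : 0 < n ^ k * n ^ k := by
      rcases Nat.eq_zero_or_pos (n ^ k * n ^ k) with h | h
      · rw [h, mul_zero] at hr
        exact absurd hr (Nat.not_lt_zero _)
      · exact h
    have hk : 0 < n ^ k := Nat.pos_of_mul_pos_left hpos
    have hp : r % (n ^ k * n ^ k) < n ^ k * n ^ k := Nat.mod_lt _ hpos
    have hi : r / (n ^ k * n ^ k) < k + 2 := Nat.div_lt_of_lt_mul (by rwa [mul_comm])
    have hc : r % (n ^ k * n ^ k) / n ^ k < n ^ k := Nat.div_lt_of_lt_mul hp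
    have hd : r % (n ^ k * n ^ k) % n ^ k < n ^ k := Nat.mod_lt _ hk
    have e : r = r / (n ^ k * n ^ k) * (n ^ k * n ^ k) +
        (r % (n ^ k * n ^ k) / n ^ k * n ^ k + r % (n ^ k * n ^ k) % n ^ k) := by
      rw [Nat.div_add_mod', Nat.div_add_mod']
    rw [e, liftCoeff_sum x (by omega) hc hd]
    split_ifs with h
    · exact h2 _ hc _ hd
    · rw [h1 _ (by omega) _ hc _ hd, sub_self]

/-- A vector outside the range is separated from it by a functional, which is then a left kernel
vector of `A`. -/
theorem mem_range_mulVecLin_iff {κ τ : Type*} [Fintype κ] [Fintype τ] (A : Matrix κ τ F)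
    (u : κ → F) :
    u ∈ LinearMap.range A.mulVecLin ↔ ∀ y : κ → F, y ᵥ* A = 0 → y ⬝ᵥ u = 0 := by
  classical
  constructor
  · rintro ⟨x, rfl⟩ y hy
    rw [Matrix.mulVecLin_apply, Matrix.dotProduct_mulVec, hy, zero_dotProduct]
  · intro h
    by_contra hu
    obtain ⟨f, hf, hfU⟩ := Submodule.exists_le_ker_of_notMem hu
    have hfy : ∀ x, f x = (fun c => f (Pi.single c 1)) ⬝ᵥ x := by
      intro x
      conv_lhs => rw [← Finset.univ_sum_single x]
      rw [map_sum, dotProduct]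
      refine Finset.sum_congr rfl fun c _ => ?_
      rw [mul_comm, ← smul_eq_mul, ← map_smul, ← Pi.single_smul, smul_eq_mul, mul_one]
    refine hf ?_
    rw [hfy]
    refine h _ ?_
    ext b
    have : f (A *ᵥ Pi.single b 1) = 0 := hfU ⟨Pi.single b 1, rfl⟩
    rw [hfy, Matrix.dotProduct_mulVec, dotProduct_single, mul_one] at this
    exact this

/-- Extension of a function of multi-indices to all numbers. -/
def extend {n k : ℕ} (u : (Fin k → Fin n) → F) (j : ℕ) : F :=
  if h : j < n ^ k then u (finFunctionFinEquiv.symm ⟨j, h⟩) else 0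

theorem extend_idx {n k : ℕ} (u : (Fin k → Fin n) → F) (c : Fin k → Fin n) :
    extend u (idx c) = u c := by
  rw [extend, dif_pos (idx_lt c)]
  exact congrArg u (finFunctionFinEquiv.symm_apply_apply c)

section RangeBasis

variable {n m : ℕ} {T : Tensor F n m} {L K : ℕ → ℕ → F} {s : ℕ}

theorem IsKernelBasis.vecMul_eq_zero_iff
    (hL : ∀ b : Fin (m / 2) → Fin n, ∀ a : Fin ((m + 1) / 2) → Fin n,
      L (idx b) (idx a) = flatten T a b) (y : ℕ → F) :
    (∀ i < n ^ (m / 2), ∑ j ∈ Finset.range (n ^ ((m + 1) / 2)), L i j * y j = 0) ↔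
      (fun a : Fin ((m + 1) / 2) → Fin n => y (idx a)) ᵥ* flatten T = 0 := by
  have : ∀ b : Fin (m / 2) → Fin n, ∑ j ∈ Finset.range (n ^ ((m + 1) / 2)), L (idx b) j * y j =
      ((fun a : Fin ((m + 1) / 2) → Fin n => y (idx a)) ᵥ* flatten T) b := by
    intro b
    rw [← sum_idx fun j => L (idx b) j * y j]
    refine Finset.sum_congr rfl fun a _ => ?_
    rw [hL, mul_comm]
  constructor
  · intro h
    ext b
    rw [← this, h _ (idx_lt b)]
    rfl
  · intro h i hi
    obtain ⟨b, rfl⟩ := exists_idx_eq hi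
    rw [this, h]
    rfl

/-- The left kernel of the flattening consists of the equations of `U`. Rows of `K` beyond the basis
are zero, so testing all `n ^ k` rows is harmless and frees the loop bounds from the computed number
`s`. -/
theorem IsKernelBasis.mem_flatRange_iff
    (hL : ∀ b : Fin (m / 2) → Fin n, ∀ a : Fin ((m + 1) / 2) → Fin n,
      L (idx b) (idx a) = flatten T a b)
    (hK : IsKernelBasis L (n ^ (m / 2)) (n ^ ((m + 1) / 2)) K s) (hs : s ≤ n ^ ((m + 1) / 2))
    (u : Tensor F n ((m + 1) / 2)) :
    u ∈ flatRange T ↔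
      ∀ t < n ^ ((m + 1) / 2), ∑ a : Fin ((m + 1) / 2) → Fin n, K t (idx a) * u a = 0 := by
  rw [flatRange, mem_range_mulVecLin_iff]
  constructor
  · intro h t _
    exact h _ ((IsKernelBasis.vecMul_eq_zero_iff hL (K t)).mp (hK.mem t))
  · intro h y hy
    obtain ⟨c, hc⟩ := hK.span (extend y) (by
      rw [IsKernelBasis.vecMul_eq_zero_iff hL]
      simpa only [extend_idx] using hy)
    have : ∀ a, y a * u a = ∑ t ∈ Finset.range s, c t * (K t (idx a) * u a) := fun a => by
      rw [← extend_idx y a, hc _ (idx_lt a), Finset.sum_mul]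
      exact Finset.sum_congr rfl fun t _ => by ring
    simp only [dotProduct]
    rw [Finset.sum_congr rfl fun a _ => this a, Finset.sum_comm]
    refine Finset.sum_eq_zero fun t ht => ?_
    rw [← Finset.mul_sum, h t (lt_of_lt_of_le (Finset.mem_range.mp ht) hs), mul_zero]

theorem IsKernelBasis.finrank_flatRange
    (hL : ∀ b : Fin (m / 2) → Fin n, ∀ a : Fin ((m + 1) / 2) → Fin n,
      L (idx b) (idx a) = flatten T a b)
    (hK : IsKernelBasis L (n ^ (m / 2)) (n ^ ((m + 1) / 2)) K s) :
    Module.finrank F (flatRange T) + s = n ^ ((m + 1) / 2) := by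
  classical
  set v : Fin s → Tensor F n ((m + 1) / 2) := fun t a => K t (idx a) with hv
  have hLI : LinearIndependent F v := by
    rw [Fintype.linearIndependent_iff]
    intro c hc t
    have := hK.indep (fun t => if h : t < s then c ⟨t, h⟩ else 0) (fun j hj => by
      obtain ⟨a, rfl⟩ := exists_idx_eq hj
      have := congrFun hc a
      rw [Finset.sum_range]
      simpa [hv] using this) t t.2
    simpa using this
  have hspan : Submodule.span F (Set.range v) = LinearMap.ker (flatten T).vecMulLinear := by
    apply le_antisymm
    · rw [Submodule.span_le]
      rintro _ ⟨t, rfl⟩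
      exact (IsKernelBasis.vecMul_eq_zero_iff hL (K t)).mp (hK.mem t)
    · intro y hy
      have hy' : y ᵥ* flatten T = 0 := hy
      obtain ⟨c, hc⟩ := hK.span (extend y) (by
        rw [IsKernelBasis.vecMul_eq_zero_iff hL]
        simpa only [extend_idx] using hy')
      have : y = ∑ t : Fin s, c t • v t := by
        ext a
        rw [← extend_idx y a, hc _ (idx_lt a), Finset.sum_range, Finset.sum_apply]
        rfl
      rw [this]
      exact Submodule.sum_mem _ fun t _ =>
        Submodule.smul_mem _ _ (Submodule.subset_span (Set.mem_range_self t))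
  have h1 := finrank_span_eq_card hLI
  rw [hspan, Fintype.card_fin] at h1
  have h2 := LinearMap.finrank_range_add_finrank_ker (flatten T).vecMulLinear
  rw [h1, Module.finrank_fintype_fun_eq_card] at h2
  have h3 : Module.finrank F (LinearMap.range (flatten T).vecMulLinear) =
      Module.finrank F (flatRange T) := by
    have : (flatten T).vecMulLinear = (flatten T)ᵀ.mulVecLin := by
      ext; simp
    rw [this]
    exact Matrix.rank_transpose (flatten T)
  rw [h3] at h2
  simpa using h2

end RangeBasis

section LiftedBasis

variable {n m : ℕ} {T : Tensor F n m} {L1 L K Q : ℕ → ℕ → F} {s1 s : ℕ}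

/-- A row of an array, as a matrix. -/
def rowMatrix (n k : ℕ) (x : ℕ → F) : Matrix (Fin k → Fin n) (Fin k → Fin n) F :=
  fun c d => x (idx c * n ^ k + idx d)

/-- The condition on `P` depends on `T` alone. Any basis of `U` and any basis of the quadrics
complete `P` to a setup, so neither has to be computed. -/
theorem exists_isSetup {P : Fin s → Matrix (Fin ((m + 1) / 2) → Fin n) (Fin ((m + 1) / 2) → Fin n) F}
    (hP : LinearIndependent F P)
    (hPm : ∀ M, M ∈ Submodule.span F (Set.range P) ↔ M ∈ symSquare (flatRange T) ∧
      PrefixInvariant M) :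
    ∃ (R p : ℕ) (u : Fin R → Tensor F n ((m + 1) / 2))
      (A : Fin p → Matrix (Fin ((m + 1) / 2) → Fin n) (Fin ((m + 1) / 2) → Fin n) F),
      IsSetup T u A P := by
  obtain ⟨R, u, hu, huU⟩ := exists_basis_family (flatRange T)
  obtain ⟨p, A, hA, hAs⟩ := exists_quadric_basis (productTensors F n ((m + 1) / 2))
  have hA' : (Submodule.span F (Set.range A) : Set _) =
      quadricsVanishingOn (productTensors F n ((m + 1) / 2)) := by
    rw [hAs]
    ext B
    exact mem_quadricSpace
  refine ⟨R, p, u, A, hu, huU, hA, hA', hP, fun M => ?_⟩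
  rw [hPm, huU, forall_pairing_eq_zero_iff hA']
  refine and_congr_right fun hM => ⟨fun h A hA => h.pairing_eq_zero hA, fun h => ?_⟩
  exact prefixInvariant_of_pairing_eq_zero (mem_symSquare_iff.mp hM).1 h

/-- Exchange invariance already implies symmetry. Given it, annihilation of the columns by `K` puts
the range into `U`, which is membership in `symSquare`. -/
theorem IsKernelBasis.lifted
    (hL1 : ∀ b : Fin (m / 2) → Fin n, ∀ a : Fin ((m + 1) / 2) → Fin n,
      L1 (idx b) (idx a) = flatten T a b)
    (hK : IsKernelBasis L1 (n ^ (m / 2)) (n ^ ((m + 1) / 2)) K s1) (hs : s1 ≤ n ^ ((m + 1) / 2))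
    (hL : ∀ r < ((m + 1) / 2 + 2) * (n ^ ((m + 1) / 2) * n ^ ((m + 1) / 2)),
      ∀ y < n ^ ((m + 1) / 2) * n ^ ((m + 1) / 2),
        L r y = liftCoeff K n ((m + 1) / 2) (n ^ ((m + 1) / 2)) r y)
    (hQ : IsKernelBasis L (((m + 1) / 2 + 2) * (n ^ ((m + 1) / 2) * n ^ ((m + 1) / 2)))
      (n ^ ((m + 1) / 2) * n ^ ((m + 1) / 2)) Q s) :
    LinearIndependent F (fun t : Fin s => rowMatrix n ((m + 1) / 2) (Q t)) ∧
      ∀ M, M ∈ Submodule.span F (Set.range fun t : Fin s => rowMatrix n ((m + 1) / 2) (Q t)) ↔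
        M ∈ symSquare (flatRange T) ∧ PrefixInvariant M := by
  have hsys : ∀ x : ℕ → F, (∀ r < ((m + 1) / 2 + 2) * (n ^ ((m + 1) / 2) * n ^ ((m + 1) / 2)),
      ∑ y ∈ Finset.range (n ^ ((m + 1) / 2) * n ^ ((m + 1) / 2)), L r y * x y = 0) ↔
      rowMatrix n ((m + 1) / 2) x ∈ symSquare (flatRange T) ∧ PrefixInvariant (rowMatrix n ((m + 1) / 2) x) := by
    intro x
    rw [liftCoeff_iff hL, and_comm]
    refine and_congr_left fun hx => ?_
    have hsymm : (rowMatrix n ((m + 1) / 2) x).IsSymm := PrefixInvariant.isSymm hx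
    rw [mem_symSquare_iff]
    have hcol : ∀ c < n ^ ((m + 1) / 2), ∀ d : Fin ((m + 1) / 2) → Fin n,
        ∑ a : Fin ((m + 1) / 2) → Fin n, K c (idx a) * (rowMatrix n ((m + 1) / 2) x) a d =
          ∑ z ∈ Finset.range (n ^ ((m + 1) / 2)), K c z * x (z * n ^ ((m + 1) / 2) + idx d) := fun c _ d =>
      sum_idx fun z => K c z * x (z * n ^ ((m + 1) / 2) + idx d)
    constructor
    · intro h
      refine ⟨hsymm, fun y => ?_⟩
      have hy : rowMatrix n ((m + 1) / 2) x *ᵥ y =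
          ∑ d, y d • fun a => rowMatrix n ((m + 1) / 2) x a d := by
        ext a
        simp [Matrix.mulVec, dotProduct, mul_comm]
      rw [hy]
      refine Submodule.sum_mem _ fun d _ => ?_
      refine Submodule.smul_mem _ _ ?_
      rw [hK.mem_flatRange_iff hL1 hs]
      intro t ht
      exact (hcol t ht d).trans (h t ht _ (idx_lt d))
    · rintro ⟨-, h⟩ c hc d hd
      obtain ⟨d, rfl⟩ := exists_idx_eq hd
      rw [← hcol c hc]
      have := (hK.mem_flatRange_iff hL1 hs _).mp (h (Pi.single d 1)) c hc
      simpa using this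
  constructor
  · rw [Fintype.linearIndependent_iff]
    intro c hc t
    have := hQ.indep (fun t => if h : t < s then c ⟨t, h⟩ else 0) (fun j hj => by
      have hkk : 0 < n ^ ((m + 1) / 2) := by
        rcases Nat.eq_zero_or_pos (n ^ ((m + 1) / 2)) with h | h
        · simp [h] at hj
        · exact h
      obtain ⟨a, ha⟩ := exists_idx_eq (Nat.div_lt_of_lt_mul hj)
      obtain ⟨b, hb⟩ := exists_idx_eq (Nat.mod_lt j hkk)
      have := congrFun (congrFun hc a) b
      rw [Matrix.sum_apply] at this
      rw [Finset.sum_range]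
      simp only [Matrix.smul_apply, rowMatrix, ha, hb, Nat.div_add_mod', smul_eq_mul] at this
      simpa using this) t t.2
    simpa using this
  · intro M
    have hrow : ∀ c : ℕ → F, ∑ t : Fin s, c t • rowMatrix n ((m + 1) / 2) (Q t) =
        rowMatrix n ((m + 1) / 2) fun j => ∑ t ∈ Finset.range s, c t * Q t j := by
      intro c
      ext a b
      rw [Matrix.sum_apply]
      simp only [rowMatrix, Matrix.smul_apply, smul_eq_mul]
      rw [Finset.sum_range]
    constructor
    · intro hM
      rw [Submodule.mem_span_range_iff_exists_fun] at hM
      obtain ⟨c, rfl⟩ := hM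
      obtain ⟨c', hc'⟩ : ∃ c' : ℕ → F, ∀ t : Fin s, c' t = c t :=
        ⟨fun t => if h : t < s then c ⟨t, h⟩ else 0, fun t => by simp⟩
      have := hrow c'
      simp_rw [hc'] at this
      rw [this, ← hsys]
      intro r hr
      simp_rw [Finset.mul_sum]
      rw [Finset.sum_comm]
      refine Finset.sum_eq_zero fun t _ => ?_
      have := hQ.mem t r hr
      simp_rw [mul_left_comm (L r _)]
      rw [← Finset.mul_sum, this, mul_zero]
    · intro hM
      set x : ℕ → F := fun j => extend (fun a => extend (M a) (j % n ^ ((m + 1) / 2))) (j / n ^ ((m + 1) / 2)) with hx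
      have hMx : M = rowMatrix n ((m + 1) / 2) x := by
        ext a b
        obtain ⟨h1, h2⟩ := mul_add_div_mod (idx a) (idx_lt b)
        simp only [rowMatrix, hx, h1, h2, extend_idx]
      rw [hMx, ← hsys] at hM
      obtain ⟨c, hc⟩ := hQ.span x hM
      rw [hMx]
      have : rowMatrix n ((m + 1) / 2) x = ∑ t : Fin s, c t • rowMatrix n ((m + 1) / 2) (Q t) := by
        rw [hrow]
        ext a b
        exact hc _ (mul_add_lt (idx_lt a) (idx_lt b))
      rw [this]
      exact Submodule.sum_mem _ fun t _ =>
        Submodule.smul_mem _ _ (Submodule.subset_span (Set.mem_range_self t))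

end LiftedBasis

end TensorDecomp
end

noncomputable section
namespace TensorDecomp

/-! ### Correctness of the final checks -/

variable {F : Type*} [RCLike F]

section Diagonalization

variable {κ : Type*} {s : ℕ}

/-- If `X x` is the combination of the `v a` with coefficients `c a`, subtracting the combination
with coefficients `c a / lam a` from `x` leaves a kernel vector. So eigenvectors span the space, and
a basis can be extracted from them. -/
theorem exists_diagonalization_of_range_le [Fintype κ] [DecidableEq κ] {v : Fin s → κ → F} {X : Matrix κ κ F}
    {lam : Fin s → F} (hl : ∀ a, lam a ≠ 0) (hX : ∀ a, X *ᵥ v a = lam a • v a)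
    (hr : ∀ y, X *ᵥ y ∈ Submodule.span F (Set.range v)) :
    ∃ (d : κ → F) (W : Matrix κ κ F), IsUnit W ∧ X * W = W * Matrix.diagonal d := by
  have htop : ⊤ ≤ Submodule.span F {x : κ → F | ∃ μ : F, X *ᵥ x = μ • x} := by
    intro x _
    obtain ⟨c, hc⟩ := (Submodule.mem_span_range_iff_exists_fun F).mp (hr x)
    have hx : x = (x - ∑ a, (c a / lam a) • v a) + ∑ a, (c a / lam a) • v a := by abel
    rw [hx]
    refine Submodule.add_mem _ (Submodule.subset_span ⟨0, ?_⟩)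
      (Submodule.sum_mem _ fun a _ => Submodule.smul_mem _ _ (Submodule.subset_span ⟨_, hX a⟩))
    rw [Matrix.mulVec_sub, ← hc, Matrix.mulVec_sum, zero_smul, sub_eq_zero]
    refine Finset.sum_congr rfl fun a _ => ?_
    rw [Matrix.mulVec_smul, hX, smul_smul, div_mul_cancel₀ _ (hl a)]
  let b := Module.Basis.ofSpan htop
  have hfin := Module.Finite.finite_basis b
  have := Fintype.ofFinite ↑((linearIndepOn_empty F id).extend
    (Set.empty_subset {x : κ → F | ∃ μ : F, X *ᵥ x = μ • x}))
  have hcard := Module.finrank_eq_card_basis b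
  rw [Module.finrank_fintype_fun_eq_card] at hcard
  let e := Fintype.equivOfCardEq hcard
  have hb : ∀ j, ∃ μ : F, X *ᵥ b (e j) = μ • b (e j) := fun j =>
    Module.Basis.ofSpan_subset htop ⟨e j, rfl⟩
  choose d hd using hb
  refine ⟨d, Matrix.of fun i j => b (e j) i, ?_, ?_⟩
  · rw [← Matrix.linearIndependent_cols_iff_isUnit]
    exact b.linearIndependent.comp e e.injective
  · ext i j
    rw [Matrix.mul_diagonal, mul_comm]
    exact congrFun (hd j) i

/-- Each `w t` is a multiple of one `v a`, different ones of different `v a` by independence; the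
two families are equally long since each `v a` lies in the span of the `w t`. -/
theorem exists_equiv_of_eigen [Fintype κ] {v : Fin s → κ → F} (hv : LinearIndependent F v)
    {X : Matrix κ κ F} {lam : Fin s → F} (hl : Function.Injective lam)
    (hX : ∀ a, X *ᵥ v a = lam a • v a) (hr : ∀ y, X *ᵥ y ∈ Submodule.span F (Set.range v))
    {r : ℕ} {w : Fin r → κ → F} (hw : LinearIndependent F w) {μ : Fin r → F} (hμ : ∀ t, μ t ≠ 0)
    (hXw : ∀ t, X *ᵥ w t = μ t • w t) (hvw : ∀ a, v a ∈ Submodule.span F (Set.range w)) :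
    ∃ (e : Fin r ≃ Fin s) (c : Fin r → F), (∀ t, c t ≠ 0) ∧ ∀ t, w t = c t • v (e t) := by
  choose σ hσ c hc hwc using fun t =>
    exists_eigen_of_range_le hv hl hX hr (hw.ne_zero t) (hμ t) (hXw t)
  have hinj : Function.Injective σ := by
    intro t t' h
    by_contra hne
    have := hw.notMem_span_image (s := {t'}) (x := t) hne
    rw [Set.image_singleton] at this
    refine this (Submodule.mem_span_singleton.mpr ⟨c t / c t', ?_⟩)
    rw [hwc t', hwc t, smul_smul, div_mul_cancel₀ _ (hc t'), h]
  have h1 : s ≤ r := by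
    have := Submodule.finrank_mono (Submodule.span_le.mpr (Set.range_subset_iff.mpr hvw))
    rwa [finrank_span_eq_card hv, finrank_span_eq_card hw, Fintype.card_fin,
      Fintype.card_fin] at this
  have h2 : r ≤ s := by simpa using Fintype.card_le_of_injective σ hinj
  have hbij : Function.Bijective σ := by
    rw [Fintype.bijective_iff_injective_and_card]
    exact ⟨hinj, by simp; omega⟩
  exact ⟨Equiv.ofBijective σ hbij, c, hc, hwc⟩

theorem SquareForm.rescale {P : Fin s → Matrix κ κ F} {z : Fin s → Fin s → F} {v : Fin s → κ → F}
    (h : SquareForm P z v) (e : Fin s ≃ Fin s) {c : Fin s → F} (hc : ∀ t, c t ≠ 0) :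
    SquareForm P (fun t => (c t * c t)⁻¹ • z (e t)) (fun t => c t • v (e t)) := by
  refine ⟨?_, ?_, fun x i j => ?_⟩
  · exact (h.indep_z.comp e e.injective).units_smul
      fun t => Units.mk0 (c t * c t)⁻¹ (inv_ne_zero (mul_ne_zero (hc t) (hc t)))
  · exact (h.indep_v.comp e e.injective).units_smul fun t => Units.mk0 (c t) (hc t)
  · rw [h.eq, ← e.sum_comp]
    refine Finset.sum_congr rfl fun t _ => ?_
    have := hc t
    simp only [Pi.smul_apply, smul_eq_mul]
    field_simp

theorem IsGeneric.rescale {f g : Fin s → F} {z : Fin s → Fin s → F} (h : IsGeneric f g z)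
    (e : Fin s ≃ Fin s) {c : Fin s → F} (hc : ∀ t, c t ≠ 0) :
    IsGeneric f g (fun t => (c t * c t)⁻¹ • z (e t)) := by
  have hc' := fun t => inv_ne_zero (mul_ne_zero (hc t) (hc t))
  simp only [← smul_eq_mul] at hc'
  refine ⟨fun a => ?_, fun a => ?_, fun a b hab => ?_⟩ <;> simp only [dotProduct_smul]
  · exact smul_ne_zero (hc' a) (h.left _)
  · exact smul_ne_zero (hc' a) (h.right _)
  · intro H
    refine h.cross (e a) (e b) (e.injective.ne hab) ?_
    have := mul_ne_zero (hc' a) (hc' b)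
    simp only [smul_eq_mul] at H this
    refine mul_left_cancel₀ this ?_
    linear_combination H

/-- The coefficients of a square form can be computed from the slices and a dual family, which makes
the square form testable. -/
theorem SquareForm.dual_apply [Fintype κ] {P : Fin s → Matrix κ κ F} {z : Fin s → Fin s → F}
    {v φ : Fin s → κ → F} (h : SquareForm P z v) (hφ : IsDual φ v) (x a : Fin s) :
    ∑ i, ∑ j, φ a i * φ a j * P x i j = z a x := by
  have h1 : ∀ i j, φ a i * φ a j * P x i j = ∑ b, z b x * ((φ a i * v b i) * (φ a j * v b j)) := by
    intro i j
    rw [h.eq, Finset.mul_sum]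
    exact Finset.sum_congr rfl fun b _ => by ring
  have h2 : ∀ b, ∑ i, ∑ j, z b x * ((φ a i * v b i) * (φ a j * v b j)) =
      if a = b then z b x else 0 := by
    intro b
    have : ∑ i, ∑ j, z b x * ((φ a i * v b i) * (φ a j * v b j)) =
        z b x * ((φ a ⬝ᵥ v b) * (φ a ⬝ᵥ v b)) := by
      simp only [dotProduct]
      rw [Finset.sum_mul_sum]
      simp only [Finset.mul_sum]
    rw [this, hφ a b]
    split_ifs <;> simp
  simp only [h1]
  rw [Finset.sum_congr rfl fun i _ => Finset.sum_comm, Finset.sum_comm,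
    Finset.sum_congr rfl fun b _ => h2 b]
  simp

end Diagonalization

theorem sum_range_eq_sum_fin {M : Type*} [AddCommMonoid M] {f : ℕ → M} {r N : ℕ} (hr : r ≤ N)
    (hf : ∀ z, r ≤ z → f z = 0) : ∑ z ∈ Finset.range N, f z = ∑ z : Fin r, f z := by
  rw [← Finset.sum_range]
  symm
  refine Finset.sum_subset (Finset.range_mono hr) fun z _ hz => hf z ?_
  simpa using hz

theorem sum_idx_pair {M : Type*} [AddCommMonoid M] {n k : ℕ} (f : ℕ → M) :
    ∑ j ∈ Finset.range (n ^ k * n ^ k), f j =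
      ∑ c : Fin k → Fin n, ∑ d : Fin k → Fin n, f (idx c * n ^ k + idx d) := by
  rw [sum_range_mul, ← sum_idx fun i => ∑ j ∈ Finset.range (n ^ k), f (i * n ^ k + j)]
  exact Finset.sum_congr rfl fun c _ => (sum_idx _).symm

/-- A row of an array, as a tensor. -/
def rowTensor (n k : ℕ) (x : ℕ → F) : Tensor F n k := fun c => x (idx c)

/-- A test for product tensors, in terms of the numbers of multi-indices. -/
def ExchangeTest (n l : ℕ) (w : ℕ → F) : Prop :=
  ∀ y < (l + 1) * (n ^ l * n ^ l),
    w (exchange (n ^ (y / (n ^ l * n ^ l))) (y % (n ^ l * n ^ l) / n ^ l)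
            (y % (n ^ l * n ^ l) % n ^ l)) *
      w (exchange (n ^ (y / (n ^ l * n ^ l))) (y % (n ^ l * n ^ l) % n ^ l)
            (y % (n ^ l * n ^ l) / n ^ l)) =
      w (y % (n ^ l * n ^ l) / n ^ l) * w (y % (n ^ l * n ^ l) % n ^ l)

theorem rowTensor_mem_productTensors_iff {n l : ℕ} (hl : 0 < l) (w : ℕ → F) :
    rowTensor n l w ∈ productTensors F n l ↔
      ExchangeTest n l w := by
  have h1 : rowTensor n l w ∈ productTensors F n l ↔
      PrefixInvariant fun c d : Fin l → Fin n => w (idx c) * w (idx d) :=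
    ⟨fun h => prefixInvariant_of_mem_productTensors h,
      fun h => mem_productTensors_of_prefixInvariant hl h⟩
  rw [h1, prefixInvariant_iff fun c d => w c * w d]
  constructor
  · intro h y hy
    have hpos : 0 < n ^ l * n ^ l := by
      rcases Nat.eq_zero_or_pos (n ^ l * n ^ l) with h | h
      · rw [h, mul_zero] at hy
        exact absurd hy (Nat.not_lt_zero _)
      · exact h
    have hi : y / (n ^ l * n ^ l) < l + 1 := Nat.div_lt_of_lt_mul (by rwa [mul_comm])
    exact h _ (by omega) _ (Nat.div_lt_of_lt_mul (Nat.mod_lt _ hpos)) _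
      (Nat.mod_lt _ (Nat.pos_of_mul_pos_left hpos))
  · intro h i hi c hc d hd
    have h2 := mul_add_lt hc hd
    have := h (i * (n ^ l * n ^ l) + (c * n ^ l + d)) (mul_add_lt (by omega) h2)
    obtain ⟨h3, h4⟩ := mul_add_div_mod i h2
    obtain ⟨h5, h6⟩ := mul_add_div_mod c hd
    rwa [h3, h4, h5, h6] at this

section Checks

variable {n m s : ℕ} {T : Tensor F n m} {P v Φ Z W : ℕ → ℕ → F} {T₀ f g Df Dg : ℕ → F}

/-- The final checks of the program, in terms of its arrays. -/
structure ChecksPass (n m s : ℕ) (P v Φ Z W : ℕ → ℕ → F) (Df Dg : ℕ → F) : Prop where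
  dual : ∀ x < s, ∀ y < s, ∑ z ∈ Finset.range (n ^ ((m + 1) / 2)), Φ x z * v y z =
    if x = y then 1 else 0
  square : ∀ x < n ^ ((m + 1) / 2) * n ^ ((m + 1) / 2),
    ∀ y < n ^ ((m + 1) / 2) * n ^ ((m + 1) / 2),
      P x y = ∑ z ∈ Finset.range (n ^ ((m + 1) / 2)),
        Z x z * v z (y / n ^ ((m + 1) / 2)) * v z (y % n ^ ((m + 1) / 2))
  ne_zero : ∀ x < s, Df x * Dg x ≠ 0
  cross : ∀ x y, x < y → y < s → Df x * Dg y - Df y * Dg x ≠ 0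
  product : ∀ x < n ^ ((m + 1) / 2), ExchangeTest n (m / 2) (W x)

/-- Rows with number at least `s` are zero, so sums over the fixed ranges reduce to sums over `Fin
s`. The array `Z` holds the only possible coefficients `z`, by duality. Their independence need not
be checked: it follows from that of the slices. -/
theorem checksPass_iff (hm : 3 ≤ m) (hs : s ≤ n ^ ((m + 1) / 2))
    (hT : ∀ a b, T₀ (idx a + n ^ ((m + 1) / 2) * idx b) = flatten T a b)
    (hP : ∀ x y, s ≤ x → P x y = 0) (hv : ∀ x y, s ≤ x → v x y = 0)
    (hΦ : ∀ x y, s ≤ x → Φ x y = 0)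
    (hPi : LinearIndependent F fun t : Fin s => rowMatrix n ((m + 1) / 2) (P t))
    (hZ : ∀ x < n ^ ((m + 1) / 2) * n ^ ((m + 1) / 2), ∀ a < n ^ ((m + 1) / 2), Z x a =
      ∑ z ∈ Finset.range (n ^ ((m + 1) / 2) * n ^ ((m + 1) / 2)),
        Φ a (z / n ^ ((m + 1) / 2)) * Φ a (z % n ^ ((m + 1) / 2)) * P x z)
    (hDf : ∀ a < n ^ ((m + 1) / 2), Df a =
      ∑ z ∈ Finset.range (n ^ ((m + 1) / 2) * n ^ ((m + 1) / 2)), f z * Z z a)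
    (hDg : ∀ a < n ^ ((m + 1) / 2), Dg a =
      ∑ z ∈ Finset.range (n ^ ((m + 1) / 2) * n ^ ((m + 1) / 2)), g z * Z z a)
    (hW : ∀ x < n ^ ((m + 1) / 2), ∀ y < n ^ (m / 2), W x y =
      ∑ z ∈ Finset.range (n ^ ((m + 1) / 2)), Φ x z * T₀ (z + n ^ ((m + 1) / 2) * y)) :
    ChecksPass n m s P v Φ Z W Df Dg ↔
      ∃ z : Fin s → Fin s → F,
        SquareForm (fun t : Fin s => rowMatrix n ((m + 1) / 2) (P t)) z
          (fun t : Fin s => rowTensor n ((m + 1) / 2) (v t)) ∧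
        IsGeneric (fun t : Fin s => f t) (fun t : Fin s => g t) z ∧
        IsDual (fun t : Fin s => rowTensor n ((m + 1) / 2) (Φ t))
          (fun t : Fin s => rowTensor n ((m + 1) / 2) (v t)) ∧
        ∀ t : Fin s, rowTensor n ((m + 1) / 2) (Φ t) ᵥ* flatten T ∈ productTensors F n (m / 2) := by
  have hs2 : s ≤ n ^ ((m + 1) / 2) * n ^ ((m + 1) / 2) := by nlinarith
  have hdual : (∀ x < s, ∀ y < s, ∑ z ∈ Finset.range (n ^ ((m + 1) / 2)), Φ x z * v y z =
      if x = y then 1 else 0) ↔ IsDual (fun t : Fin s => rowTensor n ((m + 1) / 2) (Φ t))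
          (fun t : Fin s => rowTensor n ((m + 1) / 2) (v t)) := by
    have : ∀ a b : Fin s, rowTensor n ((m + 1) / 2) (Φ a) ⬝ᵥ rowTensor n ((m + 1) / 2) (v b) =
        ∑ z ∈ Finset.range (n ^ ((m + 1) / 2)), Φ a z * v b z := fun a b =>
      sum_idx fun z => Φ a z * v b z
    constructor
    · intro h a b
      rw [this, h a a.2 b b.2]
      simp [Fin.ext_iff]
    · intro h x hx y hy
      have := (this ⟨x, hx⟩ ⟨y, hy⟩).symm.trans (h ⟨x, hx⟩ ⟨y, hy⟩)
      simpa [Fin.ext_iff] using this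
  have hZ' : ∀ x a : Fin s, Z x a = ∑ i, ∑ j, rowTensor n ((m + 1) / 2) (Φ a) i *
      rowTensor n ((m + 1) / 2) (Φ a) j * rowMatrix n ((m + 1) / 2) (P x) i j := by
    intro x a
    rw [hZ x (x.2.trans_le hs2) a (a.2.trans_le hs), sum_idx_pair]
    refine Finset.sum_congr rfl fun c _ => Finset.sum_congr rfl fun d _ => ?_
    obtain ⟨h1, h2⟩ := mul_add_div_mod (idx c) (idx_lt d)
    rw [h1, h2]
    rfl
  have hZ0 : ∀ x a, s ≤ x → x < n ^ ((m + 1) / 2) * n ^ ((m + 1) / 2) → a < n ^ ((m + 1) / 2) →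
      Z x a = 0 := by
    intro x a hx hx' ha
    rw [hZ x hx' a ha]
    exact Finset.sum_eq_zero fun z _ => by rw [hP x z hx, mul_zero]
  have hD : ∀ (h D : ℕ → F), (∀ a < n ^ ((m + 1) / 2), D a =
      ∑ z ∈ Finset.range (n ^ ((m + 1) / 2) * n ^ ((m + 1) / 2)), h z * Z z a) →
      ∀ a : Fin s, D a = (fun t : Fin s => h t) ⬝ᵥ fun x : Fin s => Z x a := by
    intro h D hD a
    have ha := a.2.trans_le hs
    have : ∀ z ∈ Finset.range (n ^ ((m + 1) / 2) * n ^ ((m + 1) / 2)), h z * Z z a =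
        if z < s then h z * Z z a else 0 := by
      intro z hz
      split_ifs with hzs
      · rfl
      · rw [hZ0 z a (by omega) (Finset.mem_range.mp hz) ha, mul_zero]
    rw [hD a ha, Finset.sum_congr rfl this,
      sum_range_eq_sum_fin hs2 fun z hz => if_neg (by omega)]
    simp [dotProduct]
  have hWt : ∀ t < n ^ ((m + 1) / 2), rowTensor n (m / 2) (W t) =
      rowTensor n ((m + 1) / 2) (Φ t) ᵥ* flatten T := by
    intro t ht
    ext b
    rw [rowTensor, hW t ht _ (idx_lt b),
      ← sum_idx fun z => Φ t z * T₀ (z + n ^ ((m + 1) / 2) * idx b)]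
    refine Finset.sum_congr rfl fun a _ => ?_
    rw [hT]
    rfl
  have hprod : (∀ x < n ^ ((m + 1) / 2), ExchangeTest n (m / 2) (W x)) ↔ ∀ t : Fin s,
      rowTensor n ((m + 1) / 2) (Φ t) ᵥ* flatten T ∈ productTensors F n (m / 2) := by
    have h1 : ∀ x < n ^ ((m + 1) / 2), ExchangeTest n (m / 2) (W x) ↔
        rowTensor n ((m + 1) / 2) (Φ x) ᵥ* flatten T ∈ productTensors F n (m / 2) := fun x hx => by
      rw [← hWt x hx, rowTensor_mem_productTensors_iff (by omega)]
    refine (forall₂_congr h1).trans ⟨fun h t => h t (t.2.trans_le hs), fun h x hx => ?_⟩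
    by_cases hxs : x < s
    · exact h ⟨x, hxs⟩
    · have : rowTensor n ((m + 1) / 2) (Φ x) = 0 := by
        ext a
        exact hΦ x _ (by omega)
      rw [this, Matrix.zero_vecMul]
      exact ⟨0, by
        ext b
        exact (Finset.prod_eq_zero (Finset.mem_univ (⟨0, by omega⟩ : Fin (m / 2))) rfl).symm⟩
  have hsq : ∀ x : Fin s, ∀ c d : Fin ((m + 1) / 2) → Fin n,
      ∑ z ∈ Finset.range (n ^ ((m + 1) / 2)),
        Z x z * v z ((idx c * n ^ ((m + 1) / 2) + idx d) / n ^ ((m + 1) / 2)) *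
          v z ((idx c * n ^ ((m + 1) / 2) + idx d) % n ^ ((m + 1) / 2)) =
      ∑ a : Fin s, Z x a * rowTensor n ((m + 1) / 2) (v a) c *
        rowTensor n ((m + 1) / 2) (v a) d := by
    intro x c d
    obtain ⟨h1, h2⟩ := mul_add_div_mod (idx c) (idx_lt d)
    rw [h1, h2]
    exact sum_range_eq_sum_fin hs fun z hz => by rw [hv z _ hz, mul_zero, zero_mul]
  constructor
  · intro h
    have hd := hdual.mp h.dual
    have heq : ∀ (x : Fin s) i j, rowMatrix n ((m + 1) / 2) (P x) i j = ∑ a : Fin s,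
        Z x a * rowTensor n ((m + 1) / 2) (v a) i * rowTensor n ((m + 1) / 2) (v a) j := by
      intro x i j
      rw [← hsq]
      exact h.square x (x.2.trans_le hs2) _ (mul_add_lt (idx_lt i) (idx_lt j))
    obtain ⟨z, hz⟩ := exists_squareForm_of_span_eq hPi hd.linearIndependent (fun x => by
      have : rowMatrix n ((m + 1) / 2) (P x) = ∑ a : Fin s, Z x a •
          Matrix.vecMulVec (rowTensor n ((m + 1) / 2) (v a)) (rowTensor n ((m + 1) / 2) (v a)) := by
        ext i j
        rw [heq x i j]
        simp [Matrix.sum_apply, Matrix.vecMulVec_apply, mul_assoc]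
      rw [this]
      exact Submodule.sum_mem _ fun a _ =>
        Submodule.smul_mem _ _ (Submodule.subset_span ⟨a, rfl⟩))
    have hzZ : ∀ a : Fin s, z a = fun x : Fin s => Z x a := by
      intro a
      ext x
      rw [hZ' x a, hz.dual_apply hd]
    refine ⟨z, hz, ⟨fun a => ?_, fun a => ?_, fun a b hab => ?_⟩, hd, hprod.mp h.product⟩
    · rw [hzZ, ← hD f Df hDf]
      exact left_ne_zero_of_mul (h.ne_zero a a.2)
    · rw [hzZ, ← hD g Dg hDg]
      exact right_ne_zero_of_mul (h.ne_zero a a.2)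
    · rw [hzZ, hzZ, ← hD g Dg hDg, ← hD g Dg hDg, ← hD f Df hDf, ← hD f Df hDf]
      rcases lt_or_gt_of_ne hab with hlt | hlt
      · exact sub_ne_zero.mp (h.cross a b hlt b.2)
      · exact (sub_ne_zero.mp (h.cross b a hlt a.2)).symm
  · rintro ⟨z, hz, hfg, hd, hw⟩
    have hzZ : ∀ a : Fin s, z a = fun x : Fin s => Z x a := by
      intro a
      ext x
      rw [hZ' x a, hz.dual_apply hd]
    refine ⟨hdual.mpr hd, fun x hx y hy => ?_, fun x hx => ?_, fun x y hxy hy => ?_,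
      hprod.mpr hw⟩
    · by_cases hxs : x < s
      · have hk : 0 < n ^ ((m + 1) / 2) := by
          rcases Nat.eq_zero_or_pos (n ^ ((m + 1) / 2)) with h | h
          · simp [h] at hx
          · exact h
        obtain ⟨a, ha⟩ := exists_idx_eq (Nat.div_lt_of_lt_mul hy)
        obtain ⟨b, hb⟩ := exists_idx_eq (Nat.mod_lt y hk)
        have hy' : y = idx a * n ^ ((m + 1) / 2) + idx b := by
          rw [ha, hb, Nat.div_add_mod']
        rw [hy']
        refine ((hz.eq ⟨x, hxs⟩ a b).trans ?_).trans (hsq ⟨x, hxs⟩ a b).symm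
        exact Finset.sum_congr rfl fun t _ => by rw [hzZ]
      · rw [hP x y (by omega)]
        refine (Finset.sum_eq_zero fun z hz => ?_).symm
        rw [hZ0 x z (by omega) hx (Finset.mem_range.mp hz), zero_mul, zero_mul]
    · have h1 := hfg.left ⟨x, hx⟩
      have h2 := hfg.right ⟨x, hx⟩
      rw [hzZ, ← hD f Df hDf] at h1
      rw [hzZ, ← hD g Dg hDg] at h2
      exact mul_ne_zero h1 h2
    · have h1 := hfg.cross ⟨x, hxy.trans hy⟩ ⟨y, hy⟩ (by simp [Fin.ext_iff]; omega)
      rw [hzZ, hzZ, ← hD g Dg hDg, ← hD g Dg hDg, ← hD f Df hDf, ← hD f Df hDf] at h1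
      exact sub_ne_zero.mpr h1

end Checks

end TensorDecomp
end

noncomputable section
namespace TensorDecomp

/-! ### Eigenvectors computed by the program -/

variable {F : Type*} [RCLike F] {n k : ℕ}

/-- The leading block of an array, as a matrix. -/
def blockMatrix (n k : ℕ) (X : ℕ → ℕ → F) : Matrix (Fin k → Fin n) (Fin k → Fin n) F :=
  fun a b => X (idx a) (idx b)

theorem block_eq_submatrix (X : ℕ → ℕ → F) :
    block X (n ^ k) (n ^ k) =
      (blockMatrix n k X).submatrix finFunctionFinEquiv.symm finFunctionFinEquiv.symm := by
  ext i j
  simp [block, blockMatrix, idx]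

theorem exists_block_diagonalization {X : ℕ → ℕ → F}
    (h : ∃ (d : (Fin k → Fin n) → F) (W : Matrix (Fin k → Fin n) (Fin k → Fin n) F),
      IsUnit W ∧ blockMatrix n k X * W = W * Matrix.diagonal d) :
    ∃ (d : Fin (n ^ k) → F) (W : Matrix (Fin (n ^ k)) (Fin (n ^ k)) F),
      IsUnit W ∧ block X (n ^ k) (n ^ k) * W = W * Matrix.diagonal d := by
  obtain ⟨d, W, hW, hd⟩ := h
  refine ⟨d ∘ finFunctionFinEquiv.symm,
    W.submatrix finFunctionFinEquiv.symm finFunctionFinEquiv.symm, ?_, ?_⟩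
  · exact (Matrix.isUnit_submatrix_equiv _ _).mpr hW
  · rw [block_eq_submatrix, Matrix.submatrix_mul_equiv, hd, ← Matrix.submatrix_mul_equiv W _ _
      finFunctionFinEquiv.symm]
    congr 1
    ext i j
    simp [Matrix.diagonal_apply]

theorem blockMatrix_mulVec (X : ℕ → ℕ → F) (x : ℕ → F) (a : Fin k → Fin n) :
    (blockMatrix n k X *ᵥ fun b => x (idx b)) a =
      ∑ j ∈ Finset.range (n ^ k), X (idx a) j * x j :=
  sum_idx fun j => X (idx a) j * x j

variable {s r : ℕ} {P : ℕ → ℕ → F} {z : Fin s → Fin s → F} {v₀ : Fin s → Tensor F n k}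
  {f g : ℕ → F} {A B K X V v : ℕ → ℕ → F} {d : ℕ → F}

theorem blockMatrix_contract (hs : s ≤ n ^ k * n ^ k) (hP : ∀ x y, s ≤ x → P x y = 0)
    (hB : ∀ x < n ^ k, ∀ y < n ^ k, B x y =
      ∑ z ∈ Finset.range (n ^ k * n ^ k), f z * P z (x * n ^ k + y)) :
    blockMatrix n k B = contract (fun t : Fin s => rowMatrix n k (P t)) fun t => f t := by
  ext a b
  rw [blockMatrix, hB _ (idx_lt a) _ (idx_lt b),
    sum_range_eq_sum_fin hs fun z hz => by rw [hP z _ hz, mul_zero]]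
  simp [contract, Matrix.sum_apply, rowMatrix]

section

variable (hsq : SquareForm (fun t : Fin s => rowMatrix n k (P t)) z v₀)
  (hfg : IsGeneric (fun t : Fin s => f t) (fun t : Fin s => g t) z)
  (hB : blockMatrix n k B = contract (fun t : Fin s => rowMatrix n k (P t)) fun t => f t)
  (hA : blockMatrix n k A = contract (fun t : Fin s => rowMatrix n k (P t)) fun t => g t)
  (hK : ∀ u : Tensor F n k, u ∈ Submodule.span F (Set.range v₀) ↔
    ∀ t < n ^ k, ∑ a : Fin k → Fin n, K t (idx a) * u a = 0)

include hsq hfg hB hA hK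

/-- A solution is the sum of the `v₀ t ⊗ φ t`, weighted by the ratios of `f ⬝ᵥ z t` and `g ⬝ᵥ z t`.
-/
theorem SquareForm.exists_solution :
    ∃ X₀ : ℕ → ℕ → F,
      (∀ i < n ^ k, ∀ j < n ^ k, ∑ z ∈ Finset.range (n ^ k), X₀ i z * A z j = B i j) ∧
      ∀ i < n ^ k, ∀ j < n ^ k, ∑ z ∈ Finset.range (n ^ k), K i z * X₀ z j = 0 := by
  obtain ⟨φ, hφ⟩ := exists_isDual hsq.indep_v
  set M : Matrix (Fin k → Fin n) (Fin k → Fin n) F := fun a b =>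
    ∑ t : Fin s, ((fun t : Fin s => f t) ⬝ᵥ z t) / ((fun t : Fin s => g t) ⬝ᵥ z t) *
      (v₀ t a * φ t b) with hM
  have hX : ∀ a b, (fun i j => extend (fun a => extend (M a) j) i) (idx a) (idx b) = M a b := by
    intro a b
    simp only [extend_idx]
  refine ⟨fun i j => extend (fun a => extend (M a) j) i, fun i hi j hj => ?_, fun i hi j hj => ?_⟩
  · obtain ⟨a, rfl⟩ := exists_idx_eq hi
    obtain ⟨b, rfl⟩ := exists_idx_eq hj
    rw [← sum_idx (n := n) (k := k)
      fun z => (fun i j => extend (fun a => extend (M a) j) i) (idx a) z * A z (idx b)]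
    simp only [hX]
    have h1 : B (idx a) (idx b) = _ := congrFun (congrFun hB a) b
    have h2 : ∀ c, A (idx c) (idx b) = _ := fun c => congrFun (congrFun hA c) b
    rw [h1, hsq.contract_apply]
    simp only [h2, hsq.contract_apply, hM, Finset.sum_mul]
    rw [Finset.sum_comm]
    refine Finset.sum_congr rfl fun t _ => ?_
    have h3 : ∀ c, ((fun t : Fin s => f t) ⬝ᵥ z t) / ((fun t : Fin s => g t) ⬝ᵥ z t) *
        (v₀ t a * φ t c) * ∑ e, ((fun t : Fin s => g t) ⬝ᵥ z e) * v₀ e c * v₀ e b =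
        ∑ e, ((fun t : Fin s => f t) ⬝ᵥ z t) / ((fun t : Fin s => g t) ⬝ᵥ z t) * v₀ t a *
          (((fun t : Fin s => g t) ⬝ᵥ z e) * v₀ e b) * (φ t c * v₀ e c) := by
      intro c
      rw [Finset.mul_sum]
      exact Finset.sum_congr rfl fun e _ => by ring
    simp only [h3]
    rw [Finset.sum_comm]
    simp only [← Finset.mul_sum]
    have h4 : ∀ e, ∑ c, φ t c * v₀ e c = if t = e then 1 else 0 := hφ t
    simp only [h4]
    have := hfg.right t
    simp only [mul_ite, mul_one, mul_zero, Finset.sum_ite_eq, Finset.mem_univ, if_true]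
    field_simp
  · obtain ⟨b, rfl⟩ := exists_idx_eq hj
    rw [← sum_idx (n := n) (k := k)
      fun z => K i z * (fun i j => extend (fun a => extend (M a) j) i) z (idx b)]
    have hX' : ∀ c, extend (fun a => extend (M a) (idx b)) (idx c) = M c b := fun c => hX c b
    simp only [hX']
    simp only [hM, Finset.mul_sum]
    rw [Finset.sum_comm]
    refine Finset.sum_eq_zero fun t _ => ?_
    have h1 := (hK (v₀ t)).mp (Submodule.subset_span ⟨t, rfl⟩) i hi
    have h2 : ∀ c, K i (idx c) * (((fun t : Fin s => f t) ⬝ᵥ z t) / ((fun t : Fin s => g t) ⬝ᵥ z t) *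
        (v₀ t c * φ t b)) = ((fun t : Fin s => f t) ⬝ᵥ z t) / ((fun t : Fin s => g t) ⬝ᵥ z t) *
          φ t b * (K i (idx c) * v₀ t c) := fun c => by ring
    simp only [h2, ← Finset.mul_sum, h1, mul_zero]

variable (hXA : ∀ i < n ^ k, ∀ j < n ^ k, ∑ z ∈ Finset.range (n ^ k), X i z * A z j = B i j)
  (hKX : ∀ i < n ^ k, ∀ j < n ^ k, ∑ z ∈ Finset.range (n ^ k), K i z * X z j = 0)

include hXA hKX

/-- Applied to the dual vector `φ t`, the equation `X A = B` reads: `X` maps `(g ⬝ᵥ z t) • v₀ t` to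
`(f ⬝ᵥ z t) • v₀ t`. The equation `K X = 0` keeps the range in the span of the `v₀ t`. This is all
that is needed of the matrix `T(f) T(g)⁺`, so any solution can replace it. -/
theorem SquareForm.solution_eigen :
    (∀ t, blockMatrix n k X *ᵥ v₀ t =
      (((fun t : Fin s => f t) ⬝ᵥ z t) / ((fun t : Fin s => g t) ⬝ᵥ z t)) • v₀ t) ∧
    ∀ y, blockMatrix n k X *ᵥ y ∈ Submodule.span F (Set.range v₀) := by
  obtain ⟨φ, hφ⟩ := exists_isDual hsq.indep_v
  have hmul : blockMatrix n k X * blockMatrix n k A = blockMatrix n k B := by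
    ext a b
    rw [Matrix.mul_apply]
    exact (sum_idx fun z => X (idx a) z * A z (idx b)).trans (hXA _ (idx_lt a) _ (idx_lt b))
  have hcon : ∀ (h : Fin s → F) (t : Fin s),
      contract (fun t : Fin s => rowMatrix n k (P t)) h *ᵥ φ t = (h ⬝ᵥ z t) • v₀ t := by
    intro h t
    rw [hsq.contract_mulVec]
    simp only [dotProduct_comm (v₀ _), hφ t, mul_ite, mul_one, mul_zero, ite_smul, zero_smul,
      Finset.sum_ite_eq, Finset.mem_univ, if_true]
  constructor
  · intro t
    have h1 : blockMatrix n k X *ᵥ (blockMatrix n k A *ᵥ φ t) = blockMatrix n k B *ᵥ φ t := by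
      rw [Matrix.mulVec_mulVec, hmul]
    rw [hA, hB, hcon, hcon, Matrix.mulVec_smul] at h1
    have hg := hfg.right t
    rw [div_eq_inv_mul, mul_smul, ← h1, smul_smul, inv_mul_cancel₀ hg, one_smul]
  · intro y
    rw [hK]
    intro t ht
    have h1 : ∀ b, ∑ a : Fin k → Fin n, K t (idx a) * blockMatrix n k X a b = 0 := fun b =>
      (sum_idx fun z => K t z * X z (idx b)).trans (hKX t ht _ (idx_lt b))
    simp only [Matrix.mulVec, dotProduct, Finset.mul_sum]
    rw [Finset.sum_comm]
    refine Finset.sum_eq_zero fun b _ => ?_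
    simp only [← mul_assoc, ← Finset.sum_mul, h1, zero_mul]

theorem SquareForm.exists_solution_diagonalization :
    ∃ (d : Fin (n ^ k) → F) (W : Matrix (Fin (n ^ k)) (Fin (n ^ k)) F),
      IsUnit W ∧ block X (n ^ k) (n ^ k) * W = W * Matrix.diagonal d := by
  obtain ⟨h1, h2⟩ := hsq.solution_eigen hfg hB hA hK hXA hKX
  exact exists_block_diagonalization (exists_diagonalization_of_range_le
    (fun a => div_ne_zero (hfg.left a) (hfg.right a)) h1 h2)

/-- The eigenvector columns with nonzero eigenvalue are multiples of the `v₀ a` because the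
eigenvalues of the latter are distinct, and each `v₀ a` is a combination of such columns, so none is
missing. -/
theorem SquareForm.solution_spectrum (hV : IsUnit (block V (n ^ k) (n ^ k)))
    (hd : block X (n ^ k) (n ^ k) * block V (n ^ k) (n ^ k) =
      block V (n ^ k) (n ^ k) * Matrix.diagonal fun j : Fin (n ^ k) => d j)
    [DecidablePred fun j => d j ≠ 0] (hr : r = Nat.count (fun j => d j ≠ 0) (n ^ k))
    (hv : ∀ i j, v i j = if i < r ∧ j < n ^ k then V j (Nat.nth (fun j => d j ≠ 0) i) else 0) :
    ∃ (e : Fin r ≃ Fin s) (c : Fin r → F), (∀ t, c t ≠ 0) ∧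
      ∀ t : Fin r, rowTensor n k (v t) = c t • v₀ (e t) := by
  obtain ⟨h1, h2⟩ := hsq.solution_eigen hfg hB hA hK hXA hKX
  obtain ⟨hinj, hsurj⟩ := isUnit_block_iff_sum hV
  have hcol : ∀ i < n ^ k, ∀ j < n ^ k,
      ∑ z ∈ Finset.range (n ^ k), X i z * V z j = V i j * d j := by
    intro i hi j hj
    have := congrFun (congrFun hd ⟨i, hi⟩) ⟨j, hj⟩
    rw [Matrix.mul_diagonal, Matrix.mul_apply] at this
    rw [Finset.sum_range]
    exact this
  have hsum : ∀ (c : ℕ → F) (j : ℕ), j < n ^ k → ∑ t ∈ Finset.range r, c t * v t j =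
      ∑ i ∈ Finset.range (n ^ k), V j i *
        if d i ≠ 0 then c (Nat.count (fun j => d j ≠ 0) i) else 0 := by
    intro c j hj
    have h := sum_range_count (fun j => d j ≠ 0)
      (fun i => V j i * c (Nat.count (fun j => d j ≠ 0) i)) (n ^ k)
    rw [← hr] at h
    simp only [mul_ite, mul_zero]
    rw [← h]
    refine Finset.sum_congr rfl fun t ht => ?_
    have ht' := Finset.mem_range.mp ht
    obtain ⟨i, hi, h1, h2, h3⟩ := exists_of_lt_count (p := fun j => d j ≠ 0) (b := n ^ k) (by rw [← hr]; exact ht')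
    rw [hv, if_pos ⟨ht', hj⟩, h3, h2, mul_comm]
  have hrow : ∀ t : Fin r, ∃ i < n ^ k, d i ≠ 0 ∧ Nat.count (fun j => d j ≠ 0) i = t ∧
      ∀ j < n ^ k, v t j = V j i := by
    intro t
    obtain ⟨i, hi, h1, h2, h3⟩ := exists_of_lt_count (p := fun j => d j ≠ 0) (b := n ^ k) (by rw [← hr]; exact t.2)
    exact ⟨i, hi, h1, h2, fun j hj => by rw [hv, if_pos ⟨t.2, hj⟩, h3]⟩
  choose σ hσ hσd hσc hσv using hrow
  refine exists_equiv_of_eigen hsq.indep_v hfg.ratio_injective h1 h2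
    (w := fun t : Fin r => rowTensor n k (v t)) ?_ (μ := fun t => d (σ t)) hσd ?_ ?_
  · rw [Fintype.linearIndependent_iff]
    intro c hc t
    obtain ⟨c', hc'⟩ : ∃ c' : ℕ → F, ∀ t : Fin r, c' t = c t :=
      ⟨fun t => if h : t < r then c ⟨t, h⟩ else 0, fun t => by simp⟩
    have := hinj _ (fun j hj => by
      rw [← hsum c' j hj, Finset.sum_range]
      obtain ⟨a, rfl⟩ := exists_idx_eq hj
      have := congrFun hc a
      simp only [hc']
      simpa [rowTensor] using this) (σ t) (hσ t)
    rwa [if_pos (hσd t), hσc, hc'] at this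
  · intro t
    ext a
    refine (blockMatrix_mulVec X (v t) a).trans ?_
    rw [Finset.sum_congr rfl fun j hj => by rw [hσv t j (Finset.mem_range.mp hj)],
      hcol _ (idx_lt a) _ (hσ t), mul_comm]
    simp [rowTensor, hσv t _ (idx_lt a)]
  · intro a
    obtain ⟨y, hy⟩ := hsurj (extend (v₀ a))
    set lam := ((fun t : Fin s => f t) ⬝ᵥ z a) / ((fun t : Fin s => g t) ⬝ᵥ z a) with hlam
    have hlam0 : lam ≠ 0 := div_ne_zero (hfg.left a) (hfg.right a)
    -- In the eigenvector basis, `v₀ a` has coordinates `y j` with `(d j - lam) * y j = 0`. As `lam`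
    -- is nonzero, they vanish wherever `d j = 0`.
    have h3 := hinj (fun j => (d j - lam) * y j) (fun i hi => by
      obtain ⟨b, rfl⟩ := exists_idx_eq hi
      have h4 := congrFun (h1 a) b
      have h5 : v₀ a = fun b => extend (v₀ a) (idx b) := by
        ext b
        rw [extend_idx]
      rw [h5, blockMatrix_mulVec] at h4
      have h6 : ∀ i ∈ Finset.range (n ^ k), X (idx b) i * extend (v₀ a) i =
          ∑ j ∈ Finset.range (n ^ k), X (idx b) i * V i j * y j := by
        intro i hi
        rw [hy i (Finset.mem_range.mp hi), Finset.mul_sum]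
        exact Finset.sum_congr rfl fun j _ => by ring
      rw [Finset.sum_congr rfl h6, Finset.sum_comm] at h4
      have h7 : ∀ j ∈ Finset.range (n ^ k),
          ∑ i ∈ Finset.range (n ^ k), X (idx b) i * V i j * y j = V (idx b) j * d j * y j := by
        intro j hj
        rw [← Finset.sum_mul, hcol _ (idx_lt b) _ (Finset.mem_range.mp hj)]
      rw [Finset.sum_congr rfl h7, Pi.smul_apply, smul_eq_mul, hy _ (idx_lt b), Finset.mul_sum,
        ← sub_eq_zero, ← Finset.sum_sub_distrib] at h4
      rw [← h4]
      exact Finset.sum_congr rfl fun j _ => by ring)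
    have h8 : v₀ a = ∑ t : Fin r, y (σ t) • rowTensor n k (v t) := by
      ext b
      have h9 := hsum (fun t => y (Nat.nth (fun j => d j ≠ 0) t)) _ (idx_lt b)
      have h10 : ∀ i ∈ Finset.range (n ^ k), V (idx b) i * (if d i ≠ 0 then
          (fun t => y (Nat.nth (fun j => d j ≠ 0) t)) (Nat.count (fun j => d j ≠ 0) i) else 0) =
          V (idx b) i * y i := by
        intro i hi
        by_cases h : d i = 0
        · have := h3 i (Finset.mem_range.mp hi)
          simp only [h, zero_sub, neg_mul, neg_eq_zero] at this
          rw [(mul_eq_zero.mp this).resolve_left hlam0, if_neg (not_not.mpr h)]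
        · rw [if_pos h]
          simp only
          rw [Nat.nth_count (p := fun j => d j ≠ 0) h]
      rw [Finset.sum_congr rfl h10, ← hy _ (idx_lt b), extend_idx, Finset.sum_range] at h9
      rw [← h9, Finset.sum_apply]
      refine Finset.sum_congr rfl fun t _ => ?_
      rw [← hσc t, Nat.nth_count (p := fun j => d j ≠ 0) (hσd t), hσc t]
      rfl
    rw [h8]
    exact Submodule.sum_mem _ fun t _ => Submodule.smul_mem _ _ (Submodule.subset_span ⟨t, rfl⟩)

end

/-- Rows of the inverse matrix are dual to the columns; selecting both by the same predicate
preserves duality. -/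
theorem selected_dual {N : ℕ} {V Y v Φ : ℕ → ℕ → F} {p : ℕ → Prop} [DecidablePred p]
    (hY : ∀ i < N, ∀ j < N, ∑ z ∈ Finset.range N, Y i z * V z j = if i = j then 1 else 0)
    (hr : r = Nat.count p N)
    (hv : ∀ i j, v i j = if i < r ∧ j < N then V j (Nat.nth p i) else 0)
    (hΦ : ∀ i j, Φ i j = if i < r ∧ j < N then Y (Nat.nth p i) j else 0) :
    ∀ x < r, ∀ y < r, ∑ z ∈ Finset.range N, Φ x z * v y z = if x = y then 1 else 0 := by
  intro x hx y hy
  obtain ⟨i, hi, -, hi2, hi3⟩ := exists_of_lt_count (hr ▸ hx)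
  obtain ⟨j, hj, -, hj2, hj3⟩ := exists_of_lt_count (hr ▸ hy)
  have h : i = j ↔ x = y := ⟨fun h => by rw [← hi2, ← hj2, h], fun h => by rw [← hi3, ← hj3, h]⟩
  rw [← if_congr h rfl rfl, ← hY i hi j hj]
  refine Finset.sum_congr rfl fun z hz => ?_
  have hz' := Finset.mem_range.mp hz
  rw [hΦ, hv, if_pos ⟨hx, hz'⟩, if_pos ⟨hy, hz'⟩, hi3, hj3]

end TensorDecomp
end

noncomputable section
namespace TensorDecomp

open Program

/-! ### Programs as parts of longer programs

Parameters of the problem are kept in the registers `0` and `20` to `26`. All facts about a part of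
a program are stated for the final state of the whole program, which is possible since no
array is overwritten. -/

/-- The registers holding the parameters. -/
def dims : List ℕ := [0, 20, 21, 22, 23, 24, 25, 26]

/-- The values of the parameters. -/
structure Params (n m : ℕ) (ρ : ℕ → ℕ) : Prop where
  side : ρ 0 = n
  ordV : ρ 20 = (m + 1) / 2
  ordW : ρ 21 = m / 2
  dimV : ρ 22 = n ^ ((m + 1) / 2)
  dimW : ρ 23 = n ^ (m / 2)
  sqV : ρ 24 = n ^ ((m + 1) / 2) * n ^ ((m + 1) / 2)
  sqW : ρ 25 = n ^ (m / 2) * n ^ (m / 2)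
  bound : ρ 26 = ((m + 1) / 2 + 2) * (n ^ ((m + 1) / 2) * n ^ ((m + 1) / 2)) + 1

theorem Params.congr {n m : ℕ} {ρ ρ' : ℕ → ℕ} (h : Params n m ρ)
    (h' : ∀ x ∈ dims, ρ' x = ρ x) : Params n m ρ' := by
  simp only [dims, List.mem_cons, List.not_mem_nil, or_false, forall_eq_or_imp, forall_eq] at h'
  obtain ⟨h1, h2, h3, h4, h5, h6, h7, h8⟩ := h'
  exact ⟨h1.trans h.side, h2.trans h.ordV, h3.trans h.ordW, h4.trans h.dimV, h5.trans h.dimW,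
    h6.trans h.sqV, h7.trans h.sqW, h8.trans h.bound⟩

variable {F : Type*} [RCLike F] {O : DiagOracle F} {n m : ℕ} {l l2 : List Program} {i : ℕ}
  {S : Machine F}

theorem runs_eq_drop (l : List Program) (i : ℕ) (S : Machine F) :
    runs O l S = runs O (l.drop i) (runs O (l.take i) S) := by
  conv_lhs => rw [← List.take_append_drop i l]
  exact runs_append _ _ _

theorem drop_succ_eq {p : Program} (h : l.drop i = p :: l2) : l.drop (i + 1) = l2 := by
  rw [← List.tail_drop, h]
  rfl

theorem runs_drop_frame (l : List Program) (i : ℕ) (S : Machine F) :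
    Frame (seqs (l.drop i)).regs (seqs (l.drop i)).arrs (runs O l S) (runs O (l.take i) S) := by
  rw [runs_eq_drop l i]
  exact (runs_frame _ _).symm

theorem runs_nat_eq {x : ℕ} (i : ℕ) (hx : x ∉ (seqs (l.drop i)).regs) :
    (runs O l S).nat x = (runs O (l.take i) S).nat x :=
  ((runs_drop_frame l i S).1 x hx).symm

theorem runs_eq_of_drop {p : Program} (h : l.drop i = p :: l2) :
    runs O l S = runs O l2 (p.run O (runs O (l.take i) S)) := by
  rw [runs_eq_drop l i, h]
  rfl

theorem take_field_eq_zero {A : ℕ} (hS : ∀ i j, S.field A i j = 0)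
    (hA : A ∉ (seqs (l.take i)).arrs) (x y : ℕ) : (runs O (l.take i) S).field A x y = 0 := by
  rw [(runs_frame _ _).2 A hA, hS]

/-- States that occur while a part of the program runs, seen from the final state. -/
structure During (n m : ℕ) (R : List ℕ) (S' S : Machine F) : Prop where
  params : Params n m S'.nat
  field : ∀ A ∈ R, S'.field A = S.field A

theorem NatExpr.val_eq_of_params {ρ ρ' : ℕ → ℕ} (h : ∀ x ∈ dims, ρ' x = ρ x) {e : NatExpr}
    (he : ∀ x ∈ e.vars, x ∈ dims) : e.val ρ' = e.val ρ :=
  NatExpr.val_congr fun x hx => h x (he x hx)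

/-- The reads and writes of a part of a program do not interfere with what follows. -/
abbrev FillSide (A : ℕ) (a b c : NatExpr) (prep : Program) (e : FieldExpr) (l2 : List Program) : Prop :=
  (∀ x ∈ dims, x ∉ (seqs (fill A a b c prep e :: l2)).regs) ∧
    (∀ x ∈ a.vars ++ (b.vars ++ c.vars), x ∈ dims) ∧
    (∀ B ∈ e.reads, B ∉ (seqs (fill A a b c prep e :: l2)).arrs) ∧
    A ∉ (seqs l2).arrs ∧ A ≠ 3 ∧ prep.arrs = [] ∧ ∀ x ∈ [10, 11, 12], x ∉ prep.regs

theorem runs_fill {A : ℕ} {a b c : NatExpr} {prep : Program} {e : FieldExpr} (seg : ℕ)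
    (hl : l.drop seg = fill A a b c prep e :: l2)
    (hc : FillSide A a b c prep e l2)
    (hS : Params n m (runs O l S).nat) {a₀ b₀ c₀ : ℕ} (ha : a.val (runs O l S).nat = a₀)
    (hb : b.val (runs O l S).nat = b₀) (hcv : c.val (runs O l S).nat = c₀) {val : ℕ → ℕ → ℕ → F}
    (hval : ∀ i < a₀, ∀ j < b₀, ∀ z < c₀, ∀ S' : Machine F,
      During n m e.reads S' (runs O l S) → S'.nat 10 = i → S'.nat 11 = j → S'.nat 12 = z →
      During n m e.reads (prep.run O S') (runs O l S) → (prep.run O S').nat 10 = i →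
      (prep.run O S').nat 11 = j → (prep.run O S').nat 12 = z → e.val (prep.run O S') = val i j z) :
    ∀ i < a₀, ∀ j < b₀, (runs O l S).field A i j = ∑ z ∈ Finset.range c₀, val i j z := by
  intro i hi j hj
  obtain ⟨h1, h2, h3, h4, h5, h6, h7⟩ := hc
  have hF := runs_drop_frame (O := O) l seg S
  have hrun := runs_eq_of_drop (O := O) (S := S) hl
  rw [hl] at hF
  set Sf := runs O l S with hSf
  set S1 := runs O (l.take seg) S with hS1
  have hn1 : ∀ x ∈ dims, S1.nat x = Sf.nat x := fun x hx =>
    hF.1 x (h1 x hx)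
  have hdim : ∀ x, x ∈ a.vars ++ (b.vars ++ c.vars) → x ∉ [10, 11, 12] ∧ x ∉ prep.regs := by
    intro x hx
    have := h1 x (h2 x hx)
    simp [seqs, fill, sum, regs] at this
    simp
    tauto
  have ha1 : a.val S1.nat = a₀ :=
    (NatExpr.val_eq_of_params hn1 fun x hx => h2 x (by simp [hx])).trans ha
  have hb1 : b.val S1.nat = b₀ :=
    (NatExpr.val_eq_of_params hn1 fun x hx => h2 x (by simp [hx])).trans hb
  have hc1 : c.val S1.nat = c₀ :=
    (NatExpr.val_eq_of_params hn1 fun x hx => h2 x (by simp [hx])).trans hcv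
  rw [hrun, (runs_frame l2 _).2 A h4, ← hc1]
  refine run_fill h6 h5 ?_ ?_ ?_ (val := val) ?_ (ha1.symm ▸ hi) (hb1.symm ▸ hj)
  · intro x hx
    simp only [List.mem_cons] at hx
    rcases hx with rfl | rfl | rfl | hx
    · exact h7 _ (by simp)
    · exact h7 _ (by simp)
    · exact h7 _ (by simp)
    · exact (hdim x (List.mem_append_right _ hx)).2
  · exact fun x hx hxb => (hdim x (by simp [hxb])).1 hx
  · exact fun x hx hxc => (hdim x (by simp [hxc])).1 hx
  · intro i hi j hj z hz S' hF' h10 h11 h12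
    have hF2 : Frame (seqs (fill A a b c prep e :: l2)).regs
        (seqs (fill A a b c prep e :: l2)).arrs Sf S' :=
      (hF.trans hF').mono (fun x hx => by simp [seqs, regs] at hx ⊢; tauto)
        (fun x hx => by simp [seqs, arrs] at hx ⊢; tauto)
    have hD : During n m e.reads S' Sf :=
      ⟨hS.congr fun x hx => hF2.1 x (h1 x hx),
        fun B hB => hF2.2 B (h3 B hB)⟩
    have hpr : ∀ x ∈ dims, x ∉ prep.regs := by
      intro x hx
      have := h1 x hx
      simp [seqs, fill, sum, regs] at this
      tauto
    have hr : ∀ x, x ∉ prep.regs → (prep.run O S').nat x = S'.nat x :=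
      fun x hx => run_nat_of_notMem hx S'
    refine hval i (ha1 ▸ hi) j (hb1 ▸ hj) z (hc1 ▸ hz) S' hD h10 h11 h12
      ⟨hD.params.congr fun x hx => hr x (hpr x hx),
        fun B hB => ?_⟩ ?_ ?_ ?_
    · rw [run_field_of_notMem (by simp [h6]), hD.field B hB]
    · rw [hr 10 (h7 10 (by simp)), h10]
    · rw [hr 11 (h7 11 (by simp)), h11]
    · rw [hr 12 (h7 12 (by simp)), h12]

/-- The reads and writes of a part of a program do not interfere with what follows. -/
abbrev CheckSide (x : ℕ) (a b : NatExpr) (prep : Program) (t : Test) (l2 : List Program) : Prop :=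
  (∀ y ∈ 31 :: dims, y ∉ (seqs (check x a b prep t :: l2)).regs) ∧
    (∀ y ∈ a.vars ++ b.vars, y ∈ dims) ∧
    (∀ B ∈ t.reads, B ∉ (seqs (check x a b prep t :: l2)).arrs) ∧
    x ∉ (seqs l2).regs ∧ x ∉ [10, 11] ∧ x ∉ prep.regs ∧ prep.arrs = [] ∧
      ∀ y ∈ [10, 11], y ∉ prep.regs

theorem runs_check {x : ℕ} {a b : NatExpr} {prep : Program} {t : Test} (seg : ℕ)
    (hl : l.drop seg = check x a b prep t :: l2)
    (hc : CheckSide x a b prep t l2)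
    (hS : Params n m (runs O l S).nat) {a₀ b₀ : ℕ} (ha : a.val (runs O l S).nat = a₀)
    (hb : b.val (runs O l S).nat = b₀) {bad : ℕ → ℕ → Prop}
    (ht : ∀ i < a₀, ∀ j < b₀, ∀ S' : Machine F,
      During n m t.reads S' (runs O l S) → S'.nat 10 = i → S'.nat 11 = j →
      During n m t.reads (prep.run O S') (runs O l S) → (prep.run O S').nat 10 = i →
      (prep.run O S').nat 11 = j → (prep.run O S').nat 31 = (runs O l S).nat 31 →
      (t.Holds (prep.run O S') ↔ bad i j)) :
    (runs O l S).nat x ≠ 0 ↔ ∀ i < a₀, ∀ j < b₀, ¬ bad i j := by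
  obtain ⟨h1, h2, h3, h4, h5, h6, h7, h8⟩ := hc
  have hF := runs_drop_frame (O := O) l seg S
  have hrun := runs_eq_of_drop (O := O) (S := S) hl
  rw [hl] at hF
  set Sf := runs O l S with hSf
  set S1 := runs O (l.take seg) S with hS1
  have hn1 : ∀ x ∈ dims, S1.nat x = Sf.nat x := fun x hx =>
    hF.1 x (h1 x (List.mem_cons_of_mem _ hx))
  have hdim : ∀ y, y ∈ 31 :: dims → y ∉ x :: 10 :: 11 :: prep.regs := by
    intro y hy
    have := h1 y hy
    simp [seqs, check, regs] at this
    simp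
    tauto
  have ha1 : a.val S1.nat = a₀ :=
    (NatExpr.val_eq_of_params hn1 fun x hx => h2 x (by simp [hx])).trans ha
  have hb1 : b.val S1.nat = b₀ :=
    (NatExpr.val_eq_of_params hn1 fun x hx => h2 x (by simp [hx])).trans hb
  rw [hrun, (runs_frame l2 _).1 x h4, ← ha1, ← hb1]
  refine run_check h7 ?_ ?_ ?_ (h8 10 (by simp)) (bad := bad) ?_
  · simp only [List.mem_cons, List.not_mem_nil, or_false, not_or] at h5 ⊢
    exact ⟨h5.1, h5.2, h6⟩
  · intro hx
    exact hdim x (List.mem_cons_of_mem _ (h2 x (by simp [hx]))) (by simp)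
  · exact fun y hy => hdim y (List.mem_cons_of_mem _ (h2 y (by simp [hy])))
  · intro i hi j hj S' hF' h10 h11
    have hF2 : Frame (seqs (check x a b prep t :: l2)).regs
        (seqs (check x a b prep t :: l2)).arrs Sf S' :=
      (hF.trans hF').mono (fun x hx => by simp [seqs, regs] at hx ⊢; tauto)
        (fun x hx => by simp [seqs, arrs] at hx ⊢; tauto)
    have hD : During n m t.reads S' Sf :=
      ⟨hS.congr fun x hx => hF2.1 x (h1 x (List.mem_cons_of_mem _ hx)),
        fun B hB => hF2.2 B (h3 B hB)⟩
    have hpr : ∀ x ∈ 31 :: dims, x ∉ prep.regs := fun x hx h => hdim x hx (by simp [h])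
    have hr : ∀ x, x ∉ prep.regs → (prep.run O S').nat x = S'.nat x :=
      fun x hx => run_nat_of_notMem hx S'
    refine ht i (ha1 ▸ hi) j (hb1 ▸ hj) S' hD h10 h11
      ⟨hD.params.congr fun x hx => hr x (hpr x (List.mem_cons_of_mem _ hx)),
        fun B hB => ?_⟩ ?_ ?_
      ((hr 31 (hpr 31 (by simp))).trans (hF2.1 31 (h1 31 (by simp))))
    · rw [run_field_of_notMem (by simp [h7]), hD.field B hB]
    · rw [hr 10 (h8 10 (by simp)), h10]
    · rw [hr 11 (h8 11 (by simp)), h11]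

/-- The reads and writes of a part of a program do not interfere with what follows. -/
abbrev SelectSide (A x : ℕ) (a b : NatExpr) (t : Test) (e : FieldExpr) (l l2 : List Program) (seg : ℕ) : Prop :=
  (∀ y ∈ dims, y ∉ (seqs (select A x a b t e :: l2)).regs) ∧
    (∀ y ∈ a.vars ++ b.vars, y ∈ dims) ∧
    (∀ B ∈ t.reads ++ e.reads, B ∉ (seqs (select A x a b t e :: l2)).arrs) ∧
    A ∉ (seqs l2).arrs ∧ A ∉ (seqs (l.take seg)).arrs ∧ x ∉ [10, 11] ∧ x ∉ (seqs l2).regs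

theorem runs_select {A x : ℕ} {a b : NatExpr} {t : Test} {e : FieldExpr} (seg : ℕ)
    (hl : l.drop seg = select A x a b t e :: l2)
    (hc : SelectSide A x a b t e l l2 seg)
    (hS0 : ∀ i j, S.field A i j = 0) {a₀ b₀ : ℕ} (ha : a.val (runs O l S).nat = a₀)
    (hb : b.val (runs O l S).nat = b₀) {p : ℕ → Prop} [DecidablePred p] {val : ℕ → ℕ → F}
    (ht : ∀ i < a₀, ∀ S' : Machine F, (∀ B ∈ t.reads, S'.field B = (runs O l S).field B) →
      S'.nat 10 = i → (t.Holds S' ↔ p i))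
    (hval : ∀ i < a₀, ∀ j < b₀, ∀ S' : Machine F,
      (∀ B ∈ e.reads, S'.field B = (runs O l S).field B) → S'.nat 10 = i → S'.nat 11 = j →
      e.val S' = val i j) :
    (runs O l S).nat x = Nat.count p a₀ ∧ ∀ i j, (runs O l S).field A i j =
      if i < Nat.count p a₀ ∧ j < b₀ then val (Nat.nth p i) j else 0 := by
  obtain ⟨h1, h2, h3, h4, h5, h6, h7⟩ := hc
  have hF := runs_drop_frame (O := O) l seg S
  have hrun := runs_eq_of_drop (O := O) (S := S) hl
  rw [hl] at hF
  have hzero := take_field_eq_zero (O := O) hS0 h5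
  set Sf := runs O l S with hSf
  set S1 := runs O (l.take seg) S with hS1
  have hn1 : ∀ x ∈ dims, S1.nat x = Sf.nat x := fun x hx => hF.1 x (h1 x hx)
  have hdim : ∀ y, y ∈ dims → y ∉ [x, 10, 11] := by
    intro y hy
    have := h1 y hy
    simp [seqs, select, regs] at this
    simp
    tauto
  have ha1 : a.val S1.nat = a₀ :=
    (NatExpr.val_eq_of_params hn1 fun x hx => h2 x (by simp [hx])).trans ha
  have hb1 : b.val S1.nat = b₀ :=
    (NatExpr.val_eq_of_params hn1 fun x hx => h2 x (by simp [hx])).trans hb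
  rw [hrun, (runs_frame l2 _).1 x h7, (runs_frame l2 _).2 A h4, ← ha1, ← hb1]
  have hF2 : ∀ S', Frame (select A x a b t e).regs (select A x a b t e).arrs S1 S' →
      Frame (seqs (select A x a b t e :: l2)).regs
        (seqs (select A x a b t e :: l2)).arrs Sf S' := fun S' hF' =>
      (hF.trans hF').mono (fun x hx => by simp [seqs, regs] at hx ⊢; tauto)
        (fun x hx => by simp [seqs, arrs] at hx ⊢; tauto)
  refine run_select h6 ?_ ?_ hzero ?_ ?_
  · exact fun hx => hdim x (h2 x (by simp [hx])) (by simp)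
  · exact fun y hy hyb => hdim y (h2 y (by simp [hyb])) hy
  · exact fun i hi S' hF' h10 => ht i (ha1 ▸ hi) S'
      (fun B hB => (hF2 S' hF').2 B (h3 B (by simp [hB]))) h10
  · exact fun i hi _ j hj S' hF' h10 h11 => hval i (ha1 ▸ hi) j (hb1 ▸ hj) S'
      (fun B hB => (hF2 S' hF').2 B (h3 B (by simp [hB]))) h10 h11

/-- The reads and writes of a part of a program do not interfere with what follows. -/
abbrev DiagSide (A E V x : ℕ) (k : NatExpr) (l2 : List Program) : Prop :=
  (∀ y ∈ dims, y ∉ (seqs (diag A k E V x :: l2)).regs) ∧ (∀ y ∈ k.vars, y ∈ dims) ∧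
    A ∉ (seqs (diag A k E V x :: l2)).arrs ∧ E ∉ (seqs l2).arrs ∧ V ∉ (seqs l2).arrs ∧ E ≠ V ∧
    x ∉ (seqs l2).regs

theorem runs_diag (hO : O.IsCorrect) {A E V x : ℕ} {k : NatExpr} (seg : ℕ)
    (hl : l.drop seg = diag A k E V x :: l2)
    (hc : DiagSide A E V x k l2)
    {K : ℕ} (hK : k.val (runs O l S).nat = K) :
    ((runs O l S).nat x ≠ 0 ↔ ∃ (d : Fin K → F) (W : Matrix (Fin K) (Fin K) F),
      IsUnit W ∧ block ((runs O l S).field A) K K * W = W * Matrix.diagonal d) ∧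
    ((runs O l S).nat x ≠ 0 →
      IsUnit (block ((runs O l S).field V) K K) ∧
      block ((runs O l S).field A) K K * block ((runs O l S).field V) K K =
        block ((runs O l S).field V) K K *
          Matrix.diagonal fun j : Fin K => (runs O l S).field E 0 j) := by
  obtain ⟨h1, h2, h3, h4, h5, h6, h7⟩ := hc
  have hF := runs_drop_frame (O := O) l seg S
  have hrun := runs_eq_of_drop (O := O) (S := S) hl
  rw [hl] at hF
  have hk : k.val (runs O (l.take seg) S).nat = K := by
    rw [← hK]
    exact NatExpr.val_eq_of_params (fun x hx => hF.1 x (h1 x hx)) h2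
  have hA : (runs O l S).field A = (runs O (l.take seg) S).field A := (hF.2 A h3).symm
  rw [hA]
  rw [hrun, (runs_frame l2 _).1 x h7, (runs_frame l2 _).2 V h5, (runs_frame l2 _).2 E h4]
  exact run_diag hO h6 _ hk

namespace Program

/-- Given an `a × b` array `L`, compute a basis of its kernel. The basis vectors become the rows of
the array `P`, and the register `x` holds their number. -/
def kernel (L G E V P flag x : ℕ) (a b : NatExpr) : List Program :=
  [fill G b b a skip (.conj (.get L (.var 12) (.var 10)) * .get L (.var 12) (.var 11)),
    diag G b E V flag,
    select P x b b (.isZero (.get E (.const 0) (.var 10))) (.get V (.var 11) (.var 10))]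

end Program

/-- The reads and writes of a part of a program do not interfere with what follows. -/
abbrev KernelSide (L G E V P flag x : ℕ) (a b : NatExpr) (l l2 : List Program) (seg : ℕ) : Prop :=
  (∀ y ∈ dims, y ∉ 10 :: 11 :: 12 :: flag :: (seqs l2).regs) ∧
    (∀ y ∈ dims, y ≠ x) ∧ (∀ y ∈ a.vars ++ b.vars, y ∈ dims) ∧
    (L ∉ 3 :: G :: E :: V :: P :: (seqs l2).arrs) ∧ (G ∉ 3 :: E :: V :: P :: (seqs l2).arrs) ∧
    (E ∉ 3 :: V :: P :: (seqs l2).arrs) ∧ (V ∉ P :: (seqs l2).arrs) ∧ (P ∉ (seqs l2).arrs) ∧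
    P ∉ 3 :: G :: E :: V :: (seqs (l.take seg)).arrs ∧ x ∉ 10 :: 11 :: (seqs l2).regs ∧
    flag ∉ x :: 10 :: 11 :: (seqs l2).regs

theorem runs_kernel (hO : O.IsCorrect) {L G E V P flag x : ℕ} {a b : NatExpr} (seg : ℕ)
    (hl : l.drop seg = kernel L G E V P flag x a b ++ l2)
    (hc : KernelSide L G E V P flag x a b l l2 seg)
    (hS : Params n m (runs O l S).nat) (hS0 : ∀ i j, S.field P i j = 0) {a₀ b₀ : ℕ}
    (ha : a.val (runs O l S).nat = a₀) (hb : b.val (runs O l S).nat = b₀) :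
    IsKernelBasis ((runs O l S).field L) a₀ b₀ ((runs O l S).field P) ((runs O l S).nat x) ∧
      (runs O l S).nat x ≤ b₀ := by
  classical
  obtain ⟨h1, h2, h3, h4, h5, h6, h7, h8, h9, h10, h11⟩ := hc
  have hl0 : l.drop seg = fill G b b a skip
      (.conj (.get L (.var 12) (.var 10)) * .get L (.var 12) (.var 11)) :: diag G b E V flag ::
      select P x b b (.isZero (.get E (.const 0) (.var 10))) (.get V (.var 11) (.var 10)) :: l2 := hl
  have hl1 := drop_succ_eq hl0
  have hl2 := drop_succ_eq hl1
  have hab : ∀ y, y ∈ b.vars → y ∈ dims := fun y hy => h3 y (by simp [hy])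
  have haa : ∀ y, y ∈ a.vars → y ∈ dims := fun y hy => h3 y (by simp [hy])
  simp only [List.mem_cons, not_or] at h1 h4 h5 h6 h7 h9 h10 h11
  -- The selection relies on its target array still being zero, so the arrays written before it have
  -- to be known.
  have htake : (seqs (l.take (seg + 1 + 1))).arrs =
      (seqs (l.take seg)).arrs ++ [3, 3, G, E, V] := by
    have : l.take (seg + 1 + 1) = l.take seg ++ [fill G b b a skip
      (.conj (.get L (.var 12) (.var 10)) * .get L (.var 12) (.var 11)), diag G b E V flag] := by
      rw [add_assoc, List.take_add, hl0]
      rfl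
    rw [this]
    have happ : ∀ l l' : List Program, (seqs (l ++ l')).arrs = (seqs l).arrs ++ (seqs l').arrs := by
      intro l l'
      induction l with
      | nil => rfl
      | cons p l ih => simp [seqs, arrs, ih]
    rw [happ]
    rfl
  have hG := runs_fill (O := O) (S := S) seg hl0
    ⟨by
      intro y hy
      have := h1 y hy
      have := h2 y hy
      simp [seqs, fill, sum, select, regs]
      tauto, by
      simp only [List.mem_append]
      tauto, by
      intro B hB
      obtain rfl : B = L := by
        simpa [FieldExpr.reads, show ∀ d e : FieldExpr, (d * e).reads = d.reads ++ e.reads from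
          fun _ _ => rfl] using hB
      simp [seqs, fill, sum, select, arrs]
      tauto, by
      simp [seqs, select, arrs]
      tauto, h5.1, rfl, by simp [regs]⟩ hS hb hb ha
    (val := fun i j z => star ((runs O l S).field L z i) * (runs O l S).field L z j)
    (by
      intro i hi j hj z hz S' hD h10 h11 h12 _ _ _ _
      have hfield := hD.field L List.mem_cons_self
      simp only [run, FieldExpr.val_hMul, FieldExpr.val_conj, FieldExpr.val_get, NatExpr.val_var,
        Machine.tick_nat, Machine.tick_field, h10, h11, h12, hfield])
  have hdiag := runs_diag (S := S) hO (seg + 1) hl1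
    ⟨by
      intro y hy
      have := h1 y hy
      have := h2 y hy
      simp [seqs, select, regs]
      tauto, hab, by
      simp [seqs, select, arrs]
      tauto, by
      simp [seqs, select, arrs]
      tauto, by
      simp [seqs, select, arrs]
      tauto, h6.2.1, by
      simp [seqs, select, regs]
      tauto⟩ hb
  -- `G` is Hermitian, so this oracle call succeeds and its flag need not be tested by the program.
  obtain ⟨hV, hd⟩ := hdiag.2 (hdiag.1.mpr (exists_diagonalization (isHermitian_block hG)))
  obtain ⟨hcount, hP⟩ := runs_select (O := O) (S := S) (seg + 1 + 1) hl2
    ⟨by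
      intro y hy
      have := h1 y hy
      have := h2 y hy
      simp [seqs, select, regs]
      tauto, by
      simp only [List.mem_append]
      tauto, by
      intro B hB
      have hB : B = E ∨ B = V := by simpa [FieldExpr.reads, Test.reads] using hB
      simp [seqs, select, arrs]
      rcases hB with rfl | rfl <;> tauto, h8, by
      rw [htake]
      simp
      tauto, by
      simp
      tauto, h10.2.2⟩ hS0 hb hb
    (p := fun j => (runs O l S).field E 0 j = 0) (val := fun i j => (runs O l S).field V j i)
    (by
      intro i hi S' hS' h10
      simp only [Test.Holds, FieldExpr.val_get, NatExpr.val_var, NatExpr.val_const, h10,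
        hS' E (by simp [Test.reads, FieldExpr.reads])])
    (by
      intro i hi j hj S' hS' h10 h11
      simp only [FieldExpr.val_get, NatExpr.val_var, h10, h11,
        hS' V (by simp [FieldExpr.reads])])
  rw [hcount]
  exact ⟨IsKernelBasis.of_diagonalization hG hV hd rfl hP, Nat.count_le _⟩

end TensorDecomp
end

/-! ### Index arithmetic and the linear solver as programs -/

noncomputable section
namespace TensorDecomp

open Program

namespace Program

/-- The digits of the register `src`: quotient and remainder by `q2`, and those of the remainder
by `q`. -/
def blockPrep (src q q2 : ℕ) : Program :=
  seq (divMod 13 14 (.var src) (.var q2) (.var 26)) (divMod 15 16 (.var 14) (.var q) (.var 26))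

/-- Quotient and remainder of the register `src` by the dimension of `V`. -/
def splitPrep (src : ℕ) : Program := divMod 6 7 (.var src) (.var 22) (.var 26)

/-- Remainders of the registers `15` and `16` by a power of `n`. -/
def exchangePrep : Program :=
  seq (pow 17 (.var 0) (.var 13) (.var 26))
    (seq (divMod 4 18 (.var 15) (.var 17) (.var 26)) (divMod 5 19 (.var 16) (.var 17) (.var 26)))

/-- The Kronecker delta. -/
def delta (d e : NatExpr) : FieldExpr := .get 2 ((d - e) + (e - d)) (.const 0)

end Program

variable {F : Type*} [RCLike F] {O : DiagOracle F} {n m : ℕ} {l l2 : List Program} {i : ℕ}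
  {S : Machine F}

theorem run_blockPrep {src q q2 : ℕ} (hsrc : src ∉ [9, 13, 14, 15, 16])
    (hq : q ∉ [9, 13, 14, 15, 16]) (hq2 : q2 ∉ [9, 13, 14, 15, 16]) (h0 : 0 < S.nat q)
    (h02 : 0 < S.nat q2) (hb : S.nat src ≤ S.nat 26) :
    ((blockPrep src q q2).run O S).nat 13 = S.nat src / S.nat q2 ∧
      ((blockPrep src q q2).run O S).nat 15 = S.nat src % S.nat q2 / S.nat q ∧
      ((blockPrep src q q2).run O S).nat 16 = S.nat src % S.nat q2 % S.nat q ∧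
      ∀ x, x ∉ [9, 13, 14, 15, 16] → ((blockPrep src q q2).run O S).nat x = S.nat x := by
  simp only [List.mem_cons, List.not_mem_nil, or_false, not_or] at hsrc hq hq2
  obtain ⟨h1, h2⟩ := run_divMod (O := O) (d := 13) (r := 14) (c := .var src) (q := .var q2)
    (b := .var 26) (by decide) (by decide) (by decide)
    (by simp [NatExpr.vars]; omega) (by simp [NatExpr.vars]) (S := S) h02 hb
  set S1 := (divMod 13 14 (.var src) (.var q2) (.var 26)).run O S with hS1
  have hf : ∀ x, x ∉ [9, 13, 14] → S1.nat x = S.nat x := fun x hx =>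
    run_nat_of_notMem (by simp [divMod, regs] at hx ⊢; tauto) S
  simp only [NatExpr.val_var] at h1 h2
  obtain ⟨h3, h4⟩ := run_divMod (O := O) (d := 15) (r := 16) (c := .var 14) (q := .var q)
    (b := .var 26) (by decide) (by decide) (by decide)
    (by simp [NatExpr.vars]; omega) (by simp [NatExpr.vars]) (S := S1)
    (by
      simp only [NatExpr.val_var]
      rwa [hf q (by simp; omega)])
    (by
      simp only [NatExpr.val_var]
      rw [h2, hf 26 (by simp)]
      exact (Nat.mod_le _ _).trans hb)
  simp only [NatExpr.val_var] at h3 h4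
  rw [h2, hf q (by simp; omega)] at h3 h4
  refine ⟨?_, h3, h4, fun x hx => run_nat_of_notMem ?_ S⟩
  · rw [← h1]
    exact run_nat_of_notMem (by simp [divMod, regs]) S1
  · simp [blockPrep, divMod, regs] at hx ⊢
    tauto

theorem run_splitPrep {src : ℕ} (hsrc : src ∉ [6, 7, 9]) (h0 : 0 < S.nat 22)
    (hb : S.nat src ≤ S.nat 26) :
    ((splitPrep src).run O S).nat 6 = S.nat src / S.nat 22 ∧
      ((splitPrep src).run O S).nat 7 = S.nat src % S.nat 22 ∧
      ∀ x, x ∉ [6, 7, 9] → ((splitPrep src).run O S).nat x = S.nat x := by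
  simp only [List.mem_cons, List.not_mem_nil, or_false, not_or] at hsrc
  obtain ⟨h1, h2⟩ := run_divMod (O := O) (d := 6) (r := 7) (c := .var src) (q := .var 22)
    (b := .var 26) (by decide) (by decide) (by decide)
    (by simp [NatExpr.vars]) (by simp [NatExpr.vars]) (S := S) h0 hb
  refine ⟨h1, h2, fun x hx => run_nat_of_notMem ?_ S⟩
  simp [splitPrep, divMod, regs] at hx ⊢
  tauto

/-- Only the remainders are of interest; the exchanged numbers are then formed by addition and
subtraction inside expressions. Register `26` bounds all numbers to be divided and hence serves as
the number of rounds. -/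
theorem run_exchangePrep (h0 : 0 < S.nat 0) (h13 : S.nat 13 ≤ S.nat 26)
    (h15 : S.nat 15 ≤ S.nat 26) (h16 : S.nat 16 ≤ S.nat 26) :
    (exchangePrep.run O S).nat 18 = S.nat 15 % S.nat 0 ^ S.nat 13 ∧
      (exchangePrep.run O S).nat 19 = S.nat 16 % S.nat 0 ^ S.nat 13 ∧
      ∀ x, x ∉ [4, 5, 8, 9, 17, 18, 19] → (exchangePrep.run O S).nat x = S.nat x := by
  have h1 := run_pow (O := O) (r := 17) (a := .var 0) (i := .var 13) (b := .var 26) (by decide)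
    (by simp [NatExpr.vars]) (by simp [NatExpr.vars]) (by simp [NatExpr.vars]) (S := S) h13
  set S1 := (pow 17 (.var 0) (.var 13) (.var 26)).run O S with hS1
  have hf : ∀ x, x ∉ [8, 17] → S1.nat x = S.nat x := fun x hx =>
    run_nat_of_notMem (by simp [pow, regs] at hx ⊢; tauto) S
  simp only [NatExpr.val_var] at h1
  have hp : 0 < S1.nat 17 := by
    rw [h1]
    exact pow_pos h0 _
  obtain ⟨-, h3⟩ := run_divMod (O := O) (d := 4) (r := 18) (c := .var 15) (q := .var 17)
    (b := .var 26) (by decide) (by decide) (by decide)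
    (by simp [NatExpr.vars]) (by simp [NatExpr.vars]) (S := S1) hp
    (by
      simp only [NatExpr.val_var]
      rwa [hf 15 (by simp), hf 26 (by simp)])
  set S2 := (divMod 4 18 (.var 15) (.var 17) (.var 26)).run O S1 with hS2
  have hf2 : ∀ x, x ∉ [4, 9, 18] → S2.nat x = S1.nat x := fun x hx =>
    run_nat_of_notMem (by simp [divMod, regs] at hx ⊢; tauto) S1
  obtain ⟨-, h4⟩ := run_divMod (O := O) (d := 5) (r := 19) (c := .var 16) (q := .var 17)
    (b := .var 26) (by decide) (by decide) (by decide)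
    (by simp [NatExpr.vars]) (by simp [NatExpr.vars]) (S := S2)
    (by
      simp only [NatExpr.val_var]
      rwa [hf2 17 (by simp)])
    (by
      simp only [NatExpr.val_var]
      rwa [hf2 16 (by simp), hf2 26 (by simp), hf 16 (by simp), hf 26 (by simp)])
  simp only [NatExpr.val_var] at h3 h4
  rw [h1, hf 15 (by simp)] at h3
  rw [hf2 17 (by simp), h1, hf2 16 (by simp), hf 16 (by simp)] at h4
  refine ⟨?_, h4, fun x hx => run_nat_of_notMem ?_ S⟩
  · rw [← h3]
    exact run_nat_of_notMem (by simp [divMod, regs]) S2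
  · simp [exchangePrep, pow, divMod, regs] at hx ⊢
    tauto

/-- With truncated subtraction `(d - e) + (e - d)` is the distance of the two numbers, and column
`0` of the array `2` is the indicator of zero. -/
theorem val_delta {d e : NatExpr} (hJ : ∀ i, S.field 2 i 0 = if i = 0 then 1 else 0) :
    (delta d e).val S = if d.val S.nat = e.val S.nat then 1 else 0 := by
  simp only [delta, FieldExpr.val_get, NatExpr.val_hAdd, NatExpr.val_hSub, NatExpr.val_const, hJ]
  exact if_congr (by omega) rfl rfl

theorem Params.pos (hn : 1 ≤ n) (h : Params n m S.nat) :
    0 < S.nat 0 ∧ 0 < S.nat 22 ∧ 0 < S.nat 23 ∧ 0 < S.nat 24 ∧ 0 < S.nat 25 := by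
  have h1 : 0 < n ^ ((m + 1) / 2) := pow_pos hn _
  have h2 : 0 < n ^ (m / 2) := pow_pos hn _
  rw [h.side, h.dimV, h.dimW, h.sqV, h.sqW]
  exact ⟨hn, h1, h2, Nat.mul_pos h1 h1, Nat.mul_pos h2 h2⟩

namespace Program

/-- The coefficients of the system of linear equations `X A = B`, `K X = 0`, in homogeneous
form. -/
def systemEntry (A B K : ℕ) : FieldExpr :=
  (.one - delta (.var 13) (.const 1)) *
      (delta (.var 15) (.var 6) * (.one - delta (.var 11) (.var 24)) *
          .get A (.var 7) (.var 16) -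
        delta (.var 11) (.var 24) * .get B (.var 15) (.var 16)) +
    delta (.var 13) (.const 1) * (.one - delta (.var 11) (.var 24)) *
      delta (.var 16) (.var 7) * .get K (.var 15) (.var 6)

/-- Solve the equations `X A = B`, `K X = 0`, if possible. -/
def solve (A B K L G E V Q D X flag x : ℕ) : List Program :=
  fill L (.const 2 * .var 24) (.var 24 + .const 1) (.const 1)
      (seq (blockPrep 10 22 24) (splitPrep 11)) (systemEntry A B K) ::
    (kernel L G E V Q flag x (.const 2 * .var 24) (.var 24 + .const 1) ++
    [fill D (.const 1) (.const 1) (.var 24 + .const 1) skip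
        (.conj (.get Q (.var 12) (.var 24)) * .get Q (.var 12) (.var 24)),
      fill X (.var 22) (.var 22) (.var 24 + .const 1) skip
        (.conj (.get Q (.var 12) (.var 24)) * .get Q (.var 12) (.var 10 * .var 22 + .var 11) /
          .get D (.const 0) (.const 0))])

end Program

/-- Field expressions have no conditionals, so each case distinction is a product with Kronecker
deltas. Out-of-range reads in a case that does not apply are multiplied by zero. -/
theorem val_systemEntry {A B K x y N : ℕ} {X Y Z : ℕ → ℕ → F}
    (hJ : ∀ i, S.field 2 i 0 = if i = 0 then 1 else 0) (hA : S.field A = X) (hB : S.field B = Y)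
    (hK : S.field K = Z) (hx : x < 2 * (N * N)) (h24 : S.nat 24 = N * N)
    (h11 : S.nat 11 = y) (h13 : S.nat 13 = x / (N * N)) (h15 : S.nat 15 = x % (N * N) / N)
    (h16 : S.nat 16 = x % (N * N) % N) (h6 : S.nat 6 = y / N) (h7 : S.nat 7 = y % N) :
    (systemEntry A B K).val S = systemCoeff X Y Z N x y := by
  have hmod : x % (N * N) % N = x % N := Nat.mod_mul_left_mod x N N
  simp only [systemEntry, FieldExpr.val_hAdd, FieldExpr.val_hSub, FieldExpr.val_hMul,
    FieldExpr.val_one, val_delta hJ, FieldExpr.val_get, NatExpr.val_var, NatExpr.val_const, hA, hB,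
    hK, h24, h11, h13, h15, h16, h6, h7, systemCoeff, hmod]
  rcases Nat.lt_or_ge x (N * N) with hlt | hge
  · rw [Nat.div_eq_of_lt hlt, Nat.mod_eq_of_lt hlt]
    by_cases hy' : y = N * N
    · simp [hy']
    · by_cases h : x / N = y / N <;> simp [hy', h]
  · have h1 : x / (N * N) = 1 := Nat.div_eq_of_lt_le (by omega) (by omega)
    rw [h1]
    by_cases hy' : y = N * N
    · simp [hy']
    · by_cases h : x % N = y % N <;> simp [hy', h]

@[simp] theorem FieldExpr.reads_hAdd (d e : FieldExpr) : (d + e).reads = d.reads ++ e.reads := rfl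
@[simp] theorem FieldExpr.reads_hSub (d e : FieldExpr) : (d - e).reads = d.reads ++ e.reads := rfl
@[simp] theorem FieldExpr.reads_hMul (d e : FieldExpr) : (d * e).reads = d.reads ++ e.reads := rfl
@[simp] theorem FieldExpr.reads_hDiv (d e : FieldExpr) : (d / e).reads = d.reads ++ e.reads := rfl

theorem reads_systemEntry (A B K : ℕ) :
    (systemEntry A B K).reads = [2, 2, 2, A, 2, B, 2, 2, 2, K] := rfl

/-- The parts of `solve` do not interfere with each other and what follows. -/
abbrev SolveSide (A B K L G E V Q D X flag x : ℕ) (l l2 : List Program) (seg : ℕ) : Prop :=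
  FillSide L (.const 2 * .var 24) (.var 24 + .const 1) (.const 1)
      (seq (blockPrep 10 22 24) (splitPrep 11)) (systemEntry A B K)
      ((solve A B K L G E V Q D X flag x).drop 1 ++ l2) ∧
    KernelSide L G E V Q flag x (.const 2 * .var 24) (.var 24 + .const 1) l
      ((solve A B K L G E V Q D X flag x).drop 4 ++ l2) (seg + 1) ∧
    FillSide D (.const 1) (.const 1) (.var 24 + .const 1) skip
      (.conj (.get Q (.var 12) (.var 24)) * .get Q (.var 12) (.var 24))
      ((solve A B K L G E V Q D X flag x).drop 5 ++ l2) ∧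
    FillSide X (.var 22) (.var 22) (.var 24 + .const 1) skip
      (.conj (.get Q (.var 12) (.var 24)) * .get Q (.var 12) (.var 10 * .var 22 + .var 11) /
          .get D (.const 0) (.const 0)) l2

theorem runs_solve (hO : O.IsCorrect) (hn : 1 ≤ n) {A B K L G E V Q D X flag x : ℕ} (seg : ℕ)
    (hl : l.drop seg = solve A B K L G E V Q D X flag x ++ l2)
    (hc : SolveSide A B K L G E V Q D X flag x l l2 seg) (hS : Params n m (runs O l S).nat)
    (hJ : ∀ i, (runs O l S).field 2 i 0 = if i = 0 then 1 else 0)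
    (hS0 : ∀ i j, S.field Q i j = 0)
    (hsol : ∃ X₀ : ℕ → ℕ → F,
      (∀ i < n ^ ((m + 1) / 2), ∀ j < n ^ ((m + 1) / 2), ∑ z ∈ Finset.range (n ^ ((m + 1) / 2)),
        X₀ i z * (runs O l S).field A z j = (runs O l S).field B i j) ∧
      ∀ i < n ^ ((m + 1) / 2), ∀ j < n ^ ((m + 1) / 2), ∑ z ∈ Finset.range (n ^ ((m + 1) / 2)),
        (runs O l S).field K i z * X₀ z j = 0) :
    (∀ i < n ^ ((m + 1) / 2), ∀ j < n ^ ((m + 1) / 2), ∑ z ∈ Finset.range (n ^ ((m + 1) / 2)),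
        (runs O l S).field X i z * (runs O l S).field A z j = (runs O l S).field B i j) ∧
      ∀ i < n ^ ((m + 1) / 2), ∀ j < n ^ ((m + 1) / 2), ∑ z ∈ Finset.range (n ^ ((m + 1) / 2)),
        (runs O l S).field K i z * (runs O l S).field X z j = 0 := by
  obtain ⟨hc1, hc2, hc3, hc4⟩ := hc
  have hl1 := drop_succ_eq (show l.drop seg = _ :: _ from hl)
  have hl2 := drop_succ_eq (show l.drop (seg + 1) = _ :: _ from hl1)
  have hl3 := drop_succ_eq (show l.drop (seg + 1 + 1) = _ :: _ from hl2)
  have hl4 := drop_succ_eq (show l.drop (seg + 1 + 1 + 1) = _ :: _ from hl3)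
  have hl5 := drop_succ_eq (show l.drop (seg + 1 + 1 + 1 + 1) = _ :: _ from hl4)
  have h24 : NatExpr.val (runs O l S).nat (.var 24) =
    n ^ ((m + 1) / 2) * n ^ ((m + 1) / 2) := hS.sqV
  have h22 : NatExpr.val (runs O l S).nat (.var 22) = n ^ ((m + 1) / 2) := hS.dimV
  have ha : NatExpr.val (runs O l S).nat (.const 2 * .var 24) =
      2 * (n ^ ((m + 1) / 2) * n ^ ((m + 1) / 2)) := by
    rw [NatExpr.val_hMul, h24, NatExpr.val_const]
  have hb : NatExpr.val (runs O l S).nat (.var 24 + .const 1) =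
      n ^ ((m + 1) / 2) * n ^ ((m + 1) / 2) + 1 := by
    rw [NatExpr.val_hAdd, h24, NatExpr.val_const]
  have hL := runs_fill (O := O) (S := S) seg (show l.drop seg = _ :: _ from hl) hc1 hS ha hb
    (NatExpr.val_const _ _) (val := fun i j _ => systemCoeff ((runs O l S).field A)
      ((runs O l S).field B) ((runs O l S).field K) (n ^ ((m + 1) / 2)) i j)
    (by
      intro i hi j hj z _ S' hD h10 h11 h12 hD' h10' h11' h12'
      obtain ⟨h0, h02, -, h04, -⟩ := hD.params.pos hn
      have hi' : i ≤ S'.nat 26 := by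
        rw [hD.params.bound, add_mul]
        omega
      have hj' : j ≤ S'.nat 26 := by
        rw [hD.params.bound, add_mul]
        omega
      obtain ⟨g13, g15, g16, gf⟩ := run_blockPrep (O := O) (S := S') (src := 10) (q := 22)
        (q2 := 24) (by decide) (by decide) (by decide) h02 h04 (h10 ▸ hi')
      set S1 := (blockPrep 10 22 24).run O S' with hS1
      obtain ⟨g6, g7, gf'⟩ := run_splitPrep (O := O) (S := S1) (src := 11) (by decide)
        (by rwa [gf 22 (by decide)]) (by
          rw [gf 11 (by decide), gf 26 (by decide), h11]
          exact hj')
      rw [gf 11 (by decide), gf 22 (by decide), h11, hD.params.dimV] at g6 g7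
      rw [h10, hD.params.sqV] at g13
      rw [h10, hD.params.sqV, hD.params.dimV] at g15 g16
      rw [run_seq, ← hS1] at hD' h10' h11' ⊢
      refine val_systemEntry (fun i => ?_) (hD'.field A (by simp [reads_systemEntry])) (hD'.field B (by simp [reads_systemEntry]))
        (hD'.field K (by simp [reads_systemEntry])) hi
        hD'.params.sqV h11' ?_ ?_ ?_ g6 g7
      · rw [hD'.field 2 (by simp [reads_systemEntry]), hJ]
      · rw [gf' 13 (by decide), g13]
      · rw [gf' 15 (by decide), g15]
      · rw [gf' 16 (by decide), g16])
  simp only [Finset.range_one, Finset.sum_singleton] at hL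
  obtain ⟨hQ, hs⟩ := runs_kernel (S := S) hO (seg + 1) hl1 hc2 hS hS0 ha hb
  have hD := runs_fill (O := O) (S := S) (seg + 1 + 1 + 1 + 1)
    (show l.drop (seg + 1 + 1 + 1 + 1) = _ :: _ from hl4) hc3 hS
    (NatExpr.val_const _ _) (NatExpr.val_const _ _) hb
    (val := fun i j z => star ((runs O l S).field Q z (n ^ ((m + 1) / 2) * n ^ ((m + 1) / 2))) *
      (runs O l S).field Q z (n ^ ((m + 1) / 2) * n ^ ((m + 1) / 2)))
    (by
      intro i hi j hj z _ S' _ _ _ _ hD' h10' h11' h12'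
      simp only [FieldExpr.val_hMul, FieldExpr.val_conj, FieldExpr.val_get, NatExpr.val_var, h12',
        hD'.params.sqV, hD'.field Q List.mem_cons_self])
    0 Nat.one_pos 0 Nat.one_pos
  have hX := runs_fill (O := O) (S := S) (seg + 1 + 1 + 1 + 1 + 1)
    (show l.drop (seg + 1 + 1 + 1 + 1 + 1) = _ :: _ from hl5) hc4 hS h22 h22 hb
    (val := fun i j z => star ((runs O l S).field Q z (n ^ ((m + 1) / 2) * n ^ ((m + 1) / 2))) *
      (runs O l S).field Q z (i * n ^ ((m + 1) / 2) + j) / (runs O l S).field D 0 0)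
    (by
      intro i hi j hj z _ S' _ _ _ _ hD' h10' h11' h12'
      simp only [FieldExpr.val_hMul, FieldExpr.val_hDiv, FieldExpr.val_conj, FieldExpr.val_get,
        NatExpr.val_var, NatExpr.val_hAdd, NatExpr.val_const, NatExpr.val_hMul, h10', h11', h12',
        hD'.params.sqV, hD'.params.dimV, hD'.field Q List.mem_cons_self,
        hD'.field D (by simp [FieldExpr.reads_hDiv, FieldExpr.reads])])
  exact system_solution hL hQ hD hX hs hsol

end TensorDecomp
end

noncomputable section
namespace TensorDecomp

open Program

/-! ### The program -/

namespace Program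

/-- The coefficients of the equations for `S²(U) ∩ I₂^⊥`. -/
def liftEntry : FieldExpr :=
  delta (.var 13) (.var 20 + .const 1) * (delta (.var 16) (.var 7) * .get 14 (.var 15) (.var 6)) +
    (.one - delta (.var 13) (.var 20 + .const 1)) *
      (delta (.var 15 * .var 22 + .var 16) (.var 11) -
        delta ((.var 15 - .var 18 + .var 19) * .var 22 + (.var 16 - .var 19 + .var 18)) (.var 11))

/-- The computation of the basis of `S²(U) ∩ I₂^⊥`. -/
def setupList : List Program :=
  fill 10 (.var 23) (.var 22) (.const 1) skip (.get 0 (.const 0) (.var 11 + .var 22 * .var 10)) ::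
  (kernel 10 11 12 13 14 37 30 (.var 23) (.var 22) ++
  fill 15 ((.var 20 + .const 2) * .var 24) (.var 24) (.const 1)
    (seq (blockPrep 10 22 24) (seq (splitPrep 11) exchangePrep)) liftEntry ::
  kernel 15 16 17 18 19 38 31 ((.var 20 + .const 2) * .var 24) (.var 24))

/-- The simultaneous diagonalization. -/
def diagList : List Program :=
  fill 20 (.var 22) (.var 22) (.var 24) skip
    (.get 1 (.const 0) (.var 12) * .get 19 (.var 12) (.var 10 * .var 22 + .var 11)) ::
  fill 21 (.var 22) (.var 22) (.var 24) skip
    (.get 1 (.const 1) (.var 12) * .get 19 (.var 12) (.var 10 * .var 22 + .var 11)) ::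
  (solve 21 20 14 22 23 24 25 26 27 28 39 34 ++
  diag 28 (.var 22) 29 30 36 ::
  fill 31 (.var 22) (.var 22) (.const 1) skip (delta (.var 10) (.var 11)) ::
  (solve 30 31 32 33 34 35 36 37 38 39 40 35 ++
  [select 40 32 (.var 22) (.var 22) (.not (.isZero (.get 29 (.const 0) (.var 10))))
      (.get 30 (.var 11) (.var 10)),
    select 41 33 (.var 22) (.var 22) (.not (.isZero (.get 29 (.const 0) (.var 10))))
      (.get 39 (.var 10) (.var 11))]))

/-- The verification of the result. -/
def checkList : List Program :=
  [fill 42 (.var 22) (.var 22) (.var 22) skip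
      (.get 41 (.var 10) (.var 12) * .get 40 (.var 11) (.var 12)),
    fill 43 (.var 24) (.var 22) (.var 24) (splitPrep 12)
      (.get 41 (.var 11) (.var 6) * .get 41 (.var 11) (.var 7) * .get 19 (.var 10) (.var 12)),
    fill 44 (.var 24) (.var 24) (.var 22) (splitPrep 11)
      (.get 43 (.var 10) (.var 12) * .get 40 (.var 12) (.var 6) * .get 40 (.var 12) (.var 7)),
    fill 45 (.const 1) (.var 22) (.var 24) skip
      (.get 1 (.const 0) (.var 12) * .get 43 (.var 12) (.var 11)),
    fill 46 (.const 1) (.var 22) (.var 24) skip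
      (.get 1 (.const 1) (.var 12) * .get 43 (.var 12) (.var 11)),
    fill 47 (.var 22) (.var 23) (.var 22) skip
      (.get 41 (.var 10) (.var 12) * .get 0 (.const 0) (.var 12 + .var 22 * .var 11)),
    check 41 (.var 22) (.var 22) skip
      (.and (.lt (.var 10) (.var 31)) (.and (.lt (.var 11) (.var 31))
        (.not (.isZero (.get 42 (.var 10) (.var 11) - delta (.var 10) (.var 11)))))),
    check 42 (.var 24) (.var 24) skip
      (.not (.isZero (.get 19 (.var 10) (.var 11) - .get 44 (.var 10) (.var 11)))),
    check 43 (.var 22) (.const 1) skip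
      (.and (.lt (.var 10) (.var 31))
        (.isZero (.get 45 (.const 0) (.var 10) * .get 46 (.const 0) (.var 10)))),
    check 44 (.var 22) (.var 22) skip
      (.and (.lt (.var 10) (.var 11)) (.and (.lt (.var 11) (.var 31))
        (.isZero (.get 45 (.const 0) (.var 10) * .get 46 (.const 0) (.var 11) -
          .get 45 (.const 0) (.var 11) * .get 46 (.const 0) (.var 10))))),
    check 45 (.var 22) ((.var 21 + .const 1) * .var 25) (seq (blockPrep 11 23 25) exchangePrep)
      (.not (.isZero (.get 47 (.var 10) (.var 15 - .var 18 + .var 19) *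
          .get 47 (.var 10) (.var 16 - .var 19 + .var 18) -
        .get 47 (.var 10) (.var 15) * .get 47 (.var 10) (.var 16))))]

/-- The main part of the program. -/
def mainList : List Program := setupList ++ (diagList ++ checkList)

end Program

theorem val_liftEntry {F : Type*} [RCLike F] {S : Machine F} {n k x y N : ℕ} {K : ℕ → ℕ → F}
    (hJ : ∀ i, S.field 2 i 0 = if i = 0 then 1 else 0) (hK : S.field 14 = K)
    (h20 : S.nat 20 = k) (h22 : S.nat 22 = N)
    (h11 : S.nat 11 = y) (h13 : S.nat 13 = x / (N * N)) (h15 : S.nat 15 = x % (N * N) / N)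
    (h16 : S.nat 16 = x % (N * N) % N) (h6 : S.nat 6 = y / N) (h7 : S.nat 7 = y % N)
    (h18 : S.nat 18 = x % (N * N) / N % n ^ (x / (N * N)))
    (h19 : S.nat 19 = x % (N * N) % N % n ^ (x / (N * N))) :
    liftEntry.val S = liftCoeff K n k N x y := by
  have hdiv : x % (N * N) / N * N + x % (N * N) % N = x % (N * N) := by
    rw [mul_comm]
    exact Nat.div_add_mod _ _
  simp only [liftEntry, FieldExpr.val_hAdd, FieldExpr.val_hSub, FieldExpr.val_hMul,
    FieldExpr.val_one, val_delta hJ, FieldExpr.val_get, NatExpr.val_var, NatExpr.val_const,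
    NatExpr.val_hAdd, NatExpr.val_hSub, NatExpr.val_hMul, hK, h20, h22, h11, h13, h15, h16, h6, h7,
    h18, h19, hdiv, liftCoeff, exchange]
  by_cases h : x / (N * N) = k + 1
  · rw [if_pos h, if_pos h]
    simp
  · rw [if_neg h, if_neg h]
    simp

section Facts

variable {F : Type*} [RCLike F] {O : DiagOracle F} {n m : ℕ} {S : Machine F} {T : Tensor F n m}

/-- That parts of the program do not interfere is a statement about finite lists of register and
array numbers, so it is settled by evaluation here and below. -/
theorem main_params (hS : Params n m S.nat) : Params n m (runs O mainList S).nat :=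
  hS.congr fun x hx => (runs_frame mainList S).1 x ((by decide +kernel :
    ∀ x ∈ dims, x ∉ (seqs mainList).regs) x hx)

theorem main_input {A : ℕ} (hA : A = 0 ∨ A = 1 ∨ A = 2 ∨ A = 32) :
    (runs O mainList S).field A = S.field A :=
  (runs_frame mainList S).2 A (by
    rcases hA with rfl | rfl | rfl | rfl <;> decide +kernel)

theorem main_delta (hJ : ∀ i, S.field 2 i 0 = if i = 0 then 1 else 0) (i : ℕ) :
    (runs O mainList S).field 2 i 0 = if i = 0 then 1 else 0 := by
  rw [main_input (by simp), hJ]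

theorem main_flatten (hS : Params n m S.nat)
    (hT : ∀ a b, S.field 0 0 (idx a + n ^ ((m + 1) / 2) * idx b) = flatten T a b)
    (b : Fin (m / 2) → Fin n) (a : Fin ((m + 1) / 2) → Fin n) :
    (runs O mainList S).field 10 (idx b) (idx a) = flatten T a b := by
  have hP := main_params (O := O) hS
  have h := runs_fill (O := O) (l := mainList) (S := S) 0 rfl (by decide +kernel) hP hP.dimW hP.dimV
    (NatExpr.val_const _ _)
    (val := fun i j _ => S.field 0 0 (j + n ^ ((m + 1) / 2) * i))
    (by
      intro i hi j hj z _ S' _ _ _ _ hD h10 h11 _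
      simp only [FieldExpr.val_get, NatExpr.val_hAdd, NatExpr.val_hMul, NatExpr.val_var,
        NatExpr.val_const, h10, h11, hD.params.dimV, hD.field 0 List.mem_cons_self,
        main_input (O := O) (S := S) (Or.inl rfl)])
    (idx b) (idx_lt b) (idx a) (idx_lt a)
  simpa [hT] using h

theorem main_kernel (hO : O.IsCorrect) (hS : Params n m S.nat)
    (h0 : ∀ A, A ∉ [0, 1, 2] → ∀ i j, S.field A i j = 0) :
    IsKernelBasis ((runs O mainList S).field 10) (n ^ (m / 2)) (n ^ ((m + 1) / 2))
      ((runs O mainList S).field 14) ((runs O mainList S).nat 30) ∧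
      (runs O mainList S).nat 30 ≤ n ^ ((m + 1) / 2) := by
  have hP := main_params (O := O) hS
  exact runs_kernel (l := mainList) (L := 10) (G := 11) (E := 12) (V := 13) (P := 14) (flag := 37)
    (x := 30) (a := .var 23) (b := .var 22)
    (l2 := mainList.drop 4) hO 1 rfl (by decide +kernel) hP (h0 14 (by decide)) hP.dimW hP.dimV

theorem main_lift_rows (hn : 1 ≤ n) (hS : Params n m S.nat)
    (hJ : ∀ i, S.field 2 i 0 = if i = 0 then 1 else 0) :
    ∀ r < ((m + 1) / 2 + 2) * (n ^ ((m + 1) / 2) * n ^ ((m + 1) / 2)),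
      ∀ y < n ^ ((m + 1) / 2) * n ^ ((m + 1) / 2), (runs O mainList S).field 15 r y =
        liftCoeff ((runs O mainList S).field 14) n ((m + 1) / 2) (n ^ ((m + 1) / 2)) r y := by
  have hP := main_params (O := O) hS
  have h := runs_fill (O := O) (l := mainList) (S := S) 4 rfl (by decide +kernel) hP
    (a₀ := ((m + 1) / 2 + 2) * (n ^ ((m + 1) / 2) * n ^ ((m + 1) / 2)))
    (by simp only [NatExpr.val_hMul, NatExpr.val_hAdd, NatExpr.val_var, NatExpr.val_const, hP.ordV,
      hP.sqV]) hP.sqV (NatExpr.val_const _ _)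
    (val := fun i j _ => liftCoeff ((runs O mainList S).field 14) n ((m + 1) / 2)
      (n ^ ((m + 1) / 2)) i j)
    (by
      intro i hi j hj z _ S' hD h10 h11 h12 hD' h10' h11' h12'
      obtain ⟨h0, h02, -, h04, -⟩ := hD.params.pos hn
      have hN2 : n ^ ((m + 1) / 2) * n ^ ((m + 1) / 2) ≤
          ((m + 1) / 2 + 2) * (n ^ ((m + 1) / 2) * n ^ ((m + 1) / 2)) :=
        Nat.le_mul_of_pos_left _ (by omega)
      have hi' : i ≤ S'.nat 26 := by
        rw [hD.params.bound]
        omega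
      have hj' : j ≤ S'.nat 26 := by
        rw [hD.params.bound]
        omega
      obtain ⟨g13, g15, g16, gf⟩ := run_blockPrep (O := O) (S := S') (src := 10) (q := 22)
        (q2 := 24) (by decide) (by decide) (by decide) h02 h04 (h10 ▸ hi')
      set S1 := (blockPrep 10 22 24).run O S' with hS1
      obtain ⟨g6, g7, gf'⟩ := run_splitPrep (O := O) (S := S1) (src := 11) (by decide)
        (by rwa [gf 22 (by decide)]) (by
          rw [gf 11 (by decide), gf 26 (by decide), h11]
          exact hj')
      rw [gf 11 (by decide), gf 22 (by decide), h11, hD.params.dimV] at g6 g7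
      rw [h10] at g13 g15 g16
      set S2 := (splitPrep 11).run O S1 with hS2
      obtain ⟨g18, g19, gf''⟩ := run_exchangePrep (O := O) (S := S2)
        (by rwa [gf' 0 (by decide), gf 0 (by decide)])
        (by
          rw [gf' 13 (by decide), g13, gf' 26 (by decide), gf 26 (by decide)]
          exact (Nat.div_le_self _ _).trans hi')
        (by
          rw [gf' 15 (by decide), g15, gf' 26 (by decide), gf 26 (by decide)]
          exact (Nat.div_le_self _ _).trans ((Nat.mod_le _ _).trans hi'))
        (by
          rw [gf' 16 (by decide), g16, gf' 26 (by decide), gf 26 (by decide)]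
          exact (Nat.mod_le _ _).trans ((Nat.mod_le _ _).trans hi'))
      rw [hD.params.sqV] at g13
      rw [hD.params.sqV, hD.params.dimV] at g15 g16
      rw [gf' 15 (by decide), g15, gf' 0 (by decide), gf 0 (by decide), hD.params.side,
        gf' 13 (by decide), g13] at g18
      rw [gf' 16 (by decide), g16, gf' 0 (by decide), gf 0 (by decide), hD.params.side,
        gf' 13 (by decide), g13] at g19
      have hrun : (seq (blockPrep 10 22 24) (seq (splitPrep 11) exchangePrep)).run O S' =
        exchangePrep.run O S2 := rfl
      rw [hrun] at hD' h10' h11' ⊢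
      refine val_liftEntry (fun i => ?_) (hD'.field 14 (by decide +kernel)) hD'.params.ordV
        hD'.params.dimV h11' ?_ ?_ ?_ ?_ ?_ g18 g19
      · rw [hD'.field 2 (by decide +kernel), main_delta hJ]
      · rw [gf'' 13 (by decide), gf' 13 (by decide), g13]
      · rw [gf'' 15 (by decide), gf' 15 (by decide), g15]
      · rw [gf'' 16 (by decide), gf' 16 (by decide), g16]
      · rw [gf'' 6 (by decide), g6]
      · rw [gf'' 7 (by decide), g7])
  simpa using h

theorem main_lift_kernel (hO : O.IsCorrect) (hS : Params n m S.nat)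
    (h0 : ∀ A, A ∉ [0, 1, 2] → ∀ i j, S.field A i j = 0) :
    IsKernelBasis ((runs O mainList S).field 15)
      (((m + 1) / 2 + 2) * (n ^ ((m + 1) / 2) * n ^ ((m + 1) / 2)))
      (n ^ ((m + 1) / 2) * n ^ ((m + 1) / 2))
      ((runs O mainList S).field 19) ((runs O mainList S).nat 31) := by
  have hP := main_params (O := O) hS
  exact (runs_kernel (l := mainList) (L := 15) (G := 16) (E := 17) (V := 18) (P := 19) (flag := 38)
    (x := 31) (a := (.var 20 + .const 2) * .var 24) (b := .var 24)
    (l2 := mainList.drop 8) hO 5 rfl (by decide +kernel) hP (h0 19 (by decide))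
    (by simp only [NatExpr.val_hMul, NatExpr.val_hAdd, NatExpr.val_var, NatExpr.val_const, hP.ordV,
      hP.sqV]) hP.sqV).1

/-- The program computes a basis of `S²(U) ∩ I₂^⊥`. -/
theorem main_lifted (hO : O.IsCorrect) (hn : 1 ≤ n) (hS : Params n m S.nat)
    (hJ : ∀ i, S.field 2 i 0 = if i = 0 then 1 else 0)
    (h0 : ∀ A, A ∉ [0, 1, 2] → ∀ i j, S.field A i j = 0)
    (hT : ∀ a b, S.field 0 0 (idx a + n ^ ((m + 1) / 2) * idx b) = flatten T a b) :
    LinearIndependent F (fun t : Fin ((runs O mainList S).nat 31) =>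
      rowMatrix n ((m + 1) / 2) ((runs O mainList S).field 19 t)) ∧
    ∀ M, M ∈ Submodule.span F (Set.range fun t : Fin ((runs O mainList S).nat 31) =>
        rowMatrix n ((m + 1) / 2) ((runs O mainList S).field 19 t)) ↔
      M ∈ symSquare (flatRange T) ∧ PrefixInvariant M := by
  obtain ⟨hK, hs⟩ := main_kernel hO hS h0
  exact IsKernelBasis.lifted (main_flatten hS hT) hK hs (main_lift_rows hn hS hJ)
    (main_lift_kernel hO hS h0)

theorem main_contract_left (hS : Params n m S.nat) :
    ∀ x < n ^ ((m + 1) / 2), ∀ y < n ^ ((m + 1) / 2), (runs O mainList S).field 20 x y =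
      ∑ z ∈ Finset.range (n ^ ((m + 1) / 2) * n ^ ((m + 1) / 2)),
        S.field 1 0 z * (runs O mainList S).field 19 z (x * n ^ ((m + 1) / 2) + y) := by
  have hP := main_params (O := O) hS
  refine runs_fill (O := O) (l := mainList) (S := S) 8 rfl (by decide +kernel) hP hP.dimV hP.dimV
    hP.sqV (fun i hi j hj z _ S' _ _ _ _ hD h10 h11 h12 => ?_)
  rw [← main_input (O := O) (S := S) (Or.inr (Or.inl rfl))]
  simp only [FieldExpr.val_hMul, FieldExpr.val_get, NatExpr.val_hAdd, NatExpr.val_hMul,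
    NatExpr.val_var, NatExpr.val_const, h10, h11, h12, hD.params.dimV,
    hD.field 1 (by decide +kernel), hD.field 19 (by decide +kernel)]

theorem main_contract_right (hS : Params n m S.nat) :
    ∀ x < n ^ ((m + 1) / 2), ∀ y < n ^ ((m + 1) / 2), (runs O mainList S).field 21 x y =
      ∑ z ∈ Finset.range (n ^ ((m + 1) / 2) * n ^ ((m + 1) / 2)),
        S.field 1 1 z * (runs O mainList S).field 19 z (x * n ^ ((m + 1) / 2) + y) := by
  have hP := main_params (O := O) hS
  refine runs_fill (O := O) (l := mainList) (S := S) 9 rfl (by decide +kernel) hP hP.dimV hP.dimV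
    hP.sqV (fun i hi j hj z _ S' _ _ _ _ hD h10 h11 h12 => ?_)
  rw [← main_input (O := O) (S := S) (Or.inr (Or.inl rfl))]
  simp only [FieldExpr.val_hMul, FieldExpr.val_get, NatExpr.val_hAdd, NatExpr.val_hMul,
    NatExpr.val_var, NatExpr.val_const, h10, h11, h12, hD.params.dimV,
    hD.field 1 (by decide +kernel), hD.field 19 (by decide +kernel)]

theorem main_solve (hO : O.IsCorrect) (hn : 1 ≤ n) (hS : Params n m S.nat)
    (hJ : ∀ i, S.field 2 i 0 = if i = 0 then 1 else 0)
    (h0 : ∀ A, A ∉ [0, 1, 2] → ∀ i j, S.field A i j = 0)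
    (hsol : ∃ X₀ : ℕ → ℕ → F,
      (∀ i < n ^ ((m + 1) / 2), ∀ j < n ^ ((m + 1) / 2), ∑ z ∈ Finset.range (n ^ ((m + 1) / 2)),
        X₀ i z * (runs O mainList S).field 21 z j = (runs O mainList S).field 20 i j) ∧
      ∀ i < n ^ ((m + 1) / 2), ∀ j < n ^ ((m + 1) / 2), ∑ z ∈ Finset.range (n ^ ((m + 1) / 2)),
        (runs O mainList S).field 14 i z * X₀ z j = 0) :
    (∀ i < n ^ ((m + 1) / 2), ∀ j < n ^ ((m + 1) / 2), ∑ z ∈ Finset.range (n ^ ((m + 1) / 2)),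
        (runs O mainList S).field 28 i z * (runs O mainList S).field 21 z j =
          (runs O mainList S).field 20 i j) ∧
      ∀ i < n ^ ((m + 1) / 2), ∀ j < n ^ ((m + 1) / 2), ∑ z ∈ Finset.range (n ^ ((m + 1) / 2)),
        (runs O mainList S).field 14 i z * (runs O mainList S).field 28 z j = 0 :=
  runs_solve (l := mainList) (l2 := mainList.drop 16) hO hn 10 rfl
    ⟨by decide +kernel, by decide +kernel, by decide +kernel, by decide +kernel⟩
    (main_params hS) (main_delta hJ) (h0 26 (by decide)) hsol

theorem main_diag (hO : O.IsCorrect) (hS : Params n m S.nat) :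
    ((runs O mainList S).nat 36 ≠ 0 ↔
      ∃ (d : Fin (n ^ ((m + 1) / 2)) → F)
        (W : Matrix (Fin (n ^ ((m + 1) / 2))) (Fin (n ^ ((m + 1) / 2))) F), IsUnit W ∧
        block ((runs O mainList S).field 28) (n ^ ((m + 1) / 2)) (n ^ ((m + 1) / 2)) * W =
          W * Matrix.diagonal d) ∧
    ((runs O mainList S).nat 36 ≠ 0 →
      IsUnit (block ((runs O mainList S).field 30) (n ^ ((m + 1) / 2)) (n ^ ((m + 1) / 2))) ∧
      block ((runs O mainList S).field 28) (n ^ ((m + 1) / 2)) (n ^ ((m + 1) / 2)) *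
        block ((runs O mainList S).field 30) (n ^ ((m + 1) / 2)) (n ^ ((m + 1) / 2)) =
        block ((runs O mainList S).field 30) (n ^ ((m + 1) / 2)) (n ^ ((m + 1) / 2)) *
          Matrix.diagonal fun j : Fin (n ^ ((m + 1) / 2)) => (runs O mainList S).field 29 0 j) :=
  runs_diag (l := mainList) (l2 := mainList.drop 17) hO 16 rfl (by decide +kernel)
    (main_params hS).dimV

/-- If the matrix is diagonalizable, the program inverts the matrix of eigenvectors. -/
theorem main_inverse (hO : O.IsCorrect) (hn : 1 ≤ n) (hS : Params n m S.nat)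
    (hJ : ∀ i, S.field 2 i 0 = if i = 0 then 1 else 0)
    (h0 : ∀ A, A ∉ [0, 1, 2] → ∀ i j, S.field A i j = 0)
    (hV : IsUnit (block ((runs O mainList S).field 30) (n ^ ((m + 1) / 2))
      (n ^ ((m + 1) / 2)))) :
    ∀ i < n ^ ((m + 1) / 2), ∀ j < n ^ ((m + 1) / 2), ∑ z ∈ Finset.range (n ^ ((m + 1) / 2)),
        (runs O mainList S).field 39 i z * (runs O mainList S).field 30 z j =
          if i = j then 1 else 0 := by
  have hP := main_params (O := O) hS
  have hI : ∀ i < n ^ ((m + 1) / 2), ∀ j < n ^ ((m + 1) / 2),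
      (runs O mainList S).field 31 i j = if i = j then 1 else 0 := by
    have h := runs_fill (O := O) (l := mainList) (S := S) 17 rfl (by decide +kernel) hP hP.dimV
      hP.dimV (NatExpr.val_const _ _) (val := fun i j _ => if i = j then 1 else 0)
      (fun i hi j hj z _ S' _ _ _ _ hD h10 h11 h12 => by
        rw [val_delta fun i => by rw [hD.field 2 (by decide +kernel), main_delta hJ]]
        simp only [NatExpr.val_var, h10, h11])
    simpa using h
  -- The array `32` is never written. As the matrix `K` of the solver it makes the equation `K X =
  -- 0` void, so the solver computes a left inverse.
  have hz : (runs O mainList S).field 32 = fun _ _ => 0 := by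
    rw [main_input (by simp)]
    exact funext fun i => funext fun j => h0 32 (by decide) i j
  intro i hi j hj
  rw [← hI i hi j hj]
  refine (runs_solve (l := mainList) (l2 := mainList.drop 24) hO hn 18 rfl
    ⟨by decide +kernel, by decide +kernel, by decide +kernel, by decide +kernel⟩
    (main_params hS) (main_delta hJ) (h0 37 (by decide)) ?_).1 i hi j hj
  obtain ⟨W, hW⟩ := hV.exists_left_inv
  refine ⟨fun i j => if h : i < n ^ ((m + 1) / 2) ∧ j < n ^ ((m + 1) / 2) then
    W ⟨i, h.1⟩ ⟨j, h.2⟩ else 0, fun i hi j hj => ?_, fun i hi j hj => by simp [hz]⟩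
  have h := congrFun (congrFun hW ⟨i, hi⟩) ⟨j, hj⟩
  rw [Matrix.mul_apply] at h
  rw [hI i hi j hj, Finset.sum_range]
  simpa [Matrix.one_apply, block, hi] using h

-- Both selections use the same eigenvalues, so rows of the arrays `40` and `41` with the same
-- number belong to the same eigenvector.
open Classical in
theorem main_select (hS : Params n m S.nat)
    (h0 : ∀ A, A ∉ [0, 1, 2] → ∀ i j, S.field A i j = 0) :
    (runs O mainList S).nat 32 =
        Nat.count (fun j => (runs O mainList S).field 29 0 j ≠ 0) (n ^ ((m + 1) / 2)) ∧
      (∀ i j, (runs O mainList S).field 40 i j =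
        if i < (runs O mainList S).nat 32 ∧ j < n ^ ((m + 1) / 2) then
          (runs O mainList S).field 30 j
            (Nat.nth (fun j => (runs O mainList S).field 29 0 j ≠ 0) i) else 0) ∧
      ∀ i j, (runs O mainList S).field 41 i j =
        if i < (runs O mainList S).nat 32 ∧ j < n ^ ((m + 1) / 2) then
          (runs O mainList S).field 39
            (Nat.nth (fun j => (runs O mainList S).field 29 0 j ≠ 0) i) j else 0 := by
  have hP := main_params (O := O) hS
  obtain ⟨h1, h2⟩ := runs_select (O := O) (l := mainList) (S := S) 24 rfl (by decide +kernel)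
    (h0 40 (by decide)) hP.dimV hP.dimV
    (p := fun j => (runs O mainList S).field 29 0 j ≠ 0)
    (val := fun i j => (runs O mainList S).field 30 j i)
    (fun i hi S' hS' h10 => by
      simp only [Test.Holds, FieldExpr.val_get, NatExpr.val_var, NatExpr.val_const, h10,
        hS' 29 (by decide +kernel), ne_eq])
    (fun i hi j hj S' hS' h10 h11 => by
      simp only [FieldExpr.val_get, NatExpr.val_var, h10, h11, hS' 30 (by decide +kernel)])
  obtain ⟨-, h3⟩ := runs_select (O := O) (l := mainList) (S := S) 25 rfl (by decide +kernel)
    (h0 41 (by decide)) hP.dimV hP.dimV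
    (p := fun j => (runs O mainList S).field 29 0 j ≠ 0)
    (val := fun i j => (runs O mainList S).field 39 i j)
    (fun i hi S' hS' h10 => by
      simp only [Test.Holds, FieldExpr.val_get, NatExpr.val_var, NatExpr.val_const, h10,
        hS' 29 (by decide +kernel), ne_eq])
    (fun i hi j hj S' hS' h10 h11 => by
      simp only [FieldExpr.val_get, NatExpr.val_var, h10, h11, hS' 39 (by decide +kernel)])
  rw [h1]
  exact ⟨rfl, h2, h3⟩

end Facts

end TensorDecomp
end

/-! ### The verification part of the program -/

noncomputable section
namespace TensorDecomp

open Program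

variable {F : Type*} [RCLike F] {O : DiagOracle F} {n m : ℕ} {S : Machine F} {T : Tensor F n m}

theorem mul_self_le_bound {N : ℕ} (k : ℕ) : N * N ≤ (k + 2) * (N * N) + 1 :=
  (Nat.le_mul_of_pos_left _ (by omega)).trans (Nat.le_succ _)

theorem main_dual_sum (hS : Params n m S.nat) :
    ∀ x < n ^ ((m + 1) / 2), ∀ y < n ^ ((m + 1) / 2), (runs O mainList S).field 42 x y =
      ∑ z ∈ Finset.range (n ^ ((m + 1) / 2)),
        (runs O mainList S).field 41 x z * (runs O mainList S).field 40 y z := by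
  have hP := main_params (O := O) hS
  refine runs_fill (O := O) (l := mainList) (S := S) 26 rfl (by decide +kernel) hP hP.dimV hP.dimV
    hP.dimV (fun i hi j hj z _ S' _ _ _ _ hD h10 h11 h12 => ?_)
  simp only [FieldExpr.val_hMul, FieldExpr.val_get, NatExpr.val_var, h10, h11, h12,
    hD.field 41 (by decide +kernel), hD.field 40 (by decide +kernel)]

theorem main_coefficients (hn : 1 ≤ n) (hS : Params n m S.nat) :
    ∀ x < n ^ ((m + 1) / 2) * n ^ ((m + 1) / 2), ∀ y < n ^ ((m + 1) / 2),
      (runs O mainList S).field 43 x y =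
      ∑ z ∈ Finset.range (n ^ ((m + 1) / 2) * n ^ ((m + 1) / 2)),
        (runs O mainList S).field 41 y (z / n ^ ((m + 1) / 2)) *
          (runs O mainList S).field 41 y (z % n ^ ((m + 1) / 2)) *
          (runs O mainList S).field 19 x z := by
  have hP := main_params (O := O) hS
  refine runs_fill (O := O) (l := mainList) (S := S) 27 rfl (by decide +kernel) hP hP.sqV hP.dimV
    hP.sqV (fun i hi j hj z hz S' hD _ _ h12 hD' h10 h11 h12' => ?_)
  obtain ⟨g6, g7, -⟩ := run_splitPrep (O := O) (S := S') (src := 12) (by decide)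
    (hD.params.pos hn).2.1 (by
      rw [h12, hD.params.bound]
      exact hz.le.trans (mul_self_le_bound _))
  rw [h12, hD.params.dimV] at g6 g7
  simp only [FieldExpr.val_hMul, FieldExpr.val_get, NatExpr.val_var, h10, h11, h12', g6, g7,
    hD'.field 41 (by decide +kernel), hD'.field 19 (by decide +kernel)]

theorem main_square_sum (hn : 1 ≤ n) (hS : Params n m S.nat) :
    ∀ x < n ^ ((m + 1) / 2) * n ^ ((m + 1) / 2), ∀ y < n ^ ((m + 1) / 2) * n ^ ((m + 1) / 2),
      (runs O mainList S).field 44 x y =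
      ∑ z ∈ Finset.range (n ^ ((m + 1) / 2)),
        (runs O mainList S).field 43 x z *
          (runs O mainList S).field 40 z (y / n ^ ((m + 1) / 2)) *
          (runs O mainList S).field 40 z (y % n ^ ((m + 1) / 2)) := by
  have hP := main_params (O := O) hS
  refine runs_fill (O := O) (l := mainList) (S := S) 28 rfl (by decide +kernel) hP hP.sqV hP.sqV
    hP.dimV (fun i hi j hj z hz S' hD _ h11 _ hD' h10 h11' h12 => ?_)
  obtain ⟨g6, g7, -⟩ := run_splitPrep (O := O) (S := S') (src := 11) (by decide)
    (hD.params.pos hn).2.1 (by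
      rw [h11, hD.params.bound]
      exact hj.le.trans (mul_self_le_bound _))
  rw [h11, hD.params.dimV] at g6 g7
  simp only [FieldExpr.val_hMul, FieldExpr.val_get, NatExpr.val_var, h10, h12, g6, g7,
    hD'.field 43 (by decide +kernel), hD'.field 40 (by decide +kernel)]

theorem main_left_values (hS : Params n m S.nat) :
    ∀ a < n ^ ((m + 1) / 2), (runs O mainList S).field 45 0 a =
      ∑ z ∈ Finset.range (n ^ ((m + 1) / 2) * n ^ ((m + 1) / 2)),
        S.field 1 0 z * (runs O mainList S).field 43 z a := by
  have hP := main_params (O := O) hS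
  refine runs_fill (O := O) (l := mainList) (S := S) 29 rfl (by decide +kernel) hP
    (NatExpr.val_const _ _) hP.dimV hP.sqV
    (val := fun _ j z => S.field 1 0 z * (runs O mainList S).field 43 z j)
    (fun i hi j hj z _ S' _ _ _ _ hD h10 h11 h12 => ?_) 0 Nat.one_pos
  rw [← main_input (O := O) (S := S) (Or.inr (Or.inl rfl))]
  simp only [FieldExpr.val_hMul, FieldExpr.val_get, NatExpr.val_var, NatExpr.val_const, h11, h12,
    hD.field 1 (by decide +kernel), hD.field 43 (by decide +kernel)]

theorem main_right_values (hS : Params n m S.nat) :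
    ∀ a < n ^ ((m + 1) / 2), (runs O mainList S).field 46 0 a =
      ∑ z ∈ Finset.range (n ^ ((m + 1) / 2) * n ^ ((m + 1) / 2)),
        S.field 1 1 z * (runs O mainList S).field 43 z a := by
  have hP := main_params (O := O) hS
  refine runs_fill (O := O) (l := mainList) (S := S) 30 rfl (by decide +kernel) hP
    (NatExpr.val_const _ _) hP.dimV hP.sqV
    (val := fun _ j z => S.field 1 1 z * (runs O mainList S).field 43 z j)
    (fun i hi j hj z _ S' _ _ _ _ hD h10 h11 h12 => ?_) 0 Nat.one_pos
  rw [← main_input (O := O) (S := S) (Or.inr (Or.inl rfl))]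
  simp only [FieldExpr.val_hMul, FieldExpr.val_get, NatExpr.val_var, NatExpr.val_const, h11, h12,
    hD.field 1 (by decide +kernel), hD.field 43 (by decide +kernel)]

theorem main_tails (hS : Params n m S.nat) :
    ∀ x < n ^ ((m + 1) / 2), ∀ y < n ^ (m / 2), (runs O mainList S).field 47 x y =
      ∑ z ∈ Finset.range (n ^ ((m + 1) / 2)),
        (runs O mainList S).field 41 x z * S.field 0 0 (z + n ^ ((m + 1) / 2) * y) := by
  have hP := main_params (O := O) hS
  refine runs_fill (O := O) (l := mainList) (S := S) 31 rfl (by decide +kernel) hP hP.dimV hP.dimW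
    hP.dimV (fun i hi j hj z _ S' _ _ _ _ hD h10 h11 h12 => ?_)
  rw [← main_input (O := O) (S := S) (Or.inl rfl)]
  simp only [FieldExpr.val_hMul, FieldExpr.val_get, NatExpr.val_var, NatExpr.val_const,
    NatExpr.val_hAdd, NatExpr.val_hMul, h10, h11, h12, hD.params.dimV,
    hD.field 41 (by decide +kernel), hD.field 0 (by decide +kernel)]

/-- The number of slices is a computed quantity, not a parameter, so the loops run over all `n ^ k`
indices and the test ignores those beyond it. By `hs` no relevant index is missed. -/
theorem main_check_dual (hS : Params n m S.nat)
    (hJ : ∀ i, S.field 2 i 0 = if i = 0 then 1 else 0)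
    (hs : (runs O mainList S).nat 31 ≤ n ^ ((m + 1) / 2)) :
    (runs O mainList S).nat 41 ≠ 0 ↔ ∀ x < (runs O mainList S).nat 31,
      ∀ y < (runs O mainList S).nat 31, ∑ z ∈ Finset.range (n ^ ((m + 1) / 2)),
        (runs O mainList S).field 41 x z * (runs O mainList S).field 40 y z =
          if x = y then 1 else 0 := by
  have hP := main_params (O := O) hS
  rw [runs_check (O := O) (l := mainList) (S := S) 32 rfl (by decide +kernel) hP hP.dimV hP.dimV
    (bad := fun i j => i < (runs O mainList S).nat 31 ∧ j < (runs O mainList S).nat 31 ∧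
      ¬ (runs O mainList S).field 42 i j - (if i = j then 1 else 0) = 0)
    (fun i hi j hj S' _ _ _ hD h10 h11 h31 => by
      simp only [Test.Holds, NatExpr.val_var, h10, h11, h31, FieldExpr.val_hSub,
        FieldExpr.val_get, hD.field 42 (by decide +kernel),
        val_delta fun i => by rw [hD.field 2 (by decide +kernel), main_delta hJ]])]
  refine ⟨fun h x hx y hy => ?_, fun h x hx y hy ⟨hx', hy', hxy⟩ => hxy ?_⟩
  · have := h x (hx.trans_le hs) y (hy.trans_le hs)
    rw [← main_dual_sum hS x (hx.trans_le hs) y (hy.trans_le hs)]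
    exact sub_eq_zero.mp (not_not.mp fun h' => this ⟨hx, hy, h'⟩)
  · rw [main_dual_sum hS x hx y hy, h x hx' y hy', sub_self]

theorem main_check_square (hn : 1 ≤ n) (hS : Params n m S.nat) :
    (runs O mainList S).nat 42 ≠ 0 ↔ ∀ x < n ^ ((m + 1) / 2) * n ^ ((m + 1) / 2),
      ∀ y < n ^ ((m + 1) / 2) * n ^ ((m + 1) / 2), (runs O mainList S).field 19 x y =
      ∑ z ∈ Finset.range (n ^ ((m + 1) / 2)),
        (runs O mainList S).field 43 x z *
          (runs O mainList S).field 40 z (y / n ^ ((m + 1) / 2)) *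
          (runs O mainList S).field 40 z (y % n ^ ((m + 1) / 2)) := by
  have hP := main_params (O := O) hS
  rw [runs_check (O := O) (l := mainList) (S := S) 33 rfl (by decide +kernel) hP hP.sqV hP.sqV
    (bad := fun i j =>
      ¬ (runs O mainList S).field 19 i j - (runs O mainList S).field 44 i j = 0)
    (fun i hi j hj S' _ _ _ hD h10 h11 _ => by
      simp only [Test.Holds, NatExpr.val_var, h10, h11, FieldExpr.val_hSub,
        FieldExpr.val_get, hD.field 19 (by decide +kernel), hD.field 44 (by decide +kernel)])]
  refine forall₄_congr fun x hx y hy => ?_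
  rw [not_not, sub_eq_zero, main_square_sum hn hS x hx y hy]

theorem main_check_ne_zero (hS : Params n m S.nat)
    (hs : (runs O mainList S).nat 31 ≤ n ^ ((m + 1) / 2)) :
    (runs O mainList S).nat 43 ≠ 0 ↔ ∀ x < (runs O mainList S).nat 31,
      (runs O mainList S).field 45 0 x * (runs O mainList S).field 46 0 x ≠ 0 := by
  have hP := main_params (O := O) hS
  rw [runs_check (O := O) (l := mainList) (S := S) 34 rfl (by decide +kernel) hP hP.dimV
    (NatExpr.val_const _ _)
    (bad := fun i _ => i < (runs O mainList S).nat 31 ∧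
      (runs O mainList S).field 45 0 i * (runs O mainList S).field 46 0 i = 0)
    (fun i hi j hj S' _ _ _ hD h10 h11 h31 => by
      simp only [Test.Holds, NatExpr.val_var, NatExpr.val_const, h10, h31, FieldExpr.val_hMul,
        FieldExpr.val_get, hD.field 45 (by decide +kernel), hD.field 46 (by decide +kernel)])]
  exact ⟨fun h x hx h' => h x (hx.trans_le hs) 0 Nat.one_pos ⟨hx, h'⟩,
    fun h x _ _ _ h' => h x h'.1 h'.2⟩

theorem main_check_cross (hS : Params n m S.nat)
    (hs : (runs O mainList S).nat 31 ≤ n ^ ((m + 1) / 2)) :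
    (runs O mainList S).nat 44 ≠ 0 ↔ ∀ x y, x < y → y < (runs O mainList S).nat 31 →
      (runs O mainList S).field 45 0 x * (runs O mainList S).field 46 0 y -
        (runs O mainList S).field 45 0 y * (runs O mainList S).field 46 0 x ≠ 0 := by
  have hP := main_params (O := O) hS
  rw [runs_check (O := O) (l := mainList) (S := S) 35 rfl (by decide +kernel) hP hP.dimV hP.dimV
    (bad := fun i j => i < j ∧ j < (runs O mainList S).nat 31 ∧
      (runs O mainList S).field 45 0 i * (runs O mainList S).field 46 0 j -
        (runs O mainList S).field 45 0 j * (runs O mainList S).field 46 0 i = 0)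
    (fun i hi j hj S' _ _ _ hD h10 h11 h31 => by
      simp only [Test.Holds, NatExpr.val_var, NatExpr.val_const, h10, h11, h31,
        FieldExpr.val_hMul, FieldExpr.val_hSub, FieldExpr.val_get,
        hD.field 45 (by decide +kernel), hD.field 46 (by decide +kernel)])]
  exact ⟨fun h x y hxy hy h' => h x (by omega) y (by omega) ⟨hxy, hy, h'⟩,
    fun h x _ y _ h' => h x y h'.1 h'.2.1 h'.2.2⟩

theorem main_check_product (hn : 1 ≤ n) (hS : Params n m S.nat) :
    (runs O mainList S).nat 45 ≠ 0 ↔ ∀ x < n ^ ((m + 1) / 2),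
      ExchangeTest n (m / 2) ((runs O mainList S).field 47 x) := by
  have hP := main_params (O := O) hS
  rw [runs_check (O := O) (l := mainList) (S := S) 36 rfl (by decide +kernel) hP hP.dimV
    (b₀ := (m / 2 + 1) * (n ^ (m / 2) * n ^ (m / 2)))
    (by simp only [NatExpr.val_hMul, NatExpr.val_hAdd, NatExpr.val_var, NatExpr.val_const, hP.ordW,
      hP.sqW])
    (bad := fun x y =>
      ¬ (runs O mainList S).field 47 x (exchange (n ^ (y / (n ^ (m / 2) * n ^ (m / 2))))
            (y % (n ^ (m / 2) * n ^ (m / 2)) / n ^ (m / 2))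
            (y % (n ^ (m / 2) * n ^ (m / 2)) % n ^ (m / 2))) *
          (runs O mainList S).field 47 x (exchange (n ^ (y / (n ^ (m / 2) * n ^ (m / 2))))
            (y % (n ^ (m / 2) * n ^ (m / 2)) % n ^ (m / 2))
            (y % (n ^ (m / 2) * n ^ (m / 2)) / n ^ (m / 2))) -
        (runs O mainList S).field 47 x (y % (n ^ (m / 2) * n ^ (m / 2)) / n ^ (m / 2)) *
          (runs O mainList S).field 47 x (y % (n ^ (m / 2) * n ^ (m / 2)) % n ^ (m / 2)) = 0)
    (by
      intro i hi j hj S' hD h10 h11 hD' h10' h11' _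
      obtain ⟨h0, -, h03, -, h05⟩ := hD.params.pos hn
      have hj' : j ≤ S'.nat 26 := by
        rw [hD.params.bound]
        refine (hj.le.trans (Nat.mul_le_mul (by omega) (Nat.mul_le_mul ?_ ?_))).trans
          (Nat.le_succ _) <;> exact Nat.pow_le_pow_right hn (by omega)
      obtain ⟨g13, g15, g16, gf⟩ := run_blockPrep (O := O) (S := S') (src := 11) (q := 23)
        (q2 := 25) (by decide) (by decide) (by decide) h03 h05 (h11 ▸ hj')
      set S1 := (blockPrep 11 23 25).run O S' with hS1
      rw [h11] at g13 g15 g16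
      obtain ⟨g18, g19, gf'⟩ := run_exchangePrep (O := O) (S := S1)
        (by rwa [gf 0 (by decide)])
        (by
          rw [g13, gf 26 (by decide)]
          exact (Nat.div_le_self _ _).trans hj')
        (by
          rw [g15, gf 26 (by decide)]
          exact (Nat.div_le_self _ _).trans ((Nat.mod_le _ _).trans hj'))
        (by
          rw [g16, gf 26 (by decide)]
          exact (Nat.mod_le _ _).trans ((Nat.mod_le _ _).trans hj'))
      rw [g15, gf 0 (by decide), g13] at g18
      rw [g16, gf 0 (by decide), g13] at g19
      have g15' := gf' 15 (by decide)
      have g16' := gf' 16 (by decide)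
      rw [g15] at g15'
      rw [g16] at g16'
      rw [run_seq, ← hS1] at hD' h10' ⊢
      simp only [Test.Holds, NatExpr.val_var, NatExpr.val_hAdd, NatExpr.val_hSub, h10', g15', g16',
        g18, g19, FieldExpr.val_hMul, FieldExpr.val_hSub, FieldExpr.val_get,
        hD'.field 47 (by decide +kernel), exchange, hD.params.sqW, hD.params.dimW,
        hD.params.side])]
  refine forall₂_congr fun x hx => forall₂_congr fun y hy => ?_
  rw [not_not, sub_eq_zero]

theorem main_checks (hn : 1 ≤ n) (hS : Params n m S.nat)
    (hJ : ∀ i, S.field 2 i 0 = if i = 0 then 1 else 0)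
    (hs : (runs O mainList S).nat 31 ≤ n ^ ((m + 1) / 2)) :
    ((runs O mainList S).nat 41 ≠ 0 ∧ (runs O mainList S).nat 42 ≠ 0 ∧
      (runs O mainList S).nat 43 ≠ 0 ∧ (runs O mainList S).nat 44 ≠ 0 ∧
      (runs O mainList S).nat 45 ≠ 0) ↔
    ChecksPass n m ((runs O mainList S).nat 31) ((runs O mainList S).field 19)
      ((runs O mainList S).field 40) ((runs O mainList S).field 41)
      ((runs O mainList S).field 43) ((runs O mainList S).field 47)
      ((runs O mainList S).field 45 0) ((runs O mainList S).field 46 0) := by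
  rw [main_check_dual hS hJ hs, main_check_square hn hS, main_check_ne_zero hS hs,
    main_check_cross hS hs, main_check_product hn hS]
  exact ⟨fun h => ⟨h.1, h.2.1, h.2.2.1, h.2.2.2.1, h.2.2.2.2⟩,
    fun h => ⟨h.dual, h.square, h.ne_zero, h.cross, h.product⟩⟩

end TensorDecomp
end

/-! ### Agreement of the program with the algorithm -/

noncomputable section
namespace TensorDecomp

open Program

variable {F : Type*} [RCLike F] {O : DiagOracle F} {n m R p : ℕ} {S : Machine F} {T : Tensor F n m}

/-- The columns of the flattening lie in `flatRange T`, so a functional matters only through its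
values there. -/
theorem vecMul_flatten_congr {s : ℕ} {v : Fin s → Tensor F n ((m + 1) / 2)}
    {x y : Tensor F n ((m + 1) / 2)} (hv : flatRange T ≤ Submodule.span F (Set.range v))
    (h : ∀ b, x ⬝ᵥ v b = y ⬝ᵥ v b) : x ᵥ* flatten T = y ᵥ* flatten T := by
  have key : ∀ w ∈ Submodule.span F (Set.range v), x ⬝ᵥ w = y ⬝ᵥ w := by
    intro w hw
    induction hw using Submodule.span_induction with
    | mem w hw =>
      obtain ⟨b, rfl⟩ := hw
      exact h b
    | zero => simp
    | add a b _ _ ha hb => rw [dotProduct_add, dotProduct_add, ha, hb]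
    | smul c a _ ha => rw [dotProduct_smul, dotProduct_smul, ha]
  ext j
  have hj : (fun i => flatten T i j) ∈ flatRange T :=
    ⟨Pi.single j 1, by simp; rfl⟩
  exact key _ (hv hj)

theorem isDual_rowTensor {N k s : ℕ} {Φ v : ℕ → ℕ → F} (hN : N = n ^ k)
    (h : ∀ x < s, ∀ y < s, ∑ z ∈ Finset.range N, Φ x z * v y z = if x = y then 1 else 0) :
    IsDual (fun t : Fin s => rowTensor n k (Φ t)) (fun t : Fin s => rowTensor n k (v t)) := by
  subst hN
  intro a b
  refine (sum_idx fun z => Φ a z * v b z).trans ((h a a.2 b b.2).trans ?_)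
  simp [Fin.ext_iff]

theorem exists_perm_of_equiv {X : Type*} [SMul F X] {r s : ℕ} {w : ℕ → X} {v : Fin s → X}
    (h : ∃ (e : Fin r ≃ Fin s) (c : Fin r → F), (∀ t, c t ≠ 0) ∧ ∀ t : Fin r, w t = c t • v (e t)) :
    r = s ∧ ∃ (e : Fin s ≃ Fin s) (c : Fin s → F), (∀ t, c t ≠ 0) ∧
      ∀ t : Fin s, w t = c t • v (e t) := by
  obtain ⟨e, h⟩ := h
  obtain rfl : r = s := by simpa using Fintype.card_congr e
  exact ⟨rfl, e, h⟩

/-- The conditions that the program checks. -/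
def Accepts (n m : ℕ) (S : Machine F) : Prop :=
  S.nat 36 ≠ 0 ∧ S.nat 31 = n ^ ((m + 1) / 2) - S.nat 30 ∧
    S.nat 32 = n ^ ((m + 1) / 2) - S.nat 30 ∧ S.nat 41 ≠ 0 ∧ S.nat 42 ≠ 0 ∧ S.nat 43 ≠ 0 ∧
      S.nat 44 ≠ 0 ∧ S.nat 45 ≠ 0

section

variable (hO : O.IsCorrect) (hn : 1 ≤ n) (hm : 3 ≤ m) (hS : Params n m S.nat)
  (hJ : ∀ i, S.field 2 i 0 = if i = 0 then 1 else 0)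
  (h0 : ∀ A, A ∉ [0, 1, 2] → ∀ i j, S.field A i j = 0)
  (hT : ∀ a b, S.field 0 0 (idx a + n ^ ((m + 1) / 2) * idx b) = flatten T a b)
  {u : Fin R → Tensor F n ((m + 1) / 2)}
  {Q : Fin p → Matrix (Fin ((m + 1) / 2) → Fin n) (Fin ((m + 1) / 2) → Fin n) F}
  (hset : IsSetup T u Q fun t : Fin ((runs O mainList S).nat 31) =>
    rowMatrix n ((m + 1) / 2) ((runs O mainList S).field 19 t))

include hO hS h0 hT hset

theorem main_rank : n ^ ((m + 1) / 2) - (runs O mainList S).nat 30 = R := by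
  have h := IsKernelBasis.finrank_flatRange (main_flatten hS hT) (main_kernel (O := O) hO hS h0).1
  rw [hset.finrank_flatRange] at h
  omega

include hn hm hJ

theorem main_checks_iff (hs : (runs O mainList S).nat 31 ≤ n ^ ((m + 1) / 2))
    (hrs : (runs O mainList S).nat 32 = (runs O mainList S).nat 31) :
    ((runs O mainList S).nat 41 ≠ 0 ∧ (runs O mainList S).nat 42 ≠ 0 ∧
      (runs O mainList S).nat 43 ≠ 0 ∧ (runs O mainList S).nat 44 ≠ 0 ∧
      (runs O mainList S).nat 45 ≠ 0) ↔
      ∃ z, SquareForm (fun t : Fin ((runs O mainList S).nat 31) =>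
          rowMatrix n ((m + 1) / 2) ((runs O mainList S).field 19 t)) z
          (fun t : Fin ((runs O mainList S).nat 31) =>
            rowTensor n ((m + 1) / 2) ((runs O mainList S).field 40 t)) ∧
        IsGeneric (fun t : Fin ((runs O mainList S).nat 31) => S.field 1 0 t)
          (fun t : Fin ((runs O mainList S).nat 31) => S.field 1 1 t) z ∧
        IsDual (fun t : Fin ((runs O mainList S).nat 31) =>
            rowTensor n ((m + 1) / 2) ((runs O mainList S).field 41 t))
          (fun t : Fin ((runs O mainList S).nat 31) =>
            rowTensor n ((m + 1) / 2) ((runs O mainList S).field 40 t)) ∧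
        ∀ t : Fin ((runs O mainList S).nat 31), rowTensor n ((m + 1) / 2)
          ((runs O mainList S).field 41 t) ᵥ* flatten T ∈ productTensors F n (m / 2) := by
  have hlift := main_lift_kernel (O := O) hO hS h0
  have hr : ∀ A, (A = 40 ∨ A = 41) → ∀ x y, (runs O mainList S).nat 32 ≤ x →
      (runs O mainList S).field A x y = 0 := by
    classical
    obtain ⟨-, hv, hΦ⟩ := main_select (O := O) hS h0
    rintro A (rfl | rfl) x y hx
    · rw [hv, if_neg (by omega)]
    · rw [hΦ, if_neg (by omega)]
  rw [main_checks hn hS hJ hs]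
  exact checksPass_iff hm hs hT hlift.zero
    (fun x y hx => hr 40 (Or.inl rfl) x y (hrs.trans_le hx))
    (fun x y hx => hr 41 (Or.inr rfl) x y (hrs.trans_le hx)) hset.lifted.1
    (main_coefficients hn hS) (main_left_values hS) (main_right_values hS) (main_tails hS)

/-- Passed checks provide a square form, functionals in general position, a dual family and product
tensors as tails, whatever happened in the steps that produced the candidates. -/
theorem main_accept (h : Accepts n m (runs O mainList S)) :
    DecompositionOutput T R (fun t : Fin ((runs O mainList S).nat 31) =>
        rowMatrix n ((m + 1) / 2) ((runs O mainList S).field 19 t))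
      (fun t => S.field 1 0 t) (fun t => S.field 1 1 t)
      (some ⟨(runs O mainList S).nat 32, fun a =>
        outer (rowTensor n ((m + 1) / 2) ((runs O mainList S).field 40 a))
          (rowTensor n ((m + 1) / 2) ((runs O mainList S).field 41 a) ᵥ* flatten T)⟩) := by
  obtain ⟨-, hs, hr, hc⟩ := h
  have hR := main_rank hO hS h0 hT hset
  obtain ⟨z, h1, h2, h3, h4⟩ := (main_checks_iff hO hn hm hS hJ h0 hT hset (by omega)
    (hr.trans hs.symm)).mp hc
  have h5 := decompositionOutput_some h1 h2 h3 h4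
  rw [hr, ← hs]
  rw [hR] at hs
  rwa [← hs]

/-- If "Fail" were not a possible output, `P` would have a square form with `f` and `g` in general
position. Then the linear system is solvable, its solution diagonalizable, and the selected
eigenvectors are the vectors of this form up to order and scale, so every check passes. -/
theorem main_reject (h : ¬ Accepts n m (runs O mainList S)) :
    DecompositionOutput T R (fun t : Fin ((runs O mainList S).nat 31) =>
        rowMatrix n ((m + 1) / 2) ((runs O mainList S).field 19 t))
      (fun t => S.field 1 0 t) (fun t => S.field 1 1 t) none := by
  classical
  refine (decompositionOutput_none_or T R _ _ _).resolve_right ?_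
  rintro ⟨hsR, z, v₀, φ₀, hsq, hfg, hφ, hw⟩
  refine h ?_
  have hR := main_rank hO hS h0 hT hset
  obtain ⟨hK, hcount⟩ := main_kernel (O := O) hO hS h0
  have hsN : (runs O mainList S).nat 31 ≤ n ^ ((m + 1) / 2) := by omega
  have hsN2 : (runs O mainList S).nat 31 ≤ n ^ ((m + 1) / 2) * n ^ ((m + 1) / 2) :=
    hsN.trans (Nat.le_mul_self _)
  have hspan := hset.span_eq_flatRange hsq hsR
  have hKv : ∀ y : Tensor F n ((m + 1) / 2), y ∈ Submodule.span F (Set.range v₀) ↔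
      ∀ t < n ^ ((m + 1) / 2), ∑ a : Fin ((m + 1) / 2) → Fin n,
        (runs O mainList S).field 14 t (idx a) * y a = 0 := fun y => by
    rw [hspan]
    exact IsKernelBasis.mem_flatRange_iff (main_flatten hS hT) hK hcount y
  have hzero := (main_lift_kernel (O := O) hO hS h0).zero
  have hB := blockMatrix_contract hsN2 (fun x y hx => hzero x y hx) (main_contract_left (O := O) hS)
  have hA := blockMatrix_contract hsN2 (fun x y hx => hzero x y hx)
    (main_contract_right (O := O) hS)
  obtain ⟨hXA, hKX⟩ := main_solve hO hn hS hJ h0 (hsq.exists_solution hfg hB hA hKv)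
  have hflag := (main_diag hO hS).1.mpr
    (hsq.exists_solution_diagonalization hfg hB hA hKv hXA hKX)
  obtain ⟨hV, hd⟩ := (main_diag hO hS).2 hflag
  obtain ⟨hr, hv, hΦ⟩ := main_select (O := O) hS h0
  obtain ⟨hrs, e, c, hc, hev⟩ := exists_perm_of_equiv
    (w := fun t => rowTensor n ((m + 1) / 2) ((runs O mainList S).field 40 t))
    (hsq.solution_spectrum hfg hB hA hKv hXA hKX hV hd hr hv)
  have hdual := selected_dual (main_inverse hO hn hS hJ h0 hV) hr hv hΦ
  rw [hrs] at hdual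
  have hdual' := isDual_rowTensor rfl hdual
  refine ⟨hflag, by omega, by omega,
    (main_checks_iff hO hn hm hS hJ h0 hT hset hsN hrs).mpr ⟨_, ?_, hfg.rescale
      e hc, hdual', fun t => ?_⟩⟩
  · rw [funext hev]
    exact hsq.rescale e hc
  -- The computed functional and the rescaled `φ₀ (e t)` agree on a basis of `U`, hence yield the
  -- same tail up to the nonzero scalar.
  · have h1 : rowTensor n ((m + 1) / 2) ((runs O mainList S).field 41 t) ᵥ* flatten T =
        ((c t)⁻¹ • φ₀ (e t)) ᵥ* flatten T := by
      refine vecMul_flatten_congr hspan.ge fun b => ?_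
      obtain ⟨b, rfl⟩ := e.surjective b
      have h2 := hdual' t b
      simp only [hev b, dotProduct_smul, smul_eq_mul] at h2
      rw [smul_dotProduct, hφ, smul_eq_mul, if_congr e.injective.eq_iff rfl rfl]
      refine mul_left_cancel₀ (hc b) (h2.trans ?_)
      split_ifs with htb
      · rw [htb, mul_one, mul_inv_cancel₀ (hc _)]
      · simp
    rw [h1, Matrix.smul_vecMul]
    exact smul_mem_productTensors (by omega) _ (hw _)

end

end TensorDecomp
end

/-! ### The complete program and its output -/

noncomputable section
namespace TensorDecomp

open Program

namespace Program

/-- The computation of the parameters. -/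
def initList : List Program :=
  [divMod 20 27 (.var 1 + .const 1) (.const 2) (.var 1 + .const 1),
    divMod 21 27 (.var 1) (.const 2) (.var 1),
    pow 22 (.var 0) (.var 20) (.var 1),
    pow 23 (.var 0) (.var 21) (.var 1),
    setNat 24 (.var 22 * .var 22),
    setNat 25 (.var 23 * .var 23),
    setNat 26 ((.var 20 + .const 2) * .var 24 + .const 1),
    setField 2 (.const 0) (.const 0) .one]

/-- Nonzero if and only if the expressions have the same value. -/
def eqExpr (d e : NatExpr) : NatExpr := .const 1 - ((d - e) + (e - d))

/-- The computation of the rank one terms. -/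
def termList : List Program :=
  [setNat 46 (.var 36 * (eqExpr (.var 31) (.var 22 - .var 30) *
      (eqExpr (.var 32) (.var 22 - .var 30) *
        (.var 41 * (.var 42 * (.var 43 * (.var 44 * .var 45))))))),
    fill 0 (.var 22) (.var 22 * .var 23) (.const 1) (splitPrep 11)
      (.get 40 (.var 10) (.var 7) * .get 47 (.var 10) (.var 6))]

/-- The whole program. -/
def decompose : Program :=
  seqs (initList ++ (mainList ++ (termList ++ [setNat 1 (.var 32), setNat 0 (.var 46)])))

end Program

variable {F : Type*} [RCLike F] {O : DiagOracle F} {n m R p : ℕ} {S : Machine F} {T : Tensor F n m}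
  {f g : ℕ → F}

theorem init_params (hm : 3 ≤ m) (h0 : S.nat 0 = n) (h1 : S.nat 1 = m) :
    Params n m (runs O initList S).nat := by
  obtain ⟨a1, -⟩ := run_divMod (O := O) (d := 20) (r := 27) (c := .var 1 + .const 1)
    (q := .const 2) (b := .var 1 + .const 1) (by decide) (by decide) (by decide) (by decide)
    (by decide) (S := S) (by simp) le_rfl
  set S1 := (divMod 20 27 (.var 1 + .const 1) (.const 2) (.var 1 + .const 1)).run O S with hS1
  have f1 : ∀ x, x ∉ [9, 20, 27] → S1.nat x = S.nat x := fun x hx =>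
    run_nat_of_notMem (by simp [divMod, regs] at hx ⊢; tauto) S
  obtain ⟨a2, -⟩ := run_divMod (O := O) (d := 21) (r := 27) (c := .var 1)
    (q := .const 2) (b := .var 1) (by decide) (by decide) (by decide) (by decide)
    (by decide) (S := S1) (by simp) le_rfl
  set S2 := (divMod 21 27 (.var 1) (.const 2) (.var 1)).run O S1 with hS2
  have f2 : ∀ x, x ∉ [9, 21, 27] → S2.nat x = S1.nat x := fun x hx =>
    run_nat_of_notMem (by simp [divMod, regs] at hx ⊢; tauto) S1
  simp only [NatExpr.val_hAdd, NatExpr.val_var, NatExpr.val_const, f1 1 (by decide), h1] at a1 a2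
  have b0 : S2.nat 0 = n := by rw [f2 0 (by decide), f1 0 (by decide), h0]
  have b1 : S2.nat 1 = m := by rw [f2 1 (by decide), f1 1 (by decide), h1]
  have b20 : S2.nat 20 = (m + 1) / 2 := by rw [f2 20 (by decide), a1]
  have a3 := run_pow (O := O) (r := 22) (a := .var 0) (i := .var 20) (b := .var 1) (by decide)
    (by decide) (by decide) (by decide) (S := S2) (by
      simp only [NatExpr.val_var, b1, b20]
      omega)
  set S3 := (pow 22 (.var 0) (.var 20) (.var 1)).run O S2 with hS3
  have f3 : ∀ x, x ∉ [8, 22] → S3.nat x = S2.nat x := fun x hx =>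
    run_nat_of_notMem (by simp [pow, regs] at hx ⊢; tauto) S2
  have a4 := run_pow (O := O) (r := 23) (a := .var 0) (i := .var 21) (b := .var 1) (by decide)
    (by decide) (by decide) (by decide) (S := S3) (by
      simp only [NatExpr.val_var, f3 1 (by decide), f3 21 (by decide), b1, a2]
      omega)
  set S4 := (pow 23 (.var 0) (.var 21) (.var 1)).run O S3 with hS4
  have f4 : ∀ x, x ∉ [8, 23] → S4.nat x = S3.nat x := fun x hx =>
    run_nat_of_notMem (by simp [pow, regs] at hx ⊢; tauto) S3
  simp only [NatExpr.val_var, f3 0 (by decide), f3 21 (by decide), b0, b20, a2] at a3 a4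
  have c0 : S4.nat 0 = n := by rw [f4 0 (by decide), f3 0 (by decide), b0]
  have c20 : S4.nat 20 = (m + 1) / 2 := by rw [f4 20 (by decide), f3 20 (by decide), b20]
  have c21 : S4.nat 21 = m / 2 := by rw [f4 21 (by decide), f3 21 (by decide), a2]
  have c22 : S4.nat 22 = n ^ ((m + 1) / 2) := by rw [f4 22 (by decide), a3]
  have hrun : runs O initList S = (setField 2 (.const 0) (.const 0) .one).run O
    ((setNat 26 ((.var 20 + .const 2) * .var 24 + .const 1)).run O
      ((setNat 25 (.var 23 * .var 23)).run O ((setNat 24 (.var 22 * .var 22)).run O S4))) := rfl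
  rw [hrun]
  constructor <;> simp [run, Machine.writeNat_nat, c0, c20, c21, c22, a4]

theorem init_field {A : ℕ} (hA : A ≠ 2) : (runs O initList S).field A = S.field A :=
  (runs_frame initList S).2 A (by
    simpa [initList, seqs, arrs, divMod, pow] using hA)

theorem init_delta (h2 : ∀ i j, S.field 2 i j = 0) (i : ℕ) :
    (runs O initList S).field 2 i 0 = if i = 0 then 1 else 0 := by
  have hrun : runs O initList S = (setField 2 (.const 0) (.const 0) .one).run O
    (runs O (initList.take 7) S) := rfl
  have h := (runs_frame (O := O) (initList.take 7) S).2 2 (by decide +kernel)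
  rw [hrun]
  simp [run, Machine.writeField_field, h, h2]

/-- The conjunction is a product of natural numbers; `eqExpr` is `1` or `0` by truncated
subtraction. -/
theorem termList_flag (S : Machine F) : (runs O termList S).nat 46 ≠ 0 ↔
    S.nat 36 ≠ 0 ∧ S.nat 31 = S.nat 22 - S.nat 30 ∧ S.nat 32 = S.nat 22 - S.nat 30 ∧
      S.nat 41 ≠ 0 ∧ S.nat 42 ≠ 0 ∧ S.nat 43 ≠ 0 ∧ S.nat 44 ≠ 0 ∧ S.nat 45 ≠ 0 := by
  rw [runs_nat_eq 1 (by decide +kernel)]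
  change (NatExpr.val S.nat _) ≠ 0 ↔ _
  simp only [eqExpr, NatExpr.val_hMul, NatExpr.val_hSub, NatExpr.val_hAdd, NatExpr.val_var,
    NatExpr.val_const, mul_ne_zero_iff]
  refine and_congr_right fun _ => and_congr ?_ (and_congr ?_ Iff.rfl) <;> omega

theorem termList_field (hn : 1 ≤ n) (hS : Params n m S.nat) :
    ∀ a < n ^ ((m + 1) / 2), ∀ y < n ^ ((m + 1) / 2) * n ^ (m / 2),
      (runs O termList S).field 0 a y = S.field 40 a (y % n ^ ((m + 1) / 2)) *
        S.field 47 a (y / n ^ ((m + 1) / 2)) := by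
  have hP : Params n m (runs O termList S).nat :=
    hS.congr fun x hx => (runs_frame termList S).1 x ((by decide +kernel :
      ∀ x ∈ dims, x ∉ (seqs termList).regs) x hx)
  have h := runs_fill (O := O) (l := termList) (S := S) 1 rfl (by decide +kernel) hP hP.dimV
    (b₀ := n ^ ((m + 1) / 2) * n ^ (m / 2))
    (by simp only [NatExpr.val_hMul, NatExpr.val_var, hP.dimV, hP.dimW]) (NatExpr.val_const _ _)
    (val := fun i j _ => S.field 40 i (j % n ^ ((m + 1) / 2)) *
        S.field 47 i (j / n ^ ((m + 1) / 2)))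
    (fun i hi j hj z hz S' hD _ h11 _ hD' h10 h11' h12 => by
      obtain ⟨g6, g7, -⟩ := run_splitPrep (O := O) (S := S') (src := 11) (by decide)
        (hD.params.pos hn).2.1 (by
          rw [h11, hD.params.bound]
          refine (hj.le.trans (Nat.mul_le_mul_left _ ?_)).trans (mul_self_le_bound _)
          exact Nat.pow_le_pow_right hn (by omega))
      rw [h11, hD.params.dimV] at g6 g7
      have h40 := (runs_frame (O := O) termList S).2 40 (by decide +kernel)
      have h47 := (runs_frame (O := O) termList S).2 47 (by decide +kernel)
      simp only [FieldExpr.val_hMul, FieldExpr.val_get, NatExpr.val_var, h10, g6, g7,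
        hD'.field 40 (by decide +kernel), hD'.field 47 (by decide +kernel), h40, h47])
  simpa using h

theorem runs_results (S : Machine F) :
    (runs O [setNat 1 (.var 32), setNat 0 (.var 46)] S).nat 0 = S.nat 46 ∧
      (runs O [setNat 1 (.var 32), setNat 0 (.var 46)] S).nat 1 = S.nat 32 ∧
      (runs O [setNat 1 (.var 32), setNat 0 (.var 46)] S).field = S.field := ⟨rfl, rfl, rfl⟩

theorem start_field_zero (T : Tensor F n m) (f g : ℕ → F) (j : ℕ) :
    (Machine.start T f g).field 0 0 j = extend T j := by
  simp [Machine.start, extend]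

/-- The state before the rank one terms are computed. -/
def mainState (O : DiagOracle F) (T : Tensor F n m) (f g : ℕ → F) : Machine F :=
  runs O mainList (runs O initList (Machine.start T f g))

theorem start_zero {A : ℕ} (hA : A ≠ 0) (hA' : A ≠ 1) (i j : ℕ) :
    (Machine.start T f g).field A i j = 0 := by
  simp [Machine.start, hA, hA']

theorem init_start_zero (A : ℕ) (hA : A ∉ [0, 1, 2]) (i j : ℕ) :
    (runs O initList (Machine.start T f g)).field A i j = 0 := by
  simp only [List.mem_cons, List.not_mem_nil, or_false, not_or] at hA
  rw [init_field hA.2.2, start_zero hA.1 hA.2.1]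

theorem init_start_flatten (a : Fin ((m + 1) / 2) → Fin n) (b : Fin (m / 2) → Fin n) :
    (runs O initList (Machine.start T f g)).field 0 0 (idx a + n ^ ((m + 1) / 2) * idx b) =
      flatten T a b := by
  rw [init_field (by decide), start_field_zero, ← idx_joinIdx, extend_idx]
  rfl

theorem init_start_params (hm : 3 ≤ m) :
    Params n m (runs O initList (Machine.start T f g)).nat := init_params hm rfl rfl

theorem output_eq_some {E : Machine F} {r : ℕ} {H : ℕ → Tensor F n m} (h0 : E.nat 0 ≠ 0)
    (h1 : E.nat 1 = r) (h : ∀ a < r, ∀ c, E.field 0 a (idx c) = H a c) :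
    E.output n m = some ⟨r, fun a => H a⟩ := by
  subst h1
  rw [Machine.output, if_neg h0]
  congr 2
  exact funext fun a => funext fun c => h a a.2 c

theorem main_tail_vec (hS : Params n m S.nat)
    (hT : ∀ a b, S.field 0 0 (idx a + n ^ ((m + 1) / 2) * idx b) = flatten T a b) :
    ∀ a < n ^ ((m + 1) / 2), ∀ b : Fin (m / 2) → Fin n,
      (runs O mainList S).field 47 a (idx b) =
        (rowTensor n ((m + 1) / 2) ((runs O mainList S).field 41 a) ᵥ* flatten T) b := by
  intro a ha b
  rw [main_tails hS a ha _ (idx_lt b), ← sum_idx fun z => (runs O mainList S).field 41 a z *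
    S.field 0 0 (z + n ^ ((m + 1) / 2) * idx b)]
  simp only [hT]
  rfl

/-- The number of a multi-index is that of its head plus `n ^ k` times that of its tail, so
remainder and quotient by `n ^ k` address the two factors of a term. -/
theorem terms_output (M : Machine F) (hn : 1 ≤ n) (hP : Params n m M.nat)
    (hW : ∀ a < n ^ ((m + 1) / 2), ∀ b : Fin (m / 2) → Fin n, M.field 47 a (idx b) =
      (rowTensor n ((m + 1) / 2) (M.field 41 a) ᵥ* flatten T) b) :
    (¬ Accepts n m M → (runs O [setNat 1 (.var 32), setNat 0 (.var 46)]
        (runs O termList M)).output n m = none) ∧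
    (Accepts n m M → (runs O [setNat 1 (.var 32), setNat 0 (.var 46)]
        (runs O termList M)).output n m =
      some ⟨M.nat 32, fun a => outer (rowTensor n ((m + 1) / 2) (M.field 40 a))
        (rowTensor n ((m + 1) / 2) (M.field 41 a) ᵥ* flatten T)⟩) := by
  obtain ⟨r0, r1, r2⟩ := runs_results (O := O) (runs O termList M)
  have hflag := termList_flag (O := O) M
  rw [← r0, hP.dimV] at hflag
  rw [(runs_frame (O := O) termList M).1 32 (by decide +kernel)] at r1
  refine ⟨fun h => if_pos (not_not.mp (mt hflag.mp h)), fun h => ?_⟩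
  have hle : M.nat 32 ≤ n ^ ((m + 1) / 2) := h.2.2.1.trans_le (Nat.sub_le _ _)
  refine output_eq_some (H := fun a => outer (rowTensor n ((m + 1) / 2) (M.field 40 a))
      (rowTensor n ((m + 1) / 2) (M.field 41 a) ᵥ* flatten T)) (hflag.mpr h) r1 fun a ha c => ?_
  have hc : idx c = idx (headIdx c) + n ^ ((m + 1) / 2) * idx (tailIdx c) := by
    rw [← idx_joinIdx, joinIdx_headIdx_tailIdx]
  have hpos : 0 < n ^ ((m + 1) / 2) := pow_pos hn _
  rw [r2, hc, termList_field hn hP a (ha.trans_le hle), outer, ← hW a (ha.trans_le hle),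
    Nat.add_mul_mod_self_left, Nat.mod_eq_of_lt (idx_lt _), Nat.add_mul_div_left _ _ hpos,
    Nat.div_eq_of_lt (idx_lt _), zero_add]
  · rfl
  · rw [← hc, ← pow_add]
    exact (idx_lt c).trans_le (Nat.pow_le_pow_right hn (by omega))

theorem tick_output (M : Machine F) (t : ℕ) : (M.tick t).output n m = M.output n m := rfl

theorem mainState_params (hm : 3 ≤ m) : Params n m (mainState O T f g).nat := by
  delta mainState
  exact main_params (init_start_params hm)

theorem mainState_tail_vec (hm : 3 ≤ m) : ∀ a < n ^ ((m + 1) / 2), ∀ b : Fin (m / 2) → Fin n,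
    (mainState O T f g).field 47 a (idx b) =
      (rowTensor n ((m + 1) / 2) ((mainState O T f g).field 41 a) ᵥ* flatten T) b := by
  delta mainState
  intro a ha b
  exact main_tail_vec (init_start_params hm) init_start_flatten a ha b

theorem decompose_output (T : Tensor F n m) (f g : ℕ → F) (hn : 1 ≤ n) (hm : 3 ≤ m) :
    (¬ Accepts n m (mainState O T f g) →
      (decompose.run O (Machine.start T f g)).output n m = none) ∧
    (Accepts n m (mainState O T f g) → (decompose.run O (Machine.start T f g)).output n m =
      some ⟨(mainState O T f g).nat 32, fun a =>
        outer (rowTensor n ((m + 1) / 2) ((mainState O T f g).field 40 a))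
          (rowTensor n ((m + 1) / 2) ((mainState O T f g).field 41 a) ᵥ* flatten T)⟩) := by
  have hrun : decompose.run O (Machine.start T f g) =
      (runs O [setNat 1 (.var 32), setNat 0 (.var 46)]
        (runs O termList (mainState O T f g))).tick 1 := by
    rw [decompose, run_seqs, runs_append, runs_append, runs_append, mainState]
  rw [hrun, tick_output]
  exact terms_output _ hn (mainState_params hm) (mainState_tail_vec hm)

/-- Up to the lifted basis the program does not read the random scalars, and afterwards it
overwrites neither the basis nor its length. Hence one setup serves all `f` and `g`. -/
theorem mainState_setup (f g : ℕ → F) :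
    (mainState O T f g).nat 31 = (mainState O T 0 0).nat 31 ∧
      (mainState O T f g).field 19 = (mainState O T 0 0).field 19 := by
  have key : AgreeOff 1 (runs O (initList ++ setupList) (Machine.start T f g))
      (runs O (initList ++ setupList) (Machine.start T 0 0)) := by
    have h := AgreeOff.run (O := O) (B := 1) (p := seqs (initList ++ setupList))
      (by decide +kernel) (S := Machine.start T f g) (S' := Machine.start T 0 0) ⟨rfl, fun A hA => by
        simp [Machine.start, hA]⟩
    rwa [run_seqs, run_seqs] at h
  have hstate : ∀ f g, mainState O T f g =
      runs O (diagList ++ checkList) (runs O (initList ++ setupList) (Machine.start T f g)) := by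
    intro f g
    rw [mainState, mainList, runs_append, runs_append initList]
  constructor
  · rw [hstate, hstate, (runs_frame (diagList ++ checkList) _).1 31 (by decide +kernel),
      (runs_frame (diagList ++ checkList) _).1 31 (by decide +kernel), key.1]
  · rw [hstate, hstate, (runs_frame (diagList ++ checkList) _).2 19 (by decide +kernel),
      (runs_frame (diagList ++ checkList) _).2 19 (by decide +kernel), key.2 19 (by decide)]

/-- The data `s` and `P` enter through equations so that a setup built from the run with zero
scalars can be used for arbitrary `f` and `g`. -/
theorem decompose_correct (hO : O.IsCorrect) (hn : 1 ≤ n) (hm : 3 ≤ m) {s : ℕ} {P : ℕ → ℕ → F}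
    {f g : ℕ → F} (hs : (mainState O T f g).nat 31 = s) (hP : (mainState O T f g).field 19 = P)
    {u : Fin R → Tensor F n ((m + 1) / 2)}
    {Q : Fin p → Matrix (Fin ((m + 1) / 2) → Fin n) (Fin ((m + 1) / 2) → Fin n) F}
    (hset : IsSetup T u Q fun t : Fin s => rowMatrix n ((m + 1) / 2) (P t)) :
    DecompositionOutput T R (fun t : Fin s => rowMatrix n ((m + 1) / 2) (P t)) (fun t => f t)
      (fun t => g t) ((decompose.run O (Machine.start T f g)).output n m) := by
  subst hs hP
  have hS := init_start_params (O := O) (T := T) (f := f) (g := g) hm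
  have hJ := init_delta (O := O) (S := Machine.start T f g) (start_zero (by decide) (by decide))
  have hf : ∀ t, (runs O initList (Machine.start T f g)).field 1 0 t = f t := fun t => by
    rw [init_field (by decide)]
    simp [Machine.start]
  have hg : ∀ t, (runs O initList (Machine.start T f g)).field 1 1 t = g t := fun t => by
    rw [init_field (by decide)]
    simp [Machine.start]
  obtain ⟨h1, h2⟩ := decompose_output (O := O) T f g hn hm
  delta mainState at hset h1 h2 ⊢
  by_cases h : Accepts n m (runs O mainList (runs O initList (Machine.start T f g)))
  · rw [h2 h]
    have := main_accept hO hn hm hS hJ init_start_zero init_start_flatten hset h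
    simp only [hf, hg] at this
    exact this
  · rw [h1 h]
    have := main_reject hO hn hm hS hJ init_start_zero init_start_flatten hset h
    simp only [hf, hg] at this
    exact this

theorem exists_setup (hO : O.IsCorrect) (hn : 1 ≤ n) (hm : 3 ≤ m) (T : Tensor F n m) :
    ∃ (R p : ℕ) (u : Fin R → Tensor F n ((m + 1) / 2))
      (Q : Fin p → Matrix (Fin ((m + 1) / 2) → Fin n) (Fin ((m + 1) / 2) → Fin n) F),
      IsSetup T u Q fun t : Fin ((mainState O T 0 0).nat 31) =>
        rowMatrix n ((m + 1) / 2) ((mainState O T 0 0).field 19 t) := by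
  obtain ⟨h1, h2⟩ := main_lifted hO hn (init_start_params (O := O) (T := T) (f := 0) (g := 0) hm)
    (init_delta (start_zero (by decide) (by decide))) init_start_zero init_start_flatten
  rw [mainState]
  exact exists_isSetup h1 h2

end TensorDecomp
end

/-! ### Running time and number of oracle calls -/

noncomputable section
namespace TensorDecomp

open Program

/-- The largest constant in an expression. -/
def NatExpr.maxConst : NatExpr → ℕ
  | const c => c
  | var _ => 0
  | add d e => max d.maxConst e.maxConst
  | sub d e => max d.maxConst e.maxConst
  | mul d e => max d.maxConst e.maxConst

/-- Each operation adds one to the cost, and with `M ≥ 2` the additional factor `M` covers a sum as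
well as a product. -/
theorem NatExpr.val_le_pow {ρ : ℕ → ℕ} {M : ℕ} (hM : 2 ≤ M) {e : NatExpr}
    (hc : e.maxConst ≤ M) (hv : ∀ x ∈ e.vars, ρ x ≤ M) : e.val ρ ≤ M ^ e.cost := by
  have hpos : 1 ≤ M := by omega
  induction e with
  | const c => simpa [val, cost, maxConst] using hc
  | var x => simpa [val, cost] using hv x (by simp [vars])
  | add d e hd he | sub d e hd he | mul d e hd he =>
    simp only [maxConst, max_le_iff] at hc
    have h1 := hd hc.1 fun x hx => hv x (by simp [vars, hx])
    have h2 := he hc.2 fun x hx => hv x (by simp [vars, hx])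
    have h3 : 1 ≤ M ^ d.cost := Nat.one_le_pow _ _ hpos
    have h4 : 1 ≤ M ^ e.cost := Nat.one_le_pow _ _ hpos
    simp only [val, cost, pow_succ, pow_add]
    nlinarith [Nat.sub_le (d.val ρ) (e.val ρ), Nat.mul_le_mul h1 h2, Nat.mul_le_mul h3 h4,
      Nat.mul_le_mul_left (M ^ d.cost * M ^ e.cost) hM, Nat.mul_le_mul_left (M ^ d.cost) h4,
      Nat.mul_le_mul_right (M ^ e.cost) h3]

/-- A program whose loop bounds are expressions of cost at most `5` in registers with values at
most `M` that it does not change runs in time `O(M ^ (5 * depth))`. -/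
theorem time_run_le_pow {F : Type*} [RCLike F] {O : DiagOracle F} {D : List ℕ} {p : Program}
    {M : ℕ} (hM : 2 ≤ M) (hreg : ∀ x ∈ D, x ∉ p.regs)
    (hb : ∀ e ∈ p.bounds, e.maxConst ≤ 2 ∧ e.cost ≤ 5 ∧ ∀ x ∈ e.vars, x ∈ D) (S : Machine F)
    (hS : ∀ x ∈ D, S.nat x ≤ M) :
    (p.run O S).time ≤ S.time + p.size * M ^ (5 * p.depth) := by
  rw [pow_mul]
  exact time_run_le (Nat.one_le_pow _ _ (by omega)) hreg (fun e he => (hb e he).2.2) S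
    fun e he => (NatExpr.val_le_pow hM ((hb e he).1.trans hM) fun x hx =>
      hS x ((hb e he).2.2 x hx)).trans (Nat.pow_le_pow_right (by omega) (hb e he).2.1)

/-- The largest parameter is essentially `(k + 2) * n ^ (2 k)`. Here `2 k ≤ 2 m` costs the exponent
`2 m`, and the linear factor, at most `2 m + 1` in all, costs `2 m` more. -/
theorem Params.le_pow {n m : ℕ} {ρ : ℕ → ℕ} (hm : 3 ≤ m) (h : Params n m ρ) :
    ∀ x ∈ dims, ρ x ≤ max n 2 ^ (4 * m) := by
  set b := max n 2 with hb
  have hn : n ≤ b := le_max_left _ _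
  have h2 : 2 ≤ b := le_max_right _ _
  have hpow : ∀ {i j : ℕ}, i ≤ j → b ^ i ≤ b ^ j := fun hij => Nat.pow_le_pow_right (by omega) hij
  have hm' : m < b ^ m := Nat.lt_pow_self (by omega)
  have hmm : m < b ^ (4 * m) := hm'.trans_le (hpow (by omega))
  have hdim : ∀ j, n ^ j ≤ b ^ j := fun j => Nat.pow_le_pow_left hn j
  have hsq : ∀ j, n ^ j * n ^ j ≤ b ^ (2 * j) := fun j => by
    rw [two_mul, pow_add]
    exact Nat.mul_le_mul (hdim j) (hdim j)
  have hbound : ((m + 1) / 2 + 2) * (n ^ ((m + 1) / 2) * n ^ ((m + 1) / 2)) + 1 ≤ b ^ (4 * m) := by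
    have h3 : ((m + 1) / 2 + 2) * (n ^ ((m + 1) / 2) * n ^ ((m + 1) / 2)) ≤
        (2 * m) * b ^ (2 * ((m + 1) / 2)) := Nat.mul_le_mul (by omega) (hsq _)
    have h4 : b ^ (2 * ((m + 1) / 2)) ≤ b ^ (2 * m) := hpow (by omega)
    have h5 : 1 ≤ b ^ (2 * m) := Nat.one_le_pow _ _ (by omega)
    calc _ ≤ 2 * m * b ^ (2 * m) + b ^ (2 * m) := add_le_add (h3.trans (Nat.mul_le_mul_left _ h4)) h5
      _ = (2 * m + 1) * b ^ (2 * m) := by ring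
      _ ≤ (b ^ m * b ^ m) * b ^ (2 * m) := Nat.mul_le_mul_right _ (by nlinarith)
      _ = b ^ (4 * m) := by ring
  simp only [dims, List.mem_cons, List.not_mem_nil, or_false, forall_eq_or_imp, forall_eq,
    h.side, h.ordV, h.ordW, h.dimV, h.dimW, h.sqV, h.sqW, h.bound]
  refine ⟨?_, by omega, by omega, (hdim _).trans (hpow (by omega)), (hdim _).trans (hpow (by omega)),
    (hsq _).trans (hpow (by omega)), (hsq _).trans (hpow (by omega)), hbound⟩
  exact hn.trans ((pow_one b).symm.le.trans (hpow (by omega)))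

/-- Loop bounds are at most the fifth power of `b ^ (4 m)` and loops are nested at most four deep,
which gives the exponent `80 m`. The total size of the two parts is below `2 ^ 11`, at most `b ^ (11
m)`; hence `91 m`. -/
theorem decompose_time_le {F : Type*} [RCLike F] {O : DiagOracle F} {n m : ℕ} (hm : 3 ≤ m)
    (T : Tensor F n m) (f g : ℕ → F) :
    (decompose.run O (Machine.start T f g)).time ≤ max n 2 ^ (91 * m) := by
  set l : List Program := mainList ++ (termList ++ [setNat 1 (.var 32), setNat 0 (.var 46)]) with hl
  set b := max n 2 with hb
  have h2 : 2 ≤ b := le_max_right _ _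
  have hM : 2 ≤ b ^ (4 * m) := h2.trans (Nat.le_self_pow (by omega) _)
  have hm' : m ≤ b ^ (4 * m) := (Nat.lt_pow_self h2).le.trans (Nat.pow_le_pow_right (by omega) (by omega))
  have hn' : n ≤ b ^ (4 * m) := (le_max_left n 2).trans (Nat.le_self_pow (by omega) _)
  have t1 := time_run_le_pow (O := O) (D := [0, 1]) (p := seqs initList) hM (by decide +kernel)
    (by decide +kernel) (Machine.start T f g) (by
      simp only [List.mem_cons, List.not_mem_nil, or_false, forall_eq_or_imp, forall_eq]
      exact ⟨hn', hm'⟩)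
  -- Register `0` is left out of the protected registers because the output flag finally overwrites
  -- it; no loop bound in this part uses it.
  have t2 := time_run_le_pow (O := O) (D := dims.tail) (p := seqs l) hM (by decide +kernel)
    (by decide +kernel) (runs O initList (Machine.start T f g)) fun x hx =>
      (init_start_params hm).le_pow hm x (List.mem_of_mem_tail hx)
  rw [run_seqs, show (seqs initList).size = 89 by decide +kernel,
    show (seqs initList).depth = 1 by decide +kernel] at t1
  rw [run_seqs, show (seqs l).size = 1810 by decide +kernel,
    show (seqs l).depth = 4 by decide +kernel] at t2
  rw [decompose, run_seqs, runs_append, ← hl]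
  have h3 : (Machine.start T f g).time = 0 := rfl
  have h4 : (b ^ (4 * m)) ^ (5 * 1) ≤ (b ^ (4 * m)) ^ (5 * 4) :=
    Nat.pow_le_pow_right (by omega) (by omega)
  have h5 : 2 ^ 11 * (b ^ (4 * m)) ^ (5 * 4) ≤ b ^ (91 * m) := by
    calc 2 ^ 11 * (b ^ (4 * m)) ^ (5 * 4) ≤ b ^ (11 * m) * (b ^ (4 * m)) ^ (5 * 4) :=
          Nat.mul_le_mul_right _ ((Nat.pow_le_pow_left h2 11).trans
            (Nat.pow_le_pow_right (by omega) (by omega)))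
      _ = b ^ (91 * m) := by ring
  simp only [Machine.tick] at t1 t2 ⊢
  omega

instance decidableLoopsCallFree : ∀ p : Program, Decidable p.LoopsCallFree
  | skip => .isTrue trivial
  | setNat _ _ => .isTrue trivial
  | setField _ _ _ _ => .isTrue trivial
  | seq p q => @instDecidableAnd _ _ (decidableLoopsCallFree p) (decidableLoopsCallFree q)
  | Program.ite _ p q => @instDecidableAnd _ _ (decidableLoopsCallFree p) (decidableLoopsCallFree q)
  | loop _ _ p => @instDecidableAnd _ _ (decidableLoopsCallFree p) (Nat.decEq _ _)
  | diag _ _ _ _ _ => .isTrue trivial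

/-- There are five calls: two kernels for the lifted basis, one kernel in each of the two linear
systems, and the eigenvalue problem itself. The number `91` merely matches the constant of the time
bound. -/
theorem decompose_calls_le {F : Type*} [RCLike F] {O : DiagOracle F} {n m : ℕ}
    (T : Tensor F n m) (f g : ℕ → F) :
    (decompose.run O (Machine.start T f g)).calls ≤ 91 := by
  have h := calls_run_le (O := O) (p := decompose) (by decide +kernel) (Machine.start T f g)
  rw [show decompose.calls = 5 by decide +kernel] at h
  exact h.trans (by simp [Machine.start])

end TensorDecomp
end

theorem corollary6p5 (F : Type*) [RCLike F] :
    -- a program that runs the algorithm in time `n ^ O(m)`, with `O(1)` diagonalizations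
    (∃ (prog : Program) (C : ℕ), ∀ n m : ℕ, 1 ≤ n → 3 ≤ m →
      ∀ O : DiagOracle F, O.IsCorrect → ∀ T : Tensor F n m,
        ∃ (R p s : ℕ) (u : Fin R → Tensor F n ((m + 1) / 2))
          (Q : Fin p → Matrix (Fin ((m + 1) / 2) → Fin n) (Fin ((m + 1) / 2) → Fin n) F)
          (P : Fin s → Matrix (Fin ((m + 1) / 2) → Fin n) (Fin ((m + 1) / 2) → Fin n) F),
          IsSetup T u Q P ∧
          ∀ f g : ℕ → F,
            DecompositionOutput T R P (fun i => f i) (fun i => g i)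
              ((prog.run O (Machine.start T f g)).output n m) ∧
            (prog.run O (Machine.start T f g)).time ≤ (max n 2) ^ (C * m) ∧
            (prog.run O (Machine.start T f g)).calls ≤ C) ∧
    (∀ n m : ℕ, 1 ≤ n → 3 ≤ m →
      -- certification: an output other than "Fail" is always correct
      (∀ (T : Tensor F n m) (R p s : ℕ) (u : Fin R → Tensor F n ((m + 1) / 2))
          (Q : Fin p → Matrix (Fin ((m + 1) / 2) → Fin n) (Fin ((m + 1) / 2) → Fin n) F)
          (P : Fin s → Matrix (Fin ((m + 1) / 2) → Fin n) (Fin ((m + 1) / 2) → Fin n) F),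
        IsSetup T u Q P → ∀ (f g : Fin s → F) (r : ℕ) (y : Fin r → Tensor F n m),
          DecompositionOutput T R P f g (some ⟨r, y⟩) → IsUniqueRankDecomposition T y) ∧
      -- generic tensors have a unique decomposition, and it is recovered with probability one
      (∀ R : ℕ, (R : ℝ) ≤ rankBound n m →
        ∃ A : Set (Fin R → Tensor F n m),
          IsZariskiOpenDense {x | ∀ a, x a ∈ productTensors F n m} A ∧
          ∀ x ∈ A,
            IsUniqueRankDecomposition (∑ a, x a) x ∧
            ∀ (R' p s : ℕ) (u : Fin R' → Tensor F n ((m + 1) / 2))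
              (Q : Fin p → Matrix (Fin ((m + 1) / 2) → Fin n) (Fin ((m + 1) / 2) → Fin n) F)
              (P : Fin s → Matrix (Fin ((m + 1) / 2) → Fin n) (Fin ((m + 1) / 2) → Fin n) F),
              IsSetup (∑ a, x a) u Q P →
              ∀ μ : MeasureTheory.Measure (Fin s → F), MeasureTheory.IsProbabilityMeasure μ →
                NullOnSubspaces μ →
                ∀ᵐ fg ∂(μ.prod μ),
                  (∃ out, DecompositionOutput (∑ a, x a) R' P fg.1 fg.2 out) ∧
                  ∀ out, DecompositionOutput (∑ a, x a) R' P fg.1 fg.2 out →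
                    ∃ σ : Equiv.Perm (Fin R), out = some ⟨R, x ∘ σ⟩)) ∧
    -- the rank bound for order four, and its growth
    (∀ n : ℕ, 1 ≤ n → rankBound n 4 = ((n : ℝ) - 1) ^ 2 / 4) ∧
    (∃ c : ℝ, 0 < c ∧ ∀ n m : ℕ, 8 ≤ n → 3 ≤ m → c * (n : ℝ) ^ (m / 2) ≤ rankBound n m) := by
  refine ⟨⟨Program.decompose, 91, fun n m hn hm O hO T => ?_⟩, fun n m hn hm =>
    ⟨fun T R p s u Q P h f g r y hy => h.certification hm hy, fun R hR => ?_⟩,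
    fun n hn => rankBound_four hn, 1 / 8, by norm_num, rankBound_ge⟩
  -- The setup comes from the run with zero scalars, since it has to be fixed before `f` and `g`.
  · obtain ⟨R, p, u, Q, h⟩ := exists_setup hO hn hm T
    exact ⟨R, p, _, u, Q, _, h, fun f g =>
      ⟨decompose_correct hO hn hm (mainState_setup f g).1 (mainState_setup f g).2 h,
        decompose_time_le hm T f g, decompose_calls_le T f g⟩⟩
  · obtain ⟨A, hA, hgen⟩ := exists_isZariskiOpenDense (F := F) hn hm hR
    refine ⟨A, hA, fun x hx => ?_⟩
    obtain ⟨v, w, h⟩ := hgen x hx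
    exact ⟨h.isUniqueRankDecomposition, fun R' p s u Q P hS μ hμ hμ' => h.setup hm hS μ hμ'⟩
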